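/- Let $a>0$, $0<\alpha\neq1$, $\rho(x)=\alpha^2$ for $0\le x<a$ and $\rho(x)=1$ for $x>a$, let $q$ be real valued with $\int_0^\infty(1+x)|q(x)|\,dx<\infty$, and let $\alpha_j,\beta_j$ ($j=0,1,2$) be real with $$\delta_1=\alpha_0\beta_1-\alpha_1\beta_0\le0,\qquad \delta_2=\alpha_0\beta_2-\alpha_2\beta_0\le0,\qquad \delta_3=\alpha_1\beta_2-\alpha_2\beta_1\ge0 .$$ Put $A(\lambda)=\alpha_0+i\alpha_1\lambda+\alpha_2\lambda^2$, $B(\lambda)=\beta_0+i\beta_1\lambda+\beta_2\lambda^2$, and assume that $A$ and $B$ have no common zero with $\operatorname{Im}\lambda>0$. Consider the problem $$-y''+q(x)y=\lambda^2\rho(x)y\quad(0\le x<\infty),\qquad B(\lambda)y'(0)+A(\lambda)y(0)=0 .$$ For $\operatorname{Im}\lambda\ge0$ let $e(x,\lambda)$ be the Jost solution, i.e. the solution of the equation with $e(x,\lambda)e^{-i\lambda x}\to1$ as $x\to\infty$. For real $\lambda$ (outside a null set) and for $\operatorname{Im}\lambda>0$, respectively, put $$S(\lambda)=\frac{B(\lambda)\overline{e'(0,\lambda)}+A(\lambda)\overline{e(0,\lambda)}}{E(\lambda)},\qquad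 E(\lambda)=B(\lambda)e'(0,\lambda)+A(\lambda)e(0,\lambda),$$ where $E$ is defined by the same formula for real $\lambda$. Let $\lambda_k$ $(k=1,2,\dots)$ be the positive numbers such that $i\lambda_k$ is a zero of $E$, and let $m_k$ be given by $$m_k^{-2}=\int_0^\infty|e(x,i\lambda_k)|^2\rho(x)\,dx-\frac{\delta_1+2\delta_2\lambda_k-\delta_3\lambda_k^2}{2\lambda_k}\cdot\frac{|e(0,i\lambda_k)|^2}{B(i\lambda_k)^2},$$ where the last fraction is read as $|e'(0,i\lambda_k)|^2/A(i\lambda_k)^2$ if $B(i\lambda_k)=0$ (for $A(i\lambda_k)B(i\lambda_k)\ne0$ the two expressions coincide). Let $\tau=(\alpha-1)/(\alpha+1)$, $$S_0(\lambda)=e^{-2i\lambda a}\frac{1+\tau e^{-2i\lambda\alpha a}}{e^{-2i\lambda\alpha a}+\tau}\ \text{ if }\beta_2=0,\qquad S_0(\lambda)=-e^{-2i\lambda a}\frac{1-\tau e^{-2i\lambda\alpha a}}{e^{-2i\lambda\alpha a}-\tau}\ \text{ if }\beta_2\ne0,$$ $\mu^{\pm}(x)=\pm x\sqrt{\rho(x)}+a(1\mp\sqrt{\rho(x)})$,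 $c_\pm(x)=\frac12\bigl(1\pm\frac1{\sqrt{\rho(x)}}\bigr)$, $e_0(x,\lambda)=c_+(x)e^{i\lambda\mu^+(x)}+c_-(x)e^{i\lambda\mu^-(x)}$, $$F_{0s}(u)=\frac1{2\pi}\int_{-\infty}^{\infty}[S_0(\lambda)-S(\lambda)]e^{i\lambda u}\,d\lambda,\qquad F_0(u)=F_{0s}(u)+\sum_k m_k^2e^{-\lambda_ku}\qquad(u>2\mu^+(0)),$$ $$F(x,y)=c_+(x)F_{0s}(y+\mu^+(x))+c_-(x)F_{0s}(y+\mu^-(x))+\sum_k m_k^2e_0(x,i\lambda_k)e^{-\lambda_ky},$$ the integral being a Fourier transform in the sense of distributions. Theorem. The number of the $\lambda_k$ is finite, and $F_{0s}$ is a locally integrable function on $(2\mu^+(0),\infty)$. For each fixed $x>0$ the main equation $$F(x,y)+K(x,y)+\int_{\mu^+(x)}^{\infty}K(x,t)F_0(t+y)\,dt-\tau K(x,2a-y)=0\qquad\text{for a.e. }y>\mu^+(x),$$ in which $K(x,t)=0$ for $t\le\mu^+(x)$ and the integral converges absolutely for a.e. $y>\mu^+(x)$, has a unique solution $K(x,\cdot)\in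 L_1(\mu^+(x),\infty)$. -/

import Mathlib

open MeasureTheory Set Filter Topology
open scoped ContDiff

/-- The data of the boundary value problem
`-y'' + q(x) y = λ² ρ(x) y` for `x ≥ 0`, with `ρ = α²` on `[0, a)` and `ρ = 1` on `(a, ∞)`,
`(β₀ + i β₁ λ + β₂ λ²) y'(0) + (α₀ + i α₁ λ + α₂ λ²) y(0) = 0`. -/
structure ScatteringProblem where
  q : ℝ → ℝ
  a : ℝ
  α : ℝ
  α₀ : ℝ
  α₁ : ℝ
  α₂ : ℝ
  β₀ : ℝ
  β₁ : ℝ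
  β₂ : ℝ

namespace ScatteringProblem

noncomputable def rho (P : ScatteringProblem) (x : ℝ) : ℝ :=
  if x < P.a then P.α ^ 2 else 1

noncomputable def muPlus (P : ScatteringProblem) (x : ℝ) : ℝ :=
  x * √(P.rho x) + P.a * (1 - √(P.rho x))

noncomputable def muMinus (P : ScatteringProblem) (x : ℝ) : ℝ :=
  -x * √(P.rho x) + P.a * (1 + √(P.rho x))

/-- `τ = (α - 1) / (α + 1)`. -/
noncomputable def tau (P : ScatteringProblem) : ℝ := (P.α - 1) / (P.α + 1)

def delta1 (P : ScatteringProblem) : ℝ := P.α₀ * P.β₁ - P.α₁ * P.β₀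
def delta2 (P : ScatteringProblem) : ℝ := P.α₀ * P.β₂ - P.α₂ * P.β₀
def delta3 (P : ScatteringProblem) : ℝ := P.α₁ * P.β₂ - P.α₂ * P.β₁

/-- The coefficient `α₀ + i α₁ z + α₂ z²` of `y(0)` in the boundary condition. -/
noncomputable def coeffA (P : ScatteringProblem) (z : ℂ) : ℂ :=
  P.α₀ + Complex.I * P.α₁ * z + P.α₂ * z ^ 2

/-- The coefficient `β₀ + i β₁ z + β₂ z²` of `y'(0)` in the boundary condition. -/
noncomputable def coeffB (P : ScatteringProblem) (z : ℂ) : ℂ :=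
  P.β₀ + Complex.I * P.β₁ * z + P.β₂ * z ^ 2

/-- The Jost solution of the equation with `q = 0`. -/
noncomputable def e0 (P : ScatteringProblem) (x : ℝ) (z : ℂ) : ℂ :=
  1 / 2 * (1 + 1 / (√(P.rho x) : ℂ)) * Complex.exp (Complex.I * z * P.muPlus x) +
    1 / 2 * (1 - 1 / (√(P.rho x) : ℂ)) * Complex.exp (Complex.I * z * P.muMinus x)

/-- `y` solves `-y'' + q y = z² ρ y` on `[0, ∞)` in the Carathéodory sense: `y` is differentiable
with derivative `y'`, and `y'` is the indefinite integral of `(q - z² ρ) y`. -/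
def IsSolution (P : ScatteringProblem) (z : ℂ) (y y' : ℝ → ℂ) : Prop :=
  (∀ x : ℝ, 0 ≤ x → HasDerivWithinAt y (y' x) (Ici 0) x) ∧
    ∀ x : ℝ, 0 ≤ x → y' x = y' 0 + ∫ t in (0 : ℝ)..x, ((P.q t : ℂ) - z ^ 2 * P.rho t) * y t

/-- The Jost solution: the solution with `y(x) e^{-izx} → 1` as `x → ∞`. -/
def IsJost (P : ScatteringProblem) (z : ℂ) (y y' : ℝ → ℂ) : Prop :=
  P.IsSolution z y y' ∧
    Tendsto (fun x : ℝ => y x * Complex.exp (-(Complex.I * z * x))) atTop (𝓝 1)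

/-- The Jost solution `e(·, z)` together with its derivative. For `Im z ≥ 0` they exist and are
uniquely determined on `[0, ∞)`; only these values are ever used. -/
noncomputable def jostPair (P : ScatteringProblem) (z : ℂ) : (ℝ → ℂ) × (ℝ → ℂ) :=
  Classical.epsilon fun p : (ℝ → ℂ) × (ℝ → ℂ) => P.IsJost z p.1 p.2

/-- `e(x, z)`. -/
noncomputable def jost (P : ScatteringProblem) (x : ℝ) (z : ℂ) : ℂ := (P.jostPair z).1 x

/-- `e'(x, z)`, the derivative in `x`. -/
noncomputable def jostDeriv (P : ScatteringProblem) (x : ℝ) (z : ℂ) : ℂ := (P.jostPair z).2 x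

/-- `E(z)`. -/
noncomputable def E (P : ScatteringProblem) (z : ℂ) : ℂ :=
  P.coeffB z * P.jostDeriv 0 z + P.coeffA z * P.jost 0 z

/-- The scattering function `S(l)` of a real argument. -/
noncomputable def S (P : ScatteringProblem) (l : ℝ) : ℂ :=
  (P.coeffB l * starRingEnd ℂ (P.jostDeriv 0 l) + P.coeffA l * starRingEnd ℂ (P.jost 0 l)) / P.E l

/-- The comparison function `S₀(l)`; the denominators do not vanish since `|τ| < 1`. -/
noncomputable def S0 (P : ScatteringProblem) (l : ℝ) : ℂ :=
  if P.β₂ = 0 then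
    Complex.exp (-2 * Complex.I * l * P.a) *
      ((1 + P.tau * Complex.exp (-2 * Complex.I * l * P.α * P.a)) /
        (Complex.exp (-2 * Complex.I * l * P.α * P.a) + P.tau))
  else
    -Complex.exp (-2 * Complex.I * l * P.a) *
      ((1 - P.tau * Complex.exp (-2 * Complex.I * l * P.α * P.a)) /
        (Complex.exp (-2 * Complex.I * l * P.α * P.a) - P.tau))

/-- The numbers `λ_k > 0` such that `i λ_k` is a zero of `E`. -/
def eigenSet (P : ScatteringProblem) : Set ℝ :=
  {k | 0 < k ∧ P.E (Complex.I * k) = 0}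

/-- The squared ratio between `e(·, ik)` and the solution `w(·, ik)` with
`w(0) = coeffB (ik)`, `w'(0) = -coeffA (ik)`, for `k` in `eigenSet`: it is `|e(0, ik)|² / B²`, and,
when `B = 0`, it is `|e'(0, ik)|² / A²`, where `A = coeffA (ik)`, `B = coeffB (ik)` are real. -/
noncomputable def ratioSq (P : ScatteringProblem) (k : ℝ) : ℝ :=
  open Classical in
  if P.β₀ - P.β₁ * k - P.β₂ * k ^ 2 = 0 then
    ‖P.jostDeriv 0 (Complex.I * k)‖ ^ 2 / (P.α₀ - P.α₁ * k - P.α₂ * k ^ 2) ^ 2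
  else
    ‖P.jost 0 (Complex.I * k)‖ ^ 2 / (P.β₀ - P.β₁ * k - P.β₂ * k ^ 2) ^ 2

/-- `m_k^{-2}` for `λ_k = k`. -/
noncomputable def normInvSq (P : ScatteringProblem) (k : ℝ) : ℝ :=
  (∫ x in Ioi (0 : ℝ), ‖P.jost x (Complex.I * k)‖ ^ 2 * P.rho x) -
    (P.delta1 + 2 * P.delta2 * k - P.delta3 * k ^ 2) / (2 * k) * P.ratioSq k

/-- `m_k²` for `λ_k = k`. -/
noncomputable def normSq (P : ScatteringProblem) (k : ℝ) : ℝ := (P.normInvSq k)⁻¹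

/-- `f` is the function `F_{0s}(u) = (1/2π) ∫ (S₀(l) - S(l)) e^{ilu} dl`, for `u > 2 μ⁺(0)`.
The integral is the Fourier transform in the sense of distributions (which is the usual `L²` one
whenever `S₀ - S` is square integrable). The main equation for `x > 0` involves only
arguments `u > 2 μ⁺(0)`. -/
def IsF0s (P : ScatteringProblem) (f : ℝ → ℂ) : Prop :=
  LocallyIntegrableOn f (Ioi (2 * P.muPlus 0)) ∧
    ∀ φ : ℝ → ℝ, ContDiff ℝ ∞ φ → HasCompactSupport φ → tsupport φ ⊆ Ioi (2 * P.muPlus 0) →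
      ∫ u in Ioi (2 * P.muPlus 0), f u * φ u =
        1 / (2 * (Real.pi : ℂ)) *
          ∫ l : ℝ, (P.S0 l - P.S l) * ∫ u : ℝ, φ u * Complex.exp (Complex.I * l * u)

/-- `F₀(u) = F_{0s}(u) + ∑ m_k² e^{-λ_k u}`, with `f = F_{0s}`. -/
noncomputable def F0 (P : ScatteringProblem) (f : ℝ → ℂ) (u : ℝ) : ℂ :=
  f u + ∑ᶠ k ∈ P.eigenSet, (P.normSq k : ℂ) * Complex.exp (-(k * u))

/-- `F_s(x, y)`, with `f = F_{0s}`. -/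
noncomputable def Fs (P : ScatteringProblem) (f : ℝ → ℂ) (x y : ℝ) : ℂ :=
  1 / 2 * (1 + 1 / (√(P.rho x) : ℂ)) * f (y + P.muPlus x) +
    1 / 2 * (1 - 1 / (√(P.rho x) : ℂ)) * f (y + P.muMinus x)

/-- `F(x, y) = F_s(x, y) + ∑ m_k² e₀(x, i λ_k) e^{-λ_k y}`, with `f = F_{0s}`. -/
noncomputable def F (P : ScatteringProblem) (f : ℝ → ℂ) (x y : ℝ) : ℂ :=
  P.Fs f x y +
    ∑ᶠ k ∈ P.eigenSet, (P.normSq k : ℂ) * P.e0 x (Complex.I * k) * Complex.exp (-(k * y))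

/-- `K = K(x, ·) ∈ L₁(μ⁺(x), ∞)` solves the main equation
`F(x, y) + K(x, y) + ∫_{μ⁺(x)}^∞ K(x, t) F₀(t + y) dt - τ K(x, 2a - y) = 0` for a.e. `y > μ⁺(x)`,
the integral being absolutely convergent. In the last term `K(x, ·)` is continued by zero
to `(-∞, μ⁺(x)]`. -/
def SolvesMainEquation (P : ScatteringProblem) (f : ℝ → ℂ) (x : ℝ)
    (K : Lp ℂ 1 (volume.restrict (Ioi (P.muPlus x)))) : Prop :=
  ∀ᵐ y ∂(volume.restrict (Ioi (P.muPlus x))),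
    IntegrableOn (fun t : ℝ => K t * P.F0 f (t + y)) (Ioi (P.muPlus x)) ∧
      P.F f x y + K y + (∫ t in Ioi (P.muPlus x), K t * P.F0 f (t + y)) -
        P.tau * (Ioi (P.muPlus x)).indicator (fun t : ℝ => K t) (2 * P.a - y) = 0

end ScatteringProblem

/-! The Jost solution is the Fourier transform of two point masses, which give `e0`, plus a real
integrable kernel `jostKer` supported in `[μ⁺(x), ∞)`. The reason is that the Cauchy function of the
equation with `q = 0` is itself the transform of a compactly supported kernel, so the Volterra
iteration can be run on kernels (`jostFun_integral_eq`). All later arguments use this representation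
together with the solution `omega` determined by the boundary condition, whose Wronskian with the
Jost solution is `E`.

The signs of `δ₁, δ₂, δ₃` enter through Green's identity. In the imaginary part of `E` times the
conjugate of `ω e`, the contributions of `(0, x)`, of `(x, ∞)` and of the boundary condition all
have the sign of `Re z`. Hence `|Re z| |ω(x, z)| ≤ C |E(z)| exp(Im z μ⁺(x))`
(`exists_norm_omega_le`): zeros of `E` in the upper half plane lie on the imaginary axis, and `ω /
E` has at most simple poles there. On the real line the same signs give `|S| ≤ 1`.

Finiteness of the eigenvalues (`finite_eigenSet`). By Green's identity, the weighted inner product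
of the Jost solutions at two distinct eigenvalues is nonpositive whenever their ratios to `omega`
have the same sign. For two large or two small parameters it is positive. So only finitely many
eigenvalues are large or small, and the identity theorem deals with a compact interval in between.

Local integrability of `F_{0s}`. For real `l` one has `conj e - S e = 2 i l ω / E`, the boundary
value of a function that is meromorphic in the upper half plane. Cauchy's theorem and the estimate
above show that its integral against a Hardy type function `Ψ` is a combination of the values of `Ψ`
at the points `i λ_k` (`exists_integral_jump_eq`). For transforms of test functions this becomes a
linear equation for the inverse transform of `S₀ - S`: a combination of its translates plus a
correlation with `jostKer` equals a known integrable function (`exists_lam_equation`). For large `x`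
the kernel is small and a Neumann series solves the equation in `L¹`; at `x = 0` an exponential
weight makes the coefficients small, and what is left of the functional is confined to a bounded
range, so the weight costs nothing (`exists_lam_eq_integral`).

Uniqueness (`ae_eq_zero_of_homogeneous`). An integrable solution `g` of the homogeneous main
equation is bounded, hence square integrable. The equation says that the inverse transform `w` of `S
ĝ` equals `g` plus a sum of exponentials on `(μ⁺(x), ∞)`. Since `|S| ≤ 1`, expanding `‖w - g‖²`
shows that `‖w - g‖²` plus twice the sum of `m_k² |ĝ(i λ_k)|²` is at most zero; of the norming
constants only positivity matters. Thus `w = g`, every `ĝ(i λ_k)` vanishes and `S(l) ĝ(l) = ĝ(-l)`.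
Then `(conj e - S e) ĝ` is odd and annihilates the transforms of all test functions on `(0, ∞)`, so
it is zero; its first factor is nonzero almost everywhere, because `ω(x, ·)` does not vanish
identically for `x > 0`.

Existence. Sums of decaying exponentials are dense in `L¹` of a half line, and the Hankel operator
of such a sum has finite rank. As the reflection term has norm at most `|τ| < 1`, the operator of
the main equation is an invertible operator plus one of finite rank, and injectivity implies
surjectivity (`exists_main_operator`, `exists_eq_of_injective_add_finite_rank`). -/

/-! ### Absolutely continuous functions on the half line -/

/-- `f` is locally integrable on `[0, ∞)` and `u` is an indefinite integral of it. -/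
def IsPrimitive {𝕜 : Type*} [RCLike 𝕜] (u f : ℝ → 𝕜) : Prop :=
  (∀ x, 0 ≤ x → IntervalIntegrable f volume 0 x) ∧ ∀ x, 0 ≤ x → u x = u 0 + ∫ t in (0 : ℝ)..x, f t

namespace IsPrimitive

variable {𝕜 : Type*} [RCLike 𝕜] {u v f g : ℝ → 𝕜}

theorem intervalIntegrable (h : IsPrimitive u f) {x y : ℝ} (hx : 0 ≤ x) (hy : 0 ≤ y) :
    IntervalIntegrable f volume x y :=
  (h.1 x hx).symm.trans (h.1 y hy)

theorem sub_eq (h : IsPrimitive u f) {x y : ℝ} (hx : 0 ≤ x) (hy : 0 ≤ y) :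
    u y - u x = ∫ t in x..y, f t := by
  rw [h.2 x hx, h.2 y hy, ← intervalIntegral.integral_add_adjacent_intervals (h.1 x hx)
    (h.intervalIntegrable hx hy)]
  ring

theorem continuousOn (h : IsPrimitive u f) : ContinuousOn u (Ici 0) := by
  intro x hx
  have hx : 0 ≤ x := hx
  have h1 : ContinuousOn (fun y => u 0 + ∫ t in (0 : ℝ)..y, f t) (Icc 0 (x + 1)) := by
    have := intervalIntegral.continuousOn_primitive_interval (μ := volume) (f := f)
      (a := 0) (b := x + 1) (by
        have := h.1 (x + 1) (by linarith)
        rw [intervalIntegrable_iff_integrableOn_Icc_of_le (by linarith)] at this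
        rwa [uIcc_of_le (by linarith)])
    rw [uIcc_of_le (by linarith)] at this
    exact continuousOn_const.add this
  have h2 : ContinuousOn u (Icc 0 (x + 1)) := h1.congr fun y hy => h.2 y hy.1
  have h3 : Icc 0 (x + 1) ∈ 𝓝[Ici 0] x := by
    rw [← Ici_inter_Iic]
    exact inter_mem self_mem_nhdsWithin (mem_nhdsWithin_of_mem_nhds (Iic_mem_nhds (by linarith)))
  exact (h2 x ⟨hx, by linarith⟩).mono_of_mem_nhdsWithin h3

theorem congr (h : IsPrimitive u f) (huv : ∀ x, 0 ≤ x → v x = u x)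
    (hfg : ∀ x, 0 ≤ x → g x = f x) : IsPrimitive v g := by
  have h1 : ∀ x, 0 ≤ x → EqOn f g (uIoc 0 x) := fun x hx t ht => by
    rw [uIoc_of_le hx] at ht
    exact (hfg t ht.1.le).symm
  refine ⟨fun x hx => (h.1 x hx).congr (h1 x hx), fun x hx => ?_⟩
  rw [huv x hx, huv 0 le_rfl, h.2 x hx]
  congr 1
  refine intervalIntegral.integral_congr_ae (Eventually.of_forall fun t ht => ?_)
  exact h1 x hx ht

theorem add (h : IsPrimitive u f) (k : IsPrimitive v g) :
    IsPrimitive (fun x => u x + v x) (fun x => f x + g x) := by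
  refine ⟨fun x hx => (h.1 x hx).add (k.1 x hx), fun x hx => ?_⟩
  simp only
  rw [intervalIntegral.integral_add (h.1 x hx) (k.1 x hx), h.2 x hx, k.2 x hx]
  ring

theorem const_mul (h : IsPrimitive u f) (c : 𝕜) :
    IsPrimitive (fun x => c * u x) (fun x => c * f x) := by
  refine ⟨fun x hx => (h.1 x hx).const_mul c, fun x hx => ?_⟩
  simp only
  rw [intervalIntegral.integral_const_mul, h.2 x hx]
  ring

theorem sub (h : IsPrimitive u f) (k : IsPrimitive v g) :
    IsPrimitive (fun x => u x - v x) (fun x => f x - g x) :=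
  (h.add (k.const_mul (-1))).congr (fun x _ => by ring) (fun x _ => by ring)

/-- The product of the two integrals is an integral over the square `(0, x]²`; cutting the square
along the diagonal gives the two terms of the product rule. This makes Wronskian identities
available for a potential that is merely integrable. -/
theorem mul (h : IsPrimitive u f) (k : IsPrimitive v g) :
    IsPrimitive (fun x => u x * v x) (fun x => f x * v x + u x * g x) := by
  have hfv : ∀ x, 0 ≤ x → IntervalIntegrable (fun x => f x * v x) volume 0 x := fun x hx =>
    (h.1 x hx).mul_continuousOn (k.continuousOn.mono (by
      rw [uIcc_of_le hx]; exact fun y hy => hy.1))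
  have hug : ∀ x, 0 ≤ x → IntervalIntegrable (fun x => u x * g x) volume 0 x := fun x hx =>
    (k.1 x hx).continuousOn_mul (h.continuousOn.mono (by
      rw [uIcc_of_le hx]; exact fun y hy => hy.1))
  refine ⟨fun x hx => (hfv x hx).add (hug x hx), fun x hx => ?_⟩
  simp only
  set μ : Measure ℝ := volume.restrict (Ioc 0 x)
  have hf : Integrable f μ := (intervalIntegrable_iff_integrableOn_Ioc_of_le hx).1 (h.1 x hx)
  have hg : Integrable g μ := (intervalIntegrable_iff_integrableOn_Ioc_of_le hx).1 (k.1 x hx)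
  have hF : Integrable (fun p : ℝ × ℝ => f p.1 * g p.2) (μ.prod μ) := hf.mul_prod hg
  have hm : MeasurableSet {p : ℝ × ℝ | p.2 ≤ p.1} := measurableSet_le measurable_snd measurable_fst
  have e1 : (∫ t in (0 : ℝ)..x, f t) * (∫ t in (0 : ℝ)..x, g t) =
      (∫ p in {p : ℝ × ℝ | p.2 ≤ p.1}, f p.1 * g p.2 ∂(μ.prod μ)) +
      ∫ p in {p : ℝ × ℝ | p.2 ≤ p.1}ᶜ, f p.1 * g p.2 ∂(μ.prod μ) := by
    rw [integral_add_compl hm hF, integral_prod_mul, intervalIntegral.integral_of_le hx,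
      intervalIntegral.integral_of_le hx]
  have e2 : ∫ p in {p : ℝ × ℝ | p.2 ≤ p.1}, f p.1 * g p.2 ∂(μ.prod μ) =
      ∫ t in (0 : ℝ)..x, f t * ∫ s in (0 : ℝ)..t, g s := by
    rw [← integral_indicator hm, integral_prod _ (hF.indicator hm),
      intervalIntegral.integral_of_le hx]
    refine setIntegral_congr_fun measurableSet_Ioc fun t ht => ?_
    rw [intervalIntegral.integral_of_le ht.1.le, ← integral_const_mul]
    rw [← integral_indicator measurableSet_Ioc, ← integral_indicator measurableSet_Ioc]
    congr 1
    ext s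
    by_cases hs : 0 < s ∧ s ≤ t
    · have : s ≤ x := hs.2.trans ht.2
      simp [indicator, hs, this]
    · by_cases hs0 : 0 < s
      · simp_all [indicator]
      · simp [indicator, hs0]
  have e3 : ∫ p in {p : ℝ × ℝ | p.2 ≤ p.1}ᶜ, f p.1 * g p.2 ∂(μ.prod μ) =
      ∫ t in (0 : ℝ)..x, (∫ s in (0 : ℝ)..t, f s) * g t := by
    rw [← integral_indicator hm.compl, integral_prod_symm _ (hF.indicator hm.compl),
      intervalIntegral.integral_of_le hx]
    refine setIntegral_congr_fun measurableSet_Ioc fun t ht => ?_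
    -- The complement of `p.2 ≤ p.1` is a strict inequality, so the inner integral runs over an open
    -- interval.
    rw [intervalIntegral.integral_of_le ht.1.le, ← integral_mul_const,
      integral_Ioc_eq_integral_Ioo (x := 0) (y := t)]
    rw [← integral_indicator measurableSet_Ioc, ← integral_indicator measurableSet_Ioo]
    congr 1
    ext s
    by_cases hs : 0 < s ∧ s < t
    · have : s ≤ x := hs.2.le.trans ht.2
      simp [indicator, hs, this]
    · by_cases hs0 : 0 < s
      · simp_all [indicator]
      · simp [indicator, hs0]
  have e4 : ∫ t in (0 : ℝ)..x, f t * v t =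
      v 0 * (∫ t in (0 : ℝ)..x, f t) + ∫ t in (0 : ℝ)..x, f t * ∫ s in (0 : ℝ)..t, g s := by
    have : ∫ t in (0 : ℝ)..x, f t * (∫ s in (0 : ℝ)..t, g s) =
        ∫ t in (0 : ℝ)..x, (f t * v t - v 0 * f t) := by
      refine intervalIntegral.integral_congr fun t ht => ?_
      rw [uIcc_of_le hx] at ht
      rw [k.2 t ht.1]; ring
    rw [this, intervalIntegral.integral_sub (hfv x hx) ((h.1 x hx).const_mul _),
      intervalIntegral.integral_const_mul]
    ring
  have e5 : ∫ t in (0 : ℝ)..x, u t * g t =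
      u 0 * (∫ t in (0 : ℝ)..x, g t) + ∫ t in (0 : ℝ)..x, (∫ s in (0 : ℝ)..t, f s) * g t := by
    have : ∫ t in (0 : ℝ)..x, (∫ s in (0 : ℝ)..t, f s) * g t =
        ∫ t in (0 : ℝ)..x, (u t * g t - u 0 * g t) := by
      refine intervalIntegral.integral_congr fun t ht => ?_
      rw [uIcc_of_le hx] at ht
      rw [h.2 t ht.1]; ring
    rw [this, intervalIntegral.integral_sub (hug x hx) ((k.1 x hx).const_mul _),
      intervalIntegral.integral_const_mul]
    ring
  rw [intervalIntegral.integral_add (hfv x hx) (hug x hx), e4, e5, h.2 x hx, k.2 x hx, ← e2, ← e3]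
  linear_combination e1

theorem pow_succ (h : IsPrimitive u f) (n : ℕ) :
    IsPrimitive (fun x => u x ^ (n + 1)) (fun x => (n + 1) * u x ^ n * f x) := by
  induction n with
  | zero => exact h.congr (fun x _ => by simp) (fun x _ => by simp)
  | succ n ih =>
    refine (ih.mul h).congr (fun x _ => by ring) (fun x _ => ?_)
    push_cast
    ring

theorem eq_of_zero (h : IsPrimitive u fun _ => 0) {x : ℝ} (hx : 0 ≤ x) : u x = u 0 := by
  have := h.2 x hx
  simpa using this

/-- One-sided derivatives suffice, so functions with a corner at the jump of `ρ` are covered. -/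
theorem of_hasDeriv_right (hc : ContinuousOn u (Ici 0))
    (hd : ∀ x, 0 < x → HasDerivWithinAt u (f x) (Ioi x) x)
    (hi : ∀ x, 0 ≤ x → IntervalIntegrable f volume 0 x) : IsPrimitive u f := by
  refine ⟨hi, fun x hx => ?_⟩
  rw [intervalIntegral.integral_eq_sub_of_hasDeriv_right (f := u) (f' := f) ?_ ?_ (hi x hx)]
  · ring
  · rw [uIcc_of_le hx]; exact hc.mono fun y hy => hy.1
  · intro y hy
    rw [min_eq_left hx] at hy
    exact hd y hy.1

theorem hasDerivWithinAt (h : IsPrimitive u f) (hf : ContinuousOn f (Ici 0)) {x : ℝ}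
    (hx : 0 ≤ x) : HasDerivWithinAt u (f x) (Ici 0) x := by
  -- Extending the density by a constant to the left of `0` turns the endpoint into an ordinary
  -- point.
  have hc : Continuous fun t => f (max t 0) :=
    hf.comp_continuous (by fun_prop) fun t => mem_Ici.2 (le_max_right _ _)
  have h1 : HasDerivAt (fun y => u 0 + ∫ t in (0 : ℝ)..y, f (max t 0)) (f (max x 0)) x :=
    (intervalIntegral.integral_hasDerivAt_right (hc.intervalIntegrable _ _)
      (hc.stronglyMeasurableAtFilter _ _) hc.continuousAt).const_add _
  rw [max_eq_left hx] at h1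
  refine h1.hasDerivWithinAt.congr (fun y hy => ?_) ?_
  · rw [h.2 y hy]
    congr 1
    refine intervalIntegral.integral_congr fun t ht => ?_
    rw [uIcc_of_le hy] at ht
    rw [max_eq_left ht.1]
  · rw [h.2 x hx]
    congr 1
    refine intervalIntegral.integral_congr fun t ht => ?_
    rw [uIcc_of_le hx] at ht
    rw [max_eq_left ht.1]

end IsPrimitive

theorem isPrimitive_integral {𝕜 : Type*} [RCLike 𝕜] {f : ℝ → 𝕜}
    (hf : ∀ x, 0 ≤ x → IntervalIntegrable f volume 0 x) :
    IsPrimitive (fun x => ∫ t in (0 : ℝ)..x, f t) f :=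
  ⟨hf, fun x _ => by simp⟩

theorem isPrimitive_integral_Ioi {𝕜 : Type*} [RCLike 𝕜] {f : ℝ → 𝕜}
    (hf : IntegrableOn f (Ioi 0)) : IsPrimitive (fun x => ∫ t in Ioi x, f t) fun x => -f x := by
  have h1 : ∀ x, 0 ≤ x → IntervalIntegrable f volume 0 x := fun x hx =>
    (intervalIntegrable_iff_integrableOn_Ioc_of_le hx).2 (hf.mono_set fun y hy => hy.1)
  refine ⟨fun x hx => (h1 x hx).neg, fun x hx => ?_⟩
  rw [intervalIntegral.integral_neg]
  have := intervalIntegral.integral_interval_add_Ioi (a := 0) (b := x) (μ := volume) hf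
    (hf.mono_set (Ioi_subset_Ioi hx))
  simp only
  rw [← this]
  ring

/-! ### Tail integrals and holomorphic parameter integrals -/

/-- `∫_x^∞ κ σⁿ = σ(x)ⁿ⁺¹ / (n + 1)` for `σ(x) = ∫_x^∞ κ`. -/
theorem integral_Ioi_mul_tail_pow {κ : ℝ → ℝ} (hκ : IntegrableOn κ (Ioi 0)) (hκ0 : ∀ x, 0 ≤ κ x)
    (n : ℕ) {x : ℝ} (hx : 0 ≤ x) :
    IntegrableOn (fun t => κ t * (∫ s in Ioi t, κ s) ^ n) (Ioi 0) ∧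
    ∫ t in Ioi x, κ t * (∫ s in Ioi t, κ s) ^ n = (∫ s in Ioi x, κ s) ^ (n + 1) / (n + 1) := by
  set σ : ℝ → ℝ := fun t => ∫ s in Ioi t, κ s with hσ
  have hP : IsPrimitive σ fun t => -κ t := isPrimitive_integral_Ioi hκ
  have hσ0 : ∀ t, 0 ≤ σ t := fun t => setIntegral_nonneg measurableSet_Ioi fun s _ => hκ0 s
  have hσ1 : ∀ t, 0 ≤ t → σ t ≤ σ 0 := fun t ht =>
    setIntegral_mono_set hκ (Eventually.of_forall hκ0) (Ioi_subset_Ioi ht).eventuallyLE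
  have hint : IntegrableOn (fun t => κ t * σ t ^ n) (Ioi 0) := by
    refine Integrable.mono' (hκ.mul_const (σ 0 ^ n)) ?_ ?_
    · refine hκ.aestronglyMeasurable.mul ?_
      exact (((hP.continuousOn.mono Ioi_subset_Ici_self).pow n).aestronglyMeasurable
        measurableSet_Ioi)
    · refine (ae_restrict_iff' measurableSet_Ioi).2 (Eventually.of_forall fun t ht => ?_)
      rw [Real.norm_of_nonneg (mul_nonneg (hκ0 t) (pow_nonneg (hσ0 t) n))]
      exact mul_le_mul_of_nonneg_left (pow_le_pow_left₀ (hσ0 t) (hσ1 t (le_of_lt ht)) n) (hκ0 t)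
  refine ⟨hint, ?_⟩
  have hlim : Tendsto σ atTop (𝓝 0) := by
    have h1 := intervalIntegral_tendsto_integral_Ioi 0 hκ tendsto_id
    have h2 : Tendsto (fun x => σ 0 - ∫ t in (0 : ℝ)..x, κ t) atTop (𝓝 (σ 0 - σ 0)) :=
      tendsto_const_nhds.sub h1
    rw [sub_self] at h2
    refine h2.congr' ?_
    filter_upwards [eventually_ge_atTop 0] with y hy
    have := hP.2 y hy
    rw [intervalIntegral.integral_neg] at this
    rw [this]; ring
  -- `σⁿ⁺¹` is a primitive of `-(n + 1) σⁿ κ`, and `σ` vanishes at infinity.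
  have hq := hP.pow_succ n
  have h3 := intervalIntegral_tendsto_integral_Ioi x
    (hint.mono_set (Ioi_subset_Ioi hx)) tendsto_id
  have h4 : Tendsto (fun y => (σ x ^ (n + 1) - σ y ^ (n + 1)) / (n + 1)) atTop
      (𝓝 ((σ x ^ (n + 1) - 0 ^ (n + 1)) / (n + 1))) :=
    (tendsto_const_nhds.sub (hlim.pow _)).div_const _
  rw [zero_pow (Nat.succ_ne_zero n), sub_zero] at h4
  refine tendsto_nhds_unique h3 (h4.congr' ?_)
  filter_upwards [eventually_ge_atTop 0] with y hy
  have h5 := hq.sub_eq hx hy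
  have h6 : ∫ t in x..y, ((n : ℝ) + 1) * σ t ^ n * -κ t =
      -((n + 1) * ∫ t in x..y, κ t * σ t ^ n) := by
    rw [← intervalIntegral.integral_const_mul, ← intervalIntegral.integral_neg]
    congr 1; ext t; ring
  simp only [id]
  rw [h6] at h5
  have : ((n : ℝ) + 1) ≠ 0 := by positivity
  rw [div_eq_iff this]
  linarith

/-- A parameter integral of holomorphic functions is holomorphic. -/
theorem differentiableOn_integral_of_locally_dominated {α : Type*} [MeasurableSpace α]
    {μ : Measure α} {U : Set ℂ} (hU : IsOpen U) {F : ℂ → α → ℂ}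
    (hm : ∀ z ∈ U, AEStronglyMeasurable (F z) μ)
    (hd : ∀ᵐ a ∂μ, DifferentiableOn ℂ (fun z => F z a) U)
    (hb : ∀ z₀ ∈ U, ∃ r > 0, ∃ g : α → ℝ, Integrable g μ ∧
      ∀ᵐ a ∂μ, ∀ z ∈ Metric.ball z₀ r ∩ U, ‖F z a‖ ≤ g a) :
    DifferentiableOn ℂ (fun z => ∫ a, F z a ∂μ) U := by
  intro z₀ hz₀
  obtain ⟨r₀, hr₀, g, hg, hgb⟩ := hb z₀ hz₀
  obtain ⟨r₁, hr₁, hU₁⟩ := Metric.isOpen_iff.1 hU z₀ hz₀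
  set r := min r₀ r₁ with hr
  have hr0 : 0 < r := lt_min hr₀ hr₁
  have hsub : Metric.ball z₀ r ⊆ Metric.ball z₀ r₀ ∩ U := fun z hz =>
    ⟨Metric.ball_subset_ball (min_le_left _ _) hz,
      hU₁ (Metric.ball_subset_ball (min_le_right _ _) hz)⟩
  have hs : Metric.ball z₀ (r / 2) ∈ 𝓝 z₀ := Metric.ball_mem_nhds _ (by linarith)
  have hball : ∀ z ∈ Metric.ball z₀ (r / 2), Metric.closedBall z (r / 4) ⊆ Metric.ball z₀ r := by
    intro z hz w hw
    rw [Metric.mem_ball] at hz ⊢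
    rw [Metric.mem_closedBall] at hw
    calc dist w z₀ ≤ dist w z + dist z z₀ := dist_triangle _ _ _
      _ < r := by linarith
  have hmem : ∀ z ∈ Metric.ball z₀ (r / 2), z ∈ U := fun z hz =>
    (hsub (hball z hz (Metric.mem_closedBall_self (by linarith)))).2
  -- Cauchy's estimate on circles of radius `r / 4` converts the bound for the integrand into one
  -- for its derivative, so only the integrand itself has to be dominated.
  have key := hasDerivAt_integral_of_dominated_loc_of_deriv_le (μ := μ) (F := F)
    (F' := fun z a => deriv (fun w => F w a) z) (bound := fun a => g a / (r / 4)) hs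
    (by filter_upwards [hs] with z hz using hm z (hmem z hz))
    (by
      refine hg.mono' (hm z₀ hz₀) ?_
      filter_upwards [hgb] with a ha
      exact ha z₀ ⟨Metric.mem_ball_self hr₀, hz₀⟩)
    (by
      -- The derivative is measurable in `a` as the limit of difference quotients along a fixed null
      -- sequence.
      have hseq : Tendsto (fun n : ℕ => ((r / 4 / ((n : ℝ) + 1) : ℝ) : ℂ)) atTop (𝓝[≠] 0) := by
        rw [tendsto_nhdsWithin_iff]
        constructor
        · have : Tendsto (fun n : ℕ => r / 4 / ((n : ℝ) + 1)) atTop (𝓝 0) :=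
            tendsto_const_nhds.div_atTop
              (tendsto_atTop_add_const_right _ _ tendsto_natCast_atTop_atTop)
          exact_mod_cast (Complex.continuous_ofReal.tendsto 0).comp this
        · refine Eventually.of_forall fun n => ?_
          have : r / 4 / ((n : ℝ) + 1) ≠ 0 := by positivity
          exact Complex.ofReal_ne_zero.2 this
      refine aestronglyMeasurable_of_tendsto_ae (u := atTop)
        (f := fun (n : ℕ) a => ((r / 4 / ((n : ℝ) + 1) : ℝ) : ℂ)⁻¹ •
          (F (z₀ + ((r / 4 / ((n : ℝ) + 1) : ℝ) : ℂ)) a - F z₀ a)) ?_ ?_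
      · intro n
        have hmem' : z₀ + ((r / 4 / ((n : ℝ) + 1) : ℝ) : ℂ) ∈ U := hmem _ ?_
        · have h := (hm _ hmem').sub (hm z₀ hz₀)
          exact h.const_smul (((r / 4 / ((n : ℝ) + 1) : ℝ) : ℂ)⁻¹)
        rw [Metric.mem_ball, dist_eq_norm, add_sub_cancel_left, Complex.norm_real,
          Real.norm_of_nonneg (by positivity)]
        calc r / 4 / ((n : ℝ) + 1) ≤ r / 4 := div_le_self (by linarith) (by linarith [n.cast_nonneg (α := ℝ)])
          _ < r / 2 := by linarith
      · filter_upwards [hd] with a ha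
        have h1 : HasDerivAt (fun w => F w a) (deriv (fun w => F w a) z₀) z₀ :=
          (ha.differentiableAt (hU.mem_nhds hz₀)).hasDerivAt
        exact (hasDerivAt_iff_tendsto_slope_zero.1 h1).comp hseq)
    (by
      filter_upwards [hd, hgb] with a ha hga z hz
      refine Complex.norm_deriv_le_of_forall_mem_sphere_norm_le (by linarith) ?_ ?_
      · refine DifferentiableOn.diffContOnCl ?_
        refine ha.mono ?_
        exact (Metric.closure_ball_subset_closedBall.trans (hball z hz)).trans
          (hsub.trans inter_subset_right)
      · intro w hw
        exact hga w (hsub (hball z hz (Metric.sphere_subset_closedBall hw))))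
    (hg.div_const _)
    (by
      filter_upwards [hd] with a ha z hz
      exact (ha.differentiableAt (hU.mem_nhds (hmem z hz))).hasDerivAt)
  exact key.2.differentiableAt.differentiableWithinAt

/-! ### Cauchy's theorem in the upper half plane -/

theorem isOpen_upperHalf : IsOpen {z : ℂ | 0 < z.im} :=
  isOpen_lt continuous_const Complex.continuous_im

/-- The integral over a horizontal line of a function holomorphic in the upper half plane with
quadratic decay vanishes. -/
theorem integral_line_eq_zero {H : ℂ → ℂ} {C : ℝ} (hH : DifferentiableOn ℂ H {z | 0 < z.im})
    (hC : ∀ z : ℂ, 0 < z.im → ‖H z‖ ≤ C / (1 + ‖z‖ ^ 2)) {ε : ℝ} (hε : 0 < ε) :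
    ∫ l : ℝ, H (l + ε * Complex.I) = 0 := by
  have hC0 : 0 ≤ C := by
    have := (norm_nonneg _).trans (hC Complex.I (by simp))
    simp at this; linarith
  have hnorm : ∀ l s : ℝ, ‖(l + s * Complex.I : ℂ)‖ ^ 2 = l ^ 2 + s ^ 2 := fun l s => by
    rw [← Complex.normSq_eq_norm_sq, Complex.normSq_add_mul_I]
  have hcont : Continuous fun l : ℝ => H (l + ε * Complex.I) := by
    refine hH.continuousOn.comp_continuous (by fun_prop) fun l => ?_
    simpa using hε
  have hint : Integrable fun l : ℝ => H (l + ε * Complex.I) := by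
    refine Integrable.mono' ((integrable_inv_one_add_sq).const_mul C) hcont.aestronglyMeasurable
      (Eventually.of_forall fun l => (hC _ (by simpa using hε)).trans ?_)
    rw [hnorm, div_eq_mul_inv]
    gcongr
    nlinarith
  have h1 : Tendsto (fun T : ℝ => ∫ l in (-T)..T, H (l + ε * Complex.I)) atTop
      (𝓝 (∫ l : ℝ, H (l + ε * Complex.I))) :=
    intervalIntegral_tendsto_integral hint tendsto_neg_atTop_atBot tendsto_id
  refine tendsto_nhds_unique h1 ?_
  refine squeeze_zero_norm' (a := fun T : ℝ => 4 * C / T) ?_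
    (tendsto_const_nhds.div_atTop tendsto_id)
  filter_upwards [eventually_ge_atTop (max ε 1)] with T hT
  have hTε : ε ≤ T := (le_max_left _ _).trans hT
  have hT1 : 1 ≤ T := (le_max_right _ _).trans hT
  have hT0 : 0 < T := by linarith
  -- A rectangle between the heights `ε` and `T`. The three remote sides have length `O(T)` and the
  -- integrand on them is `O(T⁻²)`.
  have hrect := Complex.integral_boundary_rect_eq_zero_of_differentiableOn H
    (-T + ε * Complex.I) (T + T * Complex.I) (by
      refine hH.mono fun z hz => ?_
      have := hz.2
      simp only [Complex.add_im, Complex.neg_im, Complex.ofReal_im, Complex.mul_im, Complex.I_im,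
        Complex.ofReal_re, Complex.I_re, mem_preimage] at this
      rw [uIcc_of_le (by simpa using hTε)] at this
      have h3 := this.1
      simp at h3
      exact lt_of_lt_of_le hε h3)
  simp only [Complex.add_re, Complex.neg_re, Complex.ofReal_re, Complex.mul_re, Complex.I_re,
    mul_zero, Complex.ofReal_im, Complex.I_im, mul_one, sub_self, add_zero, Complex.add_im,
    Complex.neg_im, neg_zero, Complex.mul_im, zero_add] at hrect
  have b1 : ‖∫ x in (-T)..T, H (x + T * Complex.I)‖ ≤ C / T ^ 2 * |T - -T| := by
    refine intervalIntegral.norm_integral_le_of_norm_le_const fun l _ =>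
      (hC _ (by simpa using hT0)).trans ?_
    rw [hnorm]
    gcongr
    nlinarith [sq_nonneg l]
  have b2 : ∀ s : ℝ, s ^ 2 = T ^ 2 →
      ‖∫ y in ε..T, H (s + y * Complex.I)‖ ≤ C / T ^ 2 * |T - ε| := by
    intro s hs
    refine intervalIntegral.norm_integral_le_of_norm_le_const fun y hy => ?_
    rw [uIoc_of_le hTε] at hy
    refine (hC _ (by simpa using hε.trans hy.1)).trans ?_
    rw [hnorm, hs]
    gcongr
    nlinarith [sq_nonneg y]
  have b3 := b2 T rfl
  have b4 := b2 (-T) (by ring)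
  push_cast at b4
  have e : ∫ x in (-T)..T, H (x + ε * Complex.I) = (∫ x in (-T)..T, H (x + T * Complex.I)) -
      Complex.I * (∫ y in ε..T, H (T + y * Complex.I)) +
      Complex.I * (∫ y in ε..T, H (-T + y * Complex.I)) := by
    simp only [smul_eq_mul] at hrect
    push_cast at hrect
    linear_combination hrect
  rw [e]
  have hr : |T - -T| = 2 * T := by rw [abs_of_nonneg] <;> linarith
  have hr2 : |T - ε| ≤ T := by rw [abs_of_nonneg] <;> linarith
  have hCT : 0 ≤ C / T ^ 2 := by positivity
  calc _ ≤ ‖∫ x in (-T)..T, H (x + T * Complex.I)‖ + ‖∫ y in ε..T, H (T + y * Complex.I)‖ +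
      ‖∫ y in ε..T, H (-T + y * Complex.I)‖ := by
        refine (norm_add_le _ _).trans ?_
        gcongr
        · refine (norm_sub_le _ _).trans ?_
          simp
        · simp
    _ ≤ C / T ^ 2 * (2 * T) + C / T ^ 2 * T + C / T ^ 2 * T := by
        rw [hr] at b1
        gcongr
        · exact b3.trans (by gcongr)
        · exact b4.trans (by gcongr)
    _ = 4 * C / T := by field_simp; ring

/-- Boundary version of `integral_line_eq_zero`. -/
theorem integral_boundary_eq_zero {H : ℂ → ℂ} {G : ℝ → ℂ} {C : ℝ}
    (hH : DifferentiableOn ℂ H {z | 0 < z.im})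
    (hC : ∀ z : ℂ, 0 < z.im → ‖H z‖ ≤ C / (1 + ‖z‖ ^ 2))
    (hG : ∀ᵐ l : ℝ, Tendsto (fun ε : ℝ => H (l + ε * Complex.I)) (𝓝[>] 0) (𝓝 (G l))) :
    ∫ l : ℝ, G l = 0 := by
  have hC0 : 0 ≤ C := by
    have := (norm_nonneg _).trans (hC Complex.I (by simp))
    simp at this; linarith
  have hnorm : ∀ l s : ℝ, ‖(l + s * Complex.I : ℂ)‖ ^ 2 = l ^ 2 + s ^ 2 := fun l s => by
    rw [← Complex.normSq_eq_norm_sq, Complex.normSq_add_mul_I]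
  have h := tendsto_integral_filter_of_dominated_convergence (μ := volume) (l := 𝓝[>] (0 : ℝ))
    (F := fun (ε : ℝ) (l : ℝ) => H (l + ε * Complex.I)) (f := G)
    (fun l => C * (1 + l ^ 2)⁻¹) ?_ ?_ ((integrable_inv_one_add_sq).const_mul C) hG
  · refine tendsto_nhds_unique h ?_
    refine tendsto_const_nhds.congr' ?_
    filter_upwards [self_mem_nhdsWithin] with ε hε
    exact (integral_line_eq_zero hH hC hε).symm
  · filter_upwards [self_mem_nhdsWithin] with ε hε
    have hε : 0 < ε := hε
    refine (hH.continuousOn.comp_continuous (by fun_prop) fun l => ?_).aestronglyMeasurable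
    simpa using hε
  · filter_upwards [self_mem_nhdsWithin] with ε hε
    have hε : 0 < ε := hε
    refine Eventually.of_forall fun l => (hC _ (by simpa using hε)).trans ?_
    rw [hnorm, div_eq_mul_inv]
    gcongr
    nlinarith

/-- A bound that degenerates on the imaginary axis improves by the maximum principle. -/
theorem norm_le_of_norm_le_div_re {H : ℂ → ℂ} {M : ℝ} (hH : DifferentiableOn ℂ H {z | 0 < z.im})
    (hM : ∀ z : ℂ, 0 < z.im → z.re ≠ 0 → ‖H z‖ ≤ M * (‖z‖ / |z.re|) / (1 + ‖z‖ ^ 2))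
    {z : ℂ} (hz : 0 < z.im) : ‖H z‖ ≤ 48 * M / (1 + ‖z‖ ^ 2) := by
  have hM0 : 0 ≤ M := by
    have := (norm_nonneg _).trans (hM (1 + Complex.I) (by simp) (by simp))
    simp only [Complex.add_re, Complex.one_re, Complex.I_re, add_zero, abs_one, div_one] at this
    by_contra hneg
    push Not at hneg
    have hn : 0 < ‖1 + Complex.I‖ := norm_pos_iff.2 (by
      intro h; have := congrArg Complex.re h; simp at this)
    have : M * ‖1 + Complex.I‖ / (1 + ‖1 + Complex.I‖ ^ 2) < 0 :=
      div_neg_of_neg_of_pos (mul_neg_of_neg_of_pos hneg hn) (by positivity)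
    linarith
  set η := z.im with hη
  have hzn : ‖z‖ ^ 2 = z.re ^ 2 + η ^ 2 := by
    rw [← Complex.normSq_eq_norm_sq, Complex.normSq_apply]; ring
  -- Away from the axis the quotient `‖z‖ / |Re z|` is bounded; `48` is a generous constant covering
  -- both cases.
  by_cases hcase : η / 4 ≤ |z.re|
  · have hre : 0 < |z.re| := by linarith
    refine (hM z hz (abs_pos.1 hre)).trans ?_
    have h1 : ‖z‖ / |z.re| ≤ 48 := by
      rw [div_le_iff₀ hre]
      refine abs_le_of_sq_le_sq' ?_ (by positivity) |>.2
      rw [hzn, mul_pow, sq_abs]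
      have := pow_le_pow_left₀ (by positivity) hcase 2
      rw [sq_abs] at this
      nlinarith
    rw [mul_comm 48 M]
    gcongr
  · push Not at hcase
    have hsq : z.re ^ 2 ≤ η ^ 2 / 16 := by
      have := pow_le_pow_left₀ (abs_nonneg _) hcase.le 2
      rw [sq_abs] at this
      linarith
    set c : ℂ := η * Complex.I with hc
    -- On the circle of radius `η / 2` about `iη` the polynomial `g` has modulus `η |Re w|`, which
    -- cancels the singular factor, while `|g| ≥ η² / 4` at the point `z`. The maximum principle for
    -- `H g` therefore gives a bound without that factor.
    set g : ℂ → ℂ := fun w => (w - c) ^ 2 + (η / 2) ^ 2 with hg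
    have hsub : Metric.closedBall c (η / 2) ⊆ {z : ℂ | 0 < z.im} := by
      intro w hw
      rw [Metric.mem_closedBall, dist_eq_norm] at hw
      have := (Complex.abs_im_le_norm (w - c)).trans hw
      simp [hc] at this
      have := abs_le.1 this
      show 0 < w.im
      linarith [this.1]
    have hmain : ‖H z * g z‖ ≤ M * η * (3 * η / 2) / (1 + η ^ 2 / 4) := by
      refine Complex.norm_le_of_forall_mem_frontier_norm_le (U := Metric.ball c (η / 2))
        (f := fun w => H w * g w) Metric.isBounded_ball ?_ ?_ ?_
      · refine DifferentiableOn.diffContOnCl ?_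
        refine DifferentiableOn.mul (hH.mono (Metric.closure_ball_subset_closedBall.trans hsub)) ?_
        exact (by fun_prop : Differentiable ℂ g).differentiableOn
      · intro w hw
        rw [frontier_ball c (by positivity)] at hw
        have hwim : 0 < w.im := hsub (Metric.sphere_subset_closedBall hw)
        rw [mem_sphere_iff_norm] at hw
        have hw1 : Complex.normSq (w - c) = (η / 2) ^ 2 := by
          rw [Complex.normSq_eq_norm_sq, hw]
        have hw2 : w.re ^ 2 + (w.im - η) ^ 2 = (η / 2) ^ 2 := by
          rw [← hw1, Complex.normSq_apply]; simp [hc]; ring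
        have hgn : ‖g w‖ = η * |w.re| := by
          have : g w = ((2 * w.re : ℝ) : ℂ) * (w - c) := by
            have h2 : ((w.re ^ 2 + (w.im - η) ^ 2 : ℝ) : ℂ) = (((η / 2) ^ 2 : ℝ) : ℂ) := by
              rw [hw2]
            have h3 : w - c = w.re + (w.im - η) * Complex.I := by
              conv_lhs => rw [← Complex.re_add_im w]
              rw [hc]; ring
            simp only [hg]
            rw [h3]
            push_cast at h2 ⊢
            rw [← h2]
            linear_combination ((w.im : ℂ) - η) ^ 2 * Complex.I_sq
          rw [this, norm_mul, hw, Complex.norm_real, Real.norm_eq_abs, abs_mul, abs_two]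
          ring
        have hwn : ‖w‖ ≤ 3 * η / 2 := by
          calc ‖w‖ = ‖(w - c) + c‖ := by ring_nf
            _ ≤ ‖w - c‖ + ‖c‖ := norm_add_le _ _
            _ = 3 * η / 2 := by
              rw [hw, hc]; simp [abs_of_pos hz]; ring
        have hwn2 : η ^ 2 / 4 ≤ ‖w‖ ^ 2 := by
          have h4 : ‖w‖ ^ 2 = w.re ^ 2 + w.im ^ 2 := by
            rw [← Complex.normSq_eq_norm_sq, Complex.normSq_apply]; ring
          rw [h4]
          have h5 : η / 2 ≤ w.im := by
            have := abs_le_of_sq_le_sq' (a := w.im - η) (b := η / 2) (by nlinarith [sq_nonneg w.re])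
              (by positivity)
            linarith [this.1]
          nlinarith [sq_nonneg w.re]
        by_cases hre : w.re = 0
        · rw [norm_mul, hgn, hre]
          simp
          positivity
        · rw [norm_mul, hgn]
          have hre' : 0 < |w.re| := abs_pos.2 hre
          calc ‖H w‖ * (η * |w.re|) ≤ M * (‖w‖ / |w.re|) / (1 + ‖w‖ ^ 2) * (η * |w.re|) := by
                gcongr; exact hM w hwim hre
            _ = M * η * ‖w‖ / (1 + ‖w‖ ^ 2) := by field_simp
            _ ≤ M * η * (3 * η / 2) / (1 + η ^ 2 / 4) := by gcongr
      · refine subset_closure ?_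
        rw [mem_ball_iff_norm]
        have : z - c = z.re := by
          conv_lhs => rw [← Complex.re_add_im z]
          rw [hc, hη]; ring
        rw [this, Complex.norm_real, Real.norm_eq_abs]
        linarith
    have hgz : η ^ 2 / 4 ≤ ‖g z‖ := by
      have : g z = ((z.re ^ 2 + (η / 2) ^ 2 : ℝ) : ℂ) := by
        have h3 : z - c = z.re := by
          conv_lhs => rw [← Complex.re_add_im z]
          rw [hc, hη]; ring
        simp only [hg]
        rw [h3]; push_cast; ring
      rw [this, Complex.norm_real, Real.norm_eq_abs, abs_of_nonneg (by positivity)]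
      nlinarith [sq_nonneg z.re]
    rw [norm_mul] at hmain
    have hη2 : 0 < η ^ 2 / 4 := by positivity
    have h5 : ‖H z‖ * (η ^ 2 / 4) ≤ M * η * (3 * η / 2) / (1 + η ^ 2 / 4) :=
      (mul_le_mul_of_nonneg_left hgz (norm_nonneg _)).trans hmain
    have h6 : ‖H z‖ ≤ 6 * M / (1 + η ^ 2 / 4) := by
      rw [← le_div_iff₀ hη2] at h5
      refine h5.trans (le_of_eq ?_)
      field_simp
      ring
    refine h6.trans ?_
    rw [div_le_div_iff₀ (by positivity) (by positivity), hzn]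
    nlinarith [mul_nonneg hM0 (sq_nonneg η), mul_nonneg hM0 (sub_nonneg.2 hsq)]

/-! ### The Cauchy function of the free equation as a Fourier transform -/

/-- The inverse Fourier transform of `sin (z r) / z`. -/
noncomputable def boxKer (r u : ℝ) : ℝ :=
  (if |u| < r then 1 / 2 else 0) - (if |u| < -r then 1 / 2 else 0)

theorem measurable_boxKer : Measurable fun p : ℝ × ℝ => boxKer p.1 p.2 := by
  unfold boxKer
  refine Measurable.sub (Measurable.ite ?_ measurable_const measurable_const)
    (Measurable.ite ?_ measurable_const measurable_const)
  · exact measurableSet_lt (by fun_prop) (by fun_prop)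
  · exact measurableSet_lt (by fun_prop) (by fun_prop)

theorem boxKer_eq_zero {r u : ℝ} (h : |r| ≤ |u|) : boxKer r u = 0 := by
  have h1 : ¬ |u| < r := fun h' => absurd (h'.trans_le (le_abs_self r)) (not_lt.2 h)
  have h2 : ¬ |u| < -r := fun h' => absurd (h'.trans_le (neg_le_abs r)) (not_lt.2 h)
  simp [boxKer, h1, h2]

theorem abs_boxKer_le (r u : ℝ) : |boxKer r u| ≤ 1 / 2 := by
  unfold boxKer
  split_ifs with h1 h2
  · have := abs_nonneg u; linarith
  · norm_num
  · norm_num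
  · norm_num

theorem integral_boxKer_of_pos {r : ℝ} (hr : 0 < r) {z : ℂ} (hz : z ≠ 0) :
    ∫ u : ℝ, (boxKer r u : ℂ) * Complex.exp (Complex.I * z * u) = Complex.sin (z * r) / z := by
  have h1 : ∀ u : ℝ, (boxKer r u : ℂ) * Complex.exp (Complex.I * z * u) =
      (Ioo (-r) r).indicator (fun u : ℝ => 1 / 2 * Complex.exp (Complex.I * z * u)) u := by
    intro u
    have h2 : ¬ |u| < -r := by have := abs_nonneg u; intro h; linarith
    by_cases h : |u| < r
    · have : u ∈ Ioo (-r) r := abs_lt.1 h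
      rw [indicator_of_mem this]
      simp [boxKer, h, h2]
    · have : u ∉ Ioo (-r) r := fun h' => h (abs_lt.2 h')
      rw [indicator_of_notMem this]
      simp [boxKer, h, h2]
  simp_rw [h1]
  rw [integral_indicator measurableSet_Ioo, ← integral_Ioc_eq_integral_Ioo,
    ← intervalIntegral.integral_of_le (by linarith), intervalIntegral.integral_const_mul,
    integral_exp_mul_complex (mul_ne_zero Complex.I_ne_zero hz), Complex.sin]
  have hI : Complex.I ≠ 0 := Complex.I_ne_zero
  push_cast
  field_simp
  rw [Complex.I_sq]
  ring_nf

/-- `z ≠ 0` matters: at `z = 0` the right side is `0` by the convention for division, while the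
integral is `r`. -/
theorem integral_boxKer (r : ℝ) {z : ℂ} (hz : z ≠ 0) :
    ∫ u : ℝ, (boxKer r u : ℂ) * Complex.exp (Complex.I * z * u) = Complex.sin (z * r) / z := by
  rcases lt_trichotomy r 0 with h | h | h
  · have := integral_boxKer_of_pos (neg_pos.2 h) hz
    have h2 : ∀ u, boxKer r u = - boxKer (-r) u := fun u => by simp [boxKer]
    simp_rw [h2]
    push_cast at this ⊢
    simp_rw [neg_mul]
    rw [integral_neg, this]
    simp only [mul_neg, Complex.sin_neg]
    ring
  · subst h
    have h2 : ∀ u, boxKer 0 u = 0 := fun u => by simp [boxKer]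
    simp [h2]
  · exact integral_boxKer_of_pos h hz

namespace ScatteringProblem

variable {P : ScatteringProblem}

/-- Standing assumptions on the coefficients of the equation. -/
structure Admissible (P : ScatteringProblem) : Prop where
  a_pos : 0 < P.a
  α_pos : 0 < P.α
  q_meas : Measurable P.q
  q_int : IntegrableOn (fun x => (1 + x) * P.q x) (Ioi 0)

noncomputable def sqrtRho (P : ScatteringProblem) (x : ℝ) : ℝ := √(P.rho x)

/-- Signed travel time from the interface. As `muPlus = a + nu` and `muMinus = a - nu`, all phases
depend on `x` through `nu` alone. -/
noncomputable def nu (P : ScatteringProblem) (x : ℝ) : ℝ := P.sqrtRho x * (x - P.a)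

theorem sqrtRho_of_lt (h : P.Admissible) {x : ℝ} (hx : x < P.a) : P.sqrtRho x = P.α := by
  simp [sqrtRho, rho, hx, Real.sqrt_sq h.α_pos.le]

theorem sqrtRho_of_le {x : ℝ} (hx : P.a ≤ x) : P.sqrtRho x = 1 := by
  simp [sqrtRho, rho, not_lt.2 hx]

theorem sqrtRho_pos (h : P.Admissible) (x : ℝ) : 0 < P.sqrtRho x := by
  rcases lt_or_ge x P.a with hx | hx
  · rw [sqrtRho_of_lt h hx]; exact h.α_pos
  · rw [sqrtRho_of_le hx]; exact one_pos

theorem rho_eq (x : ℝ) : P.rho x = P.sqrtRho x ^ 2 := by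
  rw [sqrtRho, Real.sq_sqrt]
  unfold rho
  split_ifs
  · positivity
  · exact zero_le_one

theorem measurable_rho : Measurable P.rho :=
  Measurable.ite measurableSet_Iio measurable_const measurable_const

theorem measurable_sqrtRho : Measurable P.sqrtRho := measurable_rho.sqrt

theorem measurable_nu : Measurable P.nu := measurable_sqrtRho.mul (by fun_prop)

theorem muPlus_eq (x : ℝ) : P.muPlus x = P.a + P.nu x := by
  simp only [muPlus, nu, sqrtRho]; ring

theorem muMinus_eq (x : ℝ) : P.muMinus x = P.a - P.nu x := by
  simp only [muMinus, nu, sqrtRho]; ring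

theorem nu_of_lt (h : P.Admissible) {x : ℝ} (hx : x < P.a) : P.nu x = P.α * (x - P.a) := by
  rw [nu, sqrtRho_of_lt h hx]

theorem nu_of_le {x : ℝ} (hx : P.a ≤ x) : P.nu x = x - P.a := by
  rw [nu, sqrtRho_of_le hx, one_mul]

theorem nu_nonpos (h : P.Admissible) {x : ℝ} (hx : x ≤ P.a) : P.nu x ≤ 0 :=
  mul_nonpos_of_nonneg_of_nonpos (sqrtRho_pos h x).le (by linarith)

theorem nu_nonneg {x : ℝ} (hx : P.a ≤ x) : 0 ≤ P.nu x := by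
  rw [nu_of_le hx]; linarith

/-- The slope of `nu` lies between `min 1 α` and `max 1 α`; cruder constants suffice. -/
theorem nu_sub_le (h : P.Admissible) {x t : ℝ} (hxt : x ≤ t) :
    P.nu t - P.nu x ≤ (1 + P.α) * (t - x) := by
  have := h.α_pos
  rcases lt_or_ge x P.a with hx | hx
  · rcases lt_or_ge t P.a with ht | ht
    · rw [nu_of_lt h hx, nu_of_lt h ht]; nlinarith
    · rw [nu_of_lt h hx, nu_of_le ht]; nlinarith
  · rw [nu_of_le hx, nu_of_le (hx.trans hxt)]; nlinarith

theorem nu_strictMono (h : P.Admissible) : StrictMono P.nu := by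
  intro x t hxt
  have := h.α_pos
  rcases lt_or_ge x P.a with hx | hx
  · rcases lt_or_ge t P.a with ht | ht
    · rw [nu_of_lt h hx, nu_of_lt h ht]; nlinarith
    · rw [nu_of_lt h hx, nu_of_le ht]; nlinarith
  · rw [nu_of_le hx, nu_of_le (hx.trans hxt.le)]; linarith

/-- The wave reflected at the interface never outruns the direct one; this fixes the support of the
Cauchy kernel. -/
theorem abs_nu_add_le (h : P.Admissible) {x t : ℝ} (hx : x < P.a) (ht : P.a ≤ t) :
    |P.nu t + P.nu x| ≤ P.nu t - P.nu x := by
  have h1 := nu_nonpos h hx.le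
  have h2 := nu_nonneg ht
  rw [abs_le]; constructor <;> linarith

/-- The kernel of the Cauchy function of the equation with `q = 0`. -/
noncomputable def cauchyKer (P : ScatteringProblem) (x t u : ℝ) : ℝ :=
  1 / 2 * ((P.sqrtRho t)⁻¹ + (P.sqrtRho x)⁻¹) * boxKer (P.nu t - P.nu x) u +
    1 / 2 * ((P.sqrtRho t)⁻¹ - (P.sqrtRho x)⁻¹) * boxKer (P.nu t + P.nu x) u

/-- The Cauchy function of the equation with `q = 0`. -/
noncomputable def cauchyFun (P : ScatteringProblem) (z : ℂ) (x t : ℝ) : ℂ :=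
  1 / 2 * ((P.sqrtRho t : ℂ)⁻¹ + (P.sqrtRho x : ℂ)⁻¹) *
      (Complex.sin (z * (P.nu t - P.nu x : ℝ)) / z) +
    1 / 2 * ((P.sqrtRho t : ℂ)⁻¹ - (P.sqrtRho x : ℂ)⁻¹) *
      (Complex.sin (z * (P.nu t + P.nu x : ℝ)) / z)

theorem measurable_cauchyKer :
    Measurable fun p : ℝ × ℝ × ℝ => P.cauchyKer p.1 p.2.1 p.2.2 := by
  have hs := measurable_sqrtRho (P := P)
  have hn := measurable_nu (P := P)
  unfold cauchyKer
  refine Measurable.add (Measurable.mul ?_ ?_) (Measurable.mul ?_ ?_)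
  · exact ((hs.comp (by fun_prop)).inv.add (hs.comp (by fun_prop)).inv).const_mul _
  · exact measurable_boxKer.comp (((hn.comp (by fun_prop)).sub (hn.comp (by fun_prop))).prodMk
      (by fun_prop))
  · exact ((hs.comp (by fun_prop)).inv.sub (hs.comp (by fun_prop)).inv).const_mul _
  · exact measurable_boxKer.comp (((hn.comp (by fun_prop)).add (hn.comp (by fun_prop))).prodMk
      (by fun_prop))

theorem inv_sqrtRho_le (h : P.Admissible) (x : ℝ) : (P.sqrtRho x)⁻¹ ≤ 1 + P.α⁻¹ := by
  have := inv_pos.2 h.α_pos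
  rcases lt_or_ge x P.a with hx | hx
  · rw [sqrtRho_of_lt h hx]; linarith
  · rw [sqrtRho_of_le hx, inv_one]; linarith

theorem abs_cauchyKer_le (h : P.Admissible) (x t u : ℝ) :
    |P.cauchyKer x t u| ≤ 1 + P.α⁻¹ := by
  have h1 := inv_sqrtRho_le h x
  have h2 := inv_sqrtRho_le h t
  have h3 := inv_pos.2 (sqrtRho_pos h x)
  have h4 := inv_pos.2 (sqrtRho_pos h t)
  unfold cauchyKer
  refine (abs_add_le _ _).trans ?_
  rw [abs_mul, abs_mul, abs_mul, abs_mul]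
  have h5 : |(P.sqrtRho t)⁻¹ + (P.sqrtRho x)⁻¹| ≤ 2 * (1 + P.α⁻¹) := by
    rw [abs_of_pos (by linarith)]; linarith
  have h6 : |(P.sqrtRho t)⁻¹ - (P.sqrtRho x)⁻¹| ≤ 1 + P.α⁻¹ := by
    rw [abs_le]; constructor <;> linarith
  have h7 : |(1 / 2 : ℝ)| = 1 / 2 := by norm_num
  rw [h7]
  calc _ ≤ 1 / 2 * (2 * (1 + P.α⁻¹)) * (1 / 2) + 1 / 2 * (1 + P.α⁻¹) * (1 / 2) := by
        have h8 := inv_pos.2 h.α_pos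
        gcongr
        · exact abs_boxKer_le _ _
        · exact abs_boxKer_le _ _
    _ ≤ 1 + P.α⁻¹ := by have := inv_pos.2 h.α_pos; linarith

/-- The reflected term is present only when `x` and `t` lie on different sides of the interface, and
there its range is no longer than that of the direct term. -/
theorem cauchyKer_eq_zero (h : P.Admissible) {x t u : ℝ} (hxt : x ≤ t)
    (hu : P.nu t - P.nu x ≤ |u|) : P.cauchyKer x t u = 0 := by
  have h1 : 0 ≤ P.nu t - P.nu x := sub_nonneg.2 ((nu_strictMono h).monotone hxt)
  unfold cauchyKer
  rw [boxKer_eq_zero (r := P.nu t - P.nu x) (by rwa [abs_of_nonneg h1])]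
  rcases lt_or_ge x P.a with hx | hx
  · rcases lt_or_ge t P.a with ht | ht
    · rw [sqrtRho_of_lt h hx, sqrtRho_of_lt h ht]; ring
    · rw [boxKer_eq_zero ((abs_nu_add_le h hx ht).trans hu)]; ring
  · rw [sqrtRho_of_le hx, sqrtRho_of_le (hx.trans hxt)]; ring

/-- The mass grows linearly with the travel time from `x` to `t`; this is where the weight `1 + x`
on the potential is spent. -/
theorem lintegral_cauchyKer_le (h : P.Admissible) {x t : ℝ} (hxt : x ≤ t) :
    ∫⁻ u : ℝ, ‖P.cauchyKer x t u‖ₑ ≤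
      ENNReal.ofReal (2 * (1 + P.α⁻¹) * (P.nu t - P.nu x)) := by
  have h1 : 0 ≤ P.nu t - P.nu x := sub_nonneg.2 ((nu_strictMono h).monotone hxt)
  have h0 := inv_pos.2 h.α_pos
  calc ∫⁻ u : ℝ, ‖P.cauchyKer x t u‖ₑ
      ≤ ∫⁻ u : ℝ, (Icc (-(P.nu t - P.nu x)) (P.nu t - P.nu x)).indicator
          (fun _ => ENNReal.ofReal (1 + P.α⁻¹)) u := by
        refine lintegral_mono fun u => ?_
        by_cases hu : u ∈ Icc (-(P.nu t - P.nu x)) (P.nu t - P.nu x)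
        · simp only [indicator_of_mem hu]
          rw [← ofReal_norm, Real.norm_eq_abs]
          exact ENNReal.ofReal_le_ofReal (abs_cauchyKer_le h x t u)
        · rw [cauchyKer_eq_zero h hxt]
          · simp
          · by_contra hlt
            push Not at hlt
            exact hu (abs_le.1 hlt.le)
    _ = ENNReal.ofReal (2 * (1 + P.α⁻¹) * (P.nu t - P.nu x)) := by
        rw [lintegral_indicator measurableSet_Icc, setLIntegral_const, Real.volume_Icc,
          ← ENNReal.ofReal_mul (by positivity)]
        congr 1; ring

theorem integral_cauchyKer (x t : ℝ) {z : ℂ} (hz : z ≠ 0) :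
    ∫ u : ℝ, (P.cauchyKer x t u : ℂ) * Complex.exp (Complex.I * z * u) = P.cauchyFun z x t := by
  have hint : ∀ r : ℝ, Integrable fun u : ℝ =>
      (boxKer r u : ℂ) * Complex.exp (Complex.I * z * u) := by
    intro r
    have : (fun u : ℝ => (boxKer r u : ℂ) * Complex.exp (Complex.I * z * u)) =
        (Icc (-|r|) |r|).indicator fun u : ℝ =>
          (boxKer r u : ℂ) * Complex.exp (Complex.I * z * u) := by
      ext u
      by_cases hu : u ∈ Icc (-|r|) |r|
      · rw [indicator_of_mem hu]
      · rw [indicator_of_notMem hu, boxKer_eq_zero]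
        · simp
        · by_contra hlt
          push Not at hlt
          exact hu (abs_le.1 hlt.le)
    rw [this, integrable_indicator_iff measurableSet_Icc]
    refine Integrable.bdd_mul (c := 1 / 2)
      ((by fun_prop : Continuous fun u : ℝ => Complex.exp (Complex.I * z * u)).integrableOn_Icc)
      ?_ (Eventually.of_forall fun u => ?_)
    · exact (Complex.measurable_ofReal.comp (measurable_boxKer.comp
        (measurable_const.prodMk measurable_id))).aestronglyMeasurable
    · rw [Complex.norm_real]; exact abs_boxKer_le r u
  unfold cauchyKer cauchyFun
  rw [← integral_boxKer _ hz, ← integral_boxKer _ hz, ← integral_const_mul, ← integral_const_mul,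
    ← integral_add ((hint _).const_mul _) ((hint _).const_mul _)]
  congr 1
  ext u
  push_cast
  ring

theorem integral_cauchyKer_sub (x t p : ℝ) {z : ℂ} (hz : z ≠ 0) :
    ∫ y : ℝ, (P.cauchyKer x t (y - p) : ℂ) * Complex.exp (Complex.I * z * y) =
      P.cauchyFun z x t * Complex.exp (Complex.I * z * p) := by
  rw [← integral_cauchyKer x t hz, ← integral_mul_const,
    ← integral_sub_right_eq_self (fun u : ℝ => (P.cauchyKer x t u : ℂ) *
      Complex.exp (Complex.I * z * u) * Complex.exp (Complex.I * z * p)) p]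
  congr 1
  ext y
  rw [mul_assoc _ (Complex.exp _), ← Complex.exp_add]
  push_cast
  ring_nf

theorem norm_cauchyFun_le_of_bound (h : P.Admissible) {x t : ℝ} (hxt : x ≤ t) {z : ℂ}
    {b : ℝ} (hb : ∀ r : ℝ, |r| ≤ P.nu t - P.nu x → ‖Complex.sin (z * r) / z‖ ≤ b) :
    ‖P.cauchyFun z x t‖ ≤ 2 * (1 + P.α⁻¹) * b := by
  have h1 : 0 ≤ P.nu t - P.nu x := sub_nonneg.2 ((nu_strictMono h).monotone hxt)
  have hb0 : 0 ≤ b := (norm_nonneg _).trans (hb 0 (by simpa using h1))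
  have hs1 := inv_sqrtRho_le h x
  have hs2 := inv_sqrtRho_le h t
  have hs3 := inv_pos.2 (sqrtRho_pos h x)
  have hs4 := inv_pos.2 (sqrtRho_pos h t)
  have h5 : ‖1 / 2 * ((P.sqrtRho t : ℂ)⁻¹ + (P.sqrtRho x : ℂ)⁻¹)‖ ≤ 1 + P.α⁻¹ := by
    have : (1 / 2 * ((P.sqrtRho t : ℂ)⁻¹ + (P.sqrtRho x : ℂ)⁻¹)) =
      ((1 / 2 * ((P.sqrtRho t)⁻¹ + (P.sqrtRho x)⁻¹) : ℝ) : ℂ) := by push_cast; ring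
    rw [this, Complex.norm_real, Real.norm_eq_abs, abs_le]; constructor <;> linarith
  have h6 : ‖1 / 2 * ((P.sqrtRho t : ℂ)⁻¹ - (P.sqrtRho x : ℂ)⁻¹)‖ ≤ 1 + P.α⁻¹ := by
    have : (1 / 2 * ((P.sqrtRho t : ℂ)⁻¹ - (P.sqrtRho x : ℂ)⁻¹)) =
      ((1 / 2 * ((P.sqrtRho t)⁻¹ - (P.sqrtRho x)⁻¹) : ℝ) : ℂ) := by push_cast; ring
    rw [this, Complex.norm_real, Real.norm_eq_abs, abs_le]; constructor <;> linarith
  have h7 : ‖1 / 2 * ((P.sqrtRho t : ℂ)⁻¹ - (P.sqrtRho x : ℂ)⁻¹) *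
      (Complex.sin (z * (P.nu t + P.nu x : ℝ)) / z)‖ ≤ (1 + P.α⁻¹) * b := by
    rcases lt_or_ge x P.a with hx | hx
    · rcases lt_or_ge t P.a with ht | ht
      · rw [sqrtRho_of_lt h hx, sqrtRho_of_lt h ht, sub_self, mul_zero, zero_mul, norm_zero]
        have := inv_pos.2 h.α_pos
        positivity
      · rw [norm_mul]
        exact mul_le_mul h6 (hb _ (abs_nu_add_le h hx ht)) (norm_nonneg _)
          (by have := inv_pos.2 h.α_pos; positivity)
    · rw [sqrtRho_of_le hx, sqrtRho_of_le (hx.trans hxt), sub_self, mul_zero, zero_mul, norm_zero]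
      have := inv_pos.2 h.α_pos
      positivity
  unfold cauchyFun
  refine (norm_add_le _ _).trans ?_
  rw [norm_mul]
  have := mul_le_mul h5 (hb _ (by rw [abs_of_nonneg h1])) (norm_nonneg _)
    (by have := inv_pos.2 h.α_pos; positivity)
  linarith

theorem norm_sin_le (z : ℂ) (r b : ℝ) (hr : |r| ≤ b) :
    ‖Complex.sin (z * r)‖ ≤ Real.exp (|z.im| * b) := by
  have h1 : ∀ s : ℝ, |s| ≤ b → ‖Complex.exp (z * s * Complex.I)‖ ≤ Real.exp (|z.im| * b) := by
    intro s hs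
    rw [Complex.norm_exp]
    refine Real.exp_le_exp.2 ?_
    have : (z * s * Complex.I).re = -(z.im * s) := by simp
    rw [this]
    calc -(z.im * s) ≤ |z.im * s| := neg_le_abs _
      _ = |z.im| * |s| := abs_mul _ _
      _ ≤ |z.im| * b := by gcongr
  rw [Complex.sin, norm_div, norm_mul, Complex.norm_I, mul_one]
  have h2 := h1 r hr
  have h3 := h1 (-r) (by rwa [abs_neg])
  push_cast at h3
  have : -(z * r) * Complex.I = z * -r * Complex.I := by ring
  rw [this]
  have h4 := norm_sub_le (Complex.exp (z * -r * Complex.I)) (Complex.exp (z * r * Complex.I))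
  have h5 : ‖(2 : ℂ)‖ = 2 := by simp
  rw [h5, div_le_iff₀ (by norm_num)]
  linarith

theorem norm_cos_le (z : ℂ) (r b : ℝ) (hr : |r| ≤ b) :
    ‖Complex.cos (z * r)‖ ≤ Real.exp (|z.im| * b) := by
  have h1 : ∀ s : ℝ, |s| ≤ b → ‖Complex.exp (z * s * Complex.I)‖ ≤ Real.exp (|z.im| * b) := by
    intro s hs
    rw [Complex.norm_exp]
    refine Real.exp_le_exp.2 ?_
    have : (z * s * Complex.I).re = -(z.im * s) := by simp
    rw [this]
    calc -(z.im * s) ≤ |z.im * s| := neg_le_abs _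
      _ = |z.im| * |s| := abs_mul _ _
      _ ≤ |z.im| * b := by gcongr
  rw [Complex.cos, norm_div]
  have h2 := h1 r hr
  have h3 := h1 (-r) (by rwa [abs_neg])
  push_cast at h3
  have : -(z * r) * Complex.I = z * -r * Complex.I := by ring
  rw [this]
  have h4 := norm_add_le (Complex.exp (z * r * Complex.I)) (Complex.exp (z * -r * Complex.I))
  have h5 : ‖(2 : ℂ)‖ = 2 := by simp
  rw [h5, div_le_iff₀ (by norm_num)]
  linarith

theorem norm_cauchyFun_le (h : P.Admissible) {x t : ℝ} (hxt : x ≤ t) (z : ℂ) :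
    ‖P.cauchyFun z x t‖ ≤
      2 * (1 + P.α⁻¹) * (Real.exp (|z.im| * (P.nu t - P.nu x)) / ‖z‖) :=
  norm_cauchyFun_le_of_bound h hxt fun r hr => by
    rw [norm_div]
    gcongr
    exact norm_sin_le z r _ hr

/-- The majorant of the iteration for the Jost solution. -/
noncomputable def kap (P : ScatteringProblem) (t : ℝ) : ℝ :=
  2 * (1 + P.α⁻¹) * (1 + P.α) * |(1 + t) * P.q t|

theorem kap_nonneg (h : P.Admissible) (t : ℝ) : 0 ≤ P.kap t := by
  have := h.α_pos
  unfold kap; positivity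

theorem integrableOn_kap (h : P.Admissible) : IntegrableOn P.kap (Ioi 0) :=
  (h.q_int.abs).const_mul _

theorem integrableOn_q (h : P.Admissible) : IntegrableOn P.q (Ioi 0) := by
  refine Integrable.mono h.q_int h.q_meas.aestronglyMeasurable ?_
  refine (ae_restrict_iff' measurableSet_Ioi).2 (Eventually.of_forall fun t ht => ?_)
  have ht : 0 < t := ht
  rw [norm_mul, Real.norm_of_nonneg (by linarith : 0 ≤ 1 + t)]
  nlinarith [norm_nonneg (P.q t)]

end ScatteringProblem

/-! ### One step of the Volterra iteration on kernels -/

namespace ScatteringProblem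

variable {P : ScatteringProblem}

section VolterraStep

variable {Ω : Type*} [MeasurableSpace Ω] {m : Measure Ω}

/-- The integrand of `volterraStep`. -/
noncomputable def volterraIntegrand (P : ScatteringProblem) (p f : ℝ → Ω → ℝ) (x y : ℝ)
    (w : ℝ × Ω) : ℝ :=
  (Ioi x).indicator (fun t => P.q t * P.cauchyKer x t (y - p t w.2)) w.1 * f w.1 w.2

/-- One step of the iteration for the kernel of the Jost solution: mass `f t` at positions `p t`
is propagated by the Cauchy kernel. -/
noncomputable def volterraStep (P : ScatteringProblem) (m : Measure Ω) (p f : ℝ → Ω → ℝ)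
    (x y : ℝ) : ℝ :=
  ∫ w, P.volterraIntegrand p f x y w ∂(volume.prod m)

variable {p f : ℝ → Ω → ℝ}

theorem measurable_volterraIntegrand (h : P.Admissible) (hp : Measurable (Function.uncurry p))
    (hf : Measurable (Function.uncurry f)) :
    Measurable fun s : (ℝ × ℝ) × (ℝ × Ω) => P.volterraIntegrand p f s.1.1 s.1.2 s.2 := by
  unfold volterraIntegrand
  have hp' : Measurable fun s : (ℝ × ℝ) × (ℝ × Ω) => p s.2.1 s.2.2 :=
    hp.comp measurable_snd
  refine Measurable.mul ?_ (hf.comp measurable_snd)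
  have : (fun s : (ℝ × ℝ) × (ℝ × Ω) => (Ioi s.1.1).indicator
      (fun t => P.q t * P.cauchyKer s.1.1 t (s.1.2 - p t s.2.2)) s.2.1) =
      {s : (ℝ × ℝ) × (ℝ × Ω) | s.1.1 < s.2.1}.indicator
        (fun s => P.q s.2.1 * P.cauchyKer s.1.1 s.2.1 (s.1.2 - p s.2.1 s.2.2)) := by
    ext s
    simp [indicator]
  rw [this]
  refine Measurable.indicator ?_ (measurableSet_lt (by fun_prop) (by fun_prop))
  refine (h.q_meas.comp (by fun_prop)).mul ?_
  exact measurable_cauchyKer.comp ((by fun_prop : Measurable fun s : (ℝ × ℝ) × (ℝ × Ω) =>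
    s.1.1).prodMk ((by fun_prop : Measurable fun s : (ℝ × ℝ) × (ℝ × Ω) => s.2.1).prodMk
      ((by fun_prop : Measurable fun s : (ℝ × ℝ) × (ℝ × Ω) => s.1.2).sub hp')))

theorem measurable_volterraStep [SFinite m] (h : P.Admissible) (hp : Measurable (Function.uncurry p))
    (hf : Measurable (Function.uncurry f)) :
    Measurable (Function.uncurry (P.volterraStep m p f)) := by
  have := StronglyMeasurable.integral_prod_right (ν := volume.prod m)
    (f := fun (s : ℝ × ℝ) (w : ℝ × Ω) => P.volterraIntegrand p f s.1 s.2 w)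
    (measurable_volterraIntegrand h hp hf).stronglyMeasurable
  exact this.measurable

/-- Finite speed of propagation: mass sitting to the right of `μ⁺(t)` is moved by at most `ν(t) -
ν(x) = μ⁺(t) - μ⁺(x)`. -/
theorem volterraStep_eq_zero (h : P.Admissible)
    (hs : ∀ t, 0 ≤ t → ∀ v, f t v ≠ 0 → P.muPlus t ≤ p t v) {x y : ℝ} (hx : 0 ≤ x)
    (hy : y < P.muPlus x) : P.volterraStep m p f x y = 0 := by
  have : ∀ w, P.volterraIntegrand p f x y w = 0 := by
    rintro ⟨t, v⟩
    simp only [volterraIntegrand]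
    by_cases ht : t ∈ Ioi x
    · have hxt : x < t := ht
      by_cases hf0 : f t v = 0
      · rw [hf0, mul_zero]
      · have h1 := hs t (hx.trans hxt.le) v hf0
        rw [indicator_of_mem ht, cauchyKer_eq_zero h hxt.le, mul_zero, zero_mul]
        rw [muPlus_eq] at h1 hy
        rw [abs_sub_comm]
        refine le_trans ?_ (le_abs_self _)
        linarith
    · rw [indicator_of_notMem ht, zero_mul]
  unfold volterraStep
  simp [this]

/-- Tonelli's theorem reduces the iteration of kernels to a scalar iteration for bounds `B` of their
masses. -/
theorem lintegral_volterraIntegrand_le [SFinite m] (h : P.Admissible) (hp : Measurable (Function.uncurry p))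
    (hf : Measurable (Function.uncurry f)) {B : ℝ → ℝ}
    (hB0 : ∀ t, 0 ≤ t → 0 ≤ B t)
    (hB : ∀ t, 0 ≤ t → ∫⁻ v, ‖f t v‖ₑ ∂m ≤ ENNReal.ofReal (B t))
    (hBi : IntegrableOn (fun t => P.kap t * B t) (Ioi 0)) {x : ℝ} (hx : 0 ≤ x) :
    ∫⁻ w, ∫⁻ y, ‖P.volterraIntegrand p f x y w‖ₑ ∂volume ∂(volume.prod m) ≤
      ENNReal.ofReal (∫ t in Ioi x, P.kap t * B t) := by
  have hm := measurable_volterraIntegrand h hp hf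
  have hm1 : Measurable fun w : ℝ × Ω => ∫⁻ y, ‖P.volterraIntegrand p f x y w‖ₑ := by
    refine Measurable.lintegral_prod_right' (f := fun s : (ℝ × Ω) × ℝ =>
      ‖P.volterraIntegrand p f x s.2 s.1‖ₑ) ?_
    exact (hm.comp ((measurable_const.prodMk measurable_snd).prodMk measurable_fst)).enorm
  rw [lintegral_prod _ hm1.aemeasurable]
  have hpt : ∀ t, ∫⁻ v, ∫⁻ y, ‖P.volterraIntegrand p f x y (t, v)‖ₑ ∂volume ∂m ≤
      (Ioi x).indicator (fun t => ENNReal.ofReal (P.kap t * B t)) t := by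
    intro t
    by_cases ht : t ∈ Ioi x
    · have hxt : x < t := ht
      have ht0 : 0 ≤ t := hx.trans hxt.le
      rw [indicator_of_mem ht]
      have h1 : ∀ v, ∫⁻ y, ‖P.volterraIntegrand p f x y (t, v)‖ₑ ≤
          ENNReal.ofReal (P.kap t) * ‖f t v‖ₑ := by
        intro v
        simp only [volterraIntegrand, indicator_of_mem ht, enorm_mul]
        rw [lintegral_mul_const' _ _ (by simp), lintegral_const_mul' _ _ (by simp),
          lintegral_sub_right_eq_self (fun u => ‖P.cauchyKer x t u‖ₑ) (p t v)]
        gcongr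
        calc ‖P.q t‖ₑ * ∫⁻ u, ‖P.cauchyKer x t u‖ₑ
            ≤ ‖P.q t‖ₑ * ENNReal.ofReal (2 * (1 + P.α⁻¹) * (P.nu t - P.nu x)) := by
              gcongr; exact lintegral_cauchyKer_le h hxt.le
          _ = ENNReal.ofReal (|P.q t| * (2 * (1 + P.α⁻¹) * (P.nu t - P.nu x))) := by
              rw [ENNReal.ofReal_mul (abs_nonneg _), Real.enorm_eq_ofReal_abs]
          _ ≤ ENNReal.ofReal (P.kap t) := by
              refine ENNReal.ofReal_le_ofReal ?_
              have h2 := nu_sub_le h hxt.le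
              have h3 := h.α_pos
              have h4 : P.nu t - P.nu x ≤ (1 + P.α) * (1 + t) :=
                h2.trans (by gcongr; linarith)
              rw [kap, abs_mul, abs_of_nonneg (by linarith : 0 ≤ 1 + t)]
              calc |P.q t| * (2 * (1 + P.α⁻¹) * (P.nu t - P.nu x))
                  ≤ |P.q t| * (2 * (1 + P.α⁻¹) * ((1 + P.α) * (1 + t))) := by gcongr
                _ = _ := by ring
      calc _ ≤ ∫⁻ v, ENNReal.ofReal (P.kap t) * ‖f t v‖ₑ ∂m := lintegral_mono h1
        _ = ENNReal.ofReal (P.kap t) * ∫⁻ v, ‖f t v‖ₑ ∂m := by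
            rw [lintegral_const_mul' _ _ (by simp)]
        _ ≤ ENNReal.ofReal (P.kap t) * ENNReal.ofReal (B t) := by gcongr; exact hB t ht0
        _ = _ := (ENNReal.ofReal_mul (kap_nonneg h t)).symm
    · simp [volterraIntegrand, indicator_of_notMem ht]
  refine (lintegral_mono hpt).trans ?_
  rw [lintegral_indicator measurableSet_Ioi, ofReal_integral_eq_lintegral_ofReal
    (hBi.mono_set (Ioi_subset_Ioi hx))]
  refine (ae_restrict_iff' measurableSet_Ioi).2 (Eventually.of_forall fun t ht => ?_)
  exact mul_nonneg (kap_nonneg h t) (hB0 t (hx.trans (le_of_lt ht)))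

theorem integrable_volterraIntegrand [SFinite m] (h : P.Admissible) (hp : Measurable (Function.uncurry p))
    (hf : Measurable (Function.uncurry f)) {B : ℝ → ℝ} (hB0 : ∀ t, 0 ≤ t → 0 ≤ B t)
    (hB : ∀ t, 0 ≤ t → ∫⁻ v, ‖f t v‖ₑ ∂m ≤ ENNReal.ofReal (B t))
    (hBi : IntegrableOn (fun t => P.kap t * B t) (Ioi 0)) {x : ℝ} (hx : 0 ≤ x) :
    Integrable (fun s : (ℝ × Ω) × ℝ => P.volterraIntegrand p f x s.2 s.1)
      ((volume.prod m).prod volume) := by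
  have hm : Measurable fun s : (ℝ × Ω) × ℝ => P.volterraIntegrand p f x s.2 s.1 :=
    (measurable_volterraIntegrand h hp hf).comp
      ((measurable_const.prodMk measurable_snd).prodMk measurable_fst)
  refine ⟨hm.aestronglyMeasurable, ?_⟩
  rw [hasFiniteIntegral_iff_enorm, lintegral_prod _ hm.enorm.aemeasurable]
  exact (lintegral_volterraIntegrand_le h hp hf hB0 hB hBi hx).trans_lt ENNReal.ofReal_lt_top

theorem lintegral_volterraStep_le [SFinite m] (h : P.Admissible) (hp : Measurable (Function.uncurry p))
    (hf : Measurable (Function.uncurry f)) {B : ℝ → ℝ} (hB0 : ∀ t, 0 ≤ t → 0 ≤ B t)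
    (hB : ∀ t, 0 ≤ t → ∫⁻ v, ‖f t v‖ₑ ∂m ≤ ENNReal.ofReal (B t))
    (hBi : IntegrableOn (fun t => P.kap t * B t) (Ioi 0)) {x : ℝ} (hx : 0 ≤ x) :
    ∫⁻ y, ‖P.volterraStep m p f x y‖ₑ ≤ ENNReal.ofReal (∫ t in Ioi x, P.kap t * B t) := by
  refine le_trans ?_ (lintegral_volterraIntegrand_le h hp hf hB0 hB hBi hx)
  have hm : Measurable fun s : (ℝ × Ω) × ℝ => P.volterraIntegrand p f x s.2 s.1 :=
    (measurable_volterraIntegrand h hp hf).comp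
      ((measurable_const.prodMk measurable_snd).prodMk measurable_fst)
  rw [lintegral_lintegral_swap hm.enorm.aemeasurable]
  exact lintegral_mono fun y => enorm_integral_le_lintegral_enorm _

theorem norm_cexp_le {z : ℂ} (hz : 0 ≤ z.im) {b y : ℝ} (hy : b ≤ y) :
    ‖Complex.exp (Complex.I * z * y)‖ ≤ Real.exp (-(z.im * b)) := by
  rw [Complex.norm_exp]
  refine Real.exp_le_exp.2 ?_
  have : (Complex.I * z * y).re = -(z.im * y) := by simp
  rw [this]
  have := mul_le_mul_of_nonneg_left hy hz
  linarith

/-- On the Fourier side a step is one application of the Volterra operator. The support condition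
keeps the exponentials bounded for `Im z ≥ 0`, which justifies Fubini's theorem. -/
theorem integral_volterraStep [SFinite m] (h : P.Admissible) (hp : Measurable (Function.uncurry p))
    (hf : Measurable (Function.uncurry f)) {B : ℝ → ℝ} (hB0 : ∀ t, 0 ≤ t → 0 ≤ B t)
    (hB : ∀ t, 0 ≤ t → ∫⁻ v, ‖f t v‖ₑ ∂m ≤ ENNReal.ofReal (B t))
    (hBi : IntegrableOn (fun t => P.kap t * B t) (Ioi 0))
    (hs : ∀ t, 0 ≤ t → ∀ v, f t v ≠ 0 → P.muPlus t ≤ p t v) {x : ℝ} (hx : 0 ≤ x) {z : ℂ}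
    (hz : z ≠ 0) (hzi : 0 ≤ z.im) :
    IntegrableOn (fun t => P.cauchyFun z x t * P.q t *
      ∫ v, (f t v : ℂ) * Complex.exp (Complex.I * z * p t v) ∂m) (Ioi x) ∧
    ∫ y : ℝ, (P.volterraStep m p f x y : ℂ) * Complex.exp (Complex.I * z * y) =
      ∫ t in Ioi x, P.cauchyFun z x t * P.q t *
        ∫ v, (f t v : ℂ) * Complex.exp (Complex.I * z * p t v) ∂m := by
  have hint := integrable_volterraIntegrand h hp hf hB0 hB hBi hx
  have hint2 : Integrable (fun s : (ℝ × Ω) × ℝ => (P.volterraIntegrand p f x s.2 s.1 : ℂ) *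
      Complex.exp (Complex.I * z * s.2)) ((volume.prod m).prod volume) := by
    refine Integrable.mono' (hint.norm.mul_const (Real.exp (-(z.im * P.muPlus x))))
      (hint.ofReal.aestronglyMeasurable.mul ((by fun_prop : Continuous fun y : ℝ =>
        Complex.exp (Complex.I * z * y)).measurable.comp
          measurable_snd).aestronglyMeasurable) ?_
    refine Eventually.of_forall fun ⟨⟨t, v⟩, y⟩ => ?_
    rw [norm_mul, Complex.norm_real]
    by_cases h0 : P.volterraIntegrand p f x y (t, v) = 0
    · simp [h0]
    · gcongr
      refine norm_cexp_le hzi ?_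
      by_contra hlt
      push Not at hlt
      apply h0
      simp only [volterraIntegrand]
      by_cases ht : t ∈ Ioi x
      · have hxt : x < t := ht
        by_cases hf0 : f t v = 0
        · rw [hf0, mul_zero]
        · have h1 := hs t (hx.trans hxt.le) v hf0
          rw [indicator_of_mem ht, cauchyKer_eq_zero h hxt.le, mul_zero, zero_mul]
          rw [muPlus_eq] at h1 hlt
          rw [abs_sub_comm]
          refine le_trans ?_ (le_abs_self _)
          linarith
      · rw [indicator_of_notMem ht, zero_mul]
  have e1 : ∀ w : ℝ × Ω, ∫ y : ℝ, (P.volterraIntegrand p f x y w : ℂ) *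
      Complex.exp (Complex.I * z * y) = (Ioi x).indicator (fun t => P.cauchyFun z x t * P.q t *
        ((f t w.2 : ℂ) * Complex.exp (Complex.I * z * p t w.2))) w.1 := by
    rintro ⟨t, v⟩
    simp only [volterraIntegrand]
    by_cases ht : t ∈ Ioi x
    · simp only [indicator_of_mem ht]
      have := integral_cauchyKer_sub (P := P) x t (p t v) hz
      rw [show P.cauchyFun z x t * P.q t * ((f t v : ℂ) * Complex.exp (Complex.I * z * p t v)) =
        (P.q t * f t v : ℂ) * (P.cauchyFun z x t * Complex.exp (Complex.I * z * p t v)) by ring,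
        ← this, ← integral_const_mul]
      congr 1; ext y; push_cast; ring
    · simp [indicator_of_notMem ht]
  have hI := hint2.integral_prod_left
  simp only [e1] at hI
  have e2 : ∀ t, ∫ v, (Ioi x).indicator (fun t => P.cauchyFun z x t * P.q t *
        ((f t v : ℂ) * Complex.exp (Complex.I * z * p t v))) t ∂m =
      (Ioi x).indicator (fun t => P.cauchyFun z x t * P.q t *
        ∫ v, (f t v : ℂ) * Complex.exp (Complex.I * z * p t v) ∂m) t := by
    intro t
    by_cases ht : t ∈ Ioi x
    · simp only [indicator_of_mem ht]; rw [integral_const_mul]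
    · simp [indicator_of_notMem ht]
  constructor
  · have := hI.integral_prod_left
    simp only [e2] at this
    rwa [integrable_indicator_iff measurableSet_Ioi] at this
  · have e3 : ∀ y : ℝ, (P.volterraStep m p f x y : ℂ) * Complex.exp (Complex.I * z * y) =
        ∫ w, (P.volterraIntegrand p f x y w : ℂ) * Complex.exp (Complex.I * z * y)
          ∂(volume.prod m) := by
      intro y
      rw [integral_mul_const, volterraStep, integral_complex_ofReal]
    simp_rw [e3]
    rw [integral_integral_swap (f := fun (y : ℝ) (w : ℝ × Ω) =>
      (P.volterraIntegrand p f x y w : ℂ) * Complex.exp (Complex.I * z * y)) hint2.swap]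
    simp_rw [e1]
    rw [integral_prod _ hI]
    simp_rw [e2]
    rw [integral_indicator measurableSet_Ioi]

end VolterraStep

end ScatteringProblem

/-! ### Series of integrable functions -/

section TsumIntegral

variable {α E : Type*} [MeasurableSpace α] {μ : Measure α} [NormedAddCommGroup E]

theorem ae_summable_norm_of_summable_integral_norm {F : ℕ → α → E}
    (hF : ∀ n, Integrable (F n) μ) (hs : Summable fun n => ∫ a, ‖F n a‖ ∂μ) :
    (∀ᵐ a ∂μ, Summable fun n => ‖F n a‖) ∧
      ∫⁻ a, ∑' n, ‖F n a‖ₑ ∂μ = ENNReal.ofReal (∑' n, ∫ a, ‖F n a‖ ∂μ) := by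
  have h1 : ∫⁻ a, ∑' n, ‖F n a‖ₑ ∂μ = ENNReal.ofReal (∑' n, ∫ a, ‖F n a‖ ∂μ) := by
    rw [lintegral_tsum fun n => (hF n).aestronglyMeasurable.enorm,
      ENNReal.ofReal_tsum_of_nonneg (fun n => integral_nonneg fun a => norm_nonneg _) hs]
    congr 1
    ext n
    rw [ofReal_integral_norm_eq_lintegral_enorm (hF n)]
  refine ⟨?_, h1⟩
  have h2 : ∀ᵐ a ∂μ, ∑' n, ‖F n a‖ₑ < ⊤ := by
    refine ae_lt_top' (AEMeasurable.tsum fun n => (hF n).aestronglyMeasurable.enorm) ?_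
    rw [h1]; exact ENNReal.ofReal_ne_top
  filter_upwards [h2] with a ha
  have : Summable fun n => ‖F n a‖₊ := ENNReal.tsum_coe_ne_top_iff_summable.1 ha.ne
  exact NNReal.summable_coe.2 this

theorem integrable_tsum_of_summable_integral_norm [CompleteSpace E] {F : ℕ → α → E}
    (hF : ∀ n, Integrable (F n) μ) (hs : Summable fun n => ∫ a, ‖F n a‖ ∂μ) :
    Integrable (fun a => ∑' n, F n a) μ ∧
      ∫ a, ‖∑' n, F n a‖ ∂μ ≤ ∑' n, ∫ a, ‖F n a‖ ∂μ := by
  obtain ⟨h1, h2⟩ := ae_summable_norm_of_summable_integral_norm hF hs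
  have hm : AEStronglyMeasurable (fun a => ∑' n, F n a) μ := by
    refine aestronglyMeasurable_of_tendsto_ae (u := atTop)
      (f := fun (n : ℕ) a => ∑ i ∈ Finset.range n, F i a) (fun n => ?_) ?_
    · exact Finset.aestronglyMeasurable_fun_sum _ fun i _ => (hF i).aestronglyMeasurable
    · filter_upwards [h1] with a ha
      exact ha.of_norm.hasSum.tendsto_sum_nat
  have hle : ∫⁻ a, ‖∑' n, F n a‖ₑ ∂μ ≤ ENNReal.ofReal (∑' n, ∫ a, ‖F n a‖ ∂μ) := by
    rw [← h2]
    refine lintegral_mono_ae ?_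
    filter_upwards [h1] with a ha
    exact enorm_tsum_le_tsum_enorm
  have hi : Integrable (fun a => ∑' n, F n a) μ := ⟨hm, hle.trans_lt ENNReal.ofReal_lt_top⟩
  refine ⟨hi, ?_⟩
  rw [← ofReal_integral_norm_eq_lintegral_enorm hi] at hle
  exact (ENNReal.ofReal_le_ofReal_iff
    (tsum_nonneg fun n => integral_nonneg fun a => norm_nonneg _)).1 hle

end TsumIntegral

/-! ### The kernel and the integral equation of the Jost solution -/

namespace ScatteringProblem

variable {P : ScatteringProblem}

noncomputable def cPlus (P : ScatteringProblem) (x : ℝ) : ℝ := 1 / 2 * (1 + (P.sqrtRho x)⁻¹)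
noncomputable def cMinus (P : ScatteringProblem) (x : ℝ) : ℝ := 1 / 2 * (1 - (P.sqrtRho x)⁻¹)

theorem e0_eq (x : ℝ) (z : ℂ) : P.e0 x z =
    P.cPlus x * Complex.exp (Complex.I * z * P.muPlus x) +
      P.cMinus x * Complex.exp (Complex.I * z * P.muMinus x) := by
  simp only [e0, cPlus, cMinus, sqrtRho]
  push_cast
  simp only [one_div]

theorem cMinus_of_le {x : ℝ} (hx : P.a ≤ x) : P.cMinus x = 0 := by
  simp [cMinus, sqrtRho_of_le hx]

theorem cPlus_of_le {x : ℝ} (hx : P.a ≤ x) : P.cPlus x = 1 := by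
  simp [cPlus, sqrtRho_of_le hx]; norm_num

theorem muPlus_le_muMinus (h : P.Admissible) {x : ℝ} (hx : x ≤ P.a) :
    P.muPlus x ≤ P.muMinus x := by
  rw [muPlus_eq, muMinus_eq]
  have := nu_nonpos h hx
  linarith

/-- Either way the point masses behind `e0` do not lie to the left of `μ⁺(x)`, as the Volterra step
requires. -/
theorem cMinus_eq_zero_or (h : P.Admissible) (x : ℝ) :
    P.cMinus x = 0 ∨ P.muPlus x ≤ P.muMinus x := by
  rcases le_total P.a x with hx | hx
  · exact Or.inl (cMinus_of_le hx)
  · exact Or.inr (muPlus_le_muMinus h hx)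

theorem cPlus_nonneg (h : P.Admissible) (x : ℝ) : 0 < P.cPlus x := by
  have := inv_pos.2 (sqrtRho_pos h x)
  unfold cPlus; positivity

theorem abs_cMinus_le (h : P.Admissible) (x : ℝ) : |P.cMinus x| ≤ 1 + P.α⁻¹ := by
  have h1 := inv_pos.2 (sqrtRho_pos h x)
  have h2 := inv_sqrtRho_le h x
  have h3 := inv_pos.2 h.α_pos
  rw [cMinus, abs_le]; constructor <;> linarith

theorem abs_cPlus_le (h : P.Admissible) (x : ℝ) : |P.cPlus x| ≤ 1 + P.α⁻¹ := by
  have h1 := inv_pos.2 (sqrtRho_pos h x)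
  have h2 := inv_sqrtRho_le h x
  have h3 := inv_pos.2 h.α_pos
  rw [cPlus, abs_le]; constructor <;> linarith

/-- The iterates of the kernel of the Jost solution. -/
noncomputable def jostIter (P : ScatteringProblem) : ℕ → ℝ → ℝ → ℝ
  -- `e0` is the transform of two point masses, carried here by counting measure on `Bool`; all
  -- iterates have densities.
  | 0 => P.volterraStep (Measure.count : Measure Bool)
      (fun t b => if b then P.muPlus t else P.muMinus t)
      (fun t b => if b then P.cPlus t else P.cMinus t)
  | n + 1 => P.volterraStep volume (fun _ v => v) (P.jostIter n)

/-- `∫_x^∞ kap`. -/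
noncomputable def tailKap (P : ScatteringProblem) (x : ℝ) : ℝ := ∫ t in Ioi x, P.kap t

theorem tailKap_nonneg (h : P.Admissible) (x : ℝ) : 0 ≤ P.tailKap x :=
  setIntegral_nonneg measurableSet_Ioi fun t _ => kap_nonneg h t

theorem tailKap_anti (h : P.Admissible) {x y : ℝ} (hx : 0 ≤ x) (hxy : x ≤ y) :
    P.tailKap y ≤ P.tailKap x :=
  setIntegral_mono_set ((integrableOn_kap h).mono_set (Ioi_subset_Ioi hx))
    (Eventually.of_forall (kap_nonneg h)) (Ioi_subset_Ioi hxy).eventuallyLE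

theorem tendsto_tailKap (h : P.Admissible) : Tendsto P.tailKap atTop (𝓝 0) := by
  have hk := integrableOn_kap h
  have h1 := intervalIntegral_tendsto_integral_Ioi 0 hk tendsto_id
  have h2 : Tendsto (fun x => P.tailKap 0 - ∫ t in (0 : ℝ)..x, P.kap t) atTop
      (𝓝 (P.tailKap 0 - P.tailKap 0)) := tendsto_const_nhds.sub h1
  rw [sub_self] at h2
  refine h2.congr' ?_
  filter_upwards [eventually_ge_atTop 0] with y hy
  have := (isPrimitive_integral_Ioi hk).2 y hy
  rw [intervalIntegral.integral_neg] at this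
  simp only [tailKap]
  linarith

/-- The bound of the `n`-th iterate. -/
noncomputable def jostBound (P : ScatteringProblem) (n : ℕ) (x : ℝ) : ℝ :=
  2 * (1 + P.α⁻¹) * (P.tailKap x ^ n / n.factorial)

theorem jostBound_nonneg (h : P.Admissible) (n : ℕ) (x : ℝ) : 0 ≤ P.jostBound n x := by
  have := h.α_pos
  have := tailKap_nonneg h x
  unfold jostBound; positivity

/-- The powers `σⁿ / n!` of the tail `σ` reproduce themselves under integration against `kap = -σ'`,
so the bounds add up to an exponential. -/
theorem jostBound_step (h : P.Admissible) (n : ℕ) :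
    IntegrableOn (fun t => P.kap t * P.jostBound n t) (Ioi 0) ∧
      ∀ x, 0 ≤ x → ∫ t in Ioi x, P.kap t * P.jostBound n t = P.jostBound (n + 1) x := by
  have h1 : (fun t => P.kap t * P.jostBound n t) = fun t => 2 * (1 + P.α⁻¹) / n.factorial *
      (P.kap t * (∫ s in Ioi t, P.kap s) ^ n) := by
    ext t; simp only [jostBound, tailKap]; ring
  have h2 := fun x hx => integral_Ioi_mul_tail_pow (integrableOn_kap h) (kap_nonneg h) n (x := x) hx
  rw [h1]
  refine ⟨(h2 0 le_rfl).1.const_mul _, fun x hx => ?_⟩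
  rw [integral_const_mul, (h2 x hx).2, jostBound, Nat.factorial_succ]
  push_cast
  have h3 : ((n : ℝ) + 1) ≠ 0 := by positivity
  have h4 : (n.factorial : ℝ) ≠ 0 := by positivity
  simp only [tailKap]
  field_simp

theorem hasSum_jostBound (x : ℝ) :
    HasSum (fun n => P.jostBound n x) (2 * (1 + P.α⁻¹) * Real.exp (P.tailKap x)) := by
  have := NormedSpace.expSeries_div_hasSum_exp (P.tailKap x)
  rw [← Real.exp_eq_exp_ℝ] at this
  exact this.mul_left _

theorem measurable_cPlus : Measurable P.cPlus :=
  ((measurable_sqrtRho.inv).const_add 1).const_mul _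

theorem measurable_cMinus : Measurable P.cMinus :=
  ((measurable_sqrtRho.inv).const_sub 1).const_mul _

theorem measurable_muPlus : Measurable P.muPlus := by
  have : P.muPlus = fun x => P.a + P.nu x := funext muPlus_eq
  rw [this]; exact measurable_nu.const_add _

theorem measurable_muMinus : Measurable P.muMinus := by
  have : P.muMinus = fun x => P.a - P.nu x := funext muMinus_eq
  rw [this]; exact measurable_nu.const_sub _

theorem measurable_boolPos : Measurable (Function.uncurry
    fun (t : ℝ) (b : Bool) => if b then P.muPlus t else P.muMinus t) := by
  refine measurable_from_prod_countable_left fun b => ?_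
  cases b
  · simpa [Function.uncurry] using measurable_muMinus
  · simpa [Function.uncurry] using measurable_muPlus

theorem measurable_boolCoef : Measurable (Function.uncurry
    fun (t : ℝ) (b : Bool) => if b then P.cPlus t else P.cMinus t) := by
  refine measurable_from_prod_countable_left fun b => ?_
  cases b
  · simpa [Function.uncurry] using measurable_cMinus
  · simpa [Function.uncurry] using measurable_cPlus

theorem measurable_jostIter (h : P.Admissible) (n : ℕ) :
    Measurable (Function.uncurry (P.jostIter n)) := by
  induction n with
  | zero => exact measurable_volterraStep h measurable_boolPos measurable_boolCoef
  | succ n ih => exact measurable_volterraStep h measurable_snd ih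

theorem bool_supp (h : P.Admissible) : ∀ t, 0 ≤ t → ∀ b : Bool,
    (if b then P.cPlus t else P.cMinus t) ≠ 0 →
      P.muPlus t ≤ if b then P.muPlus t else P.muMinus t := by
  intro t _ b hb
  cases b
  · simp only [Bool.false_eq_true, if_false] at hb ⊢
    exact (cMinus_eq_zero_or h t).resolve_left hb
  · simp

theorem jostIter_eq_zero (h : P.Admissible) (n : ℕ) {x y : ℝ} (hx : 0 ≤ x)
    (hy : y < P.muPlus x) : P.jostIter n x y = 0 := by
  induction n generalizing x y with
  | zero => exact volterraStep_eq_zero h (bool_supp h) hx hy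
  | succ n ih =>
    refine volterraStep_eq_zero h (fun t ht v hv => ?_) hx hy
    by_contra hlt
    exact hv (ih ht (not_le.1 hlt))

theorem bool_bound (h : P.Admissible) : ∀ t, 0 ≤ t →
    ∫⁻ b : Bool, ‖if b then P.cPlus t else P.cMinus t‖ₑ ∂Measure.count ≤
      ENNReal.ofReal (P.jostBound 0 t) := by
  intro t _
  rw [lintegral_count, tsum_bool]
  simp only [Bool.false_eq_true, if_false, if_true]
  rw [Real.enorm_eq_ofReal_abs, Real.enorm_eq_ofReal_abs,
    ← ENNReal.ofReal_add (abs_nonneg _) (abs_nonneg _)]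
  refine ENNReal.ofReal_le_ofReal ?_
  have h1 := abs_cMinus_le h t
  have h2 := abs_cPlus_le h t
  simp [jostBound]
  linarith

theorem lintegral_jostIter_le (h : P.Admissible) (n : ℕ) {x : ℝ} (hx : 0 ≤ x) :
    ∫⁻ y, ‖P.jostIter n x y‖ₑ ≤ ENNReal.ofReal (P.jostBound (n + 1) x) := by
  induction n generalizing x with
  | zero =>
    have := lintegral_volterraStep_le (m := (Measure.count : Measure Bool)) h (measurable_boolPos (P := P))
      measurable_boolCoef (fun t _ => jostBound_nonneg h 0 t) (bool_bound h)
      (jostBound_step h 0).1 hx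
    rwa [(jostBound_step h 0).2 x hx] at this
  | succ n ih =>
    have := lintegral_volterraStep_le (m := volume) (p := fun _ v => v) h measurable_snd
      (measurable_jostIter h n) (fun t _ => jostBound_nonneg h (n + 1) t) (fun t ht => ih ht)
      (jostBound_step h (n + 1)).1 hx
    rwa [(jostBound_step h (n + 1)).2 x hx] at this

theorem measurable_jostIter_right (h : P.Admissible) (n : ℕ) (x : ℝ) :
    Measurable (P.jostIter n x) :=
  (measurable_jostIter h n).comp (measurable_const.prodMk measurable_id)

theorem integrable_jostIter (h : P.Admissible) (n : ℕ) {x : ℝ} (hx : 0 ≤ x) :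
    Integrable (P.jostIter n x) :=
  ⟨(measurable_jostIter_right h n x).aestronglyMeasurable,
    (lintegral_jostIter_le h n hx).trans_lt ENNReal.ofReal_lt_top⟩

theorem integral_norm_jostIter_le (h : P.Admissible) (n : ℕ) {x : ℝ} (hx : 0 ≤ x) :
    ∫ y, ‖P.jostIter n x y‖ ≤ P.jostBound (n + 1) x := by
  have := lintegral_jostIter_le h n hx
  rw [← ofReal_integral_norm_eq_lintegral_enorm (integrable_jostIter h n hx)] at this
  exact (ENNReal.ofReal_le_ofReal_iff (jostBound_nonneg h _ _)).1 this

theorem summable_integral_norm_jostIter (h : P.Admissible) {x : ℝ} (hx : 0 ≤ x) :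
    Summable fun n => ∫ y, ‖P.jostIter n x y‖ :=
  Summable.of_nonneg_of_le (fun _ => integral_nonneg fun _ => norm_nonneg _)
    (fun n => integral_norm_jostIter_le h n hx)
    ((summable_nat_add_iff 1).2 (hasSum_jostBound x).summable)

/-- The kernel `K(x, y)` of the representation
`e(x, z) = e₀(x, z) + ∫ K(x, y) e^{izy} dy` of the Jost solution. -/
noncomputable def jostKer (P : ScatteringProblem) (x y : ℝ) : ℝ := ∑' n, P.jostIter n x y

theorem integrable_jostKer (h : P.Admissible) {x : ℝ} (hx : 0 ≤ x) :
    Integrable (P.jostKer x) :=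
  (integrable_tsum_of_summable_integral_norm (fun n => integrable_jostIter h n hx)
    (summable_integral_norm_jostIter h hx)).1

theorem jostKer_eq_zero (h : P.Admissible) {x y : ℝ} (hx : 0 ≤ x) (hy : y < P.muPlus x) :
    P.jostKer x y = 0 := by
  simp [jostKer, jostIter_eq_zero h _ hx hy]

/-- The right side tends to `0` as `x → ∞`. This smallness gives the asymptotics of the Jost
solution and, later, the first inversion of the equation for `lam`. -/
theorem integral_norm_jostKer_le (h : P.Admissible) {x : ℝ} (hx : 0 ≤ x) :
    ∫ y, ‖P.jostKer x y‖ ≤ 2 * (1 + P.α⁻¹) * (Real.exp (P.tailKap x) - 1) := by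
  refine (integrable_tsum_of_summable_integral_norm (fun n => integrable_jostIter h n hx)
    (summable_integral_norm_jostIter h hx)).2.trans ?_
  have h1 := hasSum_jostBound (P := P) x
  have h2 := (hasSum_nat_add_iff' 1).2 h1
  refine ((summable_integral_norm_jostIter h hx).tsum_le_tsum
    (fun n => integral_norm_jostIter_le h n hx) h2.summable).trans (le_of_eq ?_)
  rw [h2.tsum_eq]
  simp [jostBound]
  ring

/-- The Fourier transform of a kernel iterate. -/
noncomputable def jostIterFT (P : ScatteringProblem) (n : ℕ) (x : ℝ) (z : ℂ) : ℂ :=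
  ∫ y : ℝ, (P.jostIter n x y : ℂ) * Complex.exp (Complex.I * z * y)

theorem norm_mul_cexp_le {z : ℂ} (hz : 0 ≤ z.im) {b y : ℝ} {w : ℝ} (hw : y < b → w = 0) :
    ‖(w : ℂ) * Complex.exp (Complex.I * z * y)‖ ≤ ‖w‖ * Real.exp (-(z.im * b)) := by
  rw [norm_mul, Complex.norm_real]
  rcases lt_or_ge y b with hy | hy
  · simp [hw hy]
  · gcongr
    exact norm_cexp_le hz hy

theorem integrable_mul_cexp {g : ℝ → ℝ} (hg : Integrable g) {b : ℝ} (hb : ∀ y, y < b → g y = 0)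
    {z : ℂ} (hz : 0 ≤ z.im) :
    Integrable fun y : ℝ => (g y : ℂ) * Complex.exp (Complex.I * z * y) := by
  refine Integrable.mono' (hg.norm.mul_const (Real.exp (-(z.im * b))))
    (hg.ofReal.aestronglyMeasurable.mul (by fun_prop : Continuous fun y : ℝ =>
      Complex.exp (Complex.I * z * y)).aestronglyMeasurable) ?_
  exact Eventually.of_forall fun y => norm_mul_cexp_le hz (hb y)

theorem norm_integral_mul_cexp_le {g : ℝ → ℝ} (hg : Integrable g) {b : ℝ}
    (hb : ∀ y, y < b → g y = 0) {z : ℂ} (hz : 0 ≤ z.im) :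
    ‖∫ y : ℝ, (g y : ℂ) * Complex.exp (Complex.I * z * y)‖ ≤
      (∫ y, ‖g y‖) * Real.exp (-(z.im * b)) := by
  rw [← integral_mul_const]
  exact norm_integral_le_of_norm_le (hg.norm.mul_const _)
    (Eventually.of_forall fun y => norm_mul_cexp_le hz (hb y))

theorem norm_jostIterFT_le (h : P.Admissible) (n : ℕ) {x : ℝ} (hx : 0 ≤ x) {z : ℂ}
    (hz : 0 ≤ z.im) :
    ‖P.jostIterFT n x z‖ ≤ P.jostBound (n + 1) x * Real.exp (-(z.im * P.muPlus x)) := by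
  refine (norm_integral_mul_cexp_le (integrable_jostIter h n hx)
    (fun y hy => jostIter_eq_zero h n hx hy) hz).trans ?_
  gcongr
  exact integral_norm_jostIter_le h n hx

theorem norm_e0_le (h : P.Admissible) (x : ℝ) {z : ℂ} (hz : 0 ≤ z.im) :
    ‖P.e0 x z‖ ≤ 2 * (1 + P.α⁻¹) * Real.exp (-(z.im * P.muPlus x)) := by
  rw [e0_eq]
  refine (norm_add_le _ _).trans ?_
  have h1 : ‖(P.cPlus x : ℂ) * Complex.exp (Complex.I * z * P.muPlus x)‖ ≤
      (1 + P.α⁻¹) * Real.exp (-(z.im * P.muPlus x)) := by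
    rw [norm_mul, Complex.norm_real]
    have := h.α_pos
    gcongr
    · exact abs_cPlus_le h x
    · exact norm_cexp_le hz le_rfl
  have h2 : ‖(P.cMinus x : ℂ) * Complex.exp (Complex.I * z * P.muMinus x)‖ ≤
      (1 + P.α⁻¹) * Real.exp (-(z.im * P.muPlus x)) := by
    have := h.α_pos
    rcases cMinus_eq_zero_or h x with h0 | h0
    · rw [h0]; simp; positivity
    · rw [norm_mul, Complex.norm_real]
      gcongr
      · exact abs_cMinus_le h x
      · exact norm_cexp_le hz h0
  linarith

theorem jostIterFT_zero (h : P.Admissible) {x : ℝ} (hx : 0 ≤ x) {z : ℂ} (hz0 : z ≠ 0)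
    (hz : 0 ≤ z.im) :
    IntegrableOn (fun t => P.cauchyFun z x t * P.q t * P.e0 t z) (Ioi x) ∧
    P.jostIterFT 0 x z = ∫ t in Ioi x, P.cauchyFun z x t * P.q t * P.e0 t z := by
  have := integral_volterraStep (m := (Measure.count : Measure Bool)) h (measurable_boolPos (P := P))
      measurable_boolCoef (fun t _ => jostBound_nonneg h 0 t) (bool_bound h)
      (jostBound_step h 0).1 (bool_supp h) hx hz0 hz
  have e : ∀ t, ∫ b : Bool, (((if b then P.cPlus t else P.cMinus t : ℝ)) : ℂ) *
      Complex.exp (Complex.I * z * ((if b then P.muPlus t else P.muMinus t : ℝ) : ℂ))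
        ∂Measure.count = P.e0 t z := by
    intro t
    rw [integral_count, e0_eq]
    simp
  simp only [e] at this
  exact this

theorem jostIterFT_succ (h : P.Admissible) (n : ℕ) {x : ℝ} (hx : 0 ≤ x) {z : ℂ} (hz0 : z ≠ 0)
    (hz : 0 ≤ z.im) :
    IntegrableOn (fun t => P.cauchyFun z x t * P.q t * P.jostIterFT n t z) (Ioi x) ∧
    P.jostIterFT (n + 1) x z =
      ∫ t in Ioi x, P.cauchyFun z x t * P.q t * P.jostIterFT n t z :=
  integral_volterraStep (m := volume) (p := fun _ v => v) h measurable_snd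
    (measurable_jostIter h n) (fun t _ => jostBound_nonneg h (n + 1) t)
    (fun t ht => lintegral_jostIter_le h n ht) (jostBound_step h (n + 1)).1
    (fun t ht v hv => by
      by_contra hlt
      exact hv (jostIter_eq_zero h n ht (not_le.1 hlt))) hx hz0 hz

/-- The Jost solution constructed from its kernel. -/
noncomputable def jostFun (P : ScatteringProblem) (x : ℝ) (z : ℂ) : ℂ :=
  P.e0 x z + ∫ y : ℝ, (P.jostKer x y : ℂ) * Complex.exp (Complex.I * z * y)

theorem hasSum_jostIterFT (h : P.Admissible) {x : ℝ} (hx : 0 ≤ x) {z : ℂ} (hz : 0 ≤ z.im) :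
    HasSum (fun n => P.jostIterFT n x z)
      (∫ y : ℝ, (P.jostKer x y : ℂ) * Complex.exp (Complex.I * z * y)) := by
  have hF := fun n => integrable_mul_cexp (integrable_jostIter h n hx)
    (fun y hy => jostIter_eq_zero h n hx hy) hz
  have hs : Summable fun n => ∫ y : ℝ, ‖(P.jostIter n x y : ℂ) *
      Complex.exp (Complex.I * z * y)‖ := by
    refine Summable.of_nonneg_of_le (fun n => integral_nonneg fun y => norm_nonneg _)
      (fun n => ?_) ((summable_integral_norm_jostIter h hx).mul_right
        (Real.exp (-(z.im * P.muPlus x))))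
    rw [← integral_mul_const]
    exact integral_mono (hF n).norm ((integrable_jostIter h n hx).norm.mul_const _)
      fun y => norm_mul_cexp_le hz (jostIter_eq_zero h n hx)
  have := hasSum_integral_of_summable_integral_norm (F := fun n (y : ℝ) =>
    (P.jostIter n x y : ℂ) * Complex.exp (Complex.I * z * y)) hF hs
  have e : ∀ y : ℝ, (P.jostKer x y : ℂ) * Complex.exp (Complex.I * z * y) =
      ∑' n, (P.jostIter n x y : ℂ) * Complex.exp (Complex.I * z * y) := fun y => by
    rw [tsum_mul_right, jostKer, Complex.ofReal_tsum]
  simp_rw [e]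
  exact this

theorem norm_jostFun_sub_e0_le (h : P.Admissible) {x : ℝ} (hx : 0 ≤ x) {z : ℂ} (hz : 0 ≤ z.im) :
    ‖P.jostFun x z - P.e0 x z‖ ≤
      2 * (1 + P.α⁻¹) * (Real.exp (P.tailKap x) - 1) * Real.exp (-(z.im * P.muPlus x)) := by
  rw [jostFun, add_sub_cancel_left]
  refine (norm_integral_mul_cexp_le (integrable_jostKer h hx)
    (fun y hy => jostKer_eq_zero h hx hy) hz).trans ?_
  gcongr
  exact integral_norm_jostKer_le h hx

/-- The bound of `e(x, z) e^{Im z μ⁺(x)}`. -/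
noncomputable def jostConst (P : ScatteringProblem) : ℝ :=
  2 * (1 + P.α⁻¹) * Real.exp (P.tailKap 0)

theorem jostConst_pos (h : P.Admissible) : 0 < P.jostConst := by
  have := h.α_pos
  unfold jostConst; positivity

theorem norm_jostFun_le (h : P.Admissible) {x : ℝ} (hx : 0 ≤ x) {z : ℂ} (hz : 0 ≤ z.im) :
    ‖P.jostFun x z‖ ≤ P.jostConst * Real.exp (-(z.im * P.muPlus x)) := by
  have h1 := norm_jostFun_sub_e0_le h hx hz
  have h2 := norm_e0_le h x hz
  have h3 : ‖P.jostFun x z‖ ≤ ‖P.jostFun x z - P.e0 x z‖ + ‖P.e0 x z‖ := by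
    simpa using norm_add_le (P.jostFun x z - P.e0 x z) (P.e0 x z)
  have h4 : Real.exp (P.tailKap x) ≤ Real.exp (P.tailKap 0) :=
    Real.exp_le_exp.2 (tailKap_anti h le_rfl hx)
  have h5 : 2 * (1 + P.α⁻¹) * Real.exp (P.tailKap x) * Real.exp (-(z.im * P.muPlus x)) ≤
      P.jostConst * Real.exp (-(z.im * P.muPlus x)) := by
    have := h.α_pos
    unfold jostConst
    gcongr
  linarith

theorem norm_cauchyFun_mul_exp_le (h : P.Admissible) {x t : ℝ} (hxt : x ≤ t) {z : ℂ}
    (hz : 0 ≤ z.im) : ‖P.cauchyFun z x t‖ * Real.exp (-(z.im * P.muPlus t)) ≤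
      2 * (1 + P.α⁻¹) / ‖z‖ * Real.exp (-(z.im * P.muPlus x)) := by
  have := h.α_pos
  calc _ ≤ 2 * (1 + P.α⁻¹) * (Real.exp (|z.im| * (P.nu t - P.nu x)) / ‖z‖) *
        Real.exp (-(z.im * P.muPlus t)) := by
        gcongr; exact norm_cauchyFun_le h hxt z
    _ = 2 * (1 + P.α⁻¹) / ‖z‖ * (Real.exp (|z.im| * (P.nu t - P.nu x)) *
        Real.exp (-(z.im * P.muPlus t))) := by ring
    _ = _ := by
        rw [← Real.exp_add, abs_of_nonneg hz, muPlus_eq, muPlus_eq]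
        congr 2; ring

/-- The integral equation of the Jost solution. -/
theorem jostFun_integral_eq (h : P.Admissible) {x : ℝ} (hx : 0 ≤ x) {z : ℂ} (hz0 : z ≠ 0)
    (hz : 0 ≤ z.im) :
    IntegrableOn (fun t => P.cauchyFun z x t * P.q t * P.jostFun t z) (Ioi x) ∧
    P.jostFun x z = P.e0 x z + ∫ t in Ioi x, P.cauchyFun z x t * P.q t * P.jostFun t z := by
  -- `F 0` carries `e0` and `F (n + 1)` carries the iterate `n`, so that the integral of `F n` is
  -- the iterate `n` and summation closes up to the integral equation.
  set F : ℕ → ℝ → ℂ := fun n => match n with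
    | 0 => fun t => P.cauchyFun z x t * P.q t * P.e0 t z
    | n + 1 => fun t => P.cauchyFun z x t * P.q t * P.jostIterFT n t z with hF
  have hFi : ∀ n, IntegrableOn (F n) (Ioi x) := by
    intro n
    cases n with
    | zero => exact (jostIterFT_zero h hx hz0 hz).1
    | succ n => exact (jostIterFT_succ h n hx hz0 hz).1
  have hFint : ∀ n, ∫ t in Ioi x, F n t = P.jostIterFT n x z := by
    intro n
    cases n with
    | zero => exact (jostIterFT_zero h hx hz0 hz).2.symm
    | succ n => exact (jostIterFT_succ h n hx hz0 hz).2.symm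
  have hαp := h.α_pos
  set D : ℝ := 2 * (1 + P.α⁻¹) / ‖z‖ * Real.exp (-(z.im * P.muPlus x)) with hD
  have hFb : ∀ n, ∀ t ∈ Ioi x, ‖F n t‖ ≤ P.jostBound n 0 * (D * |P.q t|) := by
    intro n t ht
    have hxt : x < t := ht
    have ht0 : 0 ≤ t := hx.trans hxt.le
    have key : ∀ w : ℂ, ‖w‖ ≤ P.jostBound n 0 * Real.exp (-(z.im * P.muPlus t)) →
        ‖P.cauchyFun z x t * P.q t * w‖ ≤ P.jostBound n 0 * (D * |P.q t|) := by
      intro w hw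
      rw [norm_mul, norm_mul, Complex.norm_real, Real.norm_eq_abs]
      calc _ ≤ ‖P.cauchyFun z x t‖ * |P.q t| *
            (P.jostBound n 0 * Real.exp (-(z.im * P.muPlus t))) := by gcongr
        _ = P.jostBound n 0 * ((‖P.cauchyFun z x t‖ * Real.exp (-(z.im * P.muPlus t))) *
            |P.q t|) := by ring
        _ ≤ _ := by
          have := jostBound_nonneg h n 0
          gcongr
          exact norm_cauchyFun_mul_exp_le h hxt.le hz
    cases n with
    | zero =>
      refine key _ ((norm_e0_le h t hz).trans (le_of_eq ?_))
      simp [jostBound]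
    | succ n =>
      refine key _ ((norm_jostIterFT_le h n ht0 hz).trans ?_)
      gcongr
      unfold jostBound
      have h1 := tailKap_nonneg h t
      gcongr
      exact tailKap_anti h le_rfl ht0
  have hqi : IntegrableOn (fun t => |P.q t|) (Ioi x) :=
    ((integrableOn_q h).mono_set (Ioi_subset_Ioi hx)).abs
  have hs : Summable fun n => ∫ t in Ioi x, ‖F n t‖ := by
    refine Summable.of_nonneg_of_le (fun n => integral_nonneg fun _ => norm_nonneg _)
      (fun n => ?_) ((hasSum_jostBound (P := P) 0).summable.mul_right
        (∫ t in Ioi x, D * |P.q t|))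
    rw [← integral_const_mul]
    exact setIntegral_mono_on (hFi n).norm ((hqi.const_mul D).const_mul _) measurableSet_Ioi
      (hFb n)
  have hsum : ∀ t ∈ Ioi x, ∑' n, F n t = P.cauchyFun z x t * P.q t * P.jostFun t z := by
    intro t ht
    have hxt : x < t := ht
    have ht0 : 0 ≤ t := hx.trans hxt.le
    have h1 := (hasSum_jostIterFT h ht0 hz).mul_left (P.cauchyFun z x t * P.q t)
    have h2 : HasSum (fun n => F n t) (P.cauchyFun z x t * P.q t * P.e0 t z +
        P.cauchyFun z x t * P.q t *
          ∫ y : ℝ, (P.jostKer t y : ℂ) * Complex.exp (Complex.I * z * y)) := by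
      rw [← hasSum_nat_add_iff' 1]
      simpa [hF] using h1
    rw [h2.tsum_eq, jostFun]
    ring
  have hmain := hasSum_integral_of_summable_integral_norm (F := F) hFi hs
  have hi := (integrable_tsum_of_summable_integral_norm (F := F) hFi hs).1
  refine ⟨(integrableOn_congr_fun (fun t ht => hsum t ht) measurableSet_Ioi).1 hi, ?_⟩
  rw [← setIntegral_congr_fun measurableSet_Ioi hsum, ← hmain.tsum_eq, jostFun]
  simp_rw [hFint]
  rw [(hasSum_jostIterFT h hx hz).tsum_eq]

end ScatteringProblem

/-! ### The Jost solution solves the differential equation -/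

theorem isPrimitive_ite {f g f' g' : ℝ → ℂ} {a : ℝ} (hf : ∀ x, HasDerivAt f (f' x) x)
    (hg : ∀ x, HasDerivAt g (g' x) x) (hf' : Continuous f') (hg' : Continuous g')
    (h : f a = g a) :
    IsPrimitive (fun x => if x < a then f x else g x) (fun x => if x < a then f' x else g' x) := by
  have hcf : Continuous f := continuous_iff_continuousAt.2 fun x => (hf x).continuousAt
  have hcg : Continuous g := continuous_iff_continuousAt.2 fun x => (hg x).continuousAt
  refine IsPrimitive.of_hasDeriv_right ?_ (fun x _ => ?_) (fun x _ => ?_)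
  · have : Continuous fun x => if a ≤ x then g x else f x :=
      Continuous.if_le hcg hcf continuous_const continuous_id (by rintro x rfl; exact h.symm)
    refine (this.congr fun x => ?_).continuousOn
    by_cases hx : x < a
    · simp [hx, not_le.2 hx]
    · simp [hx, not_lt.1 hx]
  · by_cases hx : x < a
    · simp only [hx, if_true]
      refine ((hf x).congr_of_eventuallyEq ?_).hasDerivWithinAt
      filter_upwards [gt_mem_nhds hx] with y hy
      simp [hy]
    · simp only [hx, if_false]
      refine (hg x).hasDerivWithinAt.congr (fun y hy => ?_) (by simp [hx])
      simp [not_lt.2 ((not_lt.1 hx).trans (le_of_lt hy))]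
  · have h1 : IntervalIntegrable (fun x => ‖f' x‖ + ‖g' x‖) volume 0 x :=
      (hf'.norm.add hg'.norm).intervalIntegrable _ _
    refine h1.mono_fun ?_ (Eventually.of_forall fun y => ?_)
    · exact (Measurable.ite measurableSet_Iio hf'.measurable hg'.measurable).aestronglyMeasurable
    · simp only
      rw [Real.norm_of_nonneg (by positivity)]
      split_ifs
      · linarith [norm_nonneg (g' y)]
      · linarith [norm_nonneg (f' y)]

namespace ScatteringProblem

variable {P : ScatteringProblem}

/-- Solutions of `-y'' + q y = z² ρ y`, as primitives. -/
def IsSol (P : ScatteringProblem) (z : ℂ) (y y' : ℝ → ℂ) : Prop :=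
  IsPrimitive y y' ∧ IsPrimitive y' fun x => ((P.q x : ℂ) - z ^ 2 * P.rho x) * y x

theorem intervalIntegrable_coeff (h : P.Admissible) (z : ℂ) {x : ℝ} (hx : 0 ≤ x) :
    IntervalIntegrable (fun x => (P.q x : ℂ) - z ^ 2 * P.rho x) volume 0 x := by
  refine IntervalIntegrable.sub ?_ (IntervalIntegrable.const_mul ?_ _)
  · rw [intervalIntegrable_iff_integrableOn_Ioc_of_le hx]
    exact ((integrableOn_q h).mono_set fun t ht => ht.1).ofReal
  · have h1 : IntervalIntegrable (fun _ : ℝ => P.α ^ 2 + 1) volume 0 x := by simp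
    refine h1.mono_fun (Complex.measurable_ofReal.comp measurable_rho).aestronglyMeasurable
      (Eventually.of_forall fun t => ?_)
    simp only
    rw [Complex.norm_real, Real.norm_eq_abs, Real.norm_of_nonneg (by positivity), rho]
    split_ifs
    · rw [abs_of_nonneg (sq_nonneg _)]; linarith
    · rw [abs_one]; linarith [sq_nonneg P.α]

theorem isSol_iff_isSolution (h : P.Admissible) {z : ℂ} {y y' : ℝ → ℂ} :
    P.IsSol z y y' ↔ P.IsSolution z y y' := by
  constructor
  · rintro ⟨h1, h2⟩
    exact ⟨fun x hx => h1.hasDerivWithinAt h2.continuousOn hx, fun x hx => h2.2 x hx⟩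
  · rintro ⟨h1, h2⟩
    have hc : ContinuousOn y (Ici 0) := fun x hx => (h1 x hx).continuousWithinAt
    have hp : IsPrimitive y' fun x => ((P.q x : ℂ) - z ^ 2 * P.rho x) * y x :=
      ⟨fun x hx => (intervalIntegrable_coeff h z hx).mul_continuousOn
        (hc.mono (by rw [uIcc_of_le hx]; exact fun t ht => ht.1)), h2⟩
    refine ⟨IsPrimitive.of_hasDeriv_right hc (fun x hx => ?_) (fun x hx => ?_), hp⟩
    · exact (h1 x hx.le).mono fun t ht => hx.le.trans (le_of_lt ht)
    · exact (hp.continuousOn.mono (by rw [uIcc_of_le hx]; exact fun t ht => ht.1)).intervalIntegrable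

theorem IsSol.const_mul {z : ℂ} {y y' : ℝ → ℂ} (hy : P.IsSol z y y') (c : ℂ) :
    P.IsSol z (fun x => c * y x) (fun x => c * y' x) :=
  ⟨hy.1.const_mul c, (hy.2.const_mul c).congr (fun _ _ => rfl) fun x _ => by ring⟩

theorem IsSol.sub {z : ℂ} {y y' v v' : ℝ → ℂ} (hy : P.IsSol z y y') (hv : P.IsSol z v v') :
    P.IsSol z (fun x => y x - v x) (fun x => y' x - v' x) :=
  ⟨hy.1.sub hv.1, (hy.2.sub hv.2).congr (fun _ _ => rfl) fun x _ => by ring⟩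

theorem isPrimitive_conj {u f : ℝ → ℂ} (h : IsPrimitive u f) :
    IsPrimitive (fun x => starRingEnd ℂ (u x)) fun x => starRingEnd ℂ (f x) := by
  have hi : ∀ x, 0 ≤ x → IntervalIntegrable (fun x => starRingEnd ℂ (f x)) volume 0 x := by
    intro x hx
    have := h.1 x hx
    rw [intervalIntegrable_iff] at this ⊢
    exact Integrable.mono this
      (Complex.continuous_conj.comp_aestronglyMeasurable this.aestronglyMeasurable)
      (Eventually.of_forall fun t => by simp)
  refine ⟨hi, fun x hx => ?_⟩
  simp only
  rw [h.2 x hx, map_add, intervalIntegral.integral_of_le hx, intervalIntegral.integral_of_le hx,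
    integral_conj]

theorem IsSol.conj {z : ℂ} {y y' : ℝ → ℂ} (hy : P.IsSol z y y') :
    P.IsSol (starRingEnd ℂ z) (fun x => starRingEnd ℂ (y x)) (fun x => starRingEnd ℂ (y' x)) :=
  ⟨isPrimitive_conj hy.1, (isPrimitive_conj hy.2).congr (fun _ _ => rfl) fun x _ => by simp⟩

/-- The potential cancels: what remains is the weighted product of the solutions times the
difference of the spectral parameters. This is the source of every Green identity below. -/
theorem IsSol.wronskian {z w : ℂ} {y y' v v' : ℝ → ℂ} (hy : P.IsSol z y y')
    (hv : P.IsSol w v v') :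
    IsPrimitive (fun x => y x * v' x - y' x * v x)
      fun x => (z ^ 2 - w ^ 2) * (P.rho x * (y x * v x)) :=
  ((hy.1.mul hv.2).sub (hy.2.mul hv.1)).congr (fun _ _ => rfl) fun x _ => by ring

theorem IsSol.wronskian_eq {z : ℂ} {y y' v v' : ℝ → ℂ} (hy : P.IsSol z y y')
    (hv : P.IsSol z v v') {x : ℝ} (hx : 0 ≤ x) :
    y x * v' x - y' x * v x = y 0 * v' 0 - y' 0 * v 0 := by
  have h1 : IsPrimitive (fun x => y x * v' x - y' x * v x) fun _ => 0 :=
    (hy.wronskian hv).congr (fun _ _ => rfl) fun x _ => by ring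
  exact h1.eq_of_zero hx

/-- The solution of the equation with `q = 0` that starts at `a` with value `1`, slope `0`. -/
noncomputable def freeCos (P : ScatteringProblem) (z : ℂ) (x : ℝ) : ℂ := Complex.cos (z * P.nu x)

/-- The solution of the equation with `q = 0` that starts at `a` with value `0`, slope `1`. -/
noncomputable def freeSin (P : ScatteringProblem) (z : ℂ) (x : ℝ) : ℂ :=
  (P.sqrtRho x : ℂ)⁻¹ * (Complex.sin (z * P.nu x) / z)

noncomputable def freeCosDeriv (P : ScatteringProblem) (z : ℂ) (x : ℝ) : ℂ :=
  -(z * P.sqrtRho x * Complex.sin (z * P.nu x))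

/-- The addition theorems separate the variables, so the integral equation can be differentiated in
`x` by the product rule. -/
theorem cauchyFun_eq (z : ℂ) (x t : ℝ) : P.cauchyFun z x t =
    P.freeCos z x * P.freeSin z t - P.freeSin z x * P.freeCos z t := by
  simp only [cauchyFun, freeCos, freeSin]
  push_cast
  rw [show z * ((P.nu t : ℂ) - P.nu x) = z * P.nu t - z * P.nu x by ring,
    show z * ((P.nu t : ℂ) + P.nu x) = z * P.nu t + z * P.nu x by ring,
    Complex.sin_sub, Complex.sin_add]
  ring

theorem isPrimitive_freeCos (h : P.Admissible) (z : ℂ) :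
    IsPrimitive (P.freeCos z) (P.freeCosDeriv z) := by
  have key : ∀ c : ℂ, ∀ x : ℝ, HasDerivAt (fun x : ℝ => Complex.cos (z * (c * (x - P.a))))
      (-(z * c * Complex.sin (z * (c * (x - P.a))))) x := by
    intro c x
    have h1 : HasDerivAt (fun x : ℝ => z * (c * ((x : ℂ) - P.a))) (z * (c * 1)) x :=
      ((((hasDerivAt_id (x : ℂ)).comp_ofReal).sub_const _).const_mul c).const_mul z
    have := (Complex.hasDerivAt_cos _).comp x h1
    refine this.congr_deriv ?_
    ring
  refine (isPrimitive_ite (a := P.a) (key P.α) (key 1) (by fun_prop) (by fun_prop)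
    (by simp)).congr (fun x _ => ?_) (fun x _ => ?_)
  · by_cases hx : x < P.a
    · simp [freeCos, hx, nu_of_lt h hx]
    · simp [freeCos, hx, nu_of_le (not_lt.1 hx)]
  · by_cases hx : x < P.a
    · simp [freeCosDeriv, hx, nu_of_lt h hx, sqrtRho_of_lt h hx]
    · simp [freeCosDeriv, hx, nu_of_le (not_lt.1 hx), sqrtRho_of_le (not_lt.1 hx)]

theorem isPrimitive_freeSin (h : P.Admissible) {z : ℂ} (hz : z ≠ 0) :
    IsPrimitive (P.freeSin z) (P.freeCos z) := by
  have key : ∀ c : ℂ, c ≠ 0 → ∀ x : ℝ,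
      HasDerivAt (fun x : ℝ => c⁻¹ * (Complex.sin (z * (c * (x - P.a))) / z))
      (Complex.cos (z * (c * (x - P.a)))) x := by
    intro c hc x
    have h1 : HasDerivAt (fun x : ℝ => z * (c * ((x : ℂ) - P.a))) (z * (c * 1)) x :=
      ((((hasDerivAt_id (x : ℂ)).comp_ofReal).sub_const _).const_mul c).const_mul z
    have := (((Complex.hasDerivAt_sin _).comp x h1).div_const z).const_mul c⁻¹
    refine this.congr_deriv ?_
    field_simp
  have hα : (P.α : ℂ) ≠ 0 := Complex.ofReal_ne_zero.2 h.α_pos.ne'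
  refine (isPrimitive_ite (a := P.a) (key P.α hα) (key 1 one_ne_zero) (by fun_prop) (by fun_prop)
    (by simp)).congr (fun x _ => ?_) (fun x _ => ?_)
  · by_cases hx : x < P.a
    · simp [freeSin, hx, nu_of_lt h hx, sqrtRho_of_lt h hx]
    · simp [freeSin, hx, nu_of_le (not_lt.1 hx), sqrtRho_of_le (not_lt.1 hx)]
  · by_cases hx : x < P.a
    · simp [freeCos, hx, nu_of_lt h hx]
    · simp [freeCos, hx, nu_of_le (not_lt.1 hx)]

theorem isPrimitive_freeCosDeriv (h : P.Admissible) (z : ℂ) :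
    IsPrimitive (P.freeCosDeriv z) fun x => -(z ^ 2 * P.rho x * P.freeCos z x) := by
  have key : ∀ c : ℂ, ∀ x : ℝ,
      HasDerivAt (fun x : ℝ => -(z * c * Complex.sin (z * (c * (x - P.a)))))
      (-(z ^ 2 * c ^ 2 * Complex.cos (z * (c * (x - P.a))))) x := by
    intro c x
    have h1 : HasDerivAt (fun x : ℝ => z * (c * ((x : ℂ) - P.a))) (z * (c * 1)) x :=
      ((((hasDerivAt_id (x : ℂ)).comp_ofReal).sub_const _).const_mul c).const_mul z
    have := (((Complex.hasDerivAt_sin _).comp x h1).const_mul (z * c)).fun_neg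
    refine this.congr_deriv ?_
    ring
  refine (isPrimitive_ite (a := P.a) (key P.α) (key 1) (by fun_prop) (by fun_prop)
    (by simp)).congr (fun x _ => ?_) (fun x _ => ?_)
  · by_cases hx : x < P.a
    · simp [freeCosDeriv, hx, nu_of_lt h hx, sqrtRho_of_lt h hx]
    · simp [freeCosDeriv, hx, nu_of_le (not_lt.1 hx), sqrtRho_of_le (not_lt.1 hx)]
  · by_cases hx : x < P.a
    · simp [freeCos, hx, nu_of_lt h hx, rho]
    · simp [freeCos, hx, nu_of_le (not_lt.1 hx), rho]

theorem e0_eq_free (h : P.Admissible) {z : ℂ} (hz : z ≠ 0) (x : ℝ) : P.e0 x z =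
    Complex.exp (Complex.I * z * P.a) * (P.freeCos z x + Complex.I * z * P.freeSin z x) := by
  have hs : (P.sqrtRho x : ℂ) ≠ 0 := Complex.ofReal_ne_zero.2 (sqrtRho_pos h x).ne'
  rw [e0_eq, muPlus_eq, muMinus_eq, cPlus, cMinus, freeCos, freeSin, Complex.cos, Complex.sin]
  push_cast
  rw [show Complex.I * z * (P.a + P.nu x) = Complex.I * z * P.a + z * P.nu x * Complex.I by ring,
    show Complex.I * z * (P.a - P.nu x) = Complex.I * z * P.a + -(z * P.nu x) * Complex.I by ring,
    Complex.exp_add, Complex.exp_add]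
  generalize Complex.exp (-(z * P.nu x) * Complex.I) = p
  generalize Complex.exp (z * P.nu x * Complex.I) = r
  field_simp
  linear_combination (r - p) * Complex.I_sq

theorem measurable_jostKer (h : P.Admissible) : Measurable (Function.uncurry P.jostKer) := by
  have : Function.uncurry P.jostKer = fun p => ∑' n, Function.uncurry (P.jostIter n) p := by
    ext p; rfl
  rw [this]
  exact Measurable.tsum fun n => measurable_jostIter h n

theorem measurable_e0 (z : ℂ) : Measurable fun x => P.e0 x z := by
  simp_rw [e0_eq]
  have h1 := Complex.measurable_ofReal.comp (measurable_cPlus (P := P))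
  have h2 := Complex.measurable_ofReal.comp (measurable_cMinus (P := P))
  have h3 := Complex.measurable_ofReal.comp (measurable_muPlus (P := P))
  have h4 := Complex.measurable_ofReal.comp (measurable_muMinus (P := P))
  exact (h1.mul (h3.const_mul _).cexp).add (h2.mul (h4.const_mul _).cexp)

theorem measurable_jostFun (h : P.Admissible) (z : ℂ) : Measurable fun x => P.jostFun x z := by
  unfold jostFun
  refine (measurable_e0 z).add ?_
  have : StronglyMeasurable (Function.uncurry fun (x y : ℝ) =>
      (P.jostKer x y : ℂ) * Complex.exp (Complex.I * z * y)) := by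
    refine (Measurable.mul (Complex.measurable_ofReal.comp (measurable_jostKer h)) ?_).stronglyMeasurable
    exact (by fun_prop : Measurable fun y : ℝ => Complex.exp (Complex.I * z * y)).comp measurable_snd
  exact this.integral_prod_right.measurable

theorem measurable_freeCos (z : ℂ) : Measurable (P.freeCos z) :=
  ((Complex.measurable_ofReal.comp measurable_nu).const_mul _).ccos

theorem measurable_freeSin (z : ℂ) : Measurable (P.freeSin z) :=
  (Complex.measurable_ofReal.comp measurable_sqrtRho).inv.mul
    (((Complex.measurable_ofReal.comp measurable_nu).const_mul _).csin.div_const _)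

theorem abs_nu_le (h : P.Admissible) {t : ℝ} (ht : 0 ≤ t) :
    |P.nu t| ≤ P.nu t + 2 * P.α * P.a := by
  have := h.α_pos
  have := h.a_pos
  rcases lt_or_ge t P.a with hx | hx
  · rw [abs_of_nonpos (nu_nonpos h hx.le), nu_of_lt h hx]; nlinarith
  · rw [abs_of_nonneg (nu_nonneg hx)]
    have : 0 ≤ 2 * P.α * P.a := by positivity
    linarith

/-- The growth of a free solution in `t` is compensated by the decay of the Jost solution, up to a
constant from the interval before the interface. -/
theorem integrableOn_free_mul (h : P.Admissible) {z : ℂ} (hz : 0 ≤ z.im) {g : ℝ → ℂ}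
    (hg : Measurable g) {M : ℝ} (hb : ∀ t, ‖g t‖ ≤ M * Real.exp (z.im * |P.nu t|)) :
    IntegrableOn (fun t => g t * P.q t * P.jostFun t z) (Ioi 0) := by
  have hM : 0 ≤ M := by
    have := (norm_nonneg _).trans (hb 0)
    exact nonneg_of_mul_nonneg_left this (Real.exp_pos _)
  set D := M * P.jostConst * Real.exp (z.im * (2 * P.α * P.a) - z.im * P.a)
  refine Integrable.mono' (((integrableOn_q h).abs).const_mul D) ?_ ?_
  · exact ((hg.mul (Complex.measurable_ofReal.comp h.q_meas)).mul
      (measurable_jostFun h z)).aestronglyMeasurable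
  · refine (ae_restrict_iff' measurableSet_Ioi).2 (Eventually.of_forall fun t ht => ?_)
    have ht : 0 ≤ t := le_of_lt ht
    rw [norm_mul, norm_mul, Complex.norm_real, Real.norm_eq_abs]
    have h1 := norm_jostFun_le h ht hz
    have h2 := jostConst_pos h
    calc ‖g t‖ * |P.q t| * ‖P.jostFun t z‖ ≤ (M * Real.exp (z.im * |P.nu t|)) * |P.q t| *
          (P.jostConst * Real.exp (-(z.im * P.muPlus t))) := by
          gcongr
          exact hb t
      _ = M * P.jostConst * (Real.exp (z.im * |P.nu t|) * Real.exp (-(z.im * P.muPlus t))) *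
          |P.q t| := by ring
      _ ≤ D * |P.q t| := by
          rw [← Real.exp_add]
          refine mul_le_mul_of_nonneg_right (mul_le_mul_of_nonneg_left (Real.exp_le_exp.2 ?_)
            (by positivity)) (abs_nonneg _)
          rw [muPlus_eq]
          nlinarith [mul_le_mul_of_nonneg_left (abs_nu_le h ht) hz]

theorem norm_freeCos_le {z : ℂ} (hz : 0 ≤ z.im) (t : ℝ) :
    ‖P.freeCos z t‖ ≤ 1 * Real.exp (z.im * |P.nu t|) := by
  have := norm_cos_le z (P.nu t) |P.nu t| le_rfl
  rw [abs_of_nonneg hz] at this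
  simpa [freeCos] using this

theorem norm_freeSin_le (h : P.Admissible) {z : ℂ} (hz : 0 ≤ z.im) (t : ℝ) :
    ‖P.freeSin z t‖ ≤ ((1 + P.α⁻¹) / ‖z‖) * Real.exp (z.im * |P.nu t|) := by
  have h1 := norm_sin_le z (P.nu t) |P.nu t| le_rfl
  rw [abs_of_nonneg hz] at h1
  have h2 := inv_pos.2 (sqrtRho_pos h t)
  rw [freeSin, norm_mul, norm_div, ← Complex.ofReal_inv, Complex.norm_real,
    Real.norm_of_nonneg h2.le]
  have := h.α_pos
  calc (P.sqrtRho t)⁻¹ * (‖Complex.sin (z * P.nu t)‖ / ‖z‖) ≤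
      (1 + P.α⁻¹) * (Real.exp (z.im * |P.nu t|) / ‖z‖) := by
        gcongr
        exact inv_sqrtRho_le h t
    _ = _ := by ring

theorem integrableOn_freeCos_mul (h : P.Admissible) {z : ℂ} (hz : 0 ≤ z.im) :
    IntegrableOn (fun t => P.freeCos z t * P.q t * P.jostFun t z) (Ioi 0) :=
  integrableOn_free_mul h hz (measurable_freeCos z) (norm_freeCos_le hz)

theorem integrableOn_freeSin_mul (h : P.Admissible) {z : ℂ} (hz : 0 ≤ z.im) :
    IntegrableOn (fun t => P.freeSin z t * P.q t * P.jostFun t z) (Ioi 0) :=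
  integrableOn_free_mul h hz (measurable_freeSin z) (norm_freeSin_le h hz)

noncomputable def e0Deriv (P : ScatteringProblem) (x : ℝ) (z : ℂ) : ℂ :=
  Complex.exp (Complex.I * z * P.a) * (P.freeCosDeriv z x + Complex.I * z * P.freeCos z x)

/-- The `x`-derivative of the Cauchy function. -/
noncomputable def cauchyDeriv (P : ScatteringProblem) (z : ℂ) (x t : ℝ) : ℂ :=
  P.freeCosDeriv z x * P.freeSin z t - P.freeCos z x * P.freeCos z t

/-- The derivative of the Jost solution. -/
noncomputable def jostFunDeriv (P : ScatteringProblem) (x : ℝ) (z : ℂ) : ℂ :=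
  P.e0Deriv x z + ∫ t in Ioi x, P.cauchyDeriv z x t * P.q t * P.jostFun t z

/-- Variation of constants: by `cauchyFun_eq` the function is a combination of the two free
solutions whose coefficients are tail integrals. -/
theorem isSol_jostFun (h : P.Admissible) {z : ℂ} (hz0 : z ≠ 0) (hz : 0 ≤ z.im) :
    P.IsSol z (fun x => P.jostFun x z) (fun x => P.jostFunDeriv x z) := by
  set S : ℝ → ℂ := fun x => ∫ t in Ioi x, P.freeSin z t * P.q t * P.jostFun t z with hS
  set C : ℝ → ℂ := fun x => ∫ t in Ioi x, P.freeCos z t * P.q t * P.jostFun t z with hC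
  have iS := integrableOn_freeSin_mul h hz
  have iC := integrableOn_freeCos_mul h hz
  have pS : IsPrimitive S _ := isPrimitive_integral_Ioi iS
  have pC : IsPrimitive C _ := isPrimitive_integral_Ioi iC
  have p1 := isPrimitive_freeCos h z
  have p2 := isPrimitive_freeSin h hz0
  have p3 := isPrimitive_freeCosDeriv h z
  have hs : ∀ x, (P.sqrtRho x : ℂ) ≠ 0 := fun x => Complex.ofReal_ne_zero.2 (sqrtRho_pos h x).ne'
  have hy : ∀ x, 0 ≤ x → P.jostFun x z = Complex.exp (Complex.I * z * P.a) *
      (P.freeCos z x + Complex.I * z * P.freeSin z x) +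
      (P.freeCos z x * S x - P.freeSin z x * C x) := by
    intro x hx
    rw [(jostFun_integral_eq h hx hz0 hz).2, e0_eq_free h hz0]
    congr 1
    rw [hS, hC]
    simp only
    rw [← integral_const_mul, ← integral_const_mul, ← integral_sub
      ((iS.mono_set (Ioi_subset_Ioi hx)).const_mul _) ((iC.mono_set (Ioi_subset_Ioi hx)).const_mul _)]
    congr 1
    ext t
    rw [cauchyFun_eq]
    ring
  have hy' : ∀ x, 0 ≤ x → P.jostFunDeriv x z = Complex.exp (Complex.I * z * P.a) *
      (P.freeCosDeriv z x + Complex.I * z * P.freeCos z x) +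
      (P.freeCosDeriv z x * S x - P.freeCos z x * C x) := by
    intro x hx
    rw [jostFunDeriv, e0Deriv]
    congr 1
    rw [hS, hC]
    simp only
    rw [← integral_const_mul, ← integral_const_mul, ← integral_sub
      ((iS.mono_set (Ioi_subset_Ioi hx)).const_mul _) ((iC.mono_set (Ioi_subset_Ioi hx)).const_mul _)]
    congr 1
    ext t
    rw [cauchyDeriv]
    ring
  constructor
  · refine (((p1.add (p2.const_mul (Complex.I * z))).const_mul
      (Complex.exp (Complex.I * z * P.a))).add ((p1.mul pS).sub (p2.mul pC))).congr hy
      fun x hx => ?_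
    rw [hy' x hx]
    ring
  · refine (((p3.add (p1.const_mul (Complex.I * z))).const_mul
      (Complex.exp (Complex.I * z * P.a))).add ((p3.mul pS).sub (p1.mul pC))).congr hy'
      fun x hx => ?_
    -- The Wronskian of the free solutions. Because it is one, differentiating the tails `S` and `C`
    -- returns exactly the term `q y`.
    have key : P.freeCos z x * P.freeCos z x - P.freeCosDeriv z x * P.freeSin z x = 1 := by
      have hsx := hs x
      rw [freeCos, freeCosDeriv, freeSin]
      field_simp
      linear_combination Complex.sin_sq_add_cos_sq (z * P.nu x)
    have key2 : P.freeCosDeriv z x = -(z ^ 2 * P.rho x * P.freeSin z x) := by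
      have hsx := hs x
      rw [freeCosDeriv, freeSin, rho_eq]
      push_cast
      field_simp
    have e1 : ((P.q x : ℂ) - z ^ 2 * P.rho x) * P.jostFun x z =
        (P.freeCos z x * P.freeCos z x - P.freeCosDeriv z x * P.freeSin z x) *
        (P.q x * P.jostFun x z) - z ^ 2 * P.rho x * P.jostFun x z := by
      rw [key]; ring
    rw [e1]
    nth_rewrite 2 [hy x hx]
    linear_combination (-Complex.exp (Complex.I * z * P.a) * Complex.I * z + C x) * key2
end ScatteringProblem

/-! ### Bounds, asymptotics and analyticity in the spectral parameter -/

namespace ScatteringProblem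

variable {P : ScatteringProblem}

theorem sqrtRho_le (h : P.Admissible) (x : ℝ) : P.sqrtRho x ≤ 1 + P.α := by
  have := h.α_pos
  rcases lt_or_ge x P.a with hx | hx
  · rw [sqrtRho_of_lt h hx]; linarith
  · rw [sqrtRho_of_le hx]; linarith

/-- Either the reflected term of `cauchyDeriv` has coefficient zero, or its phase is dominated by
the direct one. -/
theorem sqrtRho_mul_inv_eq_one_or (h : P.Admissible) {x t : ℝ} (hxt : x ≤ t) :
    P.sqrtRho x * (P.sqrtRho t)⁻¹ = 1 ∨ |P.nu t + P.nu x| ≤ P.nu t - P.nu x := by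
  rcases lt_or_ge x P.a with hx | hx
  · rcases lt_or_ge t P.a with ht | ht
    · left; rw [sqrtRho_of_lt h hx, sqrtRho_of_lt h ht, mul_inv_cancel₀ h.α_pos.ne']
    · right; exact abs_nu_add_le h hx ht
  · left; rw [sqrtRho_of_le hx, sqrtRho_of_le (hx.trans hxt)]; simp

noncomputable def derivConst (P : ScatteringProblem) : ℝ := 1 + (1 + P.α) * (1 + P.α⁻¹)

theorem derivConst_pos (h : P.Admissible) : 0 < P.derivConst := by
  have := h.α_pos
  unfold derivConst
  positivity

theorem cauchyDeriv_eq {z : ℂ} (hz : z ≠ 0) (x t : ℝ) : P.cauchyDeriv z x t =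
    -(1 / 2 * ((1 + (P.sqrtRho x * (P.sqrtRho t)⁻¹ : ℝ)) * Complex.cos (z * (P.nu t - P.nu x : ℝ)) +
      (1 - (P.sqrtRho x * (P.sqrtRho t)⁻¹ : ℝ)) * Complex.cos (z * (P.nu t + P.nu x : ℝ)))) := by
  rw [cauchyDeriv, freeCosDeriv, freeSin, freeCos, freeCos]
  push_cast
  rw [show z * ((P.nu t : ℂ) - P.nu x) = z * P.nu t - z * P.nu x by ring,
    show z * ((P.nu t : ℂ) + P.nu x) = z * P.nu t + z * P.nu x by ring,
    Complex.cos_sub, Complex.cos_add]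
  generalize ((P.sqrtRho t : ℂ))⁻¹ = r
  field_simp
  ring

theorem norm_cauchyDeriv_le (h : P.Admissible) {x t : ℝ} (hxt : x ≤ t) {z : ℂ} (hz0 : z ≠ 0)
    (hz : 0 ≤ z.im) : ‖P.cauchyDeriv z x t‖ ≤
      P.derivConst * Real.exp (z.im * (P.nu t - P.nu x)) := by
  have hν : 0 ≤ P.nu t - P.nu x := sub_nonneg.2 ((nu_strictMono h).monotone hxt)
  have h1 := norm_cos_le z (P.nu t - P.nu x) _ (abs_of_nonneg hν).le
  rw [abs_of_nonneg hz] at h1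
  have hs := sqrtRho_pos h x
  have hs' := inv_pos.2 (sqrtRho_pos h t)
  have hκ0 : 0 < P.sqrtRho x * (P.sqrtRho t)⁻¹ := mul_pos hs hs'
  have hκ : P.sqrtRho x * (P.sqrtRho t)⁻¹ ≤ (1 + P.α) * (1 + P.α⁻¹) := by
    have := h.α_pos
    exact mul_le_mul (sqrtRho_le h x) (inv_sqrtRho_le h t) hs'.le (by positivity)
  have key := sqrtRho_mul_inv_eq_one_or h hxt
  rw [cauchyDeriv_eq hz0]
  generalize P.sqrtRho x * (P.sqrtRho t)⁻¹ = κ at *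
  set e := Real.exp (z.im * (P.nu t - P.nu x))
  have h2 : ‖(1 - (κ : ℂ)) * Complex.cos (z * (P.nu t + P.nu x : ℝ))‖ ≤ (1 + κ) * e := by
    rcases key with h3 | h3
    · rw [h3]
      simp
      positivity
    · have h4 := norm_cos_le z (P.nu t + P.nu x) _ h3
      rw [abs_of_nonneg hz] at h4
      rw [norm_mul]
      refine mul_le_mul ?_ h4 (norm_nonneg _) (by positivity)
      refine (norm_sub_le _ _).trans ?_
      simp [abs_of_pos hκ0]
  have h5 : ‖(1 + (κ : ℂ)) * Complex.cos (z * (P.nu t - P.nu x : ℝ))‖ ≤ (1 + κ) * e := by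
    rw [norm_mul]
    refine mul_le_mul ?_ h1 (norm_nonneg _) (by positivity)
    refine (norm_add_le _ _).trans ?_
    simp [abs_of_pos hκ0]
  rw [norm_neg, norm_mul]
  have h6 := (norm_add_le ((1 + (κ : ℂ)) * Complex.cos (z * (P.nu t - P.nu x : ℝ)))
    ((1 - (κ : ℂ)) * Complex.cos (z * (P.nu t + P.nu x : ℝ)))).trans (add_le_add h5 h2)
  have h7 : ‖(1 / 2 : ℂ)‖ = 1 / 2 := by norm_num
  rw [h7]
  have he : 0 < e := Real.exp_pos _
  rw [derivConst]
  nlinarith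

theorem norm_cauchyDeriv_mul_le (h : P.Admissible) {x t : ℝ} (hx : 0 ≤ x) (hxt : x ≤ t) {z : ℂ}
    (hz0 : z ≠ 0) (hz : 0 ≤ z.im) : ‖P.cauchyDeriv z x t * P.q t * P.jostFun t z‖ ≤
      P.derivConst * P.jostConst * Real.exp (-(z.im * P.muPlus x)) * |P.q t| := by
  rw [norm_mul, norm_mul, Complex.norm_real, Real.norm_eq_abs]
  have h1 := norm_jostFun_le h (hx.trans hxt) hz
  have h2 := norm_cauchyDeriv_le h hxt hz0 hz
  have h3 := derivConst_pos h
  calc ‖P.cauchyDeriv z x t‖ * |P.q t| * ‖P.jostFun t z‖ ≤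
        P.derivConst * Real.exp (z.im * (P.nu t - P.nu x)) * |P.q t| *
          (P.jostConst * Real.exp (-(z.im * P.muPlus t))) := by gcongr
    _ = P.derivConst * P.jostConst * (Real.exp (z.im * (P.nu t - P.nu x)) *
          Real.exp (-(z.im * P.muPlus t))) * |P.q t| := by ring
    _ = _ := by
      rw [← Real.exp_add, muPlus_eq, muPlus_eq]
      congr 3
      ring

theorem measurable_cauchyDeriv (z : ℂ) (x : ℝ) : Measurable (P.cauchyDeriv z x) :=
  ((measurable_freeSin z).const_mul _).sub ((measurable_freeCos z).const_mul _)

theorem measurable_cauchyDeriv_mul (h : P.Admissible) (z : ℂ) (x : ℝ) :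
    Measurable fun t => P.cauchyDeriv z x t * P.q t * P.jostFun t z :=
  ((measurable_cauchyDeriv z x).mul (Complex.measurable_ofReal.comp h.q_meas)).mul
    (measurable_jostFun h z)

noncomputable def tailQ (P : ScatteringProblem) (x : ℝ) : ℝ := ∫ t in Ioi x, |P.q t|

theorem tendsto_tailQ (h : P.Admissible) : Tendsto P.tailQ atTop (𝓝 0) := by
  have h1 := isPrimitive_integral_Ioi (𝕜 := ℝ) (integrableOn_q h).abs
  have h2 := intervalIntegral_tendsto_integral_Ioi (μ := volume) 0 (integrableOn_q h).abs tendsto_id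
  have h3 : Tendsto (fun x => P.tailQ 0 - ∫ t in (0:ℝ)..x, |P.q t|) atTop (𝓝 (P.tailQ 0 - P.tailQ 0)) :=
    h2.const_sub _
  rw [sub_self] at h3
  refine h3.congr' ?_
  filter_upwards [eventually_ge_atTop 0] with x hx
  have := h1.2 x hx
  rw [intervalIntegral.integral_neg] at this
  exact this.symm

theorem norm_jostFunDeriv_sub_e0Deriv_le (h : P.Admissible) {x : ℝ} (hx : 0 ≤ x) {z : ℂ}
    (hz0 : z ≠ 0) (hz : 0 ≤ z.im) : ‖P.jostFunDeriv x z - P.e0Deriv x z‖ ≤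
      P.derivConst * P.jostConst * P.tailQ x * Real.exp (-(z.im * P.muPlus x)) := by
  rw [jostFunDeriv, add_sub_cancel_left, tailQ]
  have hi := ((integrableOn_q h).mono_set (Ioi_subset_Ioi hx)).abs
  calc _ ≤ ∫ t in Ioi x, P.derivConst * P.jostConst * Real.exp (-(z.im * P.muPlus x)) * |P.q t| :=
        norm_integral_le_of_norm_le (hi.const_mul _) ((ae_restrict_iff' measurableSet_Ioi).2
          (Eventually.of_forall fun t ht => norm_cauchyDeriv_mul_le h hx (le_of_lt ht) hz0 hz))
    _ = _ := by rw [integral_const_mul]; ring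

theorem e0Deriv_eq (x : ℝ) (z : ℂ) : P.e0Deriv x z =
    Complex.I * z * (1 / 2 * (1 + P.sqrtRho x) * Complex.exp (Complex.I * z * P.muPlus x) +
      1 / 2 * (1 - P.sqrtRho x) * Complex.exp (Complex.I * z * P.muMinus x)) := by
  rw [e0Deriv, muPlus_eq, muMinus_eq, freeCos, freeCosDeriv, Complex.cos, Complex.sin]
  push_cast
  rw [show Complex.I * z * (P.a + P.nu x) = Complex.I * z * P.a + z * P.nu x * Complex.I by ring,
    show Complex.I * z * (P.a - P.nu x) = Complex.I * z * P.a + -(z * P.nu x) * Complex.I by ring,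
    Complex.exp_add, Complex.exp_add]
  ring

theorem e0Deriv_of_le {x : ℝ} (hx : P.a ≤ x) (z : ℂ) :
    P.e0Deriv x z = Complex.I * z * Complex.exp (Complex.I * z * x) := by
  rw [e0Deriv_eq, sqrtRho_of_le hx, muPlus_eq, nu_of_le hx]
  push_cast
  rw [show (P.a : ℂ) + (x - P.a) = x by ring]
  ring

theorem e0_of_le {x : ℝ} (hx : P.a ≤ x) (z : ℂ) : P.e0 x z = Complex.exp (Complex.I * z * x) := by
  rw [e0_eq, cPlus_of_le hx, cMinus_of_le hx, muPlus_eq, nu_of_le hx]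
  push_cast
  rw [show (P.a : ℂ) + (x - P.a) = x by ring]
  ring

theorem muPlus_of_le {x : ℝ} (hx : P.a ≤ x) : P.muPlus x = x := by
  rw [muPlus_eq, nu_of_le hx]; ring

/-- The bound of the Cauchy function by `1 / ‖z‖` makes this effective for large `z`, whereas
`norm_jostFun_sub_e0_le` is effective for large `x`. -/
theorem norm_jostFun_sub_e0_le_div (h : P.Admissible) {x : ℝ} (hx : 0 ≤ x) {z : ℂ}
    (hz0 : z ≠ 0) (hz : 0 ≤ z.im) : ‖P.jostFun x z - P.e0 x z‖ ≤
      2 * (1 + P.α⁻¹) * P.jostConst * P.tailQ 0 / ‖z‖ * Real.exp (-(z.im * P.muPlus x)) := by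
  rw [(jostFun_integral_eq h hx hz0 hz).2, add_sub_cancel_left]
  have hi := ((integrableOn_q h).mono_set (Ioi_subset_Ioi hx)).abs
  have hα := h.α_pos
  have hJ := jostConst_pos h
  calc _ ≤ ∫ t in Ioi x, 2 * (1 + P.α⁻¹) / ‖z‖ * P.jostConst * Real.exp (-(z.im * P.muPlus x)) * |P.q t| := by
        refine norm_integral_le_of_norm_le (hi.const_mul _) ((ae_restrict_iff' measurableSet_Ioi).2
          (Eventually.of_forall fun t ht => ?_))
        rw [norm_mul, norm_mul, Complex.norm_real, Real.norm_eq_abs]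
        have h1 := norm_jostFun_le h (hx.trans (le_of_lt ht)) hz
        have h2 := norm_cauchyFun_mul_exp_le h (le_of_lt ht) hz (P := P)
        calc _ ≤ ‖P.cauchyFun z x t‖ * |P.q t| * (P.jostConst * Real.exp (-(z.im * P.muPlus t))) := by
              gcongr
          _ = (‖P.cauchyFun z x t‖ * Real.exp (-(z.im * P.muPlus t))) * P.jostConst * |P.q t| := by
              ring
          _ ≤ (2 * (1 + P.α⁻¹) / ‖z‖ * Real.exp (-(z.im * P.muPlus x))) * P.jostConst * |P.q t| := by
              gcongr
          _ = _ := by ring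
    _ = 2 * (1 + P.α⁻¹) / ‖z‖ * P.jostConst * Real.exp (-(z.im * P.muPlus x)) * P.tailQ x := by
        rw [integral_const_mul, tailQ]
    _ ≤ 2 * (1 + P.α⁻¹) / ‖z‖ * P.jostConst * Real.exp (-(z.im * P.muPlus x)) * P.tailQ 0 := by
        gcongr
        exact setIntegral_mono_set (integrableOn_q h).abs (Eventually.of_forall fun t => abs_nonneg _)
          (Ioi_subset_Ioi hx).eventuallyLE
    _ = _ := by ring

theorem tendsto_jostFun_mul_exp (h : P.Admissible) {z : ℂ} (hz : 0 ≤ z.im) :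
    Tendsto (fun x : ℝ => P.jostFun x z * Complex.exp (-(Complex.I * z * x))) atTop (𝓝 1) := by
  have h1 : Tendsto (fun x => 2 * (1 + P.α⁻¹) * (Real.exp (P.tailKap x) - 1)) atTop (𝓝 0) := by
    have := (((Real.continuous_exp.tendsto _).comp (tendsto_tailKap h)).sub_const 1).const_mul
      (2 * (1 + P.α⁻¹))
    simpa using this
  rw [tendsto_iff_norm_sub_tendsto_zero]
  refine squeeze_zero' (Eventually.of_forall fun _ => norm_nonneg _) ?_ h1
  filter_upwards [eventually_ge_atTop 0, eventually_ge_atTop P.a] with x hx hxa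
  have h2 := norm_jostFun_sub_e0_le h hx hz
  rw [e0_of_le hxa, muPlus_of_le hxa] at h2
  have h3 : P.jostFun x z * Complex.exp (-(Complex.I * z * x)) - 1 =
      (P.jostFun x z - Complex.exp (Complex.I * z * x)) * Complex.exp (-(Complex.I * z * x)) := by
    rw [sub_mul, ← Complex.exp_add, add_neg_cancel, Complex.exp_zero]
  have h4 : ‖Complex.exp (-(Complex.I * z * x))‖ = Real.exp (z.im * x) := by
    rw [Complex.norm_exp]; simp
  rw [h3, norm_mul, h4]
  calc _ ≤ 2 * (1 + P.α⁻¹) * (Real.exp (P.tailKap x) - 1) * Real.exp (-(z.im * x)) *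
        Real.exp (z.im * x) := by gcongr
    _ = _ := by rw [mul_assoc, ← Real.exp_add, neg_add_cancel, Real.exp_zero, mul_one]

theorem exp_neg_im_mul_le {z z₀ : ℂ} (hz : 0 ≤ z.im) (hb : z ∈ Metric.ball z₀ 1) (b : ℝ) :
    Real.exp (-(z.im * b)) ≤ Real.exp ((‖z₀‖ + 1) * |b|) := by
  refine Real.exp_le_exp.2 ?_
  have h1 : ‖z‖ ≤ ‖z₀‖ + 1 := by
    have := norm_le_norm_add_norm_sub' z z₀
    rw [mem_ball_iff_norm] at hb
    linarith
  have h2 : z.im ≤ ‖z‖ := (le_abs_self _).trans (Complex.abs_im_le_norm z)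
  have h3 : -b ≤ |b| := neg_le_abs b
  calc -(z.im * b) = z.im * -b := by ring
    _ ≤ z.im * |b| := by gcongr
    _ ≤ _ := by gcongr; linarith

theorem norm_jostKer_mul_le (h : P.Admissible) {x : ℝ} (hx : 0 ≤ x) {z z₀ : ℂ} (hz : 0 ≤ z.im)
    (hb : z ∈ Metric.ball z₀ 1) (y : ℝ) : ‖(P.jostKer x y : ℂ) * Complex.exp (Complex.I * z * y)‖ ≤
      ‖P.jostKer x y‖ * Real.exp ((‖z₀‖ + 1) * |P.muPlus x|) :=
  (norm_mul_cexp_le hz (b := P.muPlus x) (jostKer_eq_zero h hx)).trans <| by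
    gcongr ‖P.jostKer x y‖ * ?_
    exact exp_neg_im_mul_le hz hb _

theorem aestronglyMeasurable_jostKer_mul (h : P.Admissible) {x : ℝ} (hx : 0 ≤ x) (z : ℂ) :
    AEStronglyMeasurable fun y : ℝ => (P.jostKer x y : ℂ) * Complex.exp (Complex.I * z * y) :=
  (integrable_jostKer h hx).ofReal.aestronglyMeasurable.mul
    (by fun_prop : Continuous fun y : ℝ => Complex.exp (Complex.I * z * y)).aestronglyMeasurable

theorem differentiableOn_jostFun (h : P.Admissible) {x : ℝ} (hx : 0 ≤ x) :
    DifferentiableOn ℂ (P.jostFun x) {z | 0 < z.im} := by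
  have h1 : DifferentiableOn ℂ (P.e0 x) {z | 0 < z.im} := by
    have : Differentiable ℂ (P.e0 x) := by
      unfold e0
      fun_prop
    exact this.differentiableOn
  refine h1.add (differentiableOn_integral_of_locally_dominated isOpen_upperHalf
    (fun z _ => aestronglyMeasurable_jostKer_mul h hx z) (Eventually.of_forall fun y => ?_)
    fun z₀ hz₀ => ⟨1, one_pos, _, (integrable_jostKer h hx).norm.mul_const _, Eventually.of_forall
      fun y z hz => norm_jostKer_mul_le h hx (le_of_lt hz.2) hz.1 y⟩)
  have : Differentiable ℂ fun z : ℂ => (P.jostKer x y : ℂ) * Complex.exp (Complex.I * z * y) := by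
    fun_prop
  exact this.differentiableOn

theorem continuousOn_jostFun (h : P.Admissible) {x : ℝ} (hx : 0 ≤ x) :
    ContinuousOn (P.jostFun x) {z | 0 ≤ z.im} := by
  have h1 : ContinuousOn (P.e0 x) {z | 0 ≤ z.im} := by
    have : Continuous (P.e0 x) := by
      unfold e0
      fun_prop
    exact this.continuousOn
  refine h1.add fun z₀ hz₀ => ?_
  refine continuousWithinAt_of_dominated (bound := fun y => ‖P.jostKer x y‖ *
    Real.exp ((‖z₀‖ + 1) * |P.muPlus x|))
    (Eventually.of_forall fun z => aestronglyMeasurable_jostKer_mul h hx z) ?_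
    ((integrable_jostKer h hx).norm.mul_const _) (Eventually.of_forall fun y => ?_)
  · filter_upwards [self_mem_nhdsWithin, mem_nhdsWithin_of_mem_nhds (Metric.ball_mem_nhds z₀ one_pos)]
      with z hz hb
    exact Eventually.of_forall fun y => norm_jostKer_mul_le h hx hz hb y
  · exact (by fun_prop : Continuous fun z : ℂ => (P.jostKer x y : ℂ) *
      Complex.exp (Complex.I * z * y)).continuousWithinAt

theorem continuous_e0Deriv (x : ℝ) : Differentiable ℂ (P.e0Deriv x) := by
  unfold e0Deriv freeCosDeriv freeCos
  fun_prop

theorem differentiableOn_cauchyDeriv (x t : ℝ) :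
    DifferentiableOn ℂ (fun z => P.cauchyDeriv z x t) {0}ᶜ := by
  have : ∀ z ∈ ({0}ᶜ : Set ℂ), P.cauchyDeriv z x t = -(1 / 2 * ((1 + (P.sqrtRho x *
      (P.sqrtRho t)⁻¹ : ℝ)) * Complex.cos (z * (P.nu t - P.nu x : ℝ)) +
      (1 - (P.sqrtRho x * (P.sqrtRho t)⁻¹ : ℝ)) * Complex.cos (z * (P.nu t + P.nu x : ℝ)))) :=
    fun z hz => cauchyDeriv_eq hz x t
  exact DifferentiableOn.congr (by fun_prop) this

theorem norm_cauchyDeriv_mul_le_of_mem_ball (h : P.Admissible) {x t : ℝ} (hx : 0 ≤ x) (hxt : x ≤ t)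
    {z z₀ : ℂ} (hz0 : z ≠ 0) (hz : 0 ≤ z.im) (hb : z ∈ Metric.ball z₀ 1) :
    ‖P.cauchyDeriv z x t * P.q t * P.jostFun t z‖ ≤
      P.derivConst * P.jostConst * Real.exp ((‖z₀‖ + 1) * |P.muPlus x|) * |P.q t| := by
  refine (norm_cauchyDeriv_mul_le h hx hxt hz0 hz).trans ?_
  have h3 := derivConst_pos h
  have h4 := jostConst_pos h
  gcongr ?_ * _
  exact mul_le_mul_of_nonneg_left (exp_neg_im_mul_le hz hb _) (by positivity)

theorem differentiableOn_jostFunDeriv (h : P.Admissible) {x : ℝ} (hx : 0 ≤ x) :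
    DifferentiableOn ℂ (P.jostFunDeriv x) {z | 0 < z.im} := by
  have hne : {z : ℂ | 0 < z.im} ⊆ {0}ᶜ := by
    rintro z hz rfl
    simp at hz
  refine (continuous_e0Deriv x).differentiableOn.add
    (differentiableOn_integral_of_locally_dominated isOpen_upperHalf
    (fun z _ => (measurable_cauchyDeriv_mul h z x).aestronglyMeasurable)
    ((ae_restrict_iff' measurableSet_Ioi).2 (Eventually.of_forall fun t ht => ?_))
    fun z₀ hz₀ => ⟨1, one_pos, _, (((integrableOn_q h).mono_set (Ioi_subset_Ioi hx)).abs).const_mul _,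
      (ae_restrict_iff' measurableSet_Ioi).2 (Eventually.of_forall
      fun t ht z hz => norm_cauchyDeriv_mul_le_of_mem_ball h hx (le_of_lt ht) (hne hz.2)
        (le_of_lt hz.2) hz.1)⟩)
  exact (((differentiableOn_cauchyDeriv x t).mono hne).mul_const _).mul
    (differentiableOn_jostFun h (hx.trans (le_of_lt ht)))

/-- The origin is left out because `freeSin` divides by `z`; on the real line this loses only a null
set. -/
theorem continuousOn_jostFunDeriv (h : P.Admissible) {x : ℝ} (hx : 0 ≤ x) :
    ContinuousOn (P.jostFunDeriv x) {z | z ≠ 0 ∧ 0 ≤ z.im} := by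
  refine (continuous_e0Deriv x).continuous.continuousOn.add fun z₀ hz₀ => ?_
  refine continuousWithinAt_of_dominated (bound := fun t =>
    P.derivConst * P.jostConst * Real.exp ((‖z₀‖ + 1) * |P.muPlus x|) * |P.q t|)
    (Eventually.of_forall fun z => (measurable_cauchyDeriv_mul h z x).aestronglyMeasurable) ?_
    ((((integrableOn_q h).mono_set (Ioi_subset_Ioi hx)).abs).const_mul _)
    ((ae_restrict_iff' measurableSet_Ioi).2 (Eventually.of_forall fun t ht => ?_))
  · filter_upwards [self_mem_nhdsWithin, mem_nhdsWithin_of_mem_nhds (Metric.ball_mem_nhds z₀ one_pos)]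
      with z hz hb
    exact (ae_restrict_iff' measurableSet_Ioi).2 (Eventually.of_forall fun t ht =>
      norm_cauchyDeriv_mul_le_of_mem_ball h hx (le_of_lt ht) hz.1 hz.2 hb)
  · have h1 := ((differentiableOn_cauchyDeriv (P := P) x t).continuousOn.mono
      (fun z (hz : z ≠ 0 ∧ 0 ≤ z.im) => hz.1))
    have h2 := (continuousOn_jostFun h (hx.trans (le_of_lt ht))).mono
      (fun z (hz : z ≠ 0 ∧ 0 ≤ z.im) => hz.2)
    exact ((h1.mul continuousOn_const).mul h2) z₀ hz₀

theorem norm_e0Deriv_le (h : P.Admissible) (x : ℝ) {z : ℂ} (hz : 0 ≤ z.im) :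
    ‖P.e0Deriv x z‖ ≤ (2 + P.α) * ‖z‖ * Real.exp (-(z.im * P.muPlus x)) := by
  have hs := sqrtRho_pos h x
  have hs' := sqrtRho_le h x
  rw [e0Deriv_eq, norm_mul, norm_mul, Complex.norm_I, one_mul]
  have h1 : ‖(1 / 2 * (1 + P.sqrtRho x) : ℂ)‖ = 1 / 2 * (1 + P.sqrtRho x) := by
    rw [show (1 / 2 * (1 + P.sqrtRho x) : ℂ) = ((1 / 2 * (1 + P.sqrtRho x) : ℝ) : ℂ) by push_cast; rfl,
      Complex.norm_real, Real.norm_of_nonneg (by positivity)]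
  have h2 : ‖(1 / 2 * (1 - P.sqrtRho x) : ℂ)‖ ≤ 1 / 2 * (1 + P.sqrtRho x) := by
    rw [show (1 / 2 * (1 - P.sqrtRho x) : ℂ) = ((1 / 2 * (1 - P.sqrtRho x) : ℝ) : ℂ) by push_cast; rfl,
      Complex.norm_real, Real.norm_eq_abs, abs_le]
    constructor <;> linarith
  have h3 := norm_cexp_le hz (le_refl (P.muPlus x))
  have h4 : ‖(1 / 2 * (1 - P.sqrtRho x) : ℂ) * Complex.exp (Complex.I * z * P.muMinus x)‖ ≤
      1 / 2 * (1 + P.sqrtRho x) * Real.exp (-(z.im * P.muPlus x)) := by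
    rcases lt_or_ge x P.a with hx | hx
    · rw [norm_mul]
      exact mul_le_mul h2 (norm_cexp_le hz (muPlus_le_muMinus h hx.le)) (norm_nonneg _)
        (by positivity)
    · rw [sqrtRho_of_le hx]
      simp
      positivity
  have h5 : ‖(1 / 2 * (1 + P.sqrtRho x) : ℂ) * Complex.exp (Complex.I * z * P.muPlus x)‖ ≤
      1 / 2 * (1 + P.sqrtRho x) * Real.exp (-(z.im * P.muPlus x)) := by
    rw [norm_mul, h1]
    gcongr
  have h6 := (norm_add_le _ _).trans (add_le_add h5 h4)
  have h7 := Real.exp_pos (-(z.im * P.muPlus x))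
  calc _ ≤ ‖z‖ * ((2 + P.α) * Real.exp (-(z.im * P.muPlus x))) := by
        refine mul_le_mul_of_nonneg_left (h6.trans ?_) (norm_nonneg _)
        nlinarith
    _ = _ := by ring

theorem norm_jostFunDeriv_le (h : P.Admissible) {x : ℝ} (hx : 0 ≤ x) {z : ℂ}
    (hz0 : z ≠ 0) (hz : 0 ≤ z.im) : ‖P.jostFunDeriv x z‖ ≤
      ((2 + P.α) * ‖z‖ + P.derivConst * P.jostConst * P.tailQ 0) *
        Real.exp (-(z.im * P.muPlus x)) := by
  have h1 := norm_jostFunDeriv_sub_e0Deriv_le h hx hz0 hz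
  have h2 := norm_e0Deriv_le h x hz
  have h3 : P.tailQ x ≤ P.tailQ 0 :=
    setIntegral_mono_set (integrableOn_q h).abs (Eventually.of_forall fun t => abs_nonneg _)
      (Ioi_subset_Ioi hx).eventuallyLE
  have h4 := derivConst_pos h
  have h5 := jostConst_pos h
  have h6 := norm_add_le (P.jostFunDeriv x z - P.e0Deriv x z) (P.e0Deriv x z)
  rw [sub_add_cancel] at h6
  have h7 : P.derivConst * P.jostConst * P.tailQ x * Real.exp (-(z.im * P.muPlus x)) ≤
      P.derivConst * P.jostConst * P.tailQ 0 * Real.exp (-(z.im * P.muPlus x)) := by gcongr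
  linarith

/-- The kernel of the representation is real. On the imaginary axis the identity says that the Jost
solution is real. -/
theorem jostFun_neg_conj (_h : P.Admissible) (x : ℝ) (z : ℂ) :
    P.jostFun x (-(starRingEnd ℂ z)) = starRingEnd ℂ (P.jostFun x z) := by
  have h1 : ∀ y : ℝ, Complex.exp (Complex.I * -(starRingEnd ℂ z) * y) =
      starRingEnd ℂ (Complex.exp (Complex.I * z * y)) := fun y => by
    rw [← Complex.exp_conj]; simp
  rw [jostFun, jostFun, e0_eq, e0_eq, map_add, ← integral_conj]
  simp_rw [h1]
  simp

end ScatteringProblem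

/-! ### Initial value problems and their analytic dependence on the parameter -/

/-- A derivative with a nonzero limit would produce a fixed increment over every far interval of
length one. -/
theorem eq_zero_of_tendsto_of_tendsto_deriv {k k' : ℝ → ℂ} {w : ℂ} {X : ℝ}
    (hd : ∀ x, X < x → HasDerivAt k (k' x) x) (hk : Tendsto k atTop (𝓝 0))
    (hk' : Tendsto k' atTop (𝓝 w)) : w = 0 := by
  by_contra hw
  have hw' : 0 < ‖w‖ := norm_pos_iff.2 hw
  obtain ⟨Y, hY⟩ := eventually_atTop.1 (((Metric.tendsto_nhds.1 hk) (‖w‖ / 4) (by positivity)).and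
    ((Metric.tendsto_nhds.1 hk') (‖w‖ / 4) (by positivity)))
  set x := max (X + 1) Y with hx
  have hxX : X < x := lt_of_lt_of_le (by linarith) (le_max_left _ _)
  have hxY : Y ≤ x := le_max_right _ _
  have h1 := Convex.norm_image_sub_le_of_norm_hasDerivWithin_le (𝕜 := ℝ) (s := Icc x (x + 1))
    (f := fun t : ℝ => k t - t * w) (f' := fun t => k' t - 1 * w) (C := ‖w‖ / 4) (x := x) (y := x + 1)
    (fun t ht => ((hd t (hxX.trans_le ht.1)).sub
      ((((hasDerivAt_id (t : ℂ)).comp_ofReal).mul_const w))).hasDerivWithinAt)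
    (fun t ht => by
      have := (hY t (hxY.trans ht.1)).2
      rw [dist_eq_norm] at this
      rw [one_mul]; exact this.le) (convex_Icc _ _) (by simp) (by simp)
  have h2 := (hY x hxY).1
  have h3 := (hY (x + 1) (by linarith)).1
  rw [dist_zero_right] at h2 h3
  have h4 : w = k (x + 1) - k x - ((k (x + 1) - (x + 1 : ℝ) * w) - (k x - x * w)) := by
    push_cast; ring
  have h5 : ‖w‖ ≤ ‖k (x + 1)‖ + ‖k x‖ + ‖(k (x + 1) - (x + 1 : ℝ) * w) - (k x - x * w)‖ := by
    nth_rewrite 1 [h4]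
    exact (norm_sub_le _ _).trans (by gcongr; exact norm_sub_le _ _)
  have h6 : ‖w‖ / 4 * ‖x + 1 - x‖ = ‖w‖ / 4 := by simp
  rw [h6] at h1
  linarith

theorem differentiable_intervalIntegral {F : ℂ → ℝ → ℂ} {x : ℝ} (hx : 0 ≤ x)
    (hm : ∀ z, AEStronglyMeasurable (F z) (volume.restrict (Ioc 0 x)))
    (hd : ∀ t, 0 ≤ t → Differentiable ℂ fun z => F z t)
    (hb : ∀ R : ℝ, ∃ g : ℝ → ℝ, IntegrableOn g (Ioc 0 x) ∧
      ∀ z, ‖z‖ ≤ R → ∀ t ∈ Ioc 0 x, ‖F z t‖ ≤ g t) :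
    Differentiable ℂ fun z => ∫ t in (0 : ℝ)..x, F z t := by
  simp_rw [intervalIntegral.integral_of_le hx]
  rw [← differentiableOn_univ]
  refine differentiableOn_integral_of_locally_dominated isOpen_univ (fun z _ => hm z)
    ((ae_restrict_iff' measurableSet_Ioc).2 (Eventually.of_forall fun t ht =>
      (hd t ht.1.le).differentiableOn)) fun z₀ _ => ?_
  obtain ⟨g, hg, hgb⟩ := hb (‖z₀‖ + 1)
  refine ⟨1, one_pos, g, hg, (ae_restrict_iff' measurableSet_Ioc).2 (Eventually.of_forall
    fun t ht z hz => hgb z ?_ t ht)⟩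
  have h1 := hz.1
  rw [mem_ball_iff_norm] at h1
  have := norm_le_norm_add_norm_sub' z z₀
  linarith

/-- The Picard iteration for `y'' = c y`, `y 0 = b₀`, `y' 0 = b₁`. -/
noncomputable def picardIter (c : ℝ → ℂ) (b₀ b₁ : ℂ) : ℕ → ℝ → ℂ
  | 0 => fun x => b₀ + b₁ * x
  | n + 1 => fun x => ∫ s in (0 : ℝ)..x, ∫ t in (0 : ℝ)..s, c t * picardIter c b₀ b₁ n t

/-- The derivative of the correction of order `n + 1`. -/
noncomputable def picardDeriv (c : ℝ → ℂ) (b₀ b₁ : ℂ) (n : ℕ) (s : ℝ) : ℂ :=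
  ∫ t in (0 : ℝ)..s, c t * picardIter c b₀ b₁ n t

section Picard

variable {c : ℝ → ℂ} {b₀ b₁ : ℂ}

theorem continuousOn_picardIter (hc : ∀ x, 0 ≤ x → IntervalIntegrable c volume 0 x) (n : ℕ) :
    ContinuousOn (picardIter c b₀ b₁ n) (Ici 0) ∧
      IsPrimitive (picardDeriv c b₀ b₁ n) (fun t => c t * picardIter c b₀ b₁ n t) ∧
      IsPrimitive (picardIter c b₀ b₁ (n + 1)) (picardDeriv c b₀ b₁ n) := by
  have step : ∀ n, ContinuousOn (picardIter c b₀ b₁ n) (Ici 0) →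
      IsPrimitive (picardDeriv c b₀ b₁ n) (fun t => c t * picardIter c b₀ b₁ n t) ∧
      IsPrimitive (picardIter c b₀ b₁ (n + 1)) (picardDeriv c b₀ b₁ n) := by
    intro n hn
    have h1 : IsPrimitive (picardDeriv c b₀ b₁ n) (fun t => c t * picardIter c b₀ b₁ n t) :=
      isPrimitive_integral fun x hx => (hc x hx).mul_continuousOn
        (hn.mono (by rw [uIcc_of_le hx]; exact fun t ht => ht.1))
    exact ⟨h1, isPrimitive_integral fun x hx => (h1.continuousOn.mono
      (by rw [uIcc_of_le hx]; exact fun t ht => ht.1)).intervalIntegrable⟩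
  have hcont : ContinuousOn (picardIter c b₀ b₁ n) (Ici 0) := by
    induction n with
    | zero => exact (by fun_prop : Continuous fun x : ℝ => b₀ + b₁ * x).continuousOn
    | succ n ih => exact (step n ih).2.continuousOn
  exact ⟨hcont, step n hcont⟩

/-- The factorial comes from the inner integration alone; the outer one is estimated by the length
`X` of the interval. -/
theorem norm_picardIter_le {κ : ℝ → ℝ}
    (hκ : ∀ x, 0 ≤ x → IntervalIntegrable κ volume 0 x) (hcκ : ∀ t, ‖c t‖ ≤ κ t) {X : ℝ} (n : ℕ) :
    ∀ x ∈ Icc 0 X,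
    ‖picardIter c b₀ b₁ n x‖ ≤ (‖b₀‖ + ‖b₁‖ * X) * X ^ n * ((∫ t in (0 : ℝ)..x, κ t) ^ n / n.factorial) ∧
    ‖picardDeriv c b₀ b₁ n x‖ ≤
      (‖b₀‖ + ‖b₁‖ * X) * X ^ n * ((∫ t in (0 : ℝ)..x, κ t) ^ (n + 1) / (n + 1).factorial) := by
  set σ : ℝ → ℝ := fun x => ∫ t in (0 : ℝ)..x, κ t with hσ
  have pσ : IsPrimitive σ κ := isPrimitive_integral hκ
  have hκ0 : ∀ t, 0 ≤ κ t := fun t => (norm_nonneg _).trans (hcκ t)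
  have hσ0 : σ 0 = 0 := by simp [hσ]
  have hσm : ∀ s t, 0 ≤ s → s ≤ t → σ s ≤ σ t := fun s t hs hst => by
    have := pσ.sub_eq hs (hs.trans hst)
    have h2 := intervalIntegral.integral_nonneg (μ := volume) hst fun u (_ : u ∈ Icc s t) => hκ0 u
    linarith
  have hσn : ∀ s, 0 ≤ s → 0 ≤ σ s := fun s hs => hσ0 ▸ hσm 0 s le_rfl hs
  have step : ∀ n, (∀ x ∈ Icc 0 X, ‖picardIter c b₀ b₁ n x‖ ≤
      (‖b₀‖ + ‖b₁‖ * X) * X ^ n * (σ x ^ n / n.factorial)) → ∀ x ∈ Icc 0 X,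
      ‖picardDeriv c b₀ b₁ n x‖ ≤
        (‖b₀‖ + ‖b₁‖ * X) * X ^ n * (σ x ^ (n + 1) / (n + 1).factorial) := by
    intro n ih x hx
    have h1 := pσ.pow_succ n
    have h2 := h1.2 x hx.1
    simp only [hσ0] at h2
    have h3 : IntervalIntegrable (fun t => (‖b₀‖ + ‖b₁‖ * X) * X ^ n / (n + 1).factorial *
        ((n + 1) * σ t ^ n * κ t)) volume 0 x := (h1.1 x hx.1).const_mul _
    refine (intervalIntegral.norm_integral_le_of_norm_le hx.1 ?_ h3).trans_eq ?_
    · filter_upwards with t ht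
      rw [norm_mul]
      have h4 := ih t ⟨ht.1.le, ht.2.trans hx.2⟩
      calc _ ≤ κ t * ((‖b₀‖ + ‖b₁‖ * X) * X ^ n * (σ t ^ n / n.factorial)) := by
            gcongr
            · exact hκ0 t
            · exact hcκ t
        _ = _ := by
          rw [Nat.factorial_succ]
          push_cast
          field_simp
    · rw [intervalIntegral.integral_const_mul]
      have h5 : (∫ t in (0 : ℝ)..x, ((n : ℝ) + 1) * σ t ^ n * κ t) = σ x ^ (n + 1) := by
        simpa using h2.symm
      rw [h5]
      ring
  have main : ∀ x ∈ Icc 0 X, ‖picardIter c b₀ b₁ n x‖ ≤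
      (‖b₀‖ + ‖b₁‖ * X) * X ^ n * (σ x ^ n / n.factorial) := by
    induction n with
    | zero =>
      intro x hx
      simp only [picardIter, pow_zero, Nat.factorial_zero, Nat.cast_one, div_one, mul_one]
      refine (norm_add_le _ _).trans ?_
      rw [norm_mul, Complex.norm_real, Real.norm_of_nonneg hx.1]
      gcongr
      exact hx.2
    | succ n ih =>
      intro x hx
      have hX : 0 ≤ X := hx.1.trans hx.2
      have h1 : ∀ s ∈ uIoc 0 x, ‖picardDeriv c b₀ b₁ n s‖ ≤
          (‖b₀‖ + ‖b₁‖ * X) * X ^ n * (σ x ^ (n + 1) / (n + 1).factorial) := by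
        intro s hs
        rw [uIoc_of_le hx.1] at hs
        refine (step n ih s ⟨hs.1.le, hs.2.trans hx.2⟩).trans ?_
        have := hσm s x hs.1.le hs.2
        have := hσn s hs.1.le
        gcongr
      have h2 := intervalIntegral.norm_integral_le_of_norm_le_const h1
      have h3 := hσn x hx.1
      calc ‖picardIter c b₀ b₁ (n + 1) x‖ ≤ _ := h2
        _ ≤ (‖b₀‖ + ‖b₁‖ * X) * X ^ n * (σ x ^ (n + 1) / (n + 1).factorial) * X := by
          rw [sub_zero, abs_of_nonneg hx.1]
          gcongr
          exact hx.2
        _ = _ := by ring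
  exact fun x hx => ⟨main x hx, step n main x hx⟩

theorem summable_picard_bound (M X s : ℝ) :
    Summable fun n : ℕ => M * X ^ n * (s ^ n / n.factorial) := by
  have := (Real.summable_pow_div_factorial (X * s)).mul_left M
  refine this.congr fun n => ?_
  rw [mul_pow]; ring

theorem summable_picardDeriv_bound (M X s : ℝ) :
    Summable fun n : ℕ => M * X ^ n * (s ^ (n + 1) / (n + 1).factorial) := by
  have h1 := (summable_nat_add_iff 1).2 (Real.summable_pow_div_factorial (|X| * |s| + |s|))
  refine Summable.of_norm_bounded (h1.mul_left |M|) fun n => ?_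
  rw [Real.norm_eq_abs, abs_mul, abs_mul, abs_div, abs_pow, abs_pow, Nat.abs_cast]
  rw [mul_assoc, ← mul_div_assoc]
  refine mul_le_mul_of_nonneg_left ?_ (abs_nonneg _)
  gcongr ?_ / _
  rw [pow_succ, pow_succ, ← mul_assoc, ← mul_pow]
  have : 0 ≤ |X| * |s| := by positivity
  gcongr <;> linarith [abs_nonneg s]

noncomputable def picardSol (c : ℝ → ℂ) (b₀ b₁ : ℂ) (x : ℝ) : ℂ := ∑' n, picardIter c b₀ b₁ n x

noncomputable def picardSolDeriv (c : ℝ → ℂ) (b₀ b₁ : ℂ) (x : ℝ) : ℂ :=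
  b₁ + ∑' n, picardDeriv c b₀ b₁ n x

theorem isPrimitive_tsum {F f : ℕ → ℝ → ℂ} (hF : ∀ n, IsPrimitive (F n) (f n))
    (h0 : ∀ n, F n 0 = 0) {g : ℕ → ℝ → ℝ → ℝ}
    (hb : ∀ n X, ∀ t ∈ Icc 0 X, ‖f n t‖ ≤ g n X t) (hs : ∀ X t, t ∈ Icc 0 X → Summable fun n => g n X t)
    (hi : ∀ X, 0 ≤ X → IntervalIntegrable (fun t => ∑' n, g n X t) volume 0 X) :
    IsPrimitive (fun x => ∑' n, F n x) fun x => ∑' n, f n x := by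
  have key : ∀ X, 0 ≤ X → IntervalIntegrable (fun t => ∑' n, f n t) volume 0 X ∧
      HasSum (fun n => ∫ t in (0 : ℝ)..X, f n t) (∫ t in (0 : ℝ)..X, ∑' n, f n t) := by
    intro X hX
    have hm : ∀ n, AEStronglyMeasurable (f n) (volume.restrict (uIoc 0 X)) := fun n =>
      (intervalIntegrable_iff.1 ((hF n).1 X hX)).aestronglyMeasurable
    have hsum : ∀ t ∈ uIoc 0 X, HasSum (fun n => f n t) (∑' n, f n t) := by
      intro t ht
      rw [uIoc_of_le hX] at ht
      have ht' : t ∈ Icc 0 X := ⟨ht.1.le, ht.2⟩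
      exact (Summable.of_norm_bounded (hs X t ht') fun n => hb n X t ht').hasSum
    have hb' : ∀ n, ∀ᵐ t, t ∈ uIoc 0 X → ‖f n t‖ ≤ g n X t := fun n => Eventually.of_forall fun t ht => by
      rw [uIoc_of_le hX] at ht
      exact hb n X t ⟨ht.1.le, ht.2⟩
    refine ⟨?_, intervalIntegral.hasSum_integral_of_dominated_convergence (g · X) hm hb' ?_ (hi X hX)
      (Eventually.of_forall hsum)⟩
    · refine (hi X hX).mono_fun ?_ ?_
      · refine aestronglyMeasurable_of_tendsto_ae atTop
          (f := fun N : ℕ => fun t => ∑ n ∈ Finset.range N, f n t)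
          (fun N => Finset.aestronglyMeasurable_fun_sum _ fun n _ => hm n) ?_
        refine (ae_restrict_iff' measurableSet_uIoc).2 (Eventually.of_forall fun t ht => ?_)
        exact (hsum t ht).tendsto_sum_nat
      · refine (ae_restrict_iff' measurableSet_uIoc).2 (Eventually.of_forall fun t ht => ?_)
        rw [uIoc_of_le hX] at ht
        have ht' : t ∈ Icc 0 X := ⟨ht.1.le, ht.2⟩
        exact (tsum_of_norm_bounded (hs X t ht').hasSum fun n => hb n X t ht').trans
          (le_abs_self _)
    · refine Eventually.of_forall fun t ht => ?_
      rw [uIoc_of_le hX] at ht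
      exact hs X t ⟨ht.1.le, ht.2⟩
  refine ⟨fun X hX => (key X hX).1, fun X hX => ?_⟩
  simp only [h0, tsum_zero, zero_add]
  rw [← (key X hX).2.tsum_eq]
  congr 1
  ext n
  rw [(hF n).2 X hX, h0, zero_add]

theorem picardSol_spec (hc : ∀ x, 0 ≤ x → IntervalIntegrable c volume 0 x) :
    IsPrimitive (picardSol c b₀ b₁) (picardSolDeriv c b₀ b₁) ∧
      IsPrimitive (picardSolDeriv c b₀ b₁) (fun x => c x * picardSol c b₀ b₁ x) ∧
      picardSol c b₀ b₁ 0 = b₀ ∧ picardSolDeriv c b₀ b₁ 0 = b₁ := by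
  have hp := continuousOn_picardIter (b₀ := b₀) (b₁ := b₁) hc
  set κ : ℝ → ℝ := fun t => ‖c t‖
  have hκ : ∀ x, 0 ≤ x → IntervalIntegrable κ volume 0 x := fun x hx => (hc x hx).norm
  set M : ℝ → ℝ := fun X => ‖b₀‖ + ‖b₁‖ * X with hM
  set σ : ℝ → ℝ := fun x => ∫ t in (0 : ℝ)..x, κ t with hσ
  have pσ : IsPrimitive σ κ := isPrimitive_integral hκ
  have hκ0 : ∀ t, 0 ≤ κ t := fun t => norm_nonneg _
  have hσm : ∀ s t, 0 ≤ s → s ≤ t → σ s ≤ σ t := fun s t hs hst => by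
    have := pσ.sub_eq hs (hs.trans hst)
    have h2 := intervalIntegral.integral_nonneg (μ := volume) hst fun u (_ : u ∈ Icc s t) => hκ0 u
    linarith
  have hσn : ∀ s, 0 ≤ s → 0 ≤ σ s := fun s hs => by
    have := hσm 0 s le_rfl hs
    simpa [hσ] using this
  have hb : ∀ n X, ∀ t ∈ Icc 0 X, ‖picardIter c b₀ b₁ n t‖ ≤
      M X * X ^ n * (σ X ^ n / n.factorial) := by
    intro n X t ht
    refine (norm_picardIter_le hκ (fun _ => le_rfl) n t ht).1.trans ?_
    have h1 := hσm t X ht.1 ht.2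
    have h2 := hσn t ht.1
    have hX : 0 ≤ X := ht.1.trans ht.2
    simp only [hM]
    gcongr
  have hb' : ∀ n X, ∀ t ∈ Icc 0 X, ‖picardDeriv c b₀ b₁ n t‖ ≤
      M X * X ^ n * (σ X ^ (n + 1) / (n + 1).factorial) := by
    intro n X t ht
    refine (norm_picardIter_le hκ (fun _ => le_rfl) n t ht).2.trans ?_
    have h1 := hσm t X ht.1 ht.2
    have h2 := hσn t ht.1
    have hX : 0 ≤ X := ht.1.trans ht.2
    simp only [hM]
    gcongr
  have p1 : IsPrimitive (fun x => ∑' n, picardIter c b₀ b₁ (n + 1) x)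
      fun x => ∑' n, picardDeriv c b₀ b₁ n x := by
    refine isPrimitive_tsum (fun n => (hp n).2.2) (fun n => by simp [picardIter])
      (g := fun n X _ => M X * X ^ n * (σ X ^ (n + 1) / (n + 1).factorial))
      hb' (fun X t ht => summable_picardDeriv_bound _ _ _) (fun X hX => by simp)
  have p2 : IsPrimitive (fun x => ∑' n, picardDeriv c b₀ b₁ n x)
      fun x => ∑' n, c x * picardIter c b₀ b₁ n x := by
    refine isPrimitive_tsum (fun n => (hp n).2.1) (fun n => by simp [picardDeriv])
      (g := fun n X t => κ t * (M X * X ^ n * (σ X ^ n / n.factorial)))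
      (fun n X t ht => ?_)
      (fun X t ht => (summable_picard_bound _ _ _).mul_left _) (fun X hX => ?_)
    · rw [norm_mul]
      exact mul_le_mul_of_nonneg_left (hb n X t ht) (norm_nonneg _)
    · simp_rw [tsum_mul_left]
      exact (hκ X hX).mul_const _
  have hsum : ∀ x, 0 ≤ x → picardSol c b₀ b₁ x = (b₀ + b₁ * x) + ∑' n, picardIter c b₀ b₁ (n + 1) x := by
    intro x hx
    have : Summable fun n => picardIter c b₀ b₁ n x :=
      Summable.of_norm_bounded (summable_picard_bound (M x) x (σ x)) fun n => hb n x x ⟨hx, le_rfl⟩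
    rw [picardSol, this.tsum_eq_zero_add]
    rfl
  have plin : IsPrimitive (fun x : ℝ => b₀ + b₁ * x) fun _ => b₁ :=
    ⟨fun x _ => by simp, fun x _ => by simp [mul_comm]⟩
  have pconst : IsPrimitive (fun _ : ℝ => b₁) fun _ => 0 := ⟨fun x _ => by simp, fun x _ => by simp⟩
  refine ⟨(plin.add p1).congr hsum fun x _ => rfl, (pconst.add p2).congr (fun _ _ => rfl)
    (fun x _ => ?_), ?_, ?_⟩
  · rw [picardSol, tsum_mul_left, zero_add]
  · rw [hsum 0 le_rfl]
    simp [picardIter]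
  · simp [picardSolDeriv, picardDeriv]

end Picard

/-! ### Uniqueness of the Jost solution -/

namespace ScatteringProblem

variable {P : ScatteringProblem}

/-- The solution with prescribed data at `0`. -/
noncomputable def cauchySol (P : ScatteringProblem) (b₀ b₁ z : ℂ) : ℝ → ℂ :=
  picardSol (fun x => (P.q x : ℂ) - z ^ 2 * P.rho x) b₀ b₁

noncomputable def cauchySolDeriv (P : ScatteringProblem) (b₀ b₁ z : ℂ) : ℝ → ℂ :=
  picardSolDeriv (fun x => (P.q x : ℂ) - z ^ 2 * P.rho x) b₀ b₁

theorem isSol_cauchySol (h : P.Admissible) (b₀ b₁ z : ℂ) :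
    P.IsSol z (P.cauchySol b₀ b₁ z) (P.cauchySolDeriv b₀ b₁ z) :=
  ⟨(picardSol_spec fun _ hx => intervalIntegrable_coeff h z hx).1,
    (picardSol_spec fun _ hx => intervalIntegrable_coeff h z hx).2.1⟩

theorem cauchySol_zero (h : P.Admissible) (b₀ b₁ z : ℂ) : P.cauchySol b₀ b₁ z 0 = b₀ :=
  (picardSol_spec fun _ hx => intervalIntegrable_coeff h z hx).2.2.1

theorem cauchySolDeriv_zero (h : P.Admissible) (b₀ b₁ z : ℂ) : P.cauchySolDeriv b₀ b₁ z 0 = b₁ :=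
  (picardSol_spec fun _ hx => intervalIntegrable_coeff h z hx).2.2.2

theorem norm_coeff_le {z : ℂ} {R : ℝ} (hz : ‖z‖ ≤ R) (t : ℝ) :
    ‖(P.q t : ℂ) - z ^ 2 * P.rho t‖ ≤ |P.q t| + R ^ 2 * (P.α ^ 2 + 1) := by
  refine (norm_sub_le _ _).trans ?_
  rw [norm_mul, norm_pow, Complex.norm_real, Complex.norm_real, Real.norm_eq_abs, Real.norm_eq_abs]
  have : |P.rho t| ≤ P.α ^ 2 + 1 := by
    rw [rho]
    split_ifs
    · rw [abs_of_nonneg (sq_nonneg _)]; linarith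
    · rw [abs_one]; linarith [sq_nonneg P.α]
  gcongr

/-- Every Picard iterate is entire in `z`, and the majorants are uniform on discs. -/
theorem differentiable_cauchySol (h : P.Admissible) (b₀ b₁ : ℂ) {x : ℝ} (hx : 0 ≤ x) :
    Differentiable ℂ fun z => P.cauchySol b₀ b₁ z x := by
  set c : ℂ → ℝ → ℂ := fun z x => (P.q x : ℂ) - z ^ 2 * P.rho x with hc
  have hci : ∀ z x, 0 ≤ x → IntervalIntegrable (c z) volume 0 x := fun z x hx =>
    intervalIntegrable_coeff h z hx
  set κ : ℝ → ℝ → ℝ := fun R t => |P.q t| + R ^ 2 * (P.α ^ 2 + 1) with hκ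
  have hκi : ∀ R x, 0 ≤ x → IntervalIntegrable (κ R) volume 0 x := fun R x hx => by
    refine IntervalIntegrable.add ?_ (by simp)
    rw [intervalIntegrable_iff_integrableOn_Ioc_of_le hx]
    exact ((integrableOn_q h).mono_set fun t ht => ht.1).abs
  have hκ0 : ∀ R t, 0 ≤ κ R t := fun R t => by positivity
  have hσm : ∀ R s t, 0 ≤ s → s ≤ t → (∫ u in (0 : ℝ)..s, κ R u) ≤ ∫ u in (0 : ℝ)..t, κ R u :=
    fun R s t hs hst => by
      have := (isPrimitive_integral (hκi R)).sub_eq hs (hs.trans hst)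
      have h2 := intervalIntegral.integral_nonneg (μ := volume) hst fun u (_ : u ∈ Icc s t) => hκ0 R u
      linarith
  have hσn : ∀ R s, 0 ≤ s → 0 ≤ ∫ u in (0 : ℝ)..s, κ R u := fun R s hs =>
    intervalIntegral.integral_nonneg hs fun u _ => hκ0 R u
  have hb : ∀ n R X z, ‖z‖ ≤ R → ∀ t ∈ Icc 0 X, ‖picardIter (c z) b₀ b₁ n t‖ ≤
      (‖b₀‖ + ‖b₁‖ * X) * X ^ n * ((∫ u in (0 : ℝ)..X, κ R u) ^ n / n.factorial) ∧
      ‖picardDeriv (c z) b₀ b₁ n t‖ ≤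
      (‖b₀‖ + ‖b₁‖ * X) * X ^ n * ((∫ u in (0 : ℝ)..X, κ R u) ^ (n + 1) / (n + 1).factorial) := by
    intro n R X z hz t ht
    have h0 := norm_picardIter_le (b₀ := b₀) (b₁ := b₁) (hκi R) (norm_coeff_le hz) n t ht
    have h1 := hσm R t X ht.1 ht.2
    have h2 := hσn R t ht.1
    have hX : 0 ≤ X := ht.1.trans ht.2
    exact ⟨h0.1.trans (by gcongr), h0.2.trans (by gcongr)⟩
  have hd : ∀ n t, 0 ≤ t → Differentiable ℂ fun z => picardIter (c z) b₀ b₁ n t := by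
    intro n
    induction n with
    | zero => intro t _; simp only [picardIter]; fun_prop
    | succ n ih =>
      have h1 : ∀ s, 0 ≤ s → Differentiable ℂ fun z => picardDeriv (c z) b₀ b₁ n s := by
        intro s hs
        refine differentiable_intervalIntegral hs (fun z => ?_) (fun t ht => ?_) (fun R => ?_)
        · have := ((continuousOn_picardIter (b₀ := b₀) (b₁ := b₁) (hci z) n).2.1.1 s hs)
          rw [intervalIntegrable_iff_integrableOn_Ioc_of_le hs] at this
          exact this.aestronglyMeasurable
        · have := ih t ht
          simp only [hc]
          fun_prop
        · refine ⟨fun t => κ R t * ((‖b₀‖ + ‖b₁‖ * s) * s ^ n *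
            ((∫ u in (0 : ℝ)..s, κ R u) ^ n / n.factorial)), ?_, fun z hz t ht => ?_⟩
          · have := hκi R s hs
            rw [intervalIntegrable_iff_integrableOn_Ioc_of_le hs] at this
            exact this.mul_const _
          · rw [norm_mul]
            exact mul_le_mul (norm_coeff_le hz t) (hb n R s z hz t ⟨ht.1.le, ht.2⟩).1
              (norm_nonneg _) (hκ0 R t)
      intro t ht
      refine differentiable_intervalIntegral ht (fun z => ?_) h1 (fun R => ?_)
      · have := ((continuousOn_picardIter (b₀ := b₀) (b₁ := b₁) (hci z) n).2.2.1 t ht)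
        rw [intervalIntegrable_iff_integrableOn_Ioc_of_le ht] at this
        exact this.aestronglyMeasurable
      · exact ⟨fun _ => (‖b₀‖ + ‖b₁‖ * t) * t ^ n *
          ((∫ u in (0 : ℝ)..t, κ R u) ^ (n + 1) / (n + 1).factorial),
          continuous_const.integrableOn_Ioc,
          fun z hz s hs => (hb n R t z hz s ⟨hs.1.le, hs.2⟩).2⟩
  intro z₀
  have h1 : DifferentiableOn ℂ (fun z => ∑' n, picardIter (c z) b₀ b₁ n x)
      (Metric.ball 0 (‖z₀‖ + 1)) :=
    Complex.differentiableOn_tsum_of_summable_norm (summable_picard_bound (‖b₀‖ + ‖b₁‖ * x) x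
      (∫ u in (0 : ℝ)..x, κ (‖z₀‖ + 1) u)) (fun n => (hd n x hx).differentiableOn) Metric.isOpen_ball
      fun n z hz => (hb n (‖z₀‖ + 1) x z (mem_ball_zero_iff.1 hz).le x ⟨hx, le_rfl⟩).1
  exact h1.differentiableAt (Metric.isOpen_ball.mem_nhds (by simp))

/-- Cramer's rule: the Wronskians with a fundamental system of Wronskian one determine `y` and `y'`,
so no Gronwall estimate is needed. -/
theorem IsSol.eq_zero (h : P.Admissible) {z : ℂ} {y y' : ℝ → ℂ} (hy : P.IsSol z y y')
    (h0 : y 0 = 0) (h1 : y' 0 = 0) {x : ℝ} (hx : 0 ≤ x) : y x = 0 ∧ y' x = 0 := by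
  have hu := isSol_cauchySol h 1 0 z
  have hv := isSol_cauchySol h 0 1 z
  have e1 := hy.wronskian_eq hu hx
  have e2 := hy.wronskian_eq hv hx
  have e3 := hu.wronskian_eq hv hx
  simp only [cauchySol_zero h, cauchySolDeriv_zero h, h0, h1] at e1 e2 e3
  constructor
  · linear_combination P.cauchySol 1 0 z x * e2 - P.cauchySol 0 1 z x * e1 - y x * e3
  · linear_combination P.cauchySolDeriv 1 0 z x * e2 - P.cauchySolDeriv 0 1 z x * e1 - y' x * e3

theorem IsSol.hasDerivAt {z : ℂ} {y y' : ℝ → ℂ} (hy : P.IsSol z y y') {x : ℝ} (hx : 0 < x) :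
    HasDerivAt y (y' x) x :=
  (hy.1.hasDerivWithinAt hy.2.continuousOn hx.le).hasDerivAt (Ici_mem_nhds hx)

/-- Let `δ` be the difference of two Jost solutions. The quotient `δ exp(2izx) / e` tends to `0`,
while its derivative tends to the Wronskian of `e` and `δ`, which must therefore vanish. So `δ` is a
multiple of `e`, and the normalisation at infinity makes the multiple zero. The argument treats real
and nonreal `z` alike. -/
theorem jostFun_unique (h : P.Admissible) {z : ℂ} (hz0 : z ≠ 0) (hz : 0 ≤ z.im) {d d' : ℝ → ℂ}
    (hd : P.IsJost z d d') {x : ℝ} (hx : 0 ≤ x) :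
    d x = P.jostFun x z ∧ d' x = P.jostFunDeriv x z := by
  have hds := (isSol_iff_isSolution h).2 hd.1
  have he := isSol_jostFun h hz0 hz
  have hδ := hds.sub he
  have hte := tendsto_jostFun_mul_exp h hz
  have htδ := hd.2.sub hte
  set e : ℝ → ℂ := fun x => P.jostFun x z with hedef
  set e' : ℝ → ℂ := fun x => P.jostFunDeriv x z
  set δ : ℝ → ℂ := fun x => d x - e x with hδdef
  set δ' : ℝ → ℂ := fun x => d' x - e' x
  set w : ℂ := e 0 * δ' 0 - e' 0 * δ 0 with hw
  have hW : ∀ x, 0 ≤ x → e x * δ' x - e' x * δ x = w := fun x hx => he.wronskian_eq hδ hx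
  set f : ℝ → ℂ := fun x => e x * Complex.exp (-(Complex.I * z * x)) with hf
  have hexp : ∀ x : ℝ, Complex.exp (-(Complex.I * z * x)) ≠ 0 := fun x => Complex.exp_ne_zero _
  obtain ⟨X, hX⟩ := eventually_atTop.1 (hte.eventually_ne one_ne_zero)
  have hne : ∀ x, X ≤ x → e x ≠ 0 := fun x hx => left_ne_zero_of_mul (hX x hx)
  have hE2 : ∀ x : ℝ, Complex.exp (2 * (Complex.I * z * x)) =
      (Complex.exp (-(Complex.I * z * x)) ^ 2)⁻¹ := fun x => by
    rw [← Complex.exp_nat_mul, ← Complex.exp_neg]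
    congr 1
    push_cast
    ring
  have hkey : ∀ x, max X 0 < x → HasDerivAt (fun x : ℝ => δ x * Complex.exp (2 * (Complex.I * z * x)) / e x)
      (w / f x ^ 2 + 2 * Complex.I * z * (δ x * Complex.exp (2 * (Complex.I * z * x)) / e x)) x := by
    intro x hx
    have hx0 : 0 < x := (le_max_right _ _).trans_lt hx
    have hxX : X ≤ x := ((le_max_left _ _).trans_lt hx).le
    have h1 : HasDerivAt (fun x : ℝ => 2 * (Complex.I * z * (x : ℂ))) (2 * (Complex.I * z * 1)) x :=
      (((hasDerivAt_id (x : ℂ)).comp_ofReal).const_mul _).const_mul 2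
    have h2 := (Complex.hasDerivAt_exp _).comp x h1
    refine (((hδ.hasDerivAt hx0).mul h2).div (he.hasDerivAt hx0) (hne x hxX)).congr_deriv ?_
    rw [← hW x hx0.le, hf]
    simp only [Function.comp_apply, Pi.mul_apply]
    rw [hE2 x]
    have h3 := hexp x
    have h4 := hne x hxX
    field_simp
    ring
  have hk0 : Tendsto (fun x : ℝ => δ x * Complex.exp (2 * (Complex.I * z * x)) / e x) atTop (𝓝 0) := by
    have h1 : Tendsto (fun x : ℝ => (d x * Complex.exp (-(Complex.I * z * x)) - f x) / f x) atTop
        (𝓝 0) := by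
      have := htδ.div hte one_ne_zero
      rw [sub_self, zero_div] at this
      exact this
    refine squeeze_zero_norm' ?_ (by rw [← norm_zero (E := ℂ)]; exact h1.norm)
    filter_upwards [eventually_ge_atTop 0] with x hx
    have h2 : ‖Complex.exp (2 * (Complex.I * z * x))‖ ≤ 1 := by
      rw [Complex.norm_exp, Real.exp_le_one_iff]
      have := mul_nonneg hz hx
      simp
      linarith
    have h3 : (d x * Complex.exp (-(Complex.I * z * x)) - f x) / f x = δ x / e x := by
      rw [hf]
      simp only
      rw [← sub_mul, mul_div_mul_right _ _ (hexp x)]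
    rw [h3, mul_div_right_comm, norm_mul]
    exact mul_le_of_le_one_right (norm_nonneg _) h2
  have hw0 : w = 0 := by
    refine eq_zero_of_tendsto_of_tendsto_deriv hkey hk0 ?_
    have h1 := (tendsto_const_nhds (x := w)).div (hte.pow 2) (by simp)
    have h2 := h1.add (hk0.const_mul (2 * Complex.I * z))
    simpa using h2
  have hpair : ¬ (e 0 = 0 ∧ e' 0 = 0) := by
    rintro ⟨h1, h2⟩
    have h3 := (he.eq_zero h h1 h2 (le_max_right X 0)).1
    exact hne _ (le_max_left X 0) h3
  have hprop : ∃ k : ℂ, δ 0 = k * e 0 ∧ δ' 0 = k * e' 0 := by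
    rw [hw0] at hw
    by_cases h1 : e 0 = 0
    · have h2 : e' 0 ≠ 0 := fun h2 => hpair ⟨h1, h2⟩
      refine ⟨δ' 0 / e' 0, ?_, by field_simp⟩
      rw [h1, zero_mul, zero_sub, eq_comm, neg_eq_zero] at hw
      rw [h1, mul_zero]
      exact (mul_eq_zero.1 hw).resolve_left h2
    · refine ⟨δ 0 / e 0, by field_simp, ?_⟩
      field_simp
      linear_combination -hw
  obtain ⟨k, hk1, hk2⟩ := hprop
  have hz' := hδ.sub (he.const_mul k)
  have hall : ∀ x, 0 ≤ x → δ x = k * e x ∧ δ' x = k * e' x := fun x hx => by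
    have := hz'.eq_zero h (sub_eq_zero.2 hk1) (sub_eq_zero.2 hk2) hx
    exact ⟨sub_eq_zero.1 this.1, sub_eq_zero.1 this.2⟩
  have hkz : k = 0 := by
    have h1 : Tendsto (fun x : ℝ => k * f x) atTop (𝓝 (k * 1)) := hte.const_mul k
    have h2 : Tendsto (fun x : ℝ => k * f x) atTop (𝓝 (1 - 1)) := by
      refine htδ.congr' ?_
      filter_upwards [eventually_ge_atTop 0] with x hx
      rw [← sub_mul, hf]
      simp only
      rw [← mul_assoc, ← (hall x hx).1]
    simpa using tendsto_nhds_unique h1 h2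
  have h1 := hall x hx
  rw [hkz, zero_mul, zero_mul] at h1
  exact ⟨sub_eq_zero.1 h1.1, sub_eq_zero.1 h1.2⟩

theorem isJost_jostFun (h : P.Admissible) {z : ℂ} (hz0 : z ≠ 0) (hz : 0 ≤ z.im) :
    P.IsJost z (fun x => P.jostFun x z) fun x => P.jostFunDeriv x z :=
  ⟨(isSol_iff_isSolution h).1 (isSol_jostFun h hz0 hz), tendsto_jostFun_mul_exp h hz⟩

/-- Existence and uniqueness identify the solution chosen in `jostPair` with the explicit one. -/
theorem jost_eq (h : P.Admissible) {z : ℂ} (hz0 : z ≠ 0) (hz : 0 ≤ z.im) {x : ℝ} (hx : 0 ≤ x) :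
    P.jost x z = P.jostFun x z ∧ P.jostDeriv x z = P.jostFunDeriv x z := by
  have : P.IsJost z (P.jostPair z).1 (P.jostPair z).2 :=
    Classical.epsilon_spec (p := fun p : (ℝ → ℂ) × (ℝ → ℂ) => P.IsJost z p.1 p.2)
      ⟨(_, _), isJost_jostFun h hz0 hz⟩
  exact jostFun_unique h hz0 hz this hx

end ScatteringProblem

/-! ### The boundary solution and the lower estimate of `E` -/

theorem IsPrimitive.eq_neg_integral_Ioi {𝕜 : Type*} [RCLike 𝕜] {u f : ℝ → 𝕜} (h : IsPrimitive u f)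
    (hf : IntegrableOn f (Ioi 0)) (hu : Tendsto u atTop (𝓝 0)) {x : ℝ} (hx : 0 ≤ x) :
    u x = -∫ t in Ioi x, f t := by
  have h1 := intervalIntegral_tendsto_integral_Ioi (μ := volume) x
    (hf.mono_set (Ioi_subset_Ioi hx)) tendsto_id
  have h2 : Tendsto (fun X => u X - u x) atTop (𝓝 (∫ t in Ioi x, f t)) := by
    refine h1.congr' ?_
    filter_upwards [eventually_ge_atTop 0] with X hX
    exact (h.sub_eq hx hX).symm
  have h3 := tendsto_nhds_unique h2 (hu.sub_const (u x))
  rw [h3]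
  ring

namespace ScatteringProblem

variable {P : ScatteringProblem}

/-- The solution with `ω(0) = B`, `ω'(0) = -A`. -/
noncomputable def omega (P : ScatteringProblem) (z : ℂ) (x : ℝ) : ℂ :=
  P.coeffB z * P.cauchySol 1 0 z x - P.coeffA z * P.cauchySol 0 1 z x

noncomputable def omegaDeriv (P : ScatteringProblem) (z : ℂ) (x : ℝ) : ℂ :=
  P.coeffB z * P.cauchySolDeriv 1 0 z x - P.coeffA z * P.cauchySolDeriv 0 1 z x

theorem isSol_omega (h : P.Admissible) (z : ℂ) : P.IsSol z (P.omega z) (P.omegaDeriv z) :=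
  ((isSol_cauchySol h 1 0 z).const_mul _).sub ((isSol_cauchySol h 0 1 z).const_mul _)

theorem omega_zero (h : P.Admissible) (z : ℂ) : P.omega z 0 = P.coeffB z := by
  simp [omega, cauchySol_zero h]

theorem omegaDeriv_zero (h : P.Admissible) (z : ℂ) : P.omegaDeriv z 0 = -P.coeffA z := by
  simp [omegaDeriv, cauchySolDeriv_zero h]

theorem differentiable_coeffA : Differentiable ℂ P.coeffA := by
  unfold coeffA; fun_prop

theorem differentiable_coeffB : Differentiable ℂ P.coeffB := by
  unfold coeffB; fun_prop

theorem differentiable_omega (h : P.Admissible) {x : ℝ} (hx : 0 ≤ x) :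
    Differentiable ℂ fun z => P.omega z x :=
  (differentiable_coeffB.mul (differentiable_cauchySol h 1 0 hx)).sub
    (differentiable_coeffA.mul (differentiable_cauchySol h 0 1 hx))

/-- `E` in terms of the explicit Jost solution. -/
noncomputable def jostE (P : ScatteringProblem) (z : ℂ) : ℂ :=
  P.coeffB z * P.jostFunDeriv 0 z + P.coeffA z * P.jostFun 0 z

theorem E_eq (h : P.Admissible) {z : ℂ} (hz0 : z ≠ 0) (hz : 0 ≤ z.im) : P.E z = P.jostE z := by
  rw [E, jostE, (jost_eq h hz0 hz le_rfl).1, (jost_eq h hz0 hz le_rfl).2]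

theorem differentiableOn_jostE (h : P.Admissible) : DifferentiableOn ℂ P.jostE {z | 0 < z.im} :=
  (differentiable_coeffB.differentiableOn.mul (differentiableOn_jostFunDeriv h le_rfl)).add
    (differentiable_coeffA.differentiableOn.mul (differentiableOn_jostFun h le_rfl))

theorem continuousOn_jostE (h : P.Admissible) : ContinuousOn P.jostE {z | z ≠ 0 ∧ 0 ≤ z.im} :=
  (differentiable_coeffB.continuous.continuousOn.mul (continuousOn_jostFunDeriv h le_rfl)).add
    (differentiable_coeffA.continuous.continuousOn.mul
      ((continuousOn_jostFun h le_rfl).mono fun _ hz => hz.2))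

/-- As a Wronskian, `E` can be computed at any `x`; in this way estimates at `x` say something about
`E`. -/
theorem jostE_eq_wronskian (h : P.Admissible) {z : ℂ} (hz0 : z ≠ 0) (hz : 0 ≤ z.im) {x : ℝ}
    (hx : 0 ≤ x) : P.jostE z =
      P.omega z x * P.jostFunDeriv x z - P.omegaDeriv z x * P.jostFun x z := by
  rw [(isSol_omega h z).wronskian_eq (isSol_jostFun h hz0 hz) hx, omega_zero h, omegaDeriv_zero h,
    jostE]
  ring

theorem ne_zero_of_im_pos {z : ℂ} (hz : 0 < z.im) : z ≠ 0 := by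
  rintro rfl
  simp at hz

theorem sub_le_muPlus (h : P.Admissible) {t : ℝ} (ht : 0 ≤ t) : t - P.α * P.a ≤ P.muPlus t := by
  have h1 := h.α_pos
  have h2 := h.a_pos
  rcases lt_or_ge t P.a with hx | hx
  · rw [muPlus_eq, nu_of_lt h hx]; nlinarith
  · rw [muPlus_of_le hx]; nlinarith

theorem muPlus_sub_le (h : P.Admissible) {x t : ℝ} (hxt : x ≤ t) :
    P.muPlus t ≤ P.muPlus x + (1 + P.α) * (t - x) := by
  have := nu_sub_le h hxt
  rw [muPlus_eq, muPlus_eq]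
  linarith

theorem muPlus_strictMono (h : P.Admissible) : StrictMono P.muPlus := fun x y hxy => by
  have := nu_strictMono h hxy
  rw [muPlus_eq, muPlus_eq]
  linarith

theorem rho_nonneg (x : ℝ) : 0 ≤ P.rho x := by
  rw [rho_eq]; positivity

theorem rho_le (x : ℝ) : P.rho x ≤ P.α ^ 2 + 1 := by
  rw [rho]
  split_ifs
  · linarith
  · linarith [sq_nonneg P.α]

/-- A positive lower bound of `ρ`. -/
noncomputable def rhoMin (P : ScatteringProblem) : ℝ := min (P.α ^ 2) 1

theorem rhoMin_pos (h : P.Admissible) : 0 < P.rhoMin :=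
  lt_min (pow_pos h.α_pos 2) one_pos

theorem rhoMin_le (x : ℝ) : P.rhoMin ≤ P.rho x := by
  rw [rho, rhoMin]
  split_ifs
  · exact min_le_left _ _
  · exact min_le_right _ _

theorem integrableOn_exp_muPlus (h : P.Admissible) {b : ℝ} (hb : 0 < b) :
    IntegrableOn (fun t => Real.exp (-(b * P.muPlus t))) (Ioi 0) := by
  refine Integrable.mono' ((integrableOn_exp_mul_Ioi (neg_neg_of_pos hb) 0).const_mul
    (Real.exp (b * (P.α * P.a)))) ?_ ?_
  · exact (Real.measurable_exp.comp (measurable_muPlus.const_mul b).neg).aestronglyMeasurable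
  · refine (ae_restrict_iff' measurableSet_Ioi).2 (Eventually.of_forall fun t ht => ?_)
    rw [Real.norm_of_nonneg (Real.exp_nonneg _), ← Real.exp_add]
    refine Real.exp_le_exp.2 ?_
    nlinarith [sub_le_muPlus h (le_of_lt ht)]

theorem norm_jostFun_mul_le (h : P.Admissible) {z w : ℂ} (hz : 0 ≤ z.im) (hw : 0 ≤ w.im) {t : ℝ}
    (ht : 0 ≤ t) : ‖P.rho t * (P.jostFun t z * P.jostFun t w)‖ ≤
      (P.α ^ 2 + 1) * P.jostConst ^ 2 * Real.exp (-((z.im + w.im) * P.muPlus t)) := by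
  have h1 := norm_jostFun_le h ht hz
  have h2 := norm_jostFun_le h ht hw
  have h3 := jostConst_pos h
  rw [norm_mul, norm_mul, Complex.norm_real, Real.norm_of_nonneg (rho_nonneg t)]
  calc _ ≤ (P.α ^ 2 + 1) * ((P.jostConst * Real.exp (-(z.im * P.muPlus t))) *
        (P.jostConst * Real.exp (-(w.im * P.muPlus t)))) := by
        gcongr
        exact rho_le t
    _ = (P.α ^ 2 + 1) * P.jostConst ^ 2 * (Real.exp (-(z.im * P.muPlus t)) *
        Real.exp (-(w.im * P.muPlus t))) := by ring
    _ = _ := by rw [← Real.exp_add]; congr 2; ring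

theorem integrableOn_jostFun_mul (h : P.Admissible) {z w : ℂ} (hz : 0 < z.im) (hw : 0 < w.im) :
    IntegrableOn (fun t => P.rho t * (P.jostFun t z * P.jostFun t w)) (Ioi 0) := by
  refine Integrable.mono' ((integrableOn_exp_muPlus h (add_pos hz hw)).const_mul
    ((P.α ^ 2 + 1) * P.jostConst ^ 2)) ?_ ((ae_restrict_iff' measurableSet_Ioi).2
    (Eventually.of_forall fun t ht => norm_jostFun_mul_le h hz.le hw.le (le_of_lt ht)))
  exact ((Complex.measurable_ofReal.comp measurable_rho).mul
    ((measurable_jostFun h z).mul (measurable_jostFun h w))).aestronglyMeasurable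

theorem integrableOn_rho_mul_sq (h : P.Admissible) {z : ℂ} (hz : 0 < z.im) :
    IntegrableOn (fun t => P.rho t * ‖P.jostFun t z‖ ^ 2) (Ioi 0) := by
  refine (integrableOn_jostFun_mul h hz hz).norm.congr (Eventually.of_forall fun t => ?_)
  simp only
  rw [norm_mul, norm_mul, Complex.norm_real, Real.norm_of_nonneg (rho_nonneg t)]
  ring

theorem tendsto_exp_muPlus {b : ℝ} (hb : 0 < b) :
    Tendsto (fun t => Real.exp (-(b * P.muPlus t))) atTop (𝓝 0) := by
  have h1 : Tendsto (fun t : ℝ => Real.exp (-(b * t))) atTop (𝓝 0) :=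
    Real.tendsto_exp_neg_atTop_nhds_zero.comp (tendsto_id.const_mul_atTop hb)
  refine h1.congr' ?_
  filter_upwards [eventually_ge_atTop P.a] with t ht
  rw [muPlus_of_le ht]

theorem tendsto_jostFun_atTop (h : P.Admissible) {z : ℂ} (hz : 0 < z.im) :
    Tendsto (fun x => P.jostFun x z) atTop (𝓝 0) ∧
      Tendsto (fun x => P.jostFunDeriv x z) atTop (𝓝 0) := by
  have hz0 := ne_zero_of_im_pos hz
  constructor
  · refine squeeze_zero_norm' ?_ (by simpa using (tendsto_exp_muPlus (P := P) hz).const_mul P.jostConst)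
    filter_upwards [eventually_ge_atTop 0] with x hx
    exact norm_jostFun_le h hx hz.le
  · have h1 := (tendsto_exp_muPlus (P := P) hz).const_mul
      ((2 + P.α) * ‖z‖ + P.derivConst * P.jostConst * P.tailQ 0)
    rw [mul_zero] at h1
    refine squeeze_zero_norm' ?_ h1
    filter_upwards [eventually_ge_atTop 0] with x hx
    exact norm_jostFunDeriv_le h hx hz0 hz.le

/-- Green's identity for `e` and its conjugate on `(x, ∞)`, with no contribution from infinity. -/
theorem im_jostFunDeriv_mul_conj (h : P.Admissible) {z : ℂ} (hz : 0 < z.im) {x : ℝ} (hx : 0 ≤ x) :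
    (P.jostFunDeriv x z * starRingEnd ℂ (P.jostFun x z)).im =
      2 * z.re * z.im * ∫ t in Ioi x, P.rho t * ‖P.jostFun t z‖ ^ 2 := by
  have he := isSol_jostFun h (ne_zero_of_im_pos hz) hz.le
  have h1 := he.wronskian he.conj
  have hk : ∀ t, P.jostFun t z * starRingEnd ℂ (P.jostFun t z) = (‖P.jostFun t z‖ ^ 2 : ℝ) := by
    intro t
    rw [Complex.mul_conj, Complex.normSq_eq_norm_sq]
  have hf : (fun t => (z ^ 2 - starRingEnd ℂ z ^ 2) *
      ((P.rho t : ℂ) * (P.jostFun t z * starRingEnd ℂ (P.jostFun t z)))) =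
      fun t => (z ^ 2 - starRingEnd ℂ z ^ 2) * ((P.rho t * ‖P.jostFun t z‖ ^ 2 : ℝ) : ℂ) := by
    ext t
    rw [hk]
    push_cast
    rfl
  rw [hf] at h1
  have hi := (integrableOn_rho_mul_sq h hz).ofReal (𝕜 := ℂ)
  obtain ⟨t1, t2⟩ := tendsto_jostFun_atTop h hz
  have t1' := (Complex.continuous_conj.tendsto 0).comp t1
  have t2' := (Complex.continuous_conj.tendsto 0).comp t2
  have h2 := h1.eq_neg_integral_Ioi (hi.const_mul _)
    (by simpa using (t1.mul t2').sub (t2.mul t1')) hx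
  rw [integral_const_mul, integral_complex_ofReal] at h2
  have h3 := congrArg Complex.im h2
  simp only [Complex.sub_im, Complex.mul_im, Complex.conj_re, Complex.conj_im, Complex.neg_im,
    Complex.ofReal_re, Complex.ofReal_im, pow_two, Complex.sub_re, Complex.mul_re] at h3
  simp only [Complex.mul_im, Complex.conj_re, Complex.conj_im]
  simp only [pow_two]
  linear_combination -h3 / 2

/-- The sign conditions enter here: under them the bracket is nonnegative for `Im z ≥ 0`, and the
boundary form has the sign of `Re z`. -/
theorem im_coeffA_mul_conj_coeffB (z : ℂ) : (P.coeffA z * starRingEnd ℂ (P.coeffB z)).im =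
    z.re * (-P.delta1 - 2 * P.delta2 * z.im + P.delta3 * ‖z‖ ^ 2) := by
  rw [← Complex.normSq_eq_norm_sq, Complex.normSq_apply, coeffA, coeffB, delta1, delta2, delta3]
  simp [pow_two]
  ring

/-- Green's identity on `(0, x)`, with the boundary form at `0`. The sign is opposite to the one on
`(x, ∞)`, so the two contributions add up in the Wronskian. -/
theorem im_omegaDeriv_mul_conj (h : P.Admissible) (z : ℂ) {x : ℝ} (hx : 0 ≤ x) :
    (P.omegaDeriv z x * starRingEnd ℂ (P.omega z x)).im =
      -(z.re * (-P.delta1 - 2 * P.delta2 * z.im + P.delta3 * ‖z‖ ^ 2)) -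
        2 * z.re * z.im * ∫ t in (0 : ℝ)..x, P.rho t * ‖P.omega z t‖ ^ 2 := by
  have he := isSol_omega h z
  have h1 := (he.wronskian he.conj).2 x hx
  have hk : ∀ t, P.omega z t * starRingEnd ℂ (P.omega z t) = (‖P.omega z t‖ ^ 2 : ℝ) := by
    intro t
    rw [Complex.mul_conj, Complex.normSq_eq_norm_sq]
  simp only [omega_zero h, omegaDeriv_zero h] at h1
  simp_rw [hk] at h1
  rw [intervalIntegral.integral_const_mul] at h1
  have h4 : (∫ t in (0 : ℝ)..x, (P.rho t : ℂ) * ((‖P.omega z t‖ ^ 2 : ℝ) : ℂ)) =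
      ((∫ t in (0 : ℝ)..x, P.rho t * ‖P.omega z t‖ ^ 2 : ℝ) : ℂ) := by
    rw [← intervalIntegral.integral_ofReal]
    push_cast
    rfl
  rw [h4] at h1
  have h2 := im_coeffA_mul_conj_coeffB (P := P) z
  have h3 := congrArg Complex.im h1
  simp only [Complex.sub_im, Complex.add_im, Complex.mul_im, Complex.conj_re, Complex.conj_im,
    Complex.neg_im, Complex.neg_re, Complex.ofReal_re, Complex.ofReal_im, pow_two, Complex.sub_re,
    Complex.mul_re, map_neg] at h3 h2 ⊢
  linear_combination -h3 / 2 - h2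

/-- Multiply the Wronskian by the conjugate of `ω e`. The imaginary parts of both terms have the
sign of `Re z` and cannot cancel; dropping the one that carries `|e|²` leaves the inequality. -/
theorem two_mul_norm_omega_le (h : P.Admissible) (hδ1 : P.delta1 ≤ 0) (hδ2 : P.delta2 ≤ 0)
    (hδ3 : 0 ≤ P.delta3) {z : ℂ} (hz : 0 < z.im) {x : ℝ} (hx : 0 ≤ x) :
    2 * |z.re| * z.im * ‖P.omega z x‖ * (∫ t in Ioi x, P.rho t * ‖P.jostFun t z‖ ^ 2) ≤
      ‖P.jostE z‖ * ‖P.jostFun x z‖ := by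
  set I := ∫ t in Ioi x, P.rho t * ‖P.jostFun t z‖ ^ 2 with hI
  set J := ∫ t in (0 : ℝ)..x, P.rho t * ‖P.omega z t‖ ^ 2 with hJ
  have hI0 : 0 ≤ I := setIntegral_nonneg measurableSet_Ioi fun t _ =>
    mul_nonneg (rho_nonneg t) (by positivity)
  have hJ0 : 0 ≤ J := intervalIntegral.integral_nonneg hx fun t _ =>
    mul_nonneg (rho_nonneg t) (by positivity)
  have h1 := im_jostFunDeriv_mul_conj h hz hx
  have h2 := im_omegaDeriv_mul_conj h z hx
  rw [← hI] at h1
  rw [← hJ] at h2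
  set D := -P.delta1 - 2 * P.delta2 * z.im + P.delta3 * ‖z‖ ^ 2 with hD
  have hD0 : 0 ≤ D := by
    have := mul_nonneg hδ3 (sq_nonneg ‖z‖)
    nlinarith
  set w := P.omega z x
  set e := P.jostFun x z
  have h3 : (P.jostE z * starRingEnd ℂ (w * e)).im =
      z.re * (2 * z.im * ‖w‖ ^ 2 * I + ‖e‖ ^ 2 * (D + 2 * z.im * J)) := by
    have h4 : P.jostE z * starRingEnd ℂ (w * e) =
        ((‖w‖ ^ 2 : ℝ) : ℂ) * (P.jostFunDeriv x z * starRingEnd ℂ e) -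
        ((‖e‖ ^ 2 : ℝ) : ℂ) * (P.omegaDeriv z x * starRingEnd ℂ w) := by
      rw [jostE_eq_wronskian h (ne_zero_of_im_pos hz) hz.le hx, ← Complex.normSq_eq_norm_sq,
        ← Complex.normSq_eq_norm_sq, ← Complex.mul_conj, ← Complex.mul_conj, map_mul]
      ring
    rw [h4, Complex.sub_im, Complex.im_ofReal_mul, Complex.im_ofReal_mul, h1, h2]
    ring
  have h5 : |z.re| * (2 * z.im * ‖w‖ ^ 2 * I) ≤ ‖P.jostE z‖ * (‖w‖ * ‖e‖) := by
    have h6 := Complex.abs_im_le_norm (P.jostE z * starRingEnd ℂ (w * e))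
    rw [h3, norm_mul, RCLike.norm_conj, norm_mul, abs_mul] at h6
    refine le_trans ?_ h6
    have h7 : 0 ≤ 2 * z.im * ‖w‖ ^ 2 * I := by positivity
    have h8 : 0 ≤ ‖e‖ ^ 2 * (D + 2 * z.im * J) := by positivity
    rw [abs_of_nonneg (add_nonneg h7 h8)]
    gcongr
    linarith
  rcases eq_or_ne w 0 with hw | hw
  · rw [hw]
    simp
    positivity
  · have hw' : 0 < ‖w‖ := norm_pos_iff.2 hw
    refine le_of_mul_le_mul_left ?_ hw'
    calc _ = |z.re| * (2 * z.im * ‖w‖ ^ 2 * I) := by ring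
      _ ≤ _ := h5
      _ = _ := by ring

/-- `c₊ - |c₋|` is the smaller of `1` and `1 / √ρ`, and the reflected exponential does not exceed
the direct one. -/
theorem le_norm_e0 (h : P.Admissible) (t : ℝ) {z : ℂ} (hz : 0 ≤ z.im) :
    (1 + P.α)⁻¹ * Real.exp (-(z.im * P.muPlus t)) ≤ ‖P.e0 t z‖ := by
  have h1 : ∀ b : ℝ, ‖Complex.exp (Complex.I * z * b)‖ = Real.exp (-(z.im * b)) := fun b => by
    rw [Complex.norm_exp]; simp
  have hs := sqrtRho_pos h t
  have hα := h.α_pos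
  have hi : (1 + P.α)⁻¹ ≤ (P.sqrtRho t)⁻¹ := inv_anti₀ hs (sqrtRho_le h t)
  have hi1 : (1 + P.α)⁻¹ ≤ 1 := inv_le_one_of_one_le₀ (by linarith)
  have hc : (1 + P.α)⁻¹ ≤ P.cPlus t - |P.cMinus t| := by
    rw [cPlus, cMinus, abs_mul]
    rcases abs_cases (1 - (P.sqrtRho t)⁻¹) with h2 | h2 <;> rw [h2.1] <;> norm_num <;> linarith
  have h3 : ‖(P.cMinus t : ℂ) * Complex.exp (Complex.I * z * P.muMinus t)‖ ≤
      |P.cMinus t| * Real.exp (-(z.im * P.muPlus t)) := by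
    rw [norm_mul, Complex.norm_real, Real.norm_eq_abs]
    rcases cMinus_eq_zero_or h t with h4 | h4
    · simp [h4]
    · gcongr
      exact norm_cexp_le hz h4
  have h5 : ‖(P.cPlus t : ℂ) * Complex.exp (Complex.I * z * P.muPlus t)‖ =
      P.cPlus t * Real.exp (-(z.im * P.muPlus t)) := by
    rw [norm_mul, h1, Complex.norm_real, Real.norm_of_nonneg (cPlus_nonneg h t).le]
  have h6 := norm_sub_norm_le ((P.cPlus t : ℂ) * Complex.exp (Complex.I * z * P.muPlus t))
    (-((P.cMinus t : ℂ) * Complex.exp (Complex.I * z * P.muMinus t)))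
  rw [norm_neg, sub_neg_eq_add, ← e0_eq, h5] at h6
  have h7 := Real.exp_pos (-(z.im * P.muPlus t))
  nlinarith

/-- Half of the lower bound for `e0`. -/
noncomputable def lowerConst (P : ScatteringProblem) : ℝ := (1 + P.α)⁻¹ / 2

theorem lowerConst_pos (h : P.Admissible) : 0 < P.lowerConst := by
  have := h.α_pos
  unfold lowerConst
  positivity

theorem exists_norm_sub_e0_le_of_large (h : P.Admissible) : ∃ L > 0, ∀ z : ℂ, L ≤ ‖z‖ → 0 ≤ z.im →
    ∀ t, 0 ≤ t → ‖P.jostFun t z - P.e0 t z‖ ≤ P.lowerConst * Real.exp (-(z.im * P.muPlus t)) := by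
  have hc := lowerConst_pos h
  have hα := h.α_pos
  have hJ := jostConst_pos h
  have hQ : 0 ≤ P.tailQ 0 := setIntegral_nonneg measurableSet_Ioi fun _ _ => abs_nonneg _
  set C := 2 * (1 + P.α⁻¹) * P.jostConst * P.tailQ 0
  have hC : 0 ≤ C := by positivity
  refine ⟨C / P.lowerConst + 1, by positivity, fun z hzL hz t ht => ?_⟩
  have hzp : 0 < ‖z‖ := lt_of_lt_of_le (by positivity) hzL
  refine (norm_jostFun_sub_e0_le_div h ht (norm_pos_iff.1 hzp) hz).trans ?_
  gcongr
  rw [div_le_iff₀ hzp]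
  calc C = P.lowerConst * (C / P.lowerConst) := by field_simp
    _ ≤ _ := by gcongr; linarith

theorem exists_norm_sub_e0_le_of_tail (h : P.Admissible) : ∃ X, P.a ≤ X ∧ ∀ z : ℂ, 0 ≤ z.im →
    ∀ t, X ≤ t → ‖P.jostFun t z - P.e0 t z‖ ≤ P.lowerConst * Real.exp (-(z.im * P.muPlus t)) := by
  have h1 : Tendsto (fun x => 2 * (1 + P.α⁻¹) * (Real.exp (P.tailKap x) - 1)) atTop (𝓝 0) := by
    have := (((Real.continuous_exp.tendsto _).comp (tendsto_tailKap h)).sub_const 1).const_mul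
      (2 * (1 + P.α⁻¹))
    simpa using this
  obtain ⟨Y, hY⟩ := eventually_atTop.1 (h1.eventually_le_const (lowerConst_pos h))
  refine ⟨max Y P.a, le_max_right _ _, fun z hz t ht => ?_⟩
  refine (norm_jostFun_sub_e0_le h (h.a_pos.le.trans ((le_max_right _ _).trans ht)) hz).trans ?_
  gcongr
  exact hY t ((le_max_left _ _).trans ht)

theorem le_norm_of_norm_sub_e0_le (h : P.Admissible) {z : ℂ} (hz : 0 ≤ z.im) {t : ℝ}
    (ht : ‖P.jostFun t z - P.e0 t z‖ ≤ P.lowerConst * Real.exp (-(z.im * P.muPlus t))) :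
    P.lowerConst * Real.exp (-(z.im * P.muPlus t)) ≤ ‖P.jostFun t z‖ := by
  have h1 := le_norm_e0 h t hz
  have h2 := norm_le_norm_add_norm_sub (P.jostFun t z) (P.e0 t z)
  rw [lowerConst] at *
  nlinarith

theorem le_integral_of_le_norm (h : P.Admissible) {z : ℂ} (hz : 0 < z.im) {x Y : ℝ} (hx : 0 ≤ x)
    (hxY : x ≤ Y) (hb : ∀ t, Y ≤ t →
      P.lowerConst * Real.exp (-(z.im * P.muPlus t)) ≤ ‖P.jostFun t z‖) :
    P.rhoMin * P.lowerConst ^ 2 / (2 * (1 + P.α)) * Real.exp (-(2 * z.im * (1 + P.α) * (Y - x))) *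
      (Real.exp (-(2 * z.im * P.muPlus x)) / z.im) ≤
      ∫ t in Ioi x, P.rho t * ‖P.jostFun t z‖ ^ 2 := by
  have hα := h.α_pos
  have hc := lowerConst_pos h
  have hρ := rhoMin_pos h
  have hi := (integrableOn_rho_mul_sq h hz).mono_set (Ioi_subset_Ioi hx)
  have hneg : -(2 * z.im * (1 + P.α)) < 0 := by
    have : 0 < 2 * z.im * (1 + P.α) := by positivity
    linarith
  have hexp := integrableOn_exp_mul_Ioi hneg Y
  have hval := integral_exp_mul_Ioi hneg Y
  set K := P.rhoMin * P.lowerConst ^ 2 * Real.exp (-(2 * z.im * P.muPlus x)) *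
    Real.exp (2 * z.im * (1 + P.α) * x) with hK
  calc _ = ∫ t in Ioi Y, K * Real.exp (-(2 * z.im * (1 + P.α)) * t) := by
        rw [integral_const_mul, hval, hK, show -(2 * z.im * (1 + P.α) * (Y - x)) =
          2 * z.im * (1 + P.α) * x + -(2 * z.im * (1 + P.α)) * Y by ring, Real.exp_add]
        field_simp
    _ ≤ ∫ t in Ioi Y, P.rho t * ‖P.jostFun t z‖ ^ 2 := by
        refine setIntegral_mono_on (hexp.const_mul _) (hi.mono_set (Ioi_subset_Ioi hxY))
          measurableSet_Ioi fun t ht => ?_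
        have ht : Y < t := ht
        have h1 : (P.lowerConst * Real.exp (-(z.im * P.muPlus t))) ^ 2 ≤ ‖P.jostFun t z‖ ^ 2 := by
          have := hb t ht.le
          gcongr
        have h2 : Real.exp (-(2 * z.im * P.muPlus x)) * Real.exp (2 * z.im * (1 + P.α) * x) *
            Real.exp (-(2 * z.im * (1 + P.α)) * t) ≤ Real.exp (-(z.im * P.muPlus t)) ^ 2 := by
          rw [← Real.exp_add, ← Real.exp_add, ← Real.exp_nat_mul]
          refine Real.exp_le_exp.2 ?_
          have := muPlus_sub_le h (hxY.trans ht.le)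
          push_cast
          nlinarith
        calc _ = P.rhoMin * (P.lowerConst ^ 2 * (Real.exp (-(2 * z.im * P.muPlus x)) *
              Real.exp (2 * z.im * (1 + P.α) * x) * Real.exp (-(2 * z.im * (1 + P.α)) * t))) := by
              rw [hK]; ring
          _ ≤ P.rho t * ‖P.jostFun t z‖ ^ 2 := by
              refine mul_le_mul (rhoMin_le t) (le_trans ?_ h1) (by positivity) (rho_nonneg t)
              rw [mul_pow]
              gcongr
    _ ≤ _ := setIntegral_mono_set hi (Eventually.of_forall fun t =>
        mul_nonneg (rho_nonneg t) (by positivity)) (Ioi_subset_Ioi hxY).eventuallyLE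

/-- For large `‖z‖` the Jost solution is comparable with `e0` on the whole half line. For bounded
`‖z‖` it is so only beyond a fixed `X`, but then `Im z` is bounded and starting the integral at `X`
costs a constant factor. -/
theorem exists_le_integral_rho_mul_sq (h : P.Admissible) : ∃ c > 0, ∀ z : ℂ, 0 < z.im → ∀ x, 0 ≤ x →
    c * (Real.exp (-(2 * z.im * P.muPlus x)) / z.im) ≤
      ∫ t in Ioi x, P.rho t * ‖P.jostFun t z‖ ^ 2 := by
  obtain ⟨L, hL, hL'⟩ := exists_norm_sub_e0_le_of_large h
  obtain ⟨X, hX, hX'⟩ := exists_norm_sub_e0_le_of_tail h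
  have hα := h.α_pos
  have hc := lowerConst_pos h
  have hρ := rhoMin_pos h
  have hX0 : 0 ≤ X := h.a_pos.le.trans hX
  refine ⟨P.rhoMin * P.lowerConst ^ 2 / (2 * (1 + P.α)) * Real.exp (-(2 * L * (1 + P.α) * X)),
    by positivity, fun z hz x hx => ?_⟩
  rcases le_or_gt L ‖z‖ with hzL | hzL
  · refine le_trans ?_ (le_integral_of_le_norm h hz hx le_rfl fun t ht =>
      le_norm_of_norm_sub_e0_le h hz.le (hL' z hzL hz.le t (hx.trans ht)))
    have : 0 ≤ 2 * L * (1 + P.α) * X := by positivity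
    rw [sub_self, mul_zero, neg_zero]
    gcongr
    linarith
  · refine le_trans ?_ (le_integral_of_le_norm h hz hx (le_max_left x X) fun t ht =>
      le_norm_of_norm_sub_e0_le h hz.le (hX' z hz.le t ((le_max_right _ _).trans ht)))
    have h1 : z.im ≤ L := ((le_abs_self _).trans (Complex.abs_im_le_norm z)).trans hzL.le
    have h2 : max x X - x ≤ X := by
      rcases max_cases x X with h3 | h3 <;> linarith
    have h3 : 0 ≤ max x X - x := sub_nonneg.2 (le_max_left _ _)
    gcongr

/-- The central estimate: `omega / jostE` grows no faster than `exp(Im z μ⁺(x))` and degenerates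
only at the imaginary axis, at worst like `1 / |Re z|`. -/
theorem exists_norm_omega_le (h : P.Admissible) (hδ1 : P.delta1 ≤ 0) (hδ2 : P.delta2 ≤ 0)
    (hδ3 : 0 ≤ P.delta3) : ∃ C > 0, ∀ z : ℂ, 0 < z.im → ∀ x, 0 ≤ x →
      |z.re| * ‖P.omega z x‖ ≤ C * ‖P.jostE z‖ * Real.exp (z.im * P.muPlus x) := by
  obtain ⟨c, hc, hc'⟩ := exists_le_integral_rho_mul_sq h
  have hJ := jostConst_pos h
  refine ⟨P.jostConst / (2 * c), by positivity, fun z hz x hx => ?_⟩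
  have h1 := two_mul_norm_omega_le h hδ1 hδ2 hδ3 hz hx
  have h2 := hc' z hz x hx
  have h3 := norm_jostFun_le h hx hz.le
  set T := Real.exp (z.im * P.muPlus x) with hT
  have hT0 : 0 < T := Real.exp_pos _
  have e1 : Real.exp (-(z.im * P.muPlus x)) = T⁻¹ := by rw [Real.exp_neg]
  have e2 : Real.exp (-(2 * z.im * P.muPlus x)) = (T ^ 2)⁻¹ := by
    rw [Real.exp_neg, hT, ← Real.exp_nat_mul]; push_cast; rw [mul_assoc]
  rw [e2] at h2
  rw [e1] at h3
  have h4 : 2 * |z.re| * z.im * ‖P.omega z x‖ * (c * ((T ^ 2)⁻¹ / z.im)) ≤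
      ‖P.jostE z‖ * (P.jostConst * T⁻¹) := by
    refine le_trans ?_ (h1.trans ?_) <;> gcongr
  calc |z.re| * ‖P.omega z x‖ = (2 * |z.re| * z.im * ‖P.omega z x‖ * (c * ((T ^ 2)⁻¹ / z.im))) *
        (T ^ 2 / (2 * c)) := by field_simp
    _ ≤ (‖P.jostE z‖ * (P.jostConst * T⁻¹)) * (T ^ 2 / (2 * c)) := by gcongr
    _ = _ := by field_simp

theorem IsSol.deriv_eq_zero {z : ℂ} {y y' : ℝ → ℂ} (hy : P.IsSol z y y') (h0 : ∀ x, 0 ≤ x → y x = 0) :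
    y' 0 = 0 := by
  have h1 := hy.1.hasDerivWithinAt hy.2.continuousOn le_rfl
  have h2 : HasDerivWithinAt y 0 (Ici 0) 0 :=
    (hasDerivWithinAt_const (0 : ℝ) (Ici 0) (0 : ℂ)).congr h0 (h0 0 le_rfl)
  exact (uniqueDiffOn_Ici (0 : ℝ) 0 self_mem_Ici).eq_deriv _ h1 h2

/-- At a zero off the axis the estimate for all `x` makes `omega` vanish identically, so its initial
data, which are `B` and `-A`, vanish as well. -/
theorem jostE_ne_zero (h : P.Admissible) (hδ1 : P.delta1 ≤ 0) (hδ2 : P.delta2 ≤ 0)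
    (hδ3 : 0 ≤ P.delta3) (hAB : ∀ z : ℂ, 0 < z.im → ¬ (P.coeffA z = 0 ∧ P.coeffB z = 0)) {z : ℂ}
    (hz : 0 < z.im) (hre : z.re ≠ 0) : P.jostE z ≠ 0 := by
  intro hE
  obtain ⟨C, hC, hb⟩ := exists_norm_omega_le h hδ1 hδ2 hδ3
  have h0 : ∀ x, 0 ≤ x → P.omega z x = 0 := fun x hx => by
    have := hb z hz x hx
    rw [hE, norm_zero, mul_zero, zero_mul] at this
    have h1 : 0 < |z.re| := abs_pos.2 hre
    exact norm_eq_zero.1 (le_antisymm (nonpos_of_mul_nonpos_right this h1) (norm_nonneg _))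
  have h1 := h0 0 le_rfl
  have h2 := (isSol_omega h z).deriv_eq_zero h0
  rw [omega_zero h] at h1
  rw [omegaDeriv_zero h, neg_eq_zero] at h2
  exact hAB z hz ⟨h2, h1⟩

end ScatteringProblem

/-! ### Finiteness of the eigenvalues and positivity of the norming constants -/

namespace ScatteringProblem

variable {P : ScatteringProblem}

theorem coeffA_I_mul (k : ℝ) :
    P.coeffA (Complex.I * k) = ((P.α₀ - P.α₁ * k - P.α₂ * k ^ 2 : ℝ) : ℂ) := by
  rw [coeffA]
  push_cast
  linear_combination (P.α₁ * k + P.α₂ * k ^ 2 : ℂ) * Complex.I_sq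

theorem coeffB_I_mul (k : ℝ) :
    P.coeffB (Complex.I * k) = ((P.β₀ - P.β₁ * k - P.β₂ * k ^ 2 : ℝ) : ℂ) := by
  rw [coeffB]
  push_cast
  linear_combination (P.β₁ * k + P.β₂ * k ^ 2 : ℂ) * Complex.I_sq

theorem im_I_mul (k : ℝ) : (Complex.I * (k : ℂ)).im = k := by simp

theorem conj_jostFun_I_mul (h : P.Admissible) (x k : ℝ) :
    starRingEnd ℂ (P.jostFun x (Complex.I * k)) = P.jostFun x (Complex.I * k) := by
  rw [← jostFun_neg_conj h]
  simp

/-- The Jost solution on the imaginary axis, where it is real. -/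
noncomputable def realJost (P : ScatteringProblem) (k x : ℝ) : ℝ := (P.jostFun x (Complex.I * k)).re

theorem jostFun_I_mul (h : P.Admissible) (x k : ℝ) :
    P.jostFun x (Complex.I * k) = P.realJost k x :=
  (Complex.conj_eq_iff_re.1 (conj_jostFun_I_mul h x k)).symm

theorem jostFunDeriv_I_mul (h : P.Admissible) {k : ℝ} (hk : 0 < k) :
    P.jostFunDeriv 0 (Complex.I * k) = ((P.jostFunDeriv 0 (Complex.I * k)).re : ℂ) := by
  have hz : 0 < (Complex.I * (k : ℂ)).im := by rwa [im_I_mul]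
  have h1 := isSol_jostFun h (ne_zero_of_im_pos hz) hz.le
  have h2 := h1.1.sub h1.conj.1
  have h3 := h2.hasDerivWithinAt (h1.2.continuousOn.sub h1.conj.2.continuousOn) le_rfl
  have h4 : HasDerivWithinAt (fun x => P.jostFun x (Complex.I * k) -
      starRingEnd ℂ (P.jostFun x (Complex.I * k))) 0 (Ici 0) 0 := by
    simp_rw [conj_jostFun_I_mul h, sub_self]
    exact hasDerivWithinAt_const _ _ _
  have h5 := (uniqueDiffOn_Ici (0 : ℝ) 0 self_mem_Ici).eq_deriv _ h3 h4
  exact (Complex.conj_eq_iff_re.1 (sub_eq_zero.1 h5).symm).symm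

theorem mem_eigenSet (h : P.Admissible) {k : ℝ} (hk : k ∈ P.eigenSet) :
    P.jostE (Complex.I * k) = 0 := by
  have hz : 0 < (Complex.I * (k : ℂ)).im := by rw [im_I_mul]; exact hk.1
  rw [← E_eq h (ne_zero_of_im_pos hz) hz.le]
  exact hk.2

/-- The sign of the ratio `r` divides the eigenvalues into two classes; within a class the inner
products below have a sign. -/
theorem exists_ratio (h : P.Admissible)
    (hAB : ∀ z : ℂ, 0 < z.im → ¬ (P.coeffA z = 0 ∧ P.coeffB z = 0)) {k : ℝ} (hk : k ∈ P.eigenSet) :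
    ∃ r : ℝ, P.jostFun 0 (Complex.I * k) = r * P.coeffB (Complex.I * k) ∧
      P.jostFunDeriv 0 (Complex.I * k) = -(r * P.coeffA (Complex.I * k)) := by
  have hz : 0 < (Complex.I * (k : ℂ)).im := by rw [im_I_mul]; exact hk.1
  have h0 := mem_eigenSet h hk
  have h1 := hAB _ hz
  rw [jostE] at h0
  rw [jostFun_I_mul h, jostFunDeriv_I_mul h hk.1, coeffA_I_mul, coeffB_I_mul] at *
  generalize P.α₀ - P.α₁ * k - P.α₂ * k ^ 2 = A at *
  generalize P.β₀ - P.β₁ * k - P.β₂ * k ^ 2 = B at *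
  generalize (P.jostFunDeriv 0 (Complex.I * k)).re = d at *
  generalize P.realJost k 0 = e at *
  have h2 : B * d + A * e = 0 := by exact_mod_cast h0
  have h3 : ¬ (A = 0 ∧ B = 0) := by exact_mod_cast h1
  by_cases hB : B = 0
  · have hA : A ≠ 0 := fun hA => h3 ⟨hA, hB⟩
    have he : e = 0 := by
      rw [hB, zero_mul, zero_add] at h2
      exact (mul_eq_zero.1 h2).resolve_left hA
    refine ⟨-(d / A), ?_, ?_⟩
    · rw [hB, he]; simp
    · norm_cast; field_simp
  · refine ⟨e / B, ?_, ?_⟩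
    · norm_cast; field_simp
    · norm_cast; field_simp; linarith

theorem integral_realJost_mul (h : P.Admissible) {j k : ℝ} (hj : 0 < j) (hk : 0 < k) :
    (k ^ 2 - j ^ 2) * (∫ t in Ioi 0, P.rho t * (P.realJost j t * P.realJost k t) : ℝ) =
      -(P.jostFun 0 (Complex.I * j) * P.jostFunDeriv 0 (Complex.I * k) -
        P.jostFunDeriv 0 (Complex.I * j) * P.jostFun 0 (Complex.I * k)) := by
  have hzj : 0 < (Complex.I * (j : ℂ)).im := by rwa [im_I_mul]
  have hzk : 0 < (Complex.I * (k : ℂ)).im := by rwa [im_I_mul]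
  have h1 := (isSol_jostFun h (ne_zero_of_im_pos hzj) hzj.le).wronskian
    (isSol_jostFun h (ne_zero_of_im_pos hzk) hzk.le)
  obtain ⟨a1, a2⟩ := tendsto_jostFun_atTop h hzj
  obtain ⟨b1, b2⟩ := tendsto_jostFun_atTop h hzk
  have h2 := h1.eq_neg_integral_Ioi ((integrableOn_jostFun_mul h hzj hzk).const_mul _)
    (by simpa using (a1.mul b2).sub (a2.mul b1)) le_rfl
  rw [h2, integral_const_mul, ← integral_complex_ofReal, neg_neg]
  have h3 : (Complex.I * (j : ℂ)) ^ 2 - (Complex.I * k) ^ 2 = k ^ 2 - j ^ 2 := by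
    linear_combination (j ^ 2 - k ^ 2 : ℂ) * Complex.I_sq
  rw [h3]
  congr 2
  ext t
  rw [jostFun_I_mul h, jostFun_I_mul h]
  push_cast
  rfl

/-- After cancelling `k - j`, Green's identity gives `(j + k)` times the integral as `r s (δ₁ + δ₂
(j + k) - δ₃ j k)`, whose bracket is nonpositive. -/
theorem integral_realJost_nonpos (h : P.Admissible) (hδ1 : P.delta1 ≤ 0) (hδ2 : P.delta2 ≤ 0)
    (hδ3 : 0 ≤ P.delta3) {j k : ℝ} (hj : 0 < j) (hk : 0 < k) (hjk : j ≠ k) {r s : ℝ}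
    (hr : P.jostFun 0 (Complex.I * j) = r * P.coeffB (Complex.I * j) ∧
      P.jostFunDeriv 0 (Complex.I * j) = -(r * P.coeffA (Complex.I * j)))
    (hs : P.jostFun 0 (Complex.I * k) = s * P.coeffB (Complex.I * k) ∧
      P.jostFunDeriv 0 (Complex.I * k) = -(s * P.coeffA (Complex.I * k))) (hrs : 0 ≤ r * s) :
    ∫ t in Ioi 0, P.rho t * (P.realJost j t * P.realJost k t) ≤ 0 := by
  have h1 := integral_realJost_mul h hj hk
  rw [hr.1, hr.2, hs.1, hs.2, coeffA_I_mul, coeffB_I_mul, coeffA_I_mul, coeffB_I_mul] at h1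
  set I := ∫ t in Ioi 0, P.rho t * (P.realJost j t * P.realJost k t)
  have h2 : (k ^ 2 - j ^ 2) * I = (k - j) * (r * s *
      (P.delta1 + P.delta2 * (j + k) - P.delta3 * (j * k))) := by
    have h3 : (k ^ 2 - j ^ 2) * I = -(r * (P.β₀ - P.β₁ * j - P.β₂ * j ^ 2) *
      -(s * (P.α₀ - P.α₁ * k - P.α₂ * k ^ 2)) - -(r * (P.α₀ - P.α₁ * j - P.α₂ * j ^ 2)) *
      (s * (P.β₀ - P.β₁ * k - P.β₂ * k ^ 2))) := by exact_mod_cast h1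
    rw [h3, delta1, delta2, delta3]
    ring
  have h4 : (j + k) * I = r * s * (P.delta1 + P.delta2 * (j + k) - P.delta3 * (j * k)) := by
    have : k - j ≠ 0 := sub_ne_zero.2 hjk.symm
    refine mul_left_cancel₀ this ?_
    rw [← h2]
    ring
  have h5 : P.delta1 + P.delta2 * (j + k) - P.delta3 * (j * k) ≤ 0 := by
    have := mul_nonneg hδ3 (mul_pos hj hk).le
    have : P.delta2 * (j + k) ≤ 0 := mul_nonpos_of_nonpos_of_nonneg hδ2 (by positivity)
    linarith
  have h6 : (j + k) * I ≤ 0 := by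
    rw [h4]
    exact mul_nonpos_of_nonneg_of_nonpos hrs h5
  exact nonpos_of_mul_nonpos_right h6 (by positivity)

theorem abs_cMinus_le_cPlus (h : P.Admissible) (x : ℝ) : |P.cMinus x| ≤ P.cPlus x := by
  have := inv_pos.2 (sqrtRho_pos h x)
  rw [cPlus, cMinus, abs_le]
  constructor <;> linarith

theorem e0_I_mul (h : P.Admissible) {k : ℝ} (hk : 0 ≤ k) (x : ℝ) :
    P.e0 x (Complex.I * k) = (‖P.e0 x (Complex.I * k)‖ : ℂ) := by
  have h1 : P.e0 x (Complex.I * k) = ((P.cPlus x * Real.exp (-(k * P.muPlus x)) +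
      P.cMinus x * Real.exp (-(k * P.muMinus x)) : ℝ) : ℂ) := by
    have h3 : ∀ b : ℝ, Complex.I * (Complex.I * k) * b = ((-(k * b) : ℝ) : ℂ) := fun b => by
      push_cast
      linear_combination (k * b : ℂ) * Complex.I_sq
    rw [e0_eq, h3, h3]
    push_cast
    rfl
  have h2 : 0 ≤ P.cPlus x * Real.exp (-(k * P.muPlus x)) +
      P.cMinus x * Real.exp (-(k * P.muMinus x)) := by
    rcases cMinus_eq_zero_or h x with h3 | h3
    · rw [h3]
      have := cPlus_nonneg h x
      positivity
    · have h4 : Real.exp (-(k * P.muMinus x)) ≤ Real.exp (-(k * P.muPlus x)) :=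
        Real.exp_le_exp.2 (by nlinarith)
      have h5 := abs_cMinus_le_cPlus h x
      have h6 := neg_abs_le (P.cMinus x)
      have h7 := Real.exp_pos (-(k * P.muMinus x))
      nlinarith [mul_le_mul_of_nonneg_left h4 (cPlus_nonneg h x).le]
  rw [h1, Complex.norm_real, Real.norm_of_nonneg h2]

theorem le_realJost (h : P.Admissible) {k t : ℝ} (hk : 0 ≤ k)
    (ht : ‖P.jostFun t (Complex.I * k) - P.e0 t (Complex.I * k)‖ ≤
      P.lowerConst * Real.exp (-((Complex.I * (k : ℂ)).im * P.muPlus t))) :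
    P.lowerConst * Real.exp (-(k * P.muPlus t)) ≤ P.realJost k t := by
  have h1 := le_norm_e0 h t (z := Complex.I * k) (by rwa [im_I_mul])
  rw [im_I_mul] at h1 ht
  have h2 := (Complex.abs_re_le_norm _).trans ht
  rw [e0_I_mul h hk, Complex.sub_re, Complex.ofReal_re, ← realJost] at h2
  have h3 := (abs_le.1 h2).1
  rw [lowerConst] at *
  nlinarith

theorem integrableOn_realJost_mul (h : P.Admissible) {j k : ℝ} (hj : 0 < j) (hk : 0 < k) :
    IntegrableOn (fun t => P.rho t * (P.realJost j t * P.realJost k t)) (Ioi 0) := by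
  have h1 := integrableOn_jostFun_mul h (z := Complex.I * j) (w := Complex.I * k)
    (by rwa [im_I_mul]) (by rwa [im_I_mul])
  refine h1.re.congr (Eventually.of_forall fun t => ?_)
  simp only
  rw [jostFun_I_mul h, jostFun_I_mul h]
  norm_cast

theorem abs_realJost_mul_le (h : P.Admissible) {j k t : ℝ} (hj : 0 < j) (hk : 0 < k) (ht : 0 ≤ t) :
    ‖P.rho t * (P.realJost j t * P.realJost k t)‖ ≤
      (P.α ^ 2 + 1) * P.jostConst ^ 2 * Real.exp (-((j + k) * P.muPlus t)) := by
  have := norm_jostFun_mul_le h (z := Complex.I * j) (w := Complex.I * k)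
    (by rw [im_I_mul]; exact hj.le) (by rw [im_I_mul]; exact hk.le) ht
  rw [im_I_mul, im_I_mul, jostFun_I_mul h, jostFun_I_mul h] at this
  exact_mod_cast this

/-- For large parameters the Jost solution stays close to the positive function `e0` on the whole
half line. -/
theorem exists_integral_realJost_pos_of_large (h : P.Admissible) : ∃ L > 0, ∀ j k : ℝ, L ≤ j → L ≤ k →
    0 < ∫ t in Ioi 0, P.rho t * (P.realJost j t * P.realJost k t) := by
  obtain ⟨L, hL, hL'⟩ := exists_norm_sub_e0_le_of_large h
  refine ⟨L, hL, fun j k hj hk => ?_⟩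
  have hpos : ∀ k, L ≤ k → ∀ t, 0 ≤ t → 0 < P.realJost k t := fun k hk t ht => by
    have hk0 : 0 ≤ k := hL.le.trans hk
    refine lt_of_lt_of_le ?_ (le_realJost h hk0 (hL' _ (by simpa [abs_of_nonneg hk0] using hk)
      (by rwa [im_I_mul]) t ht))
    have := lowerConst_pos h
    positivity
  have hp : ∀ t ∈ Ioi (0 : ℝ), 0 < P.rho t * (P.realJost j t * P.realJost k t) := fun t ht =>
    mul_pos ((rhoMin_pos h).trans_le (rhoMin_le t))
      (mul_pos (hpos j hj t (le_of_lt ht)) (hpos k hk t (le_of_lt ht)))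
  rw [setIntegral_pos_iff_support_of_nonneg_ae ((ae_restrict_iff' measurableSet_Ioi).2
    (Eventually.of_forall fun t ht => (hp t ht).le))
    (integrableOn_realJost_mul h (hL.trans_le hj) (hL.trans_le hk))]
  have : (Function.support fun t => P.rho t * (P.realJost j t * P.realJost k t)) ∩ Ioi 0 = Ioi 0 :=
    inter_eq_right.2 fun t ht => (hp t ht).ne'
  rw [this]
  simp

/-- The tail contributes at the order of `1 / (j + k)`, which beats the bounded and possibly
negative contribution of `(0, X)`. -/
theorem exists_integral_realJost_pos_of_small (h : P.Admissible) : ∃ s > 0, ∀ j k : ℝ, 0 < j → 0 < k →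
    j < s → k < s → 0 < ∫ t in Ioi 0, P.rho t * (P.realJost j t * P.realJost k t) := by
  obtain ⟨X, hX, hX'⟩ := exists_norm_sub_e0_le_of_tail h
  have hα := h.α_pos
  have ha := h.a_pos
  have hJ := jostConst_pos h
  have hc := lowerConst_pos h
  have hX0 : 0 ≤ X := ha.le.trans hX
  set M := X * ((P.α ^ 2 + 1) * P.jostConst ^ 2 * Real.exp (P.α * P.a)) with hM
  have hM0 : 0 ≤ M := by positivity
  set N := P.lowerConst ^ 2 * Real.exp (-X) with hN
  have hN0 : 0 < N := by positivity
  -- `M` bounds the integral over `(0, X)` and the tail is at least `N / (j + k)`. The second entry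
  -- makes the tail exceed `M + 1`; the first gives `j + k < 1`, which controls the exponentials.
  refine ⟨min (1 / 2) (N / (2 * (M + 1))), lt_min (by norm_num) (by positivity),
    fun j k hj hk hjs hks => ?_⟩
  have hjk : j + k < 1 := by
    have := hjs.trans_le (min_le_left _ _)
    have := hks.trans_le (min_le_left _ _)
    linarith
  have hjk' : j + k < N / (M + 1) := by
    have h1 := hjs.trans_le (min_le_right _ _)
    have h2 := hks.trans_le (min_le_right _ _)
    have h3 : N / (M + 1) = N / (2 * (M + 1)) + N / (2 * (M + 1)) := by field_simp; ring
    linarith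
  have hi := integrableOn_realJost_mul h hj hk
  have hsplit := intervalIntegral.integral_interval_add_Ioi (a := 0) (b := X) (μ := volume) hi
    (hi.mono_set (Ioi_subset_Ioi hX0))
  have h1 : ‖∫ t in (0 : ℝ)..X, P.rho t * (P.realJost j t * P.realJost k t)‖ ≤ M := by
    refine (intervalIntegral.norm_integral_le_of_norm_le_const (C := (P.α ^ 2 + 1) *
      P.jostConst ^ 2 * Real.exp (P.α * P.a)) fun t ht => ?_).trans_eq ?_
    · rw [uIoc_of_le hX0] at ht
      refine (abs_realJost_mul_le h hj hk ht.1.le).trans ?_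
      refine mul_le_mul_of_nonneg_left (Real.exp_le_exp.2 ?_) (by positivity)
      have h2 := sub_le_muPlus h ht.1.le
      have h3 : 0 ≤ P.α * P.a := by positivity
      have h4 : 0 < t := ht.1
      have h5 : 0 < j + k := by positivity
      nlinarith
    · rw [sub_zero, abs_of_nonneg hX0, hM]; ring
  have h2 : M + 1 ≤ ∫ t in Ioi X, P.rho t * (P.realJost j t * P.realJost k t) := by
    have hneg : -(j + k) < 0 := by linarith
    have h3 : ∫ t in Ioi X, P.lowerConst ^ 2 * Real.exp (-(j + k) * t) ≤
        ∫ t in Ioi X, P.rho t * (P.realJost j t * P.realJost k t) := by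
      refine setIntegral_mono_on ((integrableOn_exp_mul_Ioi hneg X).const_mul _)
        (hi.mono_set (Ioi_subset_Ioi hX0)) measurableSet_Ioi fun t ht => ?_
      have ht : X < t := ht
      have e1 := le_realJost h hj.le (hX' _ (by rw [im_I_mul]; exact hj.le) t ht.le)
      have e2 := le_realJost h hk.le (hX' _ (by rw [im_I_mul]; exact hk.le) t ht.le)
      rw [muPlus_of_le (hX.trans ht.le)] at e1 e2
      have e3 : P.rho t = 1 := by rw [rho, if_neg (not_lt.2 (hX.trans ht.le))]
      rw [e3, one_mul]
      calc _ = (P.lowerConst * Real.exp (-(j * t))) * (P.lowerConst * Real.exp (-(k * t))) := by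
            rw [show -(j + k) * t = -(j * t) + -(k * t) by ring, Real.exp_add]; ring
        _ ≤ _ := mul_le_mul e1 e2 (by positivity) (le_trans (by positivity) e1)
    refine le_trans ?_ h3
    rw [integral_const_mul, integral_exp_mul_Ioi hneg, neg_div_neg_eq]
    have h4 : Real.exp (-X) ≤ Real.exp (-(j + k) * X) := Real.exp_le_exp.2 (by nlinarith)
    calc M + 1 ≤ N / (j + k) := by
          rw [le_div_iff₀ (by positivity)]
          rw [lt_div_iff₀ (by positivity)] at hjk'
          linarith
      _ ≤ _ := by
          rw [hN, mul_div_assoc]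
          gcongr
  have h3 := (abs_le.1 h1).1
  linarith

/-- An accumulation point would make `jostE` vanish throughout the upper half plane, although it has
no zeros off the imaginary axis. -/
theorem finite_eigenSet_inter_Icc (h : P.Admissible) (hδ1 : P.delta1 ≤ 0) (hδ2 : P.delta2 ≤ 0)
    (hδ3 : 0 ≤ P.delta3) (hAB : ∀ z : ℂ, 0 < z.im → ¬ (P.coeffA z = 0 ∧ P.coeffB z = 0)) {s L : ℝ}
    (hs : 0 < s) : (P.eigenSet ∩ Icc s L).Finite := by
  by_contra hinf
  obtain ⟨k, hk, hacc⟩ := Set.Infinite.exists_accPt_of_subset_isCompact hinf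
    (isCompact_Icc (a := s) (b := L)) inter_subset_right
  have hk0 : 0 < k := hs.trans_le hk.1
  have hz : 0 < (Complex.I * (k : ℂ)).im := by rwa [im_I_mul]
  have h1 : ∃ᶠ j : ℝ in 𝓝[≠] k, P.jostE (Complex.I * (j : ℂ)) = 0 := by
    rw [accPt_iff_frequently_nhdsNE] at hacc
    exact hacc.mono fun j hj => mem_eigenSet h hj.1
  have h2 : Tendsto (fun j : ℝ => Complex.I * (j : ℂ)) (𝓝[≠] k) (𝓝[≠] (Complex.I * k)) := by
    refine tendsto_nhdsWithin_iff.2 ⟨?_, ?_⟩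
    · exact ((by fun_prop : Continuous fun j : ℝ => Complex.I * (j : ℂ)).tendsto k).mono_left
        nhdsWithin_le_nhds
    · filter_upwards [self_mem_nhdsWithin] with j hj
      simpa using hj
  have h3 := (differentiableOn_jostE h).analyticOnNhd isOpen_upperHalf
  have h4 : IsPreconnected {z : ℂ | 0 < z.im} := (convex_halfSpace_im_gt 0).isPreconnected
  have h5 := h3.eqOn_zero_of_preconnected_of_frequently_eq_zero h4 hz (h2.frequently h1)
  have h6 : 0 < (1 + Complex.I).im := by simp
  exact jostE_ne_zero h hδ1 hδ2 hδ3 hAB h6 (by simp) (h5 h6)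

/-- Two large or two small eigenvalues with ratios of the same sign would have an inner product that
is both positive and nonpositive. Hence each of these ranges contains at most one eigenvalue per
sign, and the compact range between them is covered by the identity theorem. -/
theorem finite_eigenSet (h : P.Admissible) (hδ1 : P.delta1 ≤ 0) (hδ2 : P.delta2 ≤ 0)
    (hδ3 : 0 ≤ P.delta3) (hAB : ∀ z : ℂ, 0 < z.im → ¬ (P.coeffA z = 0 ∧ P.coeffB z = 0)) :
    P.eigenSet.Finite := by
  choose! r hr using fun k (hk : k ∈ P.eigenSet) => exists_ratio h hAB hk
  have key : ∀ D : Set ℝ, D ⊆ P.eigenSet → (∀ j ∈ D, ∀ k ∈ D,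
      0 < ∫ t in Ioi 0, P.rho t * (P.realJost j t * P.realJost k t)) → D.Finite := by
    intro D hD hpos
    have hsub : ∀ S : Set ℝ, (∀ j ∈ S, ∀ k ∈ S, j ∈ D ∧ k ∈ D ∧ 0 ≤ r j * r k) → S.Subsingleton := by
      intro S hS j hj k hk
      by_contra hjk
      obtain ⟨h1, h2, h3⟩ := hS j hj k hk
      exact absurd (hpos j h1 k h2) (not_lt.2 (integral_realJost_nonpos h hδ1 hδ2 hδ3 (hD h1).1
        (hD h2).1 hjk (hr j (hD h1)) (hr k (hD h2)) h3))
    have h1 := (hsub {j | j ∈ D ∧ 0 ≤ r j} fun j hj k hk =>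
      ⟨hj.1, hk.1, mul_nonneg hj.2 hk.2⟩).finite
    have h2 := (hsub {j | j ∈ D ∧ r j ≤ 0} fun j hj k hk =>
      ⟨hj.1, hk.1, mul_nonneg_of_nonpos_of_nonpos hj.2 hk.2⟩).finite
    exact (h1.union h2).subset fun j hj => (le_total 0 (r j)).imp (fun h => ⟨hj, h⟩) fun h => ⟨hj, h⟩
  obtain ⟨L, hL, hL'⟩ := exists_integral_realJost_pos_of_large h
  obtain ⟨s, hs, hs'⟩ := exists_integral_realJost_pos_of_small h
  have f1 := key (P.eigenSet ∩ Ici L) inter_subset_left fun j hj k hk => hL' j k hj.2 hk.2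
  have f2 := key (P.eigenSet ∩ Iio s) inter_subset_left fun j hj k hk =>
    hs' j k hj.1.1 hk.1.1 hj.2 hk.2
  have f3 := finite_eigenSet_inter_Icc h hδ1 hδ2 hδ3 hAB (L := L) hs
  refine ((f1.union f2).union f3).subset fun k hk => ?_
  rcases le_or_gt L k with h1 | h1
  · exact Or.inl (Or.inl ⟨hk, h1⟩)
  · rcases lt_or_ge k s with h2 | h2
    · exact Or.inl (Or.inr ⟨hk, h2⟩)
    · exact Or.inr ⟨hk, h2, h1.le⟩

/-- The boundary term subtracted in `normInvSq` is nonpositive by the sign conditions. Positivity is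
all that the uniqueness proof needs of the norming constants. -/
theorem normSq_pos (h : P.Admissible) (hδ1 : P.delta1 ≤ 0) (hδ2 : P.delta2 ≤ 0)
    (hδ3 : 0 ≤ P.delta3) {k : ℝ} (hk : k ∈ P.eigenSet) : 0 < P.normSq k := by
  have hk0 : 0 < k := hk.1
  have hz : 0 < (Complex.I * (k : ℂ)).im := by rwa [im_I_mul]
  obtain ⟨c, hc, hc'⟩ := exists_le_integral_rho_mul_sq h
  have h1 := hc' _ hz 0 le_rfl
  have h2 : (∫ x in Ioi (0 : ℝ), ‖P.jost x (Complex.I * k)‖ ^ 2 * P.rho x) =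
      ∫ t in Ioi 0, P.rho t * ‖P.jostFun t (Complex.I * k)‖ ^ 2 := by
    refine setIntegral_congr_fun measurableSet_Ioi fun x hx => ?_
    rw [(jost_eq h (ne_zero_of_im_pos hz) hz.le (le_of_lt hx)).1, mul_comm]
  have h3 : 0 ≤ P.ratioSq k := by
    rw [ratioSq]
    split_ifs <;> positivity
  have h4 : (P.delta1 + 2 * P.delta2 * k - P.delta3 * k ^ 2) / (2 * k) ≤ 0 := by
    refine div_nonpos_of_nonpos_of_nonneg ?_ (by positivity)
    nlinarith [mul_nonneg hδ3 (sq_nonneg k)]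
  rw [normSq, normInvSq, h2, inv_pos]
  have h5 := mul_nonpos_of_nonpos_of_nonneg h4 h3
  have h6 : 0 < c * (Real.exp (-(2 * (Complex.I * (k : ℂ)).im * P.muPlus 0)) /
    (Complex.I * (k : ℂ)).im) := by positivity
  linarith

end ScatteringProblem

/-! ### The scattering function on the real axis -/

namespace ScatteringProblem

variable {P : ScatteringProblem}

theorem tendsto_jostFunDeriv_mul_exp (h : P.Admissible) {z : ℂ} (hz0 : z ≠ 0) (hz : 0 ≤ z.im) :
    Tendsto (fun x : ℝ => P.jostFunDeriv x z * Complex.exp (-(Complex.I * z * x))) atTop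
      (𝓝 (Complex.I * z)) := by
  have h1 : Tendsto (fun x => P.derivConst * P.jostConst * P.tailQ x) atTop (𝓝 0) := by
    simpa using (tendsto_tailQ h).const_mul (P.derivConst * P.jostConst)
  rw [tendsto_iff_norm_sub_tendsto_zero]
  refine squeeze_zero' (Eventually.of_forall fun _ => norm_nonneg _) ?_ h1
  filter_upwards [eventually_ge_atTop 0, eventually_ge_atTop P.a] with x hx hxa
  have h2 := norm_jostFunDeriv_sub_e0Deriv_le h hx hz0 hz
  rw [e0Deriv_of_le hxa, muPlus_of_le hxa] at h2
  have h3 : P.jostFunDeriv x z * Complex.exp (-(Complex.I * z * x)) - Complex.I * z =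
      (P.jostFunDeriv x z - Complex.I * z * Complex.exp (Complex.I * z * x)) *
        Complex.exp (-(Complex.I * z * x)) := by
    rw [sub_mul, mul_assoc (Complex.I * z), ← Complex.exp_add, add_neg_cancel, Complex.exp_zero,
      mul_one]
  have h4 : ‖Complex.exp (-(Complex.I * z * x))‖ = Real.exp (z.im * x) := by
    rw [Complex.norm_exp]; simp
  rw [h3, norm_mul, h4]
  calc _ ≤ P.derivConst * P.jostConst * P.tailQ x * Real.exp (-(z.im * x)) *
        Real.exp (z.im * x) := by gcongr
    _ = _ := by rw [mul_assoc, ← Real.exp_add, neg_add_cancel, Real.exp_zero, mul_one]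

/-- The Wronskian of the Jost solution and its conjugate, for real `l`. -/
theorem wronskian_jostFun_conj (h : P.Admissible) {l : ℝ} (hl : l ≠ 0) {x : ℝ} (hx : 0 ≤ x) :
    P.jostFun x l * starRingEnd ℂ (P.jostFunDeriv x l) -
      P.jostFunDeriv x l * starRingEnd ℂ (P.jostFun x l) = -2 * Complex.I * l := by
  have hl0 : (l : ℂ) ≠ 0 := Complex.ofReal_ne_zero.2 hl
  have him : 0 ≤ (l : ℂ).im := by simp
  have he := isSol_jostFun h hl0 him
  have hc := he.conj
  rw [Complex.conj_ofReal] at hc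
  have hW := fun y hy => he.wronskian_eq hc (x := y) hy
  have t1 := tendsto_jostFun_mul_exp h him
  have t2 := tendsto_jostFunDeriv_mul_exp h hl0 him
  have t1' := (Complex.continuous_conj.tendsto _).comp t1
  have t2' := (Complex.continuous_conj.tendsto _).comp t2
  have t3 := (t1.mul t2').sub (t2.mul t1')
  have hnorm : ∀ y : ℝ, Complex.exp (-(Complex.I * l * y)) *
      starRingEnd ℂ (Complex.exp (-(Complex.I * l * y))) = 1 := fun y => by
    rw [Complex.mul_conj, Complex.normSq_eq_norm_sq, Complex.norm_exp]
    simp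
  have t4 : Tendsto (fun _ : ℝ => P.jostFun 0 l * starRingEnd ℂ (P.jostFunDeriv 0 l) -
      P.jostFunDeriv 0 l * starRingEnd ℂ (P.jostFun 0 l)) atTop
      (𝓝 (1 * starRingEnd ℂ (Complex.I * l) - Complex.I * l * starRingEnd ℂ 1)) := by
    refine t3.congr' ?_
    filter_upwards [eventually_ge_atTop 0] with y hy
    rw [← hW y hy]
    simp only [Function.comp_apply, map_mul]
    linear_combination (P.jostFun y l * starRingEnd ℂ (P.jostFunDeriv y l) -
      P.jostFunDeriv y l * starRingEnd ℂ (P.jostFun y l)) * hnorm y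
  rw [hW x hx, tendsto_nhds_unique tendsto_const_nhds t4]
  simp
  ring

/-- The numerator of the scattering function. -/
noncomputable def jostEConj (P : ScatteringProblem) (l : ℝ) : ℂ :=
  P.coeffB l * starRingEnd ℂ (P.jostFunDeriv 0 l) + P.coeffA l * starRingEnd ℂ (P.jostFun 0 l)

theorem S_eq (h : P.Admissible) {l : ℝ} (hl : l ≠ 0) : P.S l = P.jostEConj l / P.jostE l := by
  have hl0 : (l : ℂ) ≠ 0 := Complex.ofReal_ne_zero.2 hl
  have him : 0 ≤ (l : ℂ).im := by simp
  rw [S, E_eq h hl0 him, jostEConj, (jost_eq h hl0 him le_rfl).1, (jost_eq h hl0 him le_rfl).2]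

theorem jostEConj_eq_wronskian (h : P.Admissible) {l : ℝ} (hl : l ≠ 0) {x : ℝ} (hx : 0 ≤ x) :
    P.jostEConj l = P.omega l x * starRingEnd ℂ (P.jostFunDeriv x l) -
      P.omegaDeriv l x * starRingEnd ℂ (P.jostFun x l) := by
  have hc := (isSol_jostFun h (Complex.ofReal_ne_zero.2 hl) (by simp)).conj
  rw [Complex.conj_ofReal] at hc
  rw [(isSol_omega h l).wronskian_eq hc hx, omega_zero h, omegaDeriv_zero h, jostEConj]
  ring

/-- Divided by `E` this reads `conj e - S e = 2 i l ω / E`: the jump is the boundary value of a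
function meromorphic in the upper half plane. -/
theorem jostE_mul_conj_sub (h : P.Admissible) {l : ℝ} (hl : l ≠ 0) {x : ℝ} (hx : 0 ≤ x) :
    P.jostE l * starRingEnd ℂ (P.jostFun x l) - P.jostEConj l * P.jostFun x l =
      2 * Complex.I * l * P.omega l x := by
  rw [jostE_eq_wronskian h (Complex.ofReal_ne_zero.2 hl) (by simp) hx,
    jostEConj_eq_wronskian h hl hx]
  linear_combination -P.omega l x * wronskian_jostFun_conj h hl hx

/-- The difference of the squared moduli is `4 l` times the boundary form, which is nonnegative; so
`S` is in general only a contraction, not unimodular. -/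
theorem norm_jostEConj_le (h : P.Admissible) (hδ1 : P.delta1 ≤ 0) (hδ3 : 0 ≤ P.delta3) {l : ℝ}
    (hl : l ≠ 0) : ‖P.jostEConj l‖ ≤ ‖P.jostE l‖ := by
  have h1 := wronskian_jostFun_conj h hl le_rfl
  have h2 := im_coeffA_mul_conj_coeffB (P := P) l
  rw [← Complex.normSq_eq_norm_sq] at h2
  have h3 : 0 ≤ l * (P.coeffA l * starRingEnd ℂ (P.coeffB l)).im := by
    rw [h2, Complex.normSq_ofReal, Complex.ofReal_re, Complex.ofReal_im]
    have h4 : 0 ≤ -P.delta1 - 2 * P.delta2 * 0 + P.delta3 * (l * l) := by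
      have := mul_nonneg hδ3 (mul_self_nonneg l)
      linarith
    nlinarith [mul_nonneg (mul_self_nonneg l) h4]
  have h5 : ‖P.jostE l‖ ^ 2 - ‖P.jostEConj l‖ ^ 2 =
      4 * (l * (P.coeffA l * starRingEnd ℂ (P.coeffB l)).im) := by
    rw [← Complex.normSq_eq_norm_sq, ← Complex.normSq_eq_norm_sq, jostE, jostEConj]
    generalize P.jostFun 0 l = e at *
    generalize P.jostFunDeriv 0 l = d at *
    generalize P.coeffA l = A at *
    generalize P.coeffB l = B at *
    have r1 := congrArg Complex.re h1
    have r2 := congrArg Complex.im h1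
    simp only [Complex.sub_re, Complex.sub_im, Complex.mul_re, Complex.mul_im, Complex.conj_re,
      Complex.conj_im, Complex.neg_re, Complex.neg_im, Complex.I_re, Complex.I_im,
      Complex.ofReal_re, Complex.ofReal_im, Complex.re_ofNat, Complex.im_ofNat] at r1 r2
    simp only [Complex.normSq_apply, Complex.add_re, Complex.add_im, Complex.mul_re,
      Complex.mul_im, Complex.conj_re, Complex.conj_im]
    linear_combination (-2 * (B.im * A.re - B.re * A.im)) * (-r2)
  refine le_of_sq_le_sq ?_ (norm_nonneg _)
  linarith

theorem norm_S_le (h : P.Admissible) (hδ1 : P.delta1 ≤ 0) (hδ3 : 0 ≤ P.delta3) {l : ℝ}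
    (hl : l ≠ 0) : ‖P.S l‖ ≤ 1 := by
  rw [S_eq h hl, norm_div]
  exact div_le_one_of_le₀ (norm_jostEConj_le h hδ1 hδ3 hl) (norm_nonneg _)

/-- The numerator of `S` vanishes along with `E`, and then `omega` vanishes identically. -/
theorem jostE_ofReal_eq_zero (h : P.Admissible) (hδ1 : P.delta1 ≤ 0) (hδ3 : 0 ≤ P.delta3) {l : ℝ}
    (hl : l ≠ 0) (hE : P.jostE l = 0) : P.coeffA l = 0 ∧ P.coeffB l = 0 := by
  have h1 : P.jostEConj l = 0 := by
    have := norm_jostEConj_le h hδ1 hδ3 hl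
    rw [hE, norm_zero] at this
    exact norm_le_zero_iff.1 this
  have h2 : ∀ x, 0 ≤ x → P.omega l x = 0 := fun x hx => by
    have := jostE_mul_conj_sub h hl hx
    rw [hE, h1, zero_mul, zero_mul, sub_zero, eq_comm] at this
    have hl0 : (l : ℂ) ≠ 0 := Complex.ofReal_ne_zero.2 hl
    simpa [hl0] using this
  have h3 := (isSol_omega h l).deriv_eq_zero h2
  have h4 := h2 0 le_rfl
  rw [omega_zero h] at h4
  rw [omegaDeriv_zero h, neg_eq_zero] at h3
  exact ⟨h3, h4⟩

/-- The real zeros of an entire function that is not identically zero are isolated, hence countable.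
-/
theorem ae_ofReal_ne_zero_of_differentiable {f : ℂ → ℂ} (hf : Differentiable ℂ f) {w : ℂ}
    (hw : f w ≠ 0) : ∀ᵐ l : ℝ, f l ≠ 0 := by
  have h1 : AnalyticOnNhd ℂ f univ := fun z _ => hf.analyticAt z
  have h2 : ∀ l : ℝ, ∀ᶠ k : ℝ in 𝓝[≠] l, f (k : ℂ) ≠ 0 := by
    intro l
    by_contra hcon
    have h3 : ∃ᶠ k : ℝ in 𝓝[≠] l, f (k : ℂ) = 0 := by
      refine (not_eventually.1 hcon).mono fun k hk => not_not.1 hk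
    have h4 : Tendsto (fun k : ℝ => (k : ℂ)) (𝓝[≠] l) (𝓝[≠] (l : ℂ)) := by
      refine tendsto_nhdsWithin_iff.2 ⟨?_, ?_⟩
      · exact (Complex.continuous_ofReal.tendsto l).mono_left nhdsWithin_le_nhds
      · filter_upwards [self_mem_nhdsWithin] with k hk
        simpa using hk
    exact hw (h1.eqOn_zero_of_preconnected_of_frequently_eq_zero isPreconnected_univ (mem_univ _)
      (h4.frequently h3) (mem_univ w))
  have h6 : {l : ℝ | f l = 0}.Countable := by
    have h7 : IsClosed {l : ℝ | f l = 0} :=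
      isClosed_eq (hf.continuous.comp Complex.continuous_ofReal) continuous_const
    have h8 : DiscreteTopology {l : ℝ | f l = 0} := by
      rw [discreteTopology_subtype_iff]
      intro l hl
      rw [← disjoint_iff, disjoint_principal_right]
      exact h2 l
    exact (Set.countable_coe_iff).1 (TopologicalSpace.separableSpace_iff_countable.1 inferInstance)
  filter_upwards [h6.ae_notMem volume] with l hl using hl

theorem ae_jostE_ne_zero (h : P.Admissible) (hδ1 : P.delta1 ≤ 0) (hδ3 : 0 ≤ P.delta3)
    (hAB : ∀ z : ℂ, 0 < z.im → ¬ (P.coeffA z = 0 ∧ P.coeffB z = 0)) :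
    ∀ᵐ l : ℝ, l ≠ 0 ∧ P.jostE l ≠ 0 := by
  have h0 : ∀ᵐ l : ℝ, l ≠ 0 := by simp [ae_iff]
  have h1 : ∀ᵐ l : ℝ, ¬ (P.coeffA l = 0 ∧ P.coeffB l = 0) := by
    have h2 := hAB Complex.I (by simp)
    rw [not_and_or] at h2
    rcases h2 with h2 | h2
    · filter_upwards [ae_ofReal_ne_zero_of_differentiable differentiable_coeffA h2] with l hl h3
      exact hl h3.1
    · filter_upwards [ae_ofReal_ne_zero_of_differentiable differentiable_coeffB h2] with l hl h3
      exact hl h3.2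
  filter_upwards [h0, h1] with l hl hl1
  exact ⟨hl, fun hE => hl1 (jostE_ofReal_eq_zero h hδ1 hδ3 hl hE)⟩

theorem aestronglyMeasurable_of_continuousOn_compl {f : ℝ → ℂ} (hf : ContinuousOn f {0}ᶜ) :
    AEStronglyMeasurable f := by
  have := hf.aestronglyMeasurable (μ := volume) (measurableSet_singleton (0 : ℝ)).compl
  rwa [Measure.restrict_eq_self_of_ae_mem (by simp [ae_iff])] at this

theorem continuousOn_ofReal_of_continuousOn {f : ℂ → ℂ} (hf : ContinuousOn f {z | z ≠ 0 ∧ 0 ≤ z.im}) :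
    ContinuousOn (fun l : ℝ => f l) {0}ᶜ :=
  hf.comp Complex.continuous_ofReal.continuousOn fun l hl =>
    ⟨Complex.ofReal_ne_zero.2 hl, by simp⟩

theorem aestronglyMeasurable_S (h : P.Admissible) : AEStronglyMeasurable P.S := by
  have c1 := continuousOn_ofReal_of_continuousOn (continuousOn_jostE h)
  have c2 := continuousOn_ofReal_of_continuousOn (continuousOn_jostFunDeriv h le_rfl)
  have c3 := continuousOn_ofReal_of_continuousOn
    ((continuousOn_jostFun h le_rfl).mono fun z (hz : z ≠ 0 ∧ 0 ≤ z.im) => hz.2)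
  have c4 : ContinuousOn P.jostEConj {0}ᶜ :=
    ((differentiable_coeffB.continuous.comp Complex.continuous_ofReal).continuousOn.mul
      (Complex.continuous_conj.comp_continuousOn c2)).add
    ((differentiable_coeffA.continuous.comp Complex.continuous_ofReal).continuousOn.mul
      (Complex.continuous_conj.comp_continuousOn c3))
  have h1 := ((aestronglyMeasurable_of_continuousOn_compl c4).aemeasurable.div
    (aestronglyMeasurable_of_continuousOn_compl c1).aemeasurable).aestronglyMeasurable
  refine h1.congr ?_
  have h0 : ∀ᵐ l : ℝ, l ≠ 0 := by simp [ae_iff]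
  filter_upwards [h0] with l hl
  exact (S_eq h hl).symm

theorem ae_norm_S_le (h : P.Admissible) (hδ1 : P.delta1 ≤ 0) (hδ3 : 0 ≤ P.delta3) :
    ∀ᵐ l : ℝ, ‖P.S l‖ ≤ 1 := by
  have h0 : ∀ᵐ l : ℝ, l ≠ 0 := by simp [ae_iff]
  filter_upwards [h0] with l hl using norm_S_le h hδ1 hδ3 hl

/-- If `ω(x)` vanishes at `z = 1 + i`, Green's identity on `(0, x)` is a sum of terms of one sign
equal to zero, so `ω` vanishes on `[0, x]` and `A = B = 0` there. At `x = 0` nothing of the kind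
holds, because `omega` equals `B`, which may be identically zero. -/
theorem exists_omega_ne_zero (h : P.Admissible) (hδ1 : P.delta1 ≤ 0) (hδ2 : P.delta2 ≤ 0)
    (hδ3 : 0 ≤ P.delta3) (hAB : ∀ z : ℂ, 0 < z.im → ¬ (P.coeffA z = 0 ∧ P.coeffB z = 0)) {x : ℝ}
    (hx : 0 < x) : P.omega (1 + Complex.I) x ≠ 0 := by
  intro h0
  set z : ℂ := 1 + Complex.I with hz
  have hre : z.re = 1 := by simp [hz]
  have him : z.im = 1 := by simp [hz]
  have hs := isSol_omega h z
  have h1 := im_omegaDeriv_mul_conj h z hx.le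
  rw [h0, map_zero, mul_zero, Complex.zero_im, hre, him] at h1
  set J := ∫ t in (0 : ℝ)..x, P.rho t * ‖P.omega z t‖ ^ 2 with hJ
  have hD0 : 0 ≤ -P.delta1 - 2 * P.delta2 * 1 + P.delta3 * ‖z‖ ^ 2 := by
    have := mul_nonneg hδ3 (sq_nonneg ‖z‖)
    linarith
  have hcont : ContinuousOn (P.omega z) (Icc 0 x) := hs.1.continuousOn.mono Icc_subset_Ici_self
  have hJle : P.rhoMin * ∫ t in (0 : ℝ)..x, ‖P.omega z t‖ ^ 2 ≤ J := by
    rw [hJ, ← intervalIntegral.integral_const_mul]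
    have hi : IntervalIntegrable (fun t => ‖P.omega z t‖ ^ 2) volume 0 x := by
      refine ContinuousOn.intervalIntegrable ?_
      rw [uIcc_of_le hx.le]
      exact hcont.norm.pow 2
    refine intervalIntegral.integral_mono_on hx.le (hi.const_mul _) ?_ fun t _ => by
      have := rhoMin_le (P := P) t
      gcongr
    refine (hi.const_mul (P.α ^ 2 + 1)).mono_fun ?_ (Eventually.of_forall fun t => ?_)
    · exact measurable_rho.aestronglyMeasurable.mul (intervalIntegrable_iff.1 hi).aestronglyMeasurable
    · simp only
      rw [norm_mul, norm_mul, Real.norm_of_nonneg (rho_nonneg t),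
        Real.norm_of_nonneg (by positivity : 0 ≤ P.α ^ 2 + 1)]
      gcongr
      exact rho_le t
  have hzero : ∫ t in (0 : ℝ)..x, ‖P.omega z t‖ ^ 2 = 0 := by
    have h2 : 0 ≤ ∫ t in (0 : ℝ)..x, ‖P.omega z t‖ ^ 2 :=
      intervalIntegral.integral_nonneg hx.le fun t _ => by positivity
    have h3 := rhoMin_pos h
    nlinarith
  have hval : ∀ t ∈ Icc 0 x, P.omega z t = 0 := by
    by_contra hcon
    push Not at hcon
    obtain ⟨t, ht, hne⟩ := hcon
    have := intervalIntegral.integral_pos hx (hcont.norm.pow 2) (fun t _ => sq_nonneg _)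
      ⟨t, ht, pow_pos (norm_pos_iff.2 hne) 2⟩
    exact this.ne' hzero
  have h4 : P.omegaDeriv z 0 = 0 := by
    have h5 := (hs.1.hasDerivWithinAt hs.2.continuousOn le_rfl).mono
      (Icc_subset_Ici_self : Icc 0 x ⊆ Ici 0)
    have h6 : HasDerivWithinAt (P.omega z) 0 (Icc 0 x) 0 :=
      (hasDerivWithinAt_const (0 : ℝ) (Icc 0 x) (0 : ℂ)).congr hval (hval 0 ⟨le_rfl, hx.le⟩)
    exact (uniqueDiffOn_Icc hx 0 ⟨le_rfl, hx.le⟩).eq_deriv _ h5 h6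
  have h7 := hval 0 ⟨le_rfl, hx.le⟩
  rw [omega_zero h] at h7
  rw [omegaDeriv_zero h, neg_eq_zero] at h4
  exact hAB z (by rw [him]; exact one_pos) ⟨h4, h7⟩

theorem abs_tau_lt (h : P.Admissible) : |P.tau| < 1 := by
  have := h.α_pos
  rw [tau, abs_div, abs_of_pos (by linarith : 0 < P.α + 1), div_lt_one (by linarith), abs_lt]
  constructor <;> linarith

theorem norm_exp_neg_two (l b : ℝ) : ‖Complex.exp (-2 * Complex.I * l * b)‖ = 1 := by
  rw [Complex.norm_exp]; simp

theorem norm_exp_neg_two' (l b c : ℝ) : ‖Complex.exp (-2 * Complex.I * l * b * c)‖ = 1 := by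
  have := norm_exp_neg_two l (b * c)
  push_cast at this
  rwa [← mul_assoc] at this

theorem le_norm_add_tau {w : ℂ} (hw : ‖w‖ = 1) :
    1 - |P.tau| ≤ ‖w + P.tau‖ ∧ 1 - |P.tau| ≤ ‖w - P.tau‖ := by
  constructor
  · have := norm_sub_norm_le w (-(P.tau : ℂ))
    rwa [norm_neg, sub_neg_eq_add, hw, Complex.norm_real, Real.norm_eq_abs] at this
  · have := norm_sub_norm_le w (P.tau : ℂ)
    rwa [hw, Complex.norm_real, Real.norm_eq_abs] at this

theorem norm_S0_le (h : P.Admissible) (l : ℝ) : ‖P.S0 l‖ ≤ 2 / (1 - |P.tau|) := by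
  have hτ := abs_tau_lt h
  have hw := norm_exp_neg_two' l P.α P.a
  obtain ⟨h1, h2⟩ := le_norm_add_tau (P := P) hw
  have hτ' : 0 < 1 - |P.tau| := by linarith
  have h3 : ∀ s : ℂ, ‖s‖ = |P.tau| * 1 → ‖1 + s‖ ≤ 2 := fun s hs => by
    refine (norm_add_le _ _).trans ?_
    rw [hs, norm_one]
    linarith
  have h4 : ‖(P.tau : ℂ) * Complex.exp (-2 * Complex.I * l * P.α * P.a)‖ = |P.tau| * 1 := by
    rw [norm_mul, hw, Complex.norm_real, Real.norm_eq_abs]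
  have h5 := h3 _ h4
  have h6 := h3 (-((P.tau : ℂ) * Complex.exp (-2 * Complex.I * l * P.α * P.a))) (by rw [norm_neg, h4])
  rw [← sub_eq_add_neg] at h6
  rw [S0]
  split_ifs
  · rw [norm_mul, norm_exp_neg_two, one_mul, norm_div]
    gcongr
  · rw [norm_mul, norm_neg, norm_exp_neg_two, one_mul, norm_div]
    gcongr

theorem continuous_S0 (h : P.Admissible) : Continuous P.S0 := by
  have hτ : 0 < 1 - |P.tau| := by linarith [abs_tau_lt h]
  have hne : ∀ l : ℝ, Complex.exp (-2 * Complex.I * l * P.α * P.a) + P.tau ≠ 0 ∧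
      Complex.exp (-2 * Complex.I * l * P.α * P.a) - P.tau ≠ 0 := fun l => by
    obtain ⟨h1, h2⟩ := le_norm_add_tau (P := P) (norm_exp_neg_two' l P.α P.a)
    exact ⟨norm_pos_iff.1 (hτ.trans_le h1), norm_pos_iff.1 (hτ.trans_le h2)⟩
  unfold S0
  split_ifs
  · exact (by fun_prop : Continuous fun l : ℝ => Complex.exp (-2 * Complex.I * l * P.a)).mul
      (Continuous.div (by fun_prop) (by fun_prop) fun l => (hne l).1)
  · exact (by fun_prop : Continuous fun l : ℝ => -Complex.exp (-2 * Complex.I * l * P.a)).mul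
      (Continuous.div (by fun_prop) (by fun_prop) fun l => (hne l).2)

end ScatteringProblem

/-! ### The jump relation and the contribution of the eigenvalues -/

/-- A meromorphic function with at most a simple pole, times a function vanishing there, has a
limit. -/
theorem MeromorphicAt.exists_tendsto_mul {f g : ℂ → ℂ} {w : ℂ} (hf : MeromorphicAt f w) {M : ℝ}
    (hb : ∀ᶠ t : ℝ in 𝓝[>] 0, ‖(t : ℂ) * f (w + t)‖ ≤ M) (hg : DifferentiableAt ℂ g w)
    (hg0 : g w = 0) : ∃ c, Tendsto (fun z => f z * g z) (𝓝[≠] w) (𝓝 c) := by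
  have hφ : MeromorphicAt (fun z => (z - w) * f z) w := by fun_prop
  -- A pole of `(z - w) f` would make it unbounded along every approach to `w`, in particular along
  -- the horizontal ray of `hb`.
  have hord : 0 ≤ meromorphicOrderAt (fun z => (z - w) * f z) w := by
    by_contra hcon
    have h1 := tendsto_cobounded_of_meromorphicOrderAt_neg (not_le.1 hcon)
    have h2 : Tendsto (fun t : ℝ => w + (t : ℂ)) (𝓝[>] 0) (𝓝[≠] w) := by
      refine tendsto_nhdsWithin_iff.2 ⟨?_, ?_⟩
      · have : Tendsto (fun t : ℝ => w + (t : ℂ)) (𝓝 0) (𝓝 (w + ((0 : ℝ) : ℂ))) :=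
          (by fun_prop : Continuous fun t : ℝ => w + (t : ℂ)).tendsto 0
        rw [Complex.ofReal_zero, add_zero] at this
        exact this.mono_left nhdsWithin_le_nhds
      · filter_upwards [self_mem_nhdsWithin] with t ht
        have : (t : ℂ) ≠ 0 := Complex.ofReal_ne_zero.2 (ne_of_gt ht)
        simpa using this
    have h3 := (tendsto_norm_cobounded_atTop.comp (h1.comp h2)).eventually_gt_atTop M
    obtain ⟨t, ht1, ht2⟩ := (hb.and h3).exists
    simp only [Function.comp_apply, add_sub_cancel_left] at ht2
    linarith
  obtain ⟨c, hc⟩ := tendsto_nhds_of_meromorphicOrderAt_nonneg hφ hord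
  refine ⟨c * deriv g w, (hc.mul (hasDerivAt_iff_tendsto_slope.1 hg.hasDerivAt)).congr' ?_⟩
  filter_upwards [self_mem_nhdsWithin] with z hz
  have : z - w ≠ 0 := sub_ne_zero.2 hz
  rw [slope_def_field, hg0]
  field_simp
  ring

/-- Functions on the closed upper half plane of exponential type and quadratic decay. -/
def hardyClass (m : ℝ) : Submodule ℂ (ℂ → ℂ) where
  carrier := {Ψ | DifferentiableOn ℂ Ψ {z | 0 < z.im} ∧ ContinuousOn Ψ {z | 0 ≤ z.im} ∧
    ∃ C, ∀ z : ℂ, 0 ≤ z.im → ‖Ψ z‖ ≤ C * Real.exp (-(z.im * m)) / (1 + ‖z‖ ^ 2)}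
  add_mem' := by
    rintro f g ⟨f1, f2, C, hC⟩ ⟨g1, g2, D, hD⟩
    refine ⟨f1.add g1, f2.add g2, C + D, fun z hz => ?_⟩
    refine (norm_add_le _ _).trans ((add_le_add (hC z hz) (hD z hz)).trans_eq ?_)
    ring
  zero_mem' := ⟨differentiableOn_const 0, continuousOn_const, 0, fun z hz => by simp⟩
  smul_mem' := by
    rintro c f ⟨f1, f2, C, hC⟩
    refine ⟨f1.const_smul c, f2.const_smul c, ‖c‖ * C, fun z hz => ?_⟩
    rw [Pi.smul_apply, smul_eq_mul, norm_mul]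
    refine (mul_le_mul_of_nonneg_left (hC z hz) (norm_nonneg c)).trans_eq ?_
    ring

theorem norm_ofReal_le_of_mem_hardyClass {m : ℝ} {Ψ : ℂ → ℂ} (hΨ : Ψ ∈ hardyClass m) :
    Continuous (fun l : ℝ => Ψ l) ∧ ∃ C, ∀ l : ℝ, ‖Ψ l‖ ≤ C * (1 + l ^ 2)⁻¹ := by
  obtain ⟨h1, h2, C, hC⟩ := hΨ
  refine ⟨h2.comp_continuous Complex.continuous_ofReal fun l => by simp, C, fun l => ?_⟩
  have := hC l (by simp)
  simpa [div_eq_mul_inv] using this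

theorem integrable_ofReal_of_mem_hardyClass {m : ℝ} {Ψ : ℂ → ℂ} (hΨ : Ψ ∈ hardyClass m) :
    Integrable fun l : ℝ => Ψ l := by
  obtain ⟨h1, C, hC⟩ := norm_ofReal_le_of_mem_hardyClass hΨ
  exact (integrable_inv_one_add_sq.const_mul C).mono' h1.aestronglyMeasurable
    (Eventually.of_forall hC)

namespace ScatteringProblem

variable {P : ScatteringProblem}

theorem finite_zeros_jostE (h : P.Admissible) (hδ1 : P.delta1 ≤ 0) (hδ2 : P.delta2 ≤ 0)
    (hδ3 : 0 ≤ P.delta3) (hAB : ∀ z : ℂ, 0 < z.im → ¬ (P.coeffA z = 0 ∧ P.coeffB z = 0)) :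
    {z : ℂ | 0 < z.im ∧ P.jostE z = 0}.Finite ∧
      ∀ z : ℂ, 0 < z.im → P.jostE z = 0 → ∃ k ∈ P.eigenSet, z = Complex.I * k := by
  have key : ∀ z : ℂ, 0 < z.im → P.jostE z = 0 → ∃ k ∈ P.eigenSet, z = Complex.I * k := by
    intro z hz hE
    have hre : z.re = 0 := by
      by_contra hre
      exact jostE_ne_zero h hδ1 hδ2 hδ3 hAB hz hre hE
    have hzk : z = Complex.I * (z.im : ℂ) := by
      apply Complex.ext <;> simp [hre]
    refine ⟨z.im, ⟨hz, ?_⟩, hzk⟩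
    rw [← hzk, E_eq h (ne_zero_of_im_pos hz) hz.le, hE]
  refine ⟨((finite_eigenSet h hδ1 hδ2 hδ3 hAB).image fun k : ℝ => Complex.I * (k : ℂ)).subset ?_, key⟩
  rintro z ⟨hz, hE⟩
  obtain ⟨k, hk, rfl⟩ := key z hz hE
  exact ⟨k, hk, rfl⟩

/-- The jump of the Jost solution across the real line pairs to zero with functions vanishing at
the eigenvalues. -/
theorem integral_jump_eq_zero (h : P.Admissible) (hδ1 : P.delta1 ≤ 0) (hδ2 : P.delta2 ≤ 0)
    (hδ3 : 0 ≤ P.delta3) (hAB : ∀ z : ℂ, 0 < z.im → ¬ (P.coeffA z = 0 ∧ P.coeffB z = 0)) {x : ℝ}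
    (hx : 0 ≤ x) {Ψ : ℂ → ℂ} (hΨ : Ψ ∈ hardyClass (P.muPlus x))
    (h0 : ∀ k ∈ P.eigenSet, Ψ (Complex.I * k) = 0) :
    ∫ l : ℝ, (starRingEnd ℂ (P.jostFun x l) - P.S l * P.jostFun x l) * Ψ l = 0 := by
  obtain ⟨Ψd, Ψc, D, hD⟩ := hΨ
  obtain ⟨C, hC, hb⟩ := exists_norm_omega_le h hδ1 hδ2 hδ3
  obtain ⟨hTfin, hT⟩ := finite_zeros_jostE h hδ1 hδ2 hδ3 hAB
  set T := {z : ℂ | 0 < z.im ∧ P.jostE z = 0} with hTdef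
  have hEd := differentiableOn_jostE h
  have hωd := differentiable_omega h hx
  -- By `jostE_mul_conj_sub` the boundary values of `f` are those of `(conj e - S e) / (2i)`.
  set f : ℂ → ℂ := fun z => z * P.omega z x / P.jostE z with hf
  -- At the zeros of `jostE` the function `f` has at most simple poles, which the zeros of `Ψ`
  -- cancel; `limUnder` fills in the missing values.
  set H : ℂ → ℂ := fun z => open Classical in
    if z ∈ T then limUnder (𝓝[≠] z) (fun z => f z * Ψ z) else f z * Ψ z with hH
  have hTne : ∀ z, ∀ᶠ y in 𝓝[≠] z, y ∉ T := fun z => by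
    have : IsClosed (T \ {z}) := (hTfin.subset sdiff_subset).isClosed
    have h1 : (T \ {z})ᶜ ∈ 𝓝 z := this.isOpen_compl.mem_nhds (by simp)
    filter_upwards [mem_nhdsWithin_of_mem_nhds h1, self_mem_nhdsWithin] with y hy hyz hyT
    exact hy ⟨hyT, hyz⟩
  have hfd : ∀ z : ℂ, 0 < z.im → z ∉ T → DifferentiableAt ℂ (fun z => f z * Ψ z) z := by
    intro z hz hzT
    have h1 := hEd.differentiableAt (isOpen_upperHalf.mem_nhds hz)
    have h2 := Ψd.differentiableAt (isOpen_upperHalf.mem_nhds hz)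
    have h3 : P.jostE z ≠ 0 := fun h3 => hzT ⟨hz, h3⟩
    exact ((differentiableAt_id.mul (hωd z)).div h1 h3).mul h2
  have hHd : DifferentiableOn ℂ H {z | 0 < z.im} := by
    intro z hz
    have hz : 0 < z.im := hz
    refine DifferentiableAt.differentiableWithinAt ?_
    have hpun : ∀ᶠ y in 𝓝[≠] z, DifferentiableAt ℂ H y := by
      filter_upwards [hTne z, mem_nhdsWithin_of_mem_nhds (isOpen_upperHalf.mem_nhds hz)] with y hy hyim
      refine (hfd y hyim hy).congr_of_eventuallyEq ?_
      filter_upwards [hTfin.isClosed.isOpen_compl.mem_nhds hy] with w hw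
      simp only [hH]
      rw [if_neg hw]
    by_cases hzT : z ∈ T
    · refine (Complex.analyticAt_of_differentiable_on_punctured_nhds_of_continuousAt hpun
        ?_).differentiableAt
      obtain ⟨k, hk, hzk⟩ := hT z hz hzT.2
      have hmer : MeromorphicAt f z := by
        have h1 : AnalyticAt ℂ P.jostE z := hEd.analyticAt (isOpen_upperHalf.mem_nhds hz)
        have h2 : AnalyticAt ℂ (fun z => P.omega z x) z := hωd.analyticAt z
        exact (MeromorphicAt.id z |>.mul h2.meromorphicAt).div h1.meromorphicAt
      have hbd : ∀ᶠ t : ℝ in 𝓝[>] 0, ‖(t : ℂ) * f (z + t)‖ ≤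
          (‖z‖ + 1) * C * Real.exp (z.im * P.muPlus x) := by
        filter_upwards [Ioo_mem_nhdsGT (zero_lt_one' ℝ)] with t ht
        have e1 : (z + t).im = z.im := by simp
        have e2 : (z + t).re = t := by rw [hzk]; simp
        have h1 := hb (z + t) (by rw [e1]; exact hz) x hx
        rw [e1, e2, abs_of_pos ht.1] at h1
        have h2 : 0 < ‖P.jostE (z + t)‖ := norm_pos_iff.2
          (jostE_ne_zero h hδ1 hδ2 hδ3 hAB (by rw [e1]; exact hz) (by rw [e2]; exact ht.1.ne'))
        have h3 : ‖z + t‖ ≤ ‖z‖ + 1 := by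
          refine (norm_add_le _ _).trans ?_
          rw [Complex.norm_real, Real.norm_of_nonneg ht.1.le]
          linarith [ht.2]
        rw [hf]
        simp only
        rw [norm_mul, norm_div, norm_mul, Complex.norm_real, Real.norm_of_nonneg ht.1.le]
        calc _ = ‖z + t‖ * (t * ‖P.omega (z + t) x‖) / ‖P.jostE (z + t)‖ := by ring
          _ ≤ (‖z‖ + 1) * (C * ‖P.jostE (z + t)‖ * Real.exp (z.im * P.muPlus x)) /
              ‖P.jostE (z + t)‖ := by
              have := ht.1
              gcongr
          _ = _ := by field_simp
      obtain ⟨c, hc⟩ := hmer.exists_tendsto_mul hbd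
        (Ψd.differentiableAt (isOpen_upperHalf.mem_nhds hz)) (by rw [hzk]; exact h0 k hk)
      have hHz : H z = c := by
        simp only [hH]
        rw [if_pos hzT]
        exact hc.limUnder_eq
      rw [continuousAt_iff_punctured_nhds, hHz]
      refine hc.congr' ?_
      filter_upwards [hTne z] with y hy
      simp only [hH]
      rw [if_neg hy]
    · refine (hfd z hz hzT).congr_of_eventuallyEq ?_
      filter_upwards [hTfin.isClosed.isOpen_compl.mem_nhds hzT] with w hw
      simp only [hH]
      rw [if_neg hw]
  have hHeq : ∀ z : ℂ, 0 < z.im → z.re ≠ 0 → H z = f z * Ψ z := fun z hz hre => by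
    simp only [hH]
    rw [if_neg fun hzT => jostE_ne_zero h hδ1 hδ2 hδ3 hAB hz hre hzT.2]
  have hHb : ∀ z : ℂ, 0 < z.im → z.re ≠ 0 → ‖H z‖ ≤ (C * D) * (‖z‖ / |z.re|) / (1 + ‖z‖ ^ 2) := by
    intro z hz hre
    have h1 := hb z hz x hx
    have h2 := hD z hz.le
    have h3 : 0 < |z.re| := abs_pos.2 hre
    have h4 : 0 < ‖P.jostE z‖ := norm_pos_iff.2 (jostE_ne_zero h hδ1 hδ2 hδ3 hAB hz hre)
    rw [hHeq z hz hre, hf]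
    simp only
    rw [norm_mul, norm_div, norm_mul]
    calc ‖z‖ * ‖P.omega z x‖ / ‖P.jostE z‖ * ‖Ψ z‖ =
          ‖z‖ / |z.re| * (|z.re| * ‖P.omega z x‖) / ‖P.jostE z‖ * ‖Ψ z‖ := by field_simp
      _ ≤ ‖z‖ / |z.re| * (C * ‖P.jostE z‖ * Real.exp (z.im * P.muPlus x)) / ‖P.jostE z‖ *
          (D * Real.exp (-(z.im * P.muPlus x)) / (1 + ‖z‖ ^ 2)) := by gcongr
      _ = C * D * (‖z‖ / |z.re|) / (1 + ‖z‖ ^ 2) * (Real.exp (z.im * P.muPlus x) *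
          Real.exp (-(z.im * P.muPlus x))) := by field_simp
      _ = _ := by rw [← Real.exp_add, add_neg_cancel, Real.exp_zero, mul_one]
  have hae := ae_jostE_ne_zero h hδ1 hδ3 hAB
  have hlim : ∀ᵐ l : ℝ, Tendsto (fun ε : ℝ => H (l + ε * Complex.I)) (𝓝[>] 0)
      (𝓝 (f l * Ψ l)) := by
    filter_upwards [hae] with l hl
    have hl0 : (l : ℂ) ≠ 0 := Complex.ofReal_ne_zero.2 hl.1
    have h1 : Tendsto (fun ε : ℝ => (l : ℂ) + ε * Complex.I) (𝓝[>] 0)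
        (𝓝[{z | z ≠ 0 ∧ 0 ≤ z.im}] (l : ℂ)) := by
      refine tendsto_nhdsWithin_iff.2 ⟨?_, ?_⟩
      · have : Tendsto (fun ε : ℝ => (l : ℂ) + ε * Complex.I) (𝓝 0)
            (𝓝 ((l : ℂ) + ((0 : ℝ) : ℂ) * Complex.I)) :=
          (by fun_prop : Continuous fun ε : ℝ => (l : ℂ) + ε * Complex.I).tendsto 0
        rw [Complex.ofReal_zero, zero_mul, add_zero] at this
        exact this.mono_left nhdsWithin_le_nhds
      · filter_upwards [self_mem_nhdsWithin] with ε hε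
        have hε : 0 < ε := hε
        exact ⟨ne_zero_of_im_pos (by simpa using hε), by simpa using hε.le⟩
    have c1 := (continuousOn_jostE h) l ⟨hl0, by simp⟩
    have c2 := (Ψc l (by simp)).mono (fun z (hz : z ≠ 0 ∧ 0 ≤ z.im) => hz.2)
    have c3 : ContinuousWithinAt (fun z => f z * Ψ z) {z | z ≠ 0 ∧ 0 ≤ z.im} l :=
      ((continuousWithinAt_id.mul hωd.continuous.continuousWithinAt).div c1 hl.2).mul c2
    refine (Tendsto.comp c3 h1).congr' ?_
    filter_upwards [self_mem_nhdsWithin] with ε hε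
    have hε : 0 < ε := hε
    exact (hHeq _ (by simpa using hε) (by simpa using hl.1)).symm
  -- The factor `‖z‖ / |Re z|` in the bound of `H` is removed by the maximum principle before
  -- Cauchy's theorem is applied.
  have h1 := integral_boundary_eq_zero hHd (fun z hz => norm_le_of_norm_le_div_re hHd hHb hz) hlim
  have h2 : (fun l : ℝ => (starRingEnd ℂ (P.jostFun x l) - P.S l * P.jostFun x l) * Ψ l) =ᵐ[volume]
      fun l : ℝ => (2 * Complex.I) * (f l * Ψ l) := by
    filter_upwards [hae] with l hl
    rw [S_eq h hl.1, hf]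
    have h3 := jostE_mul_conj_sub h hl.1 hx
    have h4 := hl.2
    field_simp
    linear_combination Ψ l * h3
  rw [integral_congr_ae h2, integral_const_mul, h1, mul_zero]

theorem jump_bound (h : P.Admissible) (hδ1 : P.delta1 ≤ 0) (hδ3 : 0 ≤ P.delta3) {x : ℝ}
    (hx : 0 ≤ x) : AEStronglyMeasurable
      (fun l : ℝ => starRingEnd ℂ (P.jostFun x l) - P.S l * P.jostFun x l) ∧
    ∀ᵐ l : ℝ, ‖starRingEnd ℂ (P.jostFun x l) - P.S l * P.jostFun x l‖ ≤ 2 * P.jostConst := by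
  have hc : Continuous fun l : ℝ => P.jostFun x l :=
    (continuousOn_jostFun h hx).comp_continuous Complex.continuous_ofReal fun l => by simp
  refine ⟨(Complex.continuous_conj.comp hc).aestronglyMeasurable.sub
    ((aestronglyMeasurable_S h).mul hc.aestronglyMeasurable), ?_⟩
  filter_upwards [ae_norm_S_le h hδ1 hδ3] with l hl
  have h1 := norm_jostFun_le h hx (z := l) (by simp)
  simp only [Complex.ofReal_im, zero_mul, neg_zero, Real.exp_zero, mul_one] at h1
  refine (norm_sub_le _ _).trans ?_
  rw [RCLike.norm_conj, norm_mul]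
  have := norm_nonneg (P.jostFun x l)
  nlinarith

/-- A functional that vanishes on the common kernel of finitely many evaluations is a linear
combination of them. The coefficients, which would be residues, never have to be computed. -/
theorem exists_integral_jump_eq (h : P.Admissible) (hδ1 : P.delta1 ≤ 0) (hδ2 : P.delta2 ≤ 0)
    (hδ3 : 0 ≤ P.delta3) (hAB : ∀ z : ℂ, 0 < z.im → ¬ (P.coeffA z = 0 ∧ P.coeffB z = 0)) {x : ℝ}
    (hx : 0 ≤ x) : ∃ c : ℝ → ℂ, ∀ Ψ ∈ hardyClass (P.muPlus x),
      ∫ l : ℝ, (starRingEnd ℂ (P.jostFun x l) - P.S l * P.jostFun x l) * Ψ l =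
        ∑ᶠ k ∈ P.eigenSet, c k * Ψ (Complex.I * k) := by
  obtain ⟨hm, hb⟩ := jump_bound h hδ1 hδ3 hx
  have hfin := finite_eigenSet h hδ1 hδ2 hδ3 hAB
  have hint : ∀ Ψ ∈ hardyClass (P.muPlus x), Integrable fun l : ℝ =>
      (starRingEnd ℂ (P.jostFun x l) - P.S l * P.jostFun x l) * Ψ l := fun Ψ hΨ =>
    (integrable_ofReal_of_mem_hardyClass hΨ).bdd_mul hm hb
  let K : hardyClass (P.muPlus x) →ₗ[ℂ] ℂ :=
    { toFun := fun Ψ => ∫ l : ℝ, (starRingEnd ℂ (P.jostFun x l) - P.S l * P.jostFun x l) * Ψ.1 l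
      map_add' := fun f g => by
        rw [← integral_add (hint f.1 f.2) (hint g.1 g.2)]
        congr 1
        ext l
        simp only [Submodule.coe_add, Pi.add_apply]
        ring
      map_smul' := fun c f => by
        rw [RingHom.id_apply, smul_eq_mul, ← integral_const_mul]
        congr 1
        ext l
        simp only [Submodule.coe_smul, Pi.smul_apply, smul_eq_mul]
        ring }
  let L : P.eigenSet → hardyClass (P.muPlus x) →ₗ[ℂ] ℂ := fun k =>
    { toFun := fun Ψ => Ψ.1 (Complex.I * (k : ℝ))
      map_add' := fun f g => rfl
      map_smul' := fun c f => rfl }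
  have : Finite P.eigenSet := hfin
  have h1 : K ∈ Submodule.span ℂ (range L) := by
    refine mem_span_of_iInf_ker_le_ker fun Ψ hΨ => ?_
    rw [Submodule.mem_iInf] at hΨ
    exact integral_jump_eq_zero h hδ1 hδ2 hδ3 hAB hx Ψ.2 fun k hk => hΨ ⟨k, hk⟩
  have : Fintype P.eigenSet := hfin.fintype
  obtain ⟨c, hc⟩ := (Submodule.mem_span_range_iff_exists_fun ℂ).1 h1
  refine ⟨fun k => open Classical in if hk : k ∈ P.eigenSet then c ⟨k, hk⟩ else 0, fun Ψ hΨ => ?_⟩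
  have h2 := LinearMap.congr_fun hc ⟨Ψ, hΨ⟩
  rw [LinearMap.sum_apply] at h2
  have h3 : K ⟨Ψ, hΨ⟩ = ∫ l : ℝ, (starRingEnd ℂ (P.jostFun x l) - P.S l * P.jostFun x l) * Ψ l := rfl
  rw [← h3, ← h2, finsum_mem_eq_finite_toFinset_sum _ hfin,
    Finset.sum_subtype hfin.toFinset (p := fun k => k ∈ P.eigenSet) (fun k => hfin.mem_toFinset)]
  refine Finset.sum_congr rfl fun k _ => ?_
  simp only
  rw [dif_pos k.2]
  rfl

end ScatteringProblem

/-! ### Fourier transforms of test functions and of square integrable functions -/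

/-- The Fourier transform `∫ g(u) e^{izu} du`. -/
noncomputable def ft (g : ℝ → ℂ) (z : ℂ) : ℂ := ∫ u : ℝ, g u * Complex.exp (Complex.I * z * u)

/-- The Fourier transform of a real function. -/
noncomputable def rft (φ : ℝ → ℝ) (z : ℂ) : ℂ := ft (fun u => (φ u : ℂ)) z

/-- Real test functions supported in `(m, ∞)`. -/
structure IsTest (m : ℝ) (φ : ℝ → ℝ) : Prop where
  contDiff : ContDiff ℝ ∞ φ
  compact : HasCompactSupport φ
  supp : tsupport φ ⊆ Ioi m

theorem continuous_mul_cexp (z : ℂ) : Continuous fun u : ℝ => Complex.exp (Complex.I * z * u) := by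
  fun_prop

theorem norm_mul_cexp_le' {g : ℝ → ℂ} {b : ℝ} (hb : ∀ u < b, g u = 0) {z : ℂ} (hz : 0 ≤ z.im)
    (u : ℝ) : ‖g u * Complex.exp (Complex.I * z * u)‖ ≤ ‖g u‖ * Real.exp (-(z.im * b)) := by
  rcases lt_or_ge u b with hu | hu
  · simp [hb u hu]
  · rw [norm_mul]
    exact mul_le_mul_of_nonneg_left (ScatteringProblem.norm_cexp_le hz hu) (norm_nonneg _)

theorem integrable_ft {g : ℝ → ℂ} (hg : Integrable g) {b : ℝ} (hb : ∀ u < b, g u = 0) {z : ℂ}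
    (hz : 0 ≤ z.im) : Integrable fun u : ℝ => g u * Complex.exp (Complex.I * z * u) :=
  (hg.norm.mul_const _).mono'
    (hg.aestronglyMeasurable.mul (continuous_mul_cexp z).aestronglyMeasurable)
    (Eventually.of_forall (norm_mul_cexp_le' hb hz))

theorem norm_ft_le {g : ℝ → ℂ} (hg : Integrable g) {b : ℝ} (hb : ∀ u < b, g u = 0) {z : ℂ}
    (hz : 0 ≤ z.im) : ‖ft g z‖ ≤ (∫ u, ‖g u‖) * Real.exp (-(z.im * b)) := by
  rw [← integral_mul_const]
  exact norm_integral_le_of_norm_le (hg.norm.mul_const _)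
    (Eventually.of_forall (norm_mul_cexp_le' hb hz))

theorem norm_ft_ofReal_le (g : ℝ → ℂ) (l : ℝ) : ‖ft g l‖ ≤ ∫ u, ‖g u‖ := by
  refine (norm_integral_le_integral_norm _).trans_eq ?_
  congr 1 with u
  rw [norm_mul, show Complex.I * (l : ℂ) * u = ((l * u : ℝ) : ℂ) * Complex.I by push_cast; ring,
    Complex.norm_exp_ofReal_mul_I, mul_one]

theorem integrable_ft_ofReal {g : ℝ → ℂ} (hg : Integrable g) (l : ℝ) :
    Integrable fun u : ℝ => g u * Complex.exp (Complex.I * l * u) := by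
  refine hg.norm.mono' (hg.aestronglyMeasurable.mul (continuous_mul_cexp _).aestronglyMeasurable)
    (Eventually.of_forall fun u => ?_)
  rw [norm_mul, show Complex.I * (l : ℂ) * u = ((l * u : ℝ) : ℂ) * Complex.I by push_cast; ring,
    Complex.norm_exp_ofReal_mul_I, mul_one]

theorem continuous_ft_ofReal {g : ℝ → ℂ} (hg : Integrable g) : Continuous fun l : ℝ => ft g l := by
  refine continuous_of_dominated (bound := fun u => ‖g u‖)
    (fun l => (integrable_ft_ofReal hg l).aestronglyMeasurable)
    (fun l => Eventually.of_forall fun u => ?_) hg.norm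
    (Eventually.of_forall fun u => by fun_prop)
  rw [norm_mul, show Complex.I * (l : ℂ) * u = ((l * u : ℝ) : ℂ) * Complex.I by push_cast; ring,
    Complex.norm_exp_ofReal_mul_I, mul_one]

theorem norm_mul_cexp_le_of_mem_ball {g : ℝ → ℂ} {b : ℝ} (hb : ∀ u < b, g u = 0) {z z₀ : ℂ}
    (hz : 0 ≤ z.im) (hz₀ : z ∈ Metric.ball z₀ 1) (u : ℝ) :
    ‖g u * Complex.exp (Complex.I * z * u)‖ ≤ ‖g u‖ * Real.exp ((‖z₀‖ + 1) * |b|) :=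
  (norm_mul_cexp_le' hb hz u).trans (mul_le_mul_of_nonneg_left
    (ScatteringProblem.exp_neg_im_mul_le hz hz₀ b) (norm_nonneg _))

theorem differentiableOn_ft {g : ℝ → ℂ} (hg : Integrable g) {b : ℝ} (hb : ∀ u < b, g u = 0) :
    DifferentiableOn ℂ (ft g) {z | 0 < z.im} := by
  refine differentiableOn_integral_of_locally_dominated isOpen_upperHalf
    (fun z hz => (integrable_ft hg hb (le_of_lt hz)).aestronglyMeasurable)
    (Eventually.of_forall fun u => by fun_prop)
    fun z₀ _ => ⟨1, one_pos, _, hg.norm.mul_const _, Eventually.of_forall fun u z hz =>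
      norm_mul_cexp_le_of_mem_ball hb (le_of_lt hz.2) hz.1 u⟩

theorem continuousOn_ft {g : ℝ → ℂ} (hg : Integrable g) {b : ℝ} (hb : ∀ u < b, g u = 0) :
    ContinuousOn (ft g) {z | 0 ≤ z.im} := by
  intro z₀ hz₀
  refine continuousWithinAt_of_dominated (bound := fun u => ‖g u‖ * Real.exp ((‖z₀‖ + 1) * |b|))
    ?_ ?_ (hg.norm.mul_const _) (Eventually.of_forall fun u => by fun_prop)
  · filter_upwards [self_mem_nhdsWithin] with z hz
    exact (integrable_ft hg hb hz).aestronglyMeasurable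
  · filter_upwards [self_mem_nhdsWithin,
      mem_nhdsWithin_of_mem_nhds (Metric.ball_mem_nhds z₀ one_pos)] with z hz hzb
    exact Eventually.of_forall (norm_mul_cexp_le_of_mem_ball hb hz hzb)

theorem ft_comp_sub (g : ℝ → ℂ) (b : ℝ) (z : ℂ) :
    ft (fun u => g (u - b)) z = Complex.exp (Complex.I * z * b) * ft g z := by
  rw [ft, ft, ← integral_const_mul, ← integral_sub_right_eq_self
    (fun u : ℝ => Complex.exp (Complex.I * z * b) * (g u * Complex.exp (Complex.I * z * u))) b]
  congr 1 with u
  rw [mul_left_comm, ← Complex.exp_add]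
  push_cast
  congr 2
  ring

theorem rft_comp_sub (φ : ℝ → ℝ) (b : ℝ) (z : ℂ) :
    rft (fun u => φ (u - b)) z = Complex.exp (Complex.I * z * b) * rft φ z :=
  ft_comp_sub (fun u => (φ u : ℂ)) b z

/-- The multiplication formula. -/
theorem integral_mul_ft {k w : ℝ → ℂ} (hk : Integrable k) (hw : Integrable w) :
    ∫ t : ℝ, k t * ft w t = ∫ l : ℝ, w l * ft k l := by
  simp only [ft, ← integral_const_mul]
  rw [integral_integral_swap]
  · refine integral_congr_ae (Eventually.of_forall fun l => ?_)
    refine integral_congr_ae (Eventually.of_forall fun t => ?_)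
    simp only
    rw [mul_right_comm Complex.I]
    ring
  · have h1 := hk.mul_prod hw
    refine h1.norm.mono' ?_ (Eventually.of_forall fun p => ?_)
    · simp only [Function.uncurry_def, ← mul_assoc]
      exact h1.aestronglyMeasurable.mul (by fun_prop : Continuous fun p : ℝ × ℝ =>
        Complex.exp (Complex.I * p.1 * p.2)).aestronglyMeasurable
    · simp only [Function.uncurry_def, ← mul_assoc]
      rw [norm_mul, show Complex.I * (p.1 : ℂ) * p.2 = ((p.1 * p.2 : ℝ) : ℂ) * Complex.I by push_cast; ring,
        Complex.norm_exp_ofReal_mul_I, mul_one]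

namespace IsTest

variable {m : ℝ} {φ : ℝ → ℝ}

theorem mono {m' : ℝ} (hφ : IsTest m φ) (hm : m' ≤ m) : IsTest m' φ :=
  ⟨hφ.1, hφ.2, hφ.3.trans (Ioi_subset_Ioi hm)⟩

theorem eq_zero (hφ : IsTest m φ) {u : ℝ} (hu : u ≤ m) : φ u = 0 := by
  by_contra h0
  exact absurd (hφ.3 (subset_tsupport φ h0)) (by simpa using hu)

theorem deriv (hφ : IsTest m φ) : IsTest m (deriv φ) :=
  ⟨(contDiff_infty_iff_deriv.1 hφ.1).2, hφ.2.deriv, (tsupport_deriv_subset).trans hφ.3⟩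

theorem comp_sub (hφ : IsTest m φ) (b : ℝ) : IsTest (m + b) fun u => φ (u - b) := by
  refine ⟨hφ.1.comp (contDiff_id.sub contDiff_const),
    hφ.2.comp_homeomorph (Homeomorph.subRight b), fun u hu => ?_⟩
  have h1 : u - b ∈ tsupport φ :=
    tsupport_comp_subset_preimage φ (f := fun u => u - b) (by fun_prop) hu
  have := hφ.3 h1
  simp only [mem_Ioi] at this ⊢
  linarith

theorem continuous_ofReal (hφ : IsTest m φ) : Continuous fun u => (φ u : ℂ) :=
  Complex.continuous_ofReal.comp hφ.1.continuous

theorem compact_ofReal (hφ : IsTest m φ) : HasCompactSupport fun u => (φ u : ℂ) :=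
  hφ.2.comp_left (g := fun x : ℝ => (x : ℂ)) Complex.ofReal_zero

theorem integrable (hφ : IsTest m φ) : Integrable fun u => (φ u : ℂ) :=
  hφ.continuous_ofReal.integrable_of_hasCompactSupport hφ.compact_ofReal

theorem ofReal_eq_zero (hφ : IsTest m φ) : ∀ u < m, (φ u : ℂ) = 0 := fun _ hu =>
  Complex.ofReal_eq_zero.2 (hφ.eq_zero hu.le)

theorem rft_deriv (hφ : IsTest m φ) (z : ℂ) : rft (_root_.deriv φ) z = -(Complex.I * z * rft φ z) := by
  have h1 : Differentiable ℝ φ := hφ.1.differentiable (by simp)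
  have hi : ∀ {ψ : ℝ → ℝ} {g : ℝ → ℂ}, IsTest m ψ → Continuous g →
      Integrable ((g : ℝ → ℂ) * fun u => (ψ u : ℂ)) := fun hψ hg =>
    (hg.mul hψ.continuous_ofReal).integrable_of_hasCompactSupport hψ.compact_ofReal.mul_left
  have hd : ∀ u : ℝ, HasDerivAt (fun u : ℝ => Complex.exp (Complex.I * z * u))
      (Complex.exp (Complex.I * z * u) * (Complex.I * z)) u := fun u => by
    simpa using ((Complex.ofRealCLM.hasDerivAt (x := u)).const_mul (Complex.I * z)).cexp
  have := integral_mul_deriv_eq_deriv_mul_of_integrable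
    (u := fun u : ℝ => Complex.exp (Complex.I * z * u)) (v := fun u => (φ u : ℂ))
    (v' := fun u => ((_root_.deriv φ u : ℝ) : ℂ)) (fun u _ => hd u)
    (fun u _ => (h1 u).hasDerivAt.ofReal_comp)
    (hi hφ.deriv (by fun_prop)) (hi hφ (by fun_prop)) (hi hφ (by fun_prop))
  rw [rft, rft, ft, ft, ← integral_const_mul]
  simp only [mul_comm (Complex.ofReal _)]
  rw [this]
  congr 2 with u
  ring

/-- Two integrations by parts give the quadratic decay, and the support in `(m, ∞)` gives the
exponential factor. -/
theorem rft_mem_hardyClass (hφ : IsTest m φ) : rft φ ∈ hardyClass m := by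
  refine ⟨differentiableOn_ft hφ.integrable hφ.ofReal_eq_zero,
    continuousOn_ft hφ.integrable hφ.ofReal_eq_zero,
    (∫ u, ‖(φ u : ℂ)‖) + ∫ u, ‖((_root_.deriv (_root_.deriv φ) u : ℝ) : ℂ)‖, fun z hz => ?_⟩
  have h1 := norm_ft_le hφ.integrable hφ.ofReal_eq_zero hz
  have h2 := norm_ft_le hφ.deriv.deriv.integrable hφ.deriv.deriv.ofReal_eq_zero hz
  have h3 : ‖rft (_root_.deriv (_root_.deriv φ)) z‖ = ‖z‖ ^ 2 * ‖rft φ z‖ := by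
    rw [hφ.deriv.rft_deriv, hφ.rft_deriv]
    simp only [norm_neg, norm_mul, Complex.norm_I]
    ring
  rw [rft] at h3
  rw [h3] at h2
  rw [le_div_iff₀ (by positivity)]
  simp only [rft] at h2 ⊢
  linarith

theorem integrable_rft (hφ : IsTest m φ) : Integrable fun l : ℝ => rft φ l :=
  integrable_ofReal_of_mem_hardyClass hφ.rft_mem_hardyClass

/-- The test function as a Schwartz function. -/
noncomputable def toSchwartz (hφ : IsTest m φ) : SchwartzMap ℝ ℂ :=
  hφ.compact_ofReal.toSchwartzMap (Complex.ofRealCLM.contDiff.comp hφ.1)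

theorem fourierInv_toSchwartz (hφ : IsTest m φ) (l : ℝ) :
    (FourierTransformInv.fourierInv hφ.toSchwartz : SchwartzMap ℝ ℂ) l =
      rft φ (2 * Real.pi * l : ℝ) := by
  rw [SchwartzMap.fourierInv_coe, Real.fourierInv_eq', rft, ft]
  congr 1 with u
  rw [smul_eq_mul, mul_comm]
  congr 1
  simp only [RCLike.inner_apply, conj_trivial]
  push_cast
  congr 1
  ring

/-- Fourier inversion for test functions. -/
theorem integral_cexp_mul_rft (hφ : IsTest m φ) (b : ℝ) :
    ∫ l : ℝ, Complex.exp (-(Complex.I * l * b)) * rft φ l = 2 * Real.pi * φ b := by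
  have h1 : FourierTransform.fourier (FourierTransformInv.fourierInv hφ.toSchwartz :
      SchwartzMap ℝ ℂ) b = (φ b : ℂ) := by
    rw [FourierTransform.fourier_fourierInv_eq]
    rfl
  rw [SchwartzMap.fourier_coe, Real.fourier_eq'] at h1
  simp only [fourierInv_toSchwartz] at h1
  have h2 := Measure.integral_comp_mul_left
    (fun l : ℝ => Complex.exp (-(Complex.I * l * b)) * rft φ l) (2 * Real.pi)
  rw [← h1]
  have h3 : ∀ l : ℝ, Complex.exp (((-2 * Real.pi * inner ℝ l b : ℝ) : ℂ) * Complex.I) •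
      rft φ (2 * Real.pi * l : ℝ) =
      Complex.exp (-(Complex.I * (2 * Real.pi * l : ℝ) * b)) * rft φ (2 * Real.pi * l : ℝ) := by
    intro l
    rw [smul_eq_mul]
    congr 2
    simp only [RCLike.inner_apply, conj_trivial]
    push_cast
    ring
  simp only [h3, h2]
  rw [abs_of_pos (by positivity), Complex.real_smul]
  push_cast
  rw [← mul_assoc, mul_inv_cancel₀ (by simp [Real.pi_ne_zero]), one_mul]

end IsTest

theorem integral_sq_norm_Lp (f : Lp ℂ 2 (volume : Measure ℝ)) : ∫ u, ‖f u‖ ^ 2 = ‖f‖ ^ 2 := by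
  have h1 := inner_self_eq_norm_sq_to_K (𝕜 := ℂ) f
  rw [L2.inner_def] at h1
  simp only [inner_self_eq_norm_sq_to_K] at h1
  have h2 : ((∫ u, ‖f u‖ ^ 2 : ℝ) : ℂ) = ((‖f‖ ^ 2 : ℝ) : ℂ) := by
    rw [← integral_complex_ofReal]
    push_cast
    exact h1
  exact_mod_cast h2

/-- The Fourier transform on `L²`, tested against smooth functions. -/
theorem exists_fourier_memLp_two {v : ℝ → ℂ} (hv : MemLp v 2) : ∃ w : ℝ → ℂ, MemLp w 2 ∧
    (∀ {m : ℝ} {φ : ℝ → ℝ}, IsTest m φ →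
      ∫ u, w u * φ u = 1 / (2 * Real.pi) * ∫ l : ℝ, v l * rft φ l) ∧
    ∫ u, ‖w u‖ ^ 2 = 1 / (2 * Real.pi) * ∫ l, ‖v l‖ ^ 2 := by
  have hpi : (0 : ℝ) < 2 * Real.pi := by positivity
  -- Rescaling by `2π` passes to the normalisation in which the Fourier transform is an isometry.
  set V : ℝ → ℂ := fun s => v (2 * Real.pi * s) with hV
  have hVm : AEStronglyMeasurable V :=
    hv.1.comp_quasiMeasurePreserving (Measure.quasiMeasurePreserving_smul volume hpi.ne')
  have hV2 : MemLp V 2 := by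
    rw [memLp_two_iff_integrable_sq_norm hVm]
    exact ((memLp_two_iff_integrable_sq_norm hv.1).1 hv).comp_mul_left' hpi.ne'
  set w : Lp ℂ 2 (volume : Measure ℝ) :=
    FourierTransformInv.fourierInv (hV2.toLp V : Lp ℂ 2 (volume : Measure ℝ)) with hw
  have hVL := hV2.coeFn_toLp
  refine ⟨w, Lp.memLp w, fun {m φ} hφ => ?_, ?_⟩
  · have h1 := congrArg (fun T : TemperedDistribution ℝ ℂ => T hφ.toSchwartz)
      (Lp.fourierInv_toTemperedDistribution_eq (hV2.toLp V))
    simp only [TemperedDistribution.fourierInv_apply, Lp.toTemperedDistribution_apply] at h1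
    have h2 := Measure.integral_comp_mul_left (fun l : ℝ => v l * rft φ l) (2 * Real.pi)
    rw [abs_of_pos (by positivity), Complex.real_smul] at h2
    push_cast at h2
    rw [one_div, ← h2]
    calc ∫ u, w u * φ u = ∫ u, hφ.toSchwartz u • w u := by
          congr 1 with u
          rw [smul_eq_mul, mul_comm]
          rfl
      _ = _ := by
          rw [hw, ← h1]
          refine integral_congr_ae ?_
          filter_upwards [hVL] with s hs
          rw [hs, hφ.fourierInv_toSchwartz, smul_eq_mul, mul_comm, hV]
          push_cast
          rfl
  · rw [integral_sq_norm_Lp]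
    have h0 : ‖w‖ = ‖(hV2.toLp V : Lp ℂ 2 (volume : Measure ℝ))‖ := by
      rw [← Lp.norm_fourier_eq w, hw, FourierTransform.fourier_fourierInv_eq]
    rw [h0, ← integral_sq_norm_Lp]
    have h2 := Measure.integral_comp_mul_left (fun l : ℝ => ‖v l‖ ^ 2) (2 * Real.pi)
    rw [abs_of_pos (by positivity), smul_eq_mul] at h2
    rw [one_div, ← h2]
    refine integral_congr_ae ?_
    filter_upwards [hVL] with s hs
    rw [hs, hV]

theorem ae_eq_zero_of_integral_test {f : ℝ → ℂ} {m : ℝ} (hf : LocallyIntegrableOn f (Ioi m))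
    (h0 : ∀ φ, IsTest m φ → ∫ u, f u * φ u = 0) : ∀ᵐ u, u ∈ Ioi m → f u = 0 := by
  refine isOpen_Ioi.ae_eq_zero_of_integral_contDiff_smul_eq_zero hf fun g h1 h2 h3 => ?_
  rw [← h0 g ⟨h1, h2, h3⟩]
  congr 1 with u
  rw [Complex.real_smul, mul_comm]

theorem exists_isTest_of_hasCompactSupport {φ : ℝ → ℝ} (h1 : ContDiff ℝ ∞ φ)
    (h2 : HasCompactSupport φ) : ∃ m, IsTest m φ := by
  obtain ⟨b, hb⟩ := h2.isCompact.bddBelow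
  exact ⟨b - 1, h1, h2, fun u hu => by have := hb hu; simp only [mem_Ioi]; linarith⟩

theorem ae_eq_of_integral_test {f g : ℝ → ℂ} (hf : LocallyIntegrable f)
    (hg : LocallyIntegrable g)
    (h0 : ∀ {m φ}, IsTest m φ → ∫ u, f u * φ u = ∫ u, g u * φ u) : f =ᵐ[volume] g := by
  refine ae_eq_of_integral_contDiff_smul_eq hf hg fun φ h1 h2 => ?_
  obtain ⟨m, hm⟩ := exists_isTest_of_hasCompactSupport h1 h2
  simpa only [Complex.real_smul, mul_comm] using h0 hm

/-- Plancherel's identity for integrable and square integrable functions. -/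
theorem memLp_two_ft {g : ℝ → ℂ} (hg : Integrable g) (hg2 : MemLp g 2) :
    MemLp (fun l : ℝ => ft g l) 2 ∧
      ∫ l : ℝ, ‖ft g l‖ ^ 2 = 2 * Real.pi * ∫ u, ‖g u‖ ^ 2 := by
  obtain ⟨w, hw, h1, h2⟩ := exists_fourier_memLp_two hg2
  have hpi : (0 : ℝ) < 2 * Real.pi := by positivity
  have hpi' : (2 * Real.pi : ℂ) ≠ 0 := by simp [Real.pi_ne_zero]
  -- The abstract transform and the pointwise one agree on test functions by the multiplication
  -- formula.
  have key : w =ᵐ[volume] fun l : ℝ => 1 / (2 * Real.pi) * ft g l := by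
    refine ae_eq_of_integral_test (hw.locallyIntegrable (by norm_num))
      ((continuous_ft_ofReal hg).const_smul (1 / (2 * Real.pi) : ℂ)).locallyIntegrable ?_
    intro m φ hφ
    rw [h1 hφ]
    simp only [mul_assoc]
    rw [integral_const_mul]
    congr 1
    have := integral_mul_ft hg hφ.integrable
    simp only [rft, mul_comm (ft g _)]
    exact this
  have key2 : (fun l : ℝ => ft g l) =ᵐ[volume] fun l => (2 * Real.pi : ℂ) * w l := by
    filter_upwards [key] with l hl
    rw [hl, ← mul_assoc, mul_one_div_cancel hpi', one_mul]
  refine ⟨(hw.const_mul (2 * Real.pi : ℂ)).ae_eq key2.symm, ?_⟩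
  have h3 : ∫ l : ℝ, ‖ft g l‖ ^ 2 = ∫ l, (2 * Real.pi) ^ 2 * ‖w l‖ ^ 2 := by
    refine integral_congr_ae ?_
    filter_upwards [key2] with l hl
    rw [hl, norm_mul, mul_pow]
    congr 2
    rw [show (2 * Real.pi : ℂ) = ((2 * Real.pi : ℝ) : ℂ) by push_cast; rfl, Complex.norm_real,
      Real.norm_of_nonneg hpi.le]
  rw [h3, integral_const_mul, h2]
  field_simp

/-! ### Operators on integrable functions -/

section L1

variable {X : Type*} [MeasurableSpace X] {μ : Measure X}

/-- A bounded operator on `L¹` from an operator on integrable functions. -/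
theorem exists_clm_L1 (O : (X → ℂ) → X → ℂ) {C : ℝ} (hC : 0 ≤ C)
    (hint : ∀ f, Integrable f μ → Integrable (O f) μ)
    (hcongr : ∀ f g, f =ᵐ[μ] g → O f =ᵐ[μ] O g)
    (hadd : ∀ f g, Integrable f μ → Integrable g μ → O (f + g) =ᵐ[μ] O f + O g)
    (hsmul : ∀ (c : ℂ) (f), Integrable f μ → O (c • f) =ᵐ[μ] c • O f)
    (hbd : ∀ f, Integrable f μ → ∫ x, ‖O f x‖ ∂μ ≤ C * ∫ x, ‖f x‖ ∂μ) :
    ∃ T : Lp ℂ 1 μ →L[ℂ] Lp ℂ 1 μ, ‖T‖ ≤ C ∧ ∀ f, T f =ᵐ[μ] O f := by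
  have hO : ∀ f : Lp ℂ 1 μ, Integrable (O f) μ := fun f => hint f (L1.integrable_coeFn f)
  let L : Lp ℂ 1 μ →ₗ[ℂ] Lp ℂ 1 μ :=
    { toFun := fun f => (hO f).toL1 (O f)
      map_add' := fun f g => by
        rw [← Integrable.toL1_add _ _ (hO f) (hO g), Integrable.toL1_eq_toL1_iff]
        exact (hcongr _ _ (Lp.coeFn_add f g)).trans
          (hadd _ _ (L1.integrable_coeFn f) (L1.integrable_coeFn g))
      map_smul' := fun c f => by
        rw [RingHom.id_apply, ← Integrable.toL1_smul (O f) (hO f) c, Integrable.toL1_eq_toL1_iff]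
        exact (hcongr _ _ (Lp.coeFn_smul c f)).trans (hsmul c _ (L1.integrable_coeFn f)) }
  have hL : ∀ f, L f =ᵐ[μ] O f := fun f => (hO f).coeFn_toL1
  refine ⟨L.mkContinuous C fun f => ?_, L.mkContinuous_norm_le hC _, hL⟩
  rw [L1.norm_eq_integral_norm, L1.norm_eq_integral_norm]
  refine le_trans (le_of_eq (integral_congr_ae ?_)) (hbd f (L1.integrable_coeFn f))
  filter_upwards [hL f] with x hx
  rw [hx]

variable [SFinite μ]

theorem integrable_prod_mul_kernel {k : X → X → ℂ} {C : ℝ}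
    (hk : AEStronglyMeasurable (Function.uncurry k) (μ.prod μ))
    (hC : ∀ᵐ t ∂μ, Integrable (k t) μ ∧ ∫ y, ‖k t y‖ ∂μ ≤ C) {f : X → ℂ} (hf : Integrable f μ) :
    Integrable (fun p : X × X => f p.1 * k p.1 p.2) (μ.prod μ) := by
  have hm : AEStronglyMeasurable (fun p : X × X => f p.1 * k p.1 p.2) (μ.prod μ) :=
    (hf.aestronglyMeasurable.comp_fst).mul hk
  rw [integrable_prod_iff hm]
  refine ⟨hC.mono fun t ht => ht.1.const_mul (f t), ?_⟩
  refine (hf.norm.mul_const C).mono' hm.norm.integral_prod_right' ?_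
  filter_upwards [hC] with t ht
  rw [Real.norm_of_nonneg (integral_nonneg fun y => norm_nonneg _)]
  simp only [norm_mul]
  rw [integral_const_mul]
  exact mul_le_mul_of_nonneg_left ht.2 (norm_nonneg _)

/-- The integral operator on `L¹` with a kernel of bounded `L¹` norms. -/
theorem exists_kernel_clm {k : X → X → ℂ} {C : ℝ} (h0 : 0 ≤ C)
    (hk : AEStronglyMeasurable (Function.uncurry k) (μ.prod μ))
    (hC : ∀ᵐ t ∂μ, Integrable (k t) μ ∧ ∫ y, ‖k t y‖ ∂μ ≤ C) :
    ∃ T : Lp ℂ 1 μ →L[ℂ] Lp ℂ 1 μ, ‖T‖ ≤ C ∧ ∀ f, ∀ᵐ y ∂μ,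
      Integrable (fun t => f t * k t y) μ ∧ T f y = ∫ t, f t * k t y ∂μ := by
  have hp := fun f (hf : Integrable f μ) => integrable_prod_mul_kernel hk hC hf
  have hadd : ∀ f g, Integrable f μ → Integrable g μ →
      (fun y => ∫ t, (f + g) t * k t y ∂μ) =ᵐ[μ]
        (fun y => ∫ t, f t * k t y ∂μ) + fun y => ∫ t, g t * k t y ∂μ := fun f g hf hg => by
    filter_upwards [(hp f hf).prod_left_ae, (hp g hg).prod_left_ae] with y h1 h2
    simp only [Pi.add_apply, add_mul]
    exact integral_add h1 h2
  have hbd : ∀ f, Integrable f μ →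
      ∫ y, ‖∫ t, f t * k t y ∂μ‖ ∂μ ≤ C * ∫ t, ‖f t‖ ∂μ := fun f hf => by
    have h1 := (hp f hf).norm
    calc _ ≤ ∫ y, ∫ t, ‖f t * k t y‖ ∂μ ∂μ :=
          integral_mono (hp f hf).integral_prod_right.norm h1.integral_prod_right
            fun y => norm_integral_le_integral_norm _
      _ = ∫ t, ∫ y, ‖f t * k t y‖ ∂μ ∂μ := by
          rw [integral_integral_swap]
          exact h1.swap
      _ ≤ ∫ t, C * ‖f t‖ ∂μ := by
          refine integral_mono_ae h1.integral_prod_left (hf.norm.const_mul C) ?_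
          filter_upwards [hC] with t ht
          simp only [norm_mul]
          rw [integral_const_mul, mul_comm]
          exact mul_le_mul_of_nonneg_right ht.2 (norm_nonneg _)
      _ = _ := integral_const_mul _ _
  obtain ⟨T, h1, h2⟩ := exists_clm_L1 (μ := μ) (fun f y => ∫ t, f t * k t y ∂μ) h0
    (fun f hf => (hp f hf).integral_prod_right)
    (fun f g hfg => Eventually.of_forall fun y => integral_congr_ae
      (hfg.mono fun t ht => congrArg (· * k t y) ht)) hadd
    (fun c f _ => Eventually.of_forall fun y => by
      simp only [Pi.smul_apply, smul_eq_mul, mul_assoc]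
      exact integral_const_mul _ _) hbd
  refine ⟨T, h1, fun f => ?_⟩
  filter_upwards [h2 f, (hp f (L1.integrable_coeFn f)).prod_left_ae] with y hy hy'
  exact ⟨hy', hy⟩

end L1

/-- The operator `f ↦ f(c - ·)` on `L¹(m, ∞)`, with extension by zero. -/
theorem exists_reflection_clm (m c : ℝ) :
    ∃ T : Lp ℂ 1 (volume.restrict (Ioi m)) →L[ℂ] Lp ℂ 1 (volume.restrict (Ioi m)), ‖T‖ ≤ 1 ∧
      ∀ f, T f =ᵐ[volume.restrict (Ioi m)] fun y => (Ioi m).indicator f (c - y) := by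
  have hi : ∀ f : ℝ → ℂ, Integrable f (volume.restrict (Ioi m)) →
      Integrable fun y => (Ioi m).indicator f (c - y) := fun f hf =>
    ((integrable_indicator_iff measurableSet_Ioi).2 hf).comp_sub_left c
  refine exists_clm_L1 (fun f y => (Ioi m).indicator f (c - y)) zero_le_one
    (fun f hf => (hi f hf).restrict) (fun f g hfg => ?_) (fun f g _ _ => ?_) (fun a f _ => ?_)
    (fun f hf => ?_)
  · have h1 : (Ioi m).indicator f =ᵐ[volume] (Ioi m).indicator g := by
      filter_upwards [(ae_restrict_iff' measurableSet_Ioi).1 hfg] with y hy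
      by_cases hm : y ∈ Ioi m <;> simp [hm, hy]
    exact ae_restrict_of_ae
      ((Measure.measurePreserving_sub_left volume c).quasiMeasurePreserving.ae_eq_comp h1)
  · refine Eventually.of_forall fun y => ?_
    simp only [indicator_add', Pi.add_apply]
  · refine Eventually.of_forall fun y => ?_
    exact congrFun (indicator_const_smul (Ioi m) a f) (c - y)
  · rw [one_mul]
    calc _ ≤ ∫ y, ‖(Ioi m).indicator f (c - y)‖ :=
          integral_mono_measure Measure.restrict_le_self
            (Eventually.of_forall fun y => norm_nonneg _) (hi f hf).norm
      _ = ∫ y, ‖(Ioi m).indicator f y‖ := integral_sub_left_eq_self (fun y => ‖(Ioi m).indicator f y‖) _ c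
      _ = _ := by
          simp only [norm_indicator_eq_indicator_norm]
          exact integral_indicator measurableSet_Ioi

/-- A one-sided correlation equation with small coefficients is solvable in `L¹`. -/
theorem exists_correlation_solution {a d : ℝ} {k G : ℝ → ℂ} (hk : Integrable k)
    (hG : Integrable G) (hsmall : |a| + ∫ t, ‖k t‖ < 1) : ∃ F : ℝ → ℂ, Integrable F ∧
      ∀ᵐ v, Integrable (fun t => k t * F (v + t)) ∧
        F v + a * F (v + d) + ∫ t, k t * F (v + t) = G v := by
  have hkt : ∀ t, Integrable fun y => k (t - y) := fun t => hk.comp_sub_left t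
  have hkm : AEStronglyMeasurable (Function.uncurry fun t y : ℝ => k (t - y))
      ((volume : Measure ℝ).prod volume) :=
    hk.aestronglyMeasurable.comp_quasiMeasurePreserving
      (quasiMeasurePreserving_sub_of_right_invariant volume volume)
  obtain ⟨T, hT, hT2⟩ := exists_kernel_clm (μ := (volume : Measure ℝ))
    (k := fun t y : ℝ => k (t - y)) (C := ∫ t, ‖k t‖) (integral_nonneg fun _ => norm_nonneg _) hkm
    (Eventually.of_forall fun t => ⟨hkt t, (integral_sub_left_eq_self (fun y => ‖k y‖) _ t).le⟩)
  set R := (Lp.compMeasurePreservingₗᵢ ℂ (E := ℂ) (p := 1) (fun y : ℝ => y + d)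
    (measurePreserving_add_right volume d)).toContinuousLinearMap with hR
  have hR1 : ‖R‖ ≤ 1 := LinearIsometry.norm_toContinuousLinearMap_le _
  -- Neumann series: the shift `R` is an isometry, and `T` has norm at most the integral of `‖k‖`.
  have hlt : ‖-((a : ℂ) • R + T)‖ < 1 := by
    rw [norm_neg]
    refine (norm_add_le _ _).trans_lt (lt_of_le_of_lt (add_le_add ?_ hT) hsmall)
    rw [norm_smul, Complex.norm_real, Real.norm_eq_abs]
    exact mul_le_of_le_one_right (abs_nonneg a) hR1
  obtain ⟨u, hu⟩ := isUnit_one_sub_of_norm_lt_one hlt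
  set F : Lp ℂ 1 (volume : Measure ℝ) := (u⁻¹).1 (hG.toL1 G) with hF
  have hFe : F + ((a : ℂ) • R F + T F) = hG.toL1 G := by
    have h1 : u.1 F = hG.toL1 G := by
      rw [hF, ← mul_apply_eq_comp, Units.mul_inv, one_apply_eq_self]
    rw [hu, sub_neg_eq_add] at h1
    exact h1
  refine ⟨F, L1.integrable_coeFn F, ?_⟩
  have hRF : R F =ᵐ[volume] fun y => F (y + d) :=
    Lp.coeFn_compMeasurePreserving F (measurePreserving_add_right volume d)
  have h3 : (hG.toL1 G : ℝ → ℂ) =ᵐ[volume] G := hG.coeFn_toL1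
  rw [← hFe] at h3
  filter_upwards [h3, Lp.coeFn_add F ((a : ℂ) • R F + T F), Lp.coeFn_add ((a : ℂ) • R F) (T F),
    Lp.coeFn_smul (a : ℂ) (R F), hRF, hT2 F] with v e1 e2 e3 e4 e5 e6
  have e7 := integral_add_right_eq_self (μ := volume) (fun t => F t * k (t - v)) v
  have e8 : (fun t => k t * F (v + t)) = fun t => F (t + v) * k (t + v - v) := by
    ext t
    rw [add_sub_cancel_right, mul_comm, add_comm]
  rw [e2, Pi.add_apply, e3, Pi.add_apply, e4, Pi.smul_apply, e5, e6.2, smul_eq_mul] at e1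
  rw [e8]
  refine ⟨e6.1.comp_add_right v, ?_⟩
  rw [e7, ← e1]
  ring

/-! ### One-sided correlation equations with exponential weights -/

section Correlation

variable {m m' a β : ℝ} {k : ℝ → ℂ}

/-- A bounded solution of a homogeneous one-sided correlation equation with small coefficients
vanishes. -/
theorem eq_zero_of_correlation_eq_zero (hmm : m ≤ m') (hk0 : ∀ t < m, k t = 0)
    (hki : Integrable fun t => ‖k t‖ * Real.exp (-(β * (t - m))))
    (hsmall : |a| * Real.exp (-(β * (m' - m))) + ∫ t, ‖k t‖ * Real.exp (-(β * (t - m))) < 1)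
    {N : ℝ → ℂ} (hN : ∀ s, 0 ≤ s → N (m + s) + a * N (m' + s) + ∫ t, k t * N (t + s) = 0)
    {C : ℝ} (hC : ∀ s, m ≤ s → Real.exp (β * s) * ‖N s‖ ≤ C) {s : ℝ} (hs : m ≤ s) : N s = 0 := by
  set θ := |a| * Real.exp (-(β * (m' - m))) + ∫ t, ‖k t‖ * Real.exp (-(β * (t - m))) with hθ
  have hθ0 : 0 ≤ θ := add_nonneg (by positivity) (integral_nonneg fun t => by positivity)
  -- Each use of the equation gains a factor `θ` in the norm with weight `exp(β s)`. One-sidedness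
  -- is essential: since `k` lives on `t ≥ m` and `m ≤ m'`, only arguments to the right of `s`
  -- occur.
  have key : ∀ n : ℕ, ∀ s, m ≤ s → Real.exp (β * s) * ‖N s‖ ≤ C * θ ^ n := by
    intro n
    induction n with
    | zero => simpa using hC
    | succ n ih =>
      intro s hs
      have h1 := hN (s - m) (sub_nonneg.2 hs)
      rw [add_sub_cancel, add_assoc] at h1
      have h2 : ‖∫ t, k t * N (t + (s - m))‖ ≤
          (∫ t, ‖k t‖ * Real.exp (-(β * (t - m)))) * (Real.exp (-(β * s)) * (C * θ ^ n)) := by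
        rw [← integral_mul_const]
        refine norm_integral_le_of_norm_le (hki.mul_const _) (Eventually.of_forall fun t => ?_)
        rcases lt_or_ge t m with ht | ht
        · simp [hk0 t ht]
        · rw [norm_mul, mul_assoc]
          refine mul_le_mul_of_nonneg_left ?_ (norm_nonneg _)
          have h3 := ih (t + (s - m)) (by linarith)
          calc ‖N (t + (s - m))‖ = Real.exp (-(β * (t - m))) * (Real.exp (-(β * s)) *
                (Real.exp (β * (t + (s - m))) * ‖N (t + (s - m))‖)) := by
                rw [← mul_assoc, ← mul_assoc, ← Real.exp_add, ← Real.exp_add]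
                ring_nf
                simp
            _ ≤ _ := by gcongr
      have h4 : ‖(a : ℂ) * N (m' + (s - m))‖ ≤
          |a| * Real.exp (-(β * (m' - m))) * (Real.exp (-(β * s)) * (C * θ ^ n)) := by
        rw [norm_mul, Complex.norm_real, Real.norm_eq_abs, mul_assoc]
        refine mul_le_mul_of_nonneg_left ?_ (abs_nonneg _)
        have h3 := ih (m' + (s - m)) (by linarith)
        calc ‖N (m' + (s - m))‖ = Real.exp (-(β * (m' - m))) * (Real.exp (-(β * s)) *
              (Real.exp (β * (m' + (s - m))) * ‖N (m' + (s - m))‖)) := by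
              rw [← mul_assoc, ← mul_assoc, ← Real.exp_add, ← Real.exp_add]
              ring_nf
              simp
          _ ≤ _ := by gcongr
      have h5 : ‖N s‖ ≤ θ * (Real.exp (-(β * s)) * (C * θ ^ n)) := by
        rw [eq_neg_of_add_eq_zero_left h1, norm_neg, hθ, add_mul]
        exact (norm_add_le _ _).trans (add_le_add h4 h2)
      calc Real.exp (β * s) * ‖N s‖ ≤
            Real.exp (β * s) * (θ * (Real.exp (-(β * s)) * (C * θ ^ n))) := by gcongr
        _ = (Real.exp (β * s) * Real.exp (-(β * s))) * (C * θ ^ (n + 1)) := by ring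
        _ = _ := by rw [← Real.exp_add]; simp
  have h1 : Tendsto (fun n : ℕ => C * θ ^ n) atTop (𝓝 (C * 0)) :=
    (tendsto_pow_atTop_nhds_zero_of_lt_one hθ0 hsmall).const_mul C
  have h2 := ge_of_tendsto' h1 fun n => key n s hs
  rw [mul_zero] at h2
  exact norm_le_zero_iff.1 (nonpos_of_mul_nonpos_right h2 (Real.exp_pos _))

theorem integrable_mul_comp_add {F : ℝ → ℂ} (hk : Integrable k) (hF : Integrable F) :
    Integrable (fun p : ℝ × ℝ => k p.1 * F (p.1 + p.2)) (volume.prod volume) := by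
  refine integrable_prod_mul_kernel (k := fun t y => F (t + y)) (C := ∫ u, ‖F u‖) ?_
    (Eventually.of_forall fun t => ⟨hF.comp_add_left t, ?_⟩) hk
  · exact hF.aestronglyMeasurable.comp_quasiMeasurePreserving
      (quasiMeasurePreserving_add volume volume)
  · exact (integral_add_left_eq_self (fun y => ‖F y‖) t).le

theorem IsTest.exists_bound {φ : ℝ → ℝ} (hφ : IsTest m φ) : ∃ M, 0 ≤ M ∧ ∀ u, ‖(φ u : ℂ)‖ ≤ M := by
  obtain ⟨M, hM⟩ := hφ.compact_ofReal.exists_bound_of_continuous hφ.continuous_ofReal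
  exact ⟨M, (norm_nonneg _).trans (hM 0), hM⟩

theorem IsTest.continuous_integral {φ : ℝ → ℝ} (hφ : IsTest m φ) {F : ℝ → ℂ} (hF : Integrable F) :
    Continuous fun s : ℝ => ∫ u, F u * φ (u - s) := by
  obtain ⟨M, -, hM⟩ := hφ.exists_bound
  have hc := hφ.continuous_ofReal
  refine continuous_of_dominated (bound := fun u => ‖F u‖ * M) (fun s => ?_)
    (fun s => Eventually.of_forall fun u => ?_) (hF.norm.mul_const M)
    (Eventually.of_forall fun u => ?_)
  · exact hF.aestronglyMeasurable.mul
      (hc.comp (continuous_id.sub continuous_const)).aestronglyMeasurable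
  · rw [norm_mul]
    exact mul_le_mul_of_nonneg_left (hM _) (norm_nonneg _)
  · exact continuous_const.mul (hc.comp (continuous_const.sub continuous_id))

theorem IsTest.integral_mul_integral {φ : ℝ → ℝ} (hφ : IsTest m φ) {F : ℝ → ℂ}
    (hk : Integrable k) (hF : Integrable F) :
    Integrable (fun v => (∫ t, k t * F (v + t)) * φ v) ∧
    ∫ t, k t * ∫ u, F u * φ (u - t) = ∫ v, (∫ t, k t * F (v + t)) * φ v := by
  obtain ⟨M, -, hM⟩ := hφ.exists_bound
  have h1 : Integrable (fun p : ℝ × ℝ => k p.1 * F (p.2 + p.1) * φ p.2) (volume.prod volume) := by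
    refine Integrable.mul_bdd (c := M) ?_
      (hφ.continuous_ofReal.comp continuous_snd).aestronglyMeasurable
      (Eventually.of_forall fun p => hM p.2)
    simpa only [add_comm] using integrable_mul_comp_add hk hF
  have h2 : ∀ v, (∫ t, k t * F (v + t)) * φ v = ∫ t, k t * F (v + t) * φ v := fun v =>
    (integral_mul_const _ _).symm
  simp only [h2]
  refine ⟨h1.integral_prod_right, ?_⟩
  rw [← integral_integral_swap h1]
  refine integral_congr_ae (Eventually.of_forall fun t => ?_)
  simp only [mul_assoc]
  rw [integral_const_mul, ← integral_add_right_eq_self (fun u => F u * φ (u - t)) t]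
  simp only [add_sub_cancel_right]

/-- A functional on test functions that satisfies a one-sided correlation equation with small
coefficients is given by an integrable function. -/
theorem exists_eq_integral_of_correlation (hmm : m ≤ m') (hβ : 0 ≤ β) (hk : Integrable k)
    (hk0 : ∀ t < m, k t = 0)
    (hsmall : |a| * Real.exp (-(β * (m' - m))) + ∫ t, ‖k t‖ * Real.exp (-(β * (t - m))) < 1)
    {g : ℝ → ℂ} (hg : Integrable fun v => (Real.exp (β * (v + m)) : ℂ) * g v)
    {L : (ℝ → ℝ) → ℂ}
    (hL : ∀ φ, IsTest m φ → L (fun u => φ (u - m)) + a * L (fun u => φ (u - m')) +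
      ∫ t, k t * L (fun u => φ (u - t)) = ∫ v, g v * φ v)
    (hLc : ∀ φ, IsTest m φ → Continuous fun s => L fun u => φ (u - s))
    (hLb : ∀ φ, IsTest m φ → ∃ C, ∀ s, m ≤ s → Real.exp (β * s) * ‖L fun u => φ (u - s)‖ ≤ C) :
    ∃ F : ℝ → ℂ, Integrable F ∧ Integrable (fun u => (Real.exp (β * u) : ℂ) * F u) ∧
      ∀ ψ, IsTest (2 * m) ψ → L ψ = ∫ u, F u * ψ u := by
  have hexp : ∀ {b u : ℝ}, b ≤ u → ‖(Real.exp (-(β * u)) : ℂ)‖ ≤ Real.exp (-(β * b)) := by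
    intro b u hbu
    rw [Complex.norm_real, Real.norm_of_nonneg (Real.exp_pos _).le]
    exact Real.exp_le_exp.2 (neg_le_neg (mul_le_mul_of_nonneg_left hbu hβ))
  have hki : Integrable fun t => (Real.exp (-(β * (t - m))) : ℂ) * k t := by
    refine hk.norm.mono' ((by fun_prop : Continuous fun t : ℝ =>
      (Real.exp (-(β * (t - m))) : ℂ)).aestronglyMeasurable.mul hk.aestronglyMeasurable)
      (Eventually.of_forall fun t => ?_)
    rcases lt_or_ge t m with ht | ht
    · simp [hk0 t ht]
    · rw [norm_mul]
      have := hexp (sub_nonneg.2 ht)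
      rw [mul_zero, neg_zero, Real.exp_zero] at this
      exact mul_le_of_le_one_left (norm_nonneg _) this
  have hkn : ∀ t, ‖(Real.exp (-(β * (t - m))) : ℂ) * k t‖ =
      ‖k t‖ * Real.exp (-(β * (t - m))) := fun t => by
    rw [norm_mul, Complex.norm_real, Real.norm_of_nonneg (Real.exp_pos _).le, mul_comm]
  have hki2 := hki.norm
  simp only [hkn] at hki2
  -- The new unknown is `H(v) = exp(β (v + m)) F(v + m)`. In the equation for `H` the coefficients
  -- carry decaying exponentials, and `hsmall` says that this makes them small.
  obtain ⟨H, hH, hHeq⟩ := exists_correlation_solution (a := a * Real.exp (-(β * (m' - m))))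
    (d := m' - m) (hki.comp_add_right m) hg (by
      rw [integral_add_right_eq_self (fun t => ‖(Real.exp (-(β * (t - m))) : ℂ) * k t‖) m, abs_mul,
        abs_of_pos (Real.exp_pos _)]
      simpa only [hkn] using hsmall)
  set Fw : ℝ → ℂ := (Ioi (2 * m)).indicator fun u => H (u - m) with hFw
  set F : ℝ → ℂ := fun u => (Real.exp (-(β * u)) : ℂ) * Fw u with hF
  have hee : ∀ u : ℝ, (Real.exp (β * u) : ℂ) * Real.exp (-(β * u)) = 1 := fun u => by
    rw [← Complex.ofReal_mul, ← Real.exp_add]; simp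
  have hwi : Integrable Fw := (hH.comp_sub_right m).indicator measurableSet_Ioi
  have hweq : (fun u => (Real.exp (β * u) : ℂ) * F u) = Fw := by
    ext u
    rw [hF]
    simp only
    rw [← mul_assoc, hee, one_mul]
  have hFi : Integrable F := by
    refine (hwi.norm.const_mul (Real.exp (-(β * (2 * m))))).mono'
      ((by fun_prop : Continuous fun u : ℝ =>
        (Real.exp (-(β * u)) : ℂ)).aestronglyMeasurable.mul hwi.aestronglyMeasurable)
      (Eventually.of_forall fun u => ?_)
    by_cases hu : u ∈ Ioi (2 * m)
    · rw [hF, norm_mul]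
      exact mul_le_mul_of_nonneg_right (hexp (le_of_lt hu)) (norm_nonneg _)
    · simp [hF, hFw, hu]
  refine ⟨F, hFi, hweq ▸ hwi, ?_⟩
  have hFeq : ∀ᵐ v, m < v → F (v + m) + a * F (v + m') + ∫ t, k t * F (v + t) = g v := by
    filter_upwards [hHeq] with v hv hmv
    have e1 : F (v + m) = (Real.exp (-(β * (v + m))) : ℂ) * H v := by
      rw [hF, hFw]
      simp only
      rw [indicator_of_mem (by simp only [mem_Ioi]; linarith), add_sub_cancel_right]
    have e2 : F (v + m') = (Real.exp (-(β * (v + m))) : ℂ) * (Real.exp (-(β * (m' - m))) *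
        H (v + (m' - m))) := by
      rw [hF, hFw]
      simp only
      rw [indicator_of_mem (by simp only [mem_Ioi]; linarith), ← mul_assoc, ← Complex.ofReal_mul,
        ← Real.exp_add, add_sub_assoc]
      congr 3
      ring
    have e3 : ∫ t, k t * F (v + t) = (Real.exp (-(β * (v + m))) : ℂ) *
        ∫ t, (Real.exp (-(β * (t + m - m))) : ℂ) * k (t + m) * H (v + t) := by
      rw [← integral_const_mul, ← integral_add_right_eq_self _ m]
      congr 1 with t
      rcases lt_or_ge (t + m) m with ht | ht
      · simp [hk0 _ ht]
      · rw [hF, hFw]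
        simp only
        rw [indicator_of_mem (by simp only [mem_Ioi]; linarith), ← add_assoc, add_sub_cancel_right,
          show -(β * (v + t + m)) = -(β * (v + m)) + -(β * (t + m - m)) by ring, Real.exp_add]
        push_cast
        ring
    rw [e1, e2, e3, ← one_mul (g v), ← hee (v + m), mul_comm ((Real.exp (β * (v + m)) : ℂ)),
      mul_assoc, ← hv.2]
    push_cast
    ring
  have hFφ : ∀ φ, IsTest m φ → (∫ u, F u * φ (u - m)) + a * (∫ u, F u * φ (u - m')) +
      ∫ t, k t * ∫ u, F u * φ (u - t) = ∫ v, g v * φ v := by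
    intro φ hφ
    obtain ⟨M, -, hM⟩ := hφ.exists_bound
    obtain ⟨i3, e3⟩ := hφ.integral_mul_integral hk hFi
    have i1 : ∀ b, Integrable fun v => F (v + b) * φ v := fun b =>
      (hFi.comp_add_right b).mul_bdd (c := M) hφ.continuous_ofReal.aestronglyMeasurable
        (Eventually.of_forall hM)
    have e1 : ∀ b, ∫ u, F u * φ (u - b) = ∫ v, F (v + b) * φ v := fun b => by
      rw [← integral_add_right_eq_self (fun u => F u * φ (u - b)) b]
      simp only [add_sub_cancel_right]
    have i2 : Integrable fun v => F (v + m) * φ v + a * (F (v + m') * φ v) :=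
      (i1 m).add ((i1 m').const_mul _)
    rw [e1, e1, e3, ← integral_const_mul, ← integral_add (i1 m) ((i1 m').const_mul _),
      ← integral_add i2 i3]
    refine integral_congr_ae ?_
    filter_upwards [hFeq] with v hv
    rcases lt_or_ge m v with hmv | hmv
    · rw [← hv hmv]
      ring
    · simp [hφ.eq_zero hmv]
  intro ψ hψ
  -- A test function beyond `2m` is the translate by `m` of one beyond `m`, which is where the
  -- equation may be used.
  have hφ : IsTest m fun u => ψ (u - -m) := (hψ.comp_sub (-m)).mono (by linarith)
  set φ : ℝ → ℝ := fun u => ψ (u - -m) with hφdef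
  -- The defect `N` on translates satisfies the homogeneous equation and is bounded in the weighted
  -- norm, so it vanishes; the claim is its value at `s = m`.
  set N : ℝ → ℂ := fun s => (L fun u => φ (u - s)) - ∫ u, F u * φ (u - s) with hN
  obtain ⟨C, hC⟩ := hLb φ hφ
  obtain ⟨M, hM0, hM⟩ := hφ.exists_bound
  have hmul : ∀ {D : ℝ → ℂ} {s : ℝ}, 0 ≤ s → Continuous D → (∃ c, ∀ t, m ≤ t → ‖D t‖ ≤ c) →
      Integrable fun t => k t * D (t + s) := by
    rintro D s hs hD ⟨c, hc⟩
    refine (hk.norm.mul_const c).mono' (hk.aestronglyMeasurable.mul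
      (hD.comp (continuous_add_const s)).aestronglyMeasurable) (Eventually.of_forall fun t => ?_)
    rcases lt_or_ge t m with ht | ht
    · simp [hk0 t ht]
    · rw [norm_mul]
      exact mul_le_mul_of_nonneg_left (hc _ (by linarith)) (norm_nonneg _)
  have hFb : ∀ s, m ≤ s → Real.exp (β * s) * ‖∫ u, F u * φ (u - s)‖ ≤
      M * Real.exp (-(β * m)) * ∫ u, ‖Fw u‖ := by
    intro s _
    rw [← integral_const_mul, ← abs_of_pos (Real.exp_pos (β * s)), ← Real.norm_eq_abs,
      ← Complex.norm_real, ← norm_mul, ← integral_const_mul]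
    refine norm_integral_le_of_norm_le (hwi.norm.const_mul _) (Eventually.of_forall fun u => ?_)
    rcases le_or_gt (u - s) m with hu | hu
    · rw [hφ.eq_zero hu]
      simpa using by positivity
    · rw [hF]
      simp only [norm_mul]
      have h1 : ‖(Real.exp (β * s) : ℂ)‖ * ‖(Real.exp (-(β * u)) : ℂ)‖ ≤ Real.exp (-(β * m)) := by
        rw [Complex.norm_real, Complex.norm_real, Real.norm_of_nonneg (Real.exp_pos _).le,
          Real.norm_of_nonneg (Real.exp_pos _).le, ← Real.exp_add]
        exact Real.exp_le_exp.2 (by nlinarith)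
      calc _ = ‖(φ (u - s) : ℂ)‖ * (‖(Real.exp (β * s) : ℂ)‖ * ‖(Real.exp (-(β * u)) : ℂ)‖) *
            ‖Fw u‖ := by ring
        _ ≤ _ := by gcongr; exact hM _
  have hLb' : ∃ c, ∀ t, m ≤ t → ‖L fun u => φ (u - t)‖ ≤ c := by
    refine ⟨Real.exp (-(β * m)) * C, fun t ht => ?_⟩
    have h1 := hC t ht
    have h2 : ‖L fun u => φ (u - t)‖ = Real.exp (-(β * t)) *
        (Real.exp (β * t) * ‖L fun u => φ (u - t)‖) := by
      rw [← mul_assoc, ← Real.exp_add]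
      simp
    rw [h2]
    have h3 : Real.exp (-(β * t)) ≤ Real.exp (-(β * m)) :=
      Real.exp_le_exp.2 (neg_le_neg (mul_le_mul_of_nonneg_left ht hβ))
    exact mul_le_mul h3 h1 (by positivity) (Real.exp_pos _).le
  have hFb' : ∃ c, ∀ t, m ≤ t → ‖∫ u, F u * φ (u - t)‖ ≤ c := by
    refine ⟨∫ u, ‖F u‖ * M, fun t _ => norm_integral_le_of_norm_le (hFi.norm.mul_const M)
      (Eventually.of_forall fun u => ?_)⟩
    rw [norm_mul]
    exact mul_le_mul_of_nonneg_left (hM _) (norm_nonneg _)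
  have hvan := eq_zero_of_correlation_eq_zero (N := N) (a := a) hmm hk0 hki2 hsmall
    (fun s hs => ?_) (C := C + M * Real.exp (-(β * m)) * ∫ u, ‖Fw u‖) (fun s hs => ?_) (le_refl m)
  · simp only [hN, hφdef, sub_neg_eq_add, sub_add_cancel] at hvan
    exact sub_eq_zero.1 hvan
  · have h1 := hL _ ((hφ.comp_sub s).mono (by linarith))
    rw [← hFφ _ ((hφ.comp_sub s).mono (by linarith))] at h1
    simp only [sub_sub] at h1
    simp only [hN, mul_sub]
    rw [integral_sub (hmul hs (hLc φ hφ) hLb') (hmul hs (hφ.continuous_integral hFi) hFb')]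
    linear_combination h1
  · rw [hN]
    calc _ ≤ Real.exp (β * s) * (‖L fun u => φ (u - s)‖ + ‖∫ u, F u * φ (u - s)‖) := by
          gcongr
          exact norm_sub_le _ _
      _ ≤ _ := by
          rw [mul_add]
          exact add_le_add (hC s hs) (hFb s hs)

end Correlation

/-! ### The equation for the inverse Fourier transform of `S₀ - S` -/

/-- Finite sums of decaying exponentials. -/
noncomputable def expSum (s : Finset ℝ) (c : ℝ → ℂ) (y : ℝ) : ℂ :=
  ∑ k ∈ s, c k * Complex.exp (-(k * y))

theorem cexp_I_mul_I (k y : ℝ) :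
    Complex.exp (Complex.I * (Complex.I * k) * y) = Complex.exp (-(k * y)) := by
  rw [← mul_assoc, Complex.I_mul_I]
  congr 1
  ring

theorem continuous_expSum (s : Finset ℝ) (c : ℝ → ℂ) : Continuous (expSum s c) := by
  unfold expSum
  fun_prop

theorem integrableOn_expSum {s : Finset ℝ} (hs : ∀ k ∈ s, 0 < k) (c : ℝ → ℂ) (b : ℝ) :
    IntegrableOn (expSum s c) (Ioi b) := by
  refine integrable_finsetSum _ fun k hk => Integrable.const_mul ?_ _
  have h1 : IntegrableOn (fun y : ℝ => Real.exp (-k * y)) (Ioi b) :=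
    integrableOn_exp_mul_Ioi (neg_lt_zero.2 (hs k hk)) b
  have h2 := h1.ofReal (𝕜 := ℂ)
  refine h2.congr (Eventually.of_forall fun y => ?_)
  simp [Complex.ofReal_exp]

theorem integral_mul_expSum {s : Finset ℝ} (hs : ∀ k ∈ s, 0 < k) (c : ℝ → ℂ) {g : ℝ → ℂ}
    (hg : Integrable g) {b : ℝ} (hb : ∀ u < b, g u = 0) :
    Integrable (fun y => g y * expSum s c y) ∧
      ∫ y, g y * expSum s c y = ∑ k ∈ s, c k * ft g (Complex.I * k) := by
  have h1 : ∀ k ∈ s, Integrable fun y : ℝ => g y * (c k * Complex.exp (-(k * y))) := by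
    intro k hk
    have h2 := (integrable_ft hg hb (z := Complex.I * k) (by simpa using (hs k hk).le)).const_mul (c k)
    refine h2.congr (Eventually.of_forall fun y => ?_)
    simp only [cexp_I_mul_I]
    ring
  simp only [expSum, Finset.mul_sum]
  refine ⟨integrable_finsetSum _ h1, ?_⟩
  rw [integral_finsetSum _ h1]
  refine Finset.sum_congr rfl fun k _ => ?_
  rw [ft, ← integral_const_mul]
  congr 1 with y
  rw [cexp_I_mul_I]
  ring

theorem IsTest.integral_ft_neg_mul_rft {m : ℝ} {φ : ℝ → ℝ} (hφ : IsTest m φ) {g : ℝ → ℂ}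
    (hg : Integrable g) :
    ∫ l : ℝ, ft g (-l) * rft φ l = 2 * Real.pi * ∫ t, g t * φ t := by
  have h1 := integral_mul_ft hg hφ.integrable_rft.comp_neg
  rw [← integral_neg_eq_self, ← integral_const_mul]
  simp only [Complex.ofReal_neg, neg_neg] at h1 ⊢
  simp only [mul_comm (ft g _)]
  rw [← h1]
  congr 1 with t
  rw [mul_left_comm, ← hφ.integral_cexp_mul_rft t, ft, ← integral_neg_eq_self]
  congr 2 with l
  push_cast
  rw [neg_neg, mul_comm]
  congr 2
  ring

namespace ScatteringProblem

/-- The standing assumptions. -/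
structure Regular (P : ScatteringProblem) : Prop where
  adm : P.Admissible
  d1 : P.delta1 ≤ 0
  d2 : P.delta2 ≤ 0
  d3 : 0 ≤ P.delta3
  ab : ∀ z : ℂ, 0 < z.im → ¬ (P.coeffA z = 0 ∧ P.coeffB z = 0)

variable {P : ScatteringProblem}

/-- The finite set of eigenvalues. -/
noncomputable def Regular.eig (h : P.Regular) : Finset ℝ :=
  (finite_eigenSet h.adm h.d1 h.d2 h.d3 h.ab).toFinset

theorem Regular.mem_eig (h : P.Regular) {k : ℝ} : k ∈ h.eig ↔ k ∈ P.eigenSet :=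
  Set.Finite.mem_toFinset _

theorem Regular.eig_pos (h : P.Regular) : ∀ k ∈ h.eig, 0 < k := fun _ hk => (h.mem_eig.1 hk).1

theorem Regular.finsum_eq (h : P.Regular) (c : ℝ → ℂ) :
    ∑ᶠ k ∈ P.eigenSet, c k = ∑ k ∈ h.eig, c k := finsum_mem_eq_finite_toFinset_sum _ _

/-- `S₀` is `τ exp(-2ila)` plus boundary values of a function holomorphic in the upper half plane
whose exponential growth is compensated by test functions supported beyond `2 μ⁺(0)`. On such test
functions its inverse transform is therefore the point mass `τ` at `2a`, the origin of the term `τ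
K(x, 2a - y)` in the main equation. -/
theorem integral_S0_mul_rft (h : P.Admissible) {ψ : ℝ → ℝ} (hψ : IsTest (2 * P.muPlus 0) ψ) :
    ∫ l : ℝ, P.S0 l * rft ψ l = 2 * Real.pi * (P.tau * ψ (2 * P.a)) := by
  -- The sign `s` treats both forms of `S₀` at once.
  obtain ⟨s, hs, hS⟩ : ∃ s : ℝ, (s = 1 ∨ s = -1) ∧ ∀ l, P.S0 l =
      s * Complex.exp (-2 * Complex.I * l * P.a) *
      ((1 + s * P.tau * Complex.exp (-2 * Complex.I * l * P.α * P.a)) /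
        (Complex.exp (-2 * Complex.I * l * P.α * P.a) + s * P.tau)) := by
    by_cases hβ : P.β₂ = 0
    · exact ⟨1, Or.inl rfl, fun l => by simp [S0, hβ]⟩
    · refine ⟨-1, Or.inr rfl, fun l => ?_⟩
      simp only [S0, hβ, if_false, Complex.ofReal_neg, Complex.ofReal_one, neg_mul, one_mul,
        ← sub_eq_add_neg]
  have hs2 : (s : ℂ) * s = 1 := by rcases hs with rfl | rfl <;> simp
  have hsa : |s| = 1 := by rcases hs with rfl | rfl <;> simp
  have hτ := abs_tau_lt h
  set b := 2 * P.α * P.a with hb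
  have hb0 : 0 ≤ b := by have := h.α_pos; have := h.a_pos; positivity
  have hm0 : 2 * P.muPlus 0 = 2 * P.a - b := by
    rw [muPlus_eq, nu_of_lt h h.a_pos, hb]
    ring
  obtain ⟨ψd, ψc, C, hC⟩ := hψ.rft_mem_hardyClass
  set D : ℂ → ℂ := fun z => 1 + s * P.tau * Complex.exp (Complex.I * z * b) with hD
  -- Because `|τ| < 1` and `b ≥ 0`, the denominator stays away from zero in the closed upper half
  -- plane.
  have hDn : ∀ z : ℂ, 0 ≤ z.im → 1 - |P.tau| ≤ ‖D z‖ := fun z hz => by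
    have h1 : ‖(s : ℂ) * P.tau * Complex.exp (Complex.I * z * b)‖ ≤ |P.tau| := by
      rw [norm_mul, norm_mul, Complex.norm_real, Complex.norm_real, Real.norm_eq_abs,
        Real.norm_eq_abs, hsa, one_mul]
      refine mul_le_of_le_one_right (abs_nonneg _) ?_
      have := norm_cexp_le hz hb0
      simpa using this
    have h2 := norm_sub_le (D z) ((s : ℂ) * P.tau * Complex.exp (Complex.I * z * b))
    rw [hD] at h2 ⊢
    simp only [add_sub_cancel_right, norm_one] at h2
    simp only
    linarith
  have hD0 : ∀ z : ℂ, 0 ≤ z.im → D z ≠ 0 := fun z hz h0 => by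
    have := hDn z hz
    rw [h0, norm_zero] at this
    linarith
  set H : ℂ → ℂ := fun z => Complex.exp (Complex.I * z * (-(2 * P.muPlus 0) : ℝ)) / D z * rft ψ z
    with hH
  have hdiff : Differentiable ℂ D := by rw [hD]; fun_prop
  have hcont : ContinuousOn H {z | 0 ≤ z.im} :=
    (ContinuousOn.div (by fun_prop) hdiff.continuous.continuousOn fun z hz => hD0 z hz).mul ψc
  have hHb : ∫ l : ℝ, H l = 0 := by
    refine integral_boundary_eq_zero (H := H) (C := C / (1 - |P.tau|)) ?_ (fun z hz => ?_)
      (Eventually.of_forall fun l => ?_)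
    · exact (DifferentiableOn.div (by fun_prop) hdiff.differentiableOn
        fun z hz => hD0 z (le_of_lt hz)).mul ψd
    · have h1 := hC z hz.le
      have h2 := hDn z hz.le
      have h3 : 0 < 1 - |P.tau| := by linarith
      rw [hH]
      simp only
      rw [norm_mul, norm_div, Complex.norm_exp]
      have h4 : (Complex.I * z * ((-(2 * P.muPlus 0) : ℝ) : ℂ)).re = z.im * (2 * P.muPlus 0) := by
        simp
      rw [h4]
      calc _ ≤ Real.exp (z.im * (2 * P.muPlus 0)) / (1 - |P.tau|) *
            (C * Real.exp (-(z.im * (2 * P.muPlus 0))) / (1 + ‖z‖ ^ 2)) := by gcongr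
        _ = (Real.exp (z.im * (2 * P.muPlus 0)) * Real.exp (-(z.im * (2 * P.muPlus 0)))) *
            (C / (1 - |P.tau|) / (1 + ‖z‖ ^ 2)) := by ring
        _ = _ := by rw [← Real.exp_add]; simp
    · have h1 : Tendsto (fun ε : ℝ => (l : ℂ) + ε * Complex.I) (𝓝[>] 0)
          (𝓝[{z | 0 ≤ z.im}] (l : ℂ)) := by
        refine tendsto_nhdsWithin_iff.2 ⟨?_, ?_⟩
        · have : Tendsto (fun ε : ℝ => (l : ℂ) + ε * Complex.I) (𝓝 0)
              (𝓝 ((l : ℂ) + (0 : ℝ) * Complex.I)) :=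
            (by fun_prop : Continuous fun ε : ℝ => (l : ℂ) + ε * Complex.I).tendsto 0
          rw [Complex.ofReal_zero, zero_mul, add_zero] at this
          exact this.mono_left nhdsWithin_le_nhds
        · filter_upwards [self_mem_nhdsWithin] with ε hε
          simpa using le_of_lt (mem_Ioi.1 hε)
      exact (hcont (l : ℂ) (by simp)).tendsto.comp h1
  have key : ∀ l : ℝ, P.S0 l * rft ψ l =
      P.tau * (Complex.exp (-(Complex.I * l * (2 * P.a : ℝ))) * rft ψ l) +
        s * (1 - P.tau ^ 2) * H l := by
    intro l
    have hw : Complex.exp (-2 * Complex.I * l * P.α * P.a) * Complex.exp (Complex.I * l * b) = 1 := by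
      rw [← Complex.exp_add, hb, ← Complex.exp_zero]
      push_cast
      congr 1
      ring
    have hv : Complex.exp (Complex.I * l * (-(2 * P.muPlus 0) : ℝ)) =
        Complex.exp (-2 * Complex.I * l * P.a) * Complex.exp (Complex.I * l * b) := by
      rw [← Complex.exp_add, hm0]
      push_cast
      congr 1
      ring
    have hu : Complex.exp (-(Complex.I * l * (2 * P.a : ℝ))) =
        Complex.exp (-2 * Complex.I * l * P.a) := by
      congr 1
      push_cast
      ring
    have hd := hD0 l (by simp)
    rw [hS, hH]
    simp only
    rw [hv, hu]
    rw [hD] at hd ⊢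
    simp only at hd ⊢
    set u := Complex.exp (-2 * Complex.I * l * P.a)
    set w := Complex.exp (-2 * Complex.I * l * P.α * P.a)
    set v := Complex.exp (Complex.I * l * b)
    have hw0 : w ≠ 0 := left_ne_zero_of_mul_eq_one hw
    have hden : w + s * P.tau = w * (1 + s * P.tau * v) := by
      linear_combination (-(s * P.tau : ℂ)) * hw
    rw [hden]
    field_simp
    linear_combination (P.tau * rft ψ l * u * w) * hs2 - s * rft ψ l * u * hw
  simp only [key]
  rw [integral_add, integral_const_mul, integral_const_mul, hHb, hψ.integral_cexp_mul_rft]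
  · ring
  · refine (hψ.integrable_rft.bdd_mul (c := 1) (by fun_prop : Continuous fun l : ℝ =>
      Complex.exp (-(Complex.I * l * (2 * P.a : ℝ)))).aestronglyMeasurable
      (Eventually.of_forall fun l => ?_)).const_mul _
    rw [show -(Complex.I * l * ((2 * P.a : ℝ) : ℂ)) = ((-(l * (2 * P.a)) : ℝ) : ℂ) * Complex.I by
      push_cast; ring, Complex.norm_exp_ofReal_mul_I]
  · refine Integrable.const_mul ?_ _
    refine (hψ.integrable_rft.norm.const_mul (1 / (1 - |P.tau|))).mono'
      (hcont.comp_continuous Complex.continuous_ofReal fun l => by simp).aestronglyMeasurable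
      (Eventually.of_forall fun l => ?_)
    rw [hH, norm_mul, norm_div, show Complex.I * l * ((-(2 * P.muPlus 0) : ℝ) : ℂ) =
      ((-(l * (2 * P.muPlus 0)) : ℝ) : ℂ) * Complex.I by push_cast; ring,
      Complex.norm_exp_ofReal_mul_I]
    exact mul_le_mul_of_nonneg_right
      (one_div_le_one_div_of_le (by linarith) (hDn l (by simp))) (norm_nonneg _)

end ScatteringProblem

theorem integrable_mul_rft {v : ℝ → ℂ} {C : ℝ} (hv : AEStronglyMeasurable v)
    (hC : ∀ᵐ l, ‖v l‖ ≤ C) {m : ℝ} {φ : ℝ → ℝ} (hφ : IsTest m φ) :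
    Integrable fun l : ℝ => v l * rft φ l :=
  hφ.integrable_rft.bdd_mul (c := C) hv hC

theorem integral_mul_rft_comp_sub (v : ℝ → ℂ) (φ : ℝ → ℝ) (s : ℝ) :
    ∫ l : ℝ, v l * rft (fun u => φ (u - s)) l = ft (fun l : ℝ => v l * rft φ l) s := by
  rw [ft]
  congr 1 with l
  rw [rft_comp_sub, mul_right_comm Complex.I]
  ring

namespace ScatteringProblem

variable {P : ScatteringProblem}

/-- The inverse Fourier transform of `S₀ - S` as a functional. -/
noncomputable def lam (P : ScatteringProblem) (φ : ℝ → ℝ) : ℂ :=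
  1 / (2 * (Real.pi : ℂ)) * ∫ l : ℝ, (P.S0 l - P.S l) * rft φ l

theorem lam_comp_sub (φ : ℝ → ℝ) (s : ℝ) : P.lam (fun u => φ (u - s)) =
    1 / (2 * (Real.pi : ℂ)) * ft (fun l : ℝ => (P.S0 l - P.S l) * rft φ l) s := by
  rw [lam, integral_mul_rft_comp_sub]

theorem integrable_S_mul_rft (h : P.Regular) {m : ℝ} {φ : ℝ → ℝ} (hφ : IsTest m φ) :
    Integrable fun l : ℝ => P.S l * rft φ l :=
  integrable_mul_rft (aestronglyMeasurable_S h.adm) (ae_norm_S_le h.adm h.d1 h.d3) hφ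

theorem integrable_S0_mul_rft (h : P.Regular) {m : ℝ} {φ : ℝ → ℝ} (hφ : IsTest m φ) :
    Integrable fun l : ℝ => P.S0 l * rft φ l :=
  integrable_mul_rft (continuous_S0 h.adm).aestronglyMeasurable
    (Eventually.of_forall (norm_S0_le h.adm)) hφ

theorem integrable_S0_sub_S_mul_rft (h : P.Regular) {m : ℝ} {φ : ℝ → ℝ} (hφ : IsTest m φ) :
    Integrable fun l : ℝ => (P.S0 l - P.S l) * rft φ l := by
  simp only [sub_mul]
  exact (integrable_S0_mul_rft h hφ).sub (integrable_S_mul_rft h hφ)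

theorem lam_eq (h : P.Regular) {ψ : ℝ → ℝ} (hψ : IsTest (2 * P.muPlus 0) ψ) :
    P.lam ψ = P.tau * ψ (2 * P.a) - 1 / (2 * (Real.pi : ℂ)) * ∫ l : ℝ, P.S l * rft ψ l := by
  rw [lam]
  simp only [sub_mul]
  rw [integral_sub (integrable_S0_mul_rft h hψ) (integrable_S_mul_rft h hψ),
    integral_S0_mul_rft h.adm hψ, mul_sub, ← mul_assoc, one_div_mul_cancel, one_mul]
  simp [Real.pi_ne_zero]

theorem integrable_ofReal_jostKer (h : P.Admissible) {x : ℝ} (hx : 0 ≤ x) :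
    Integrable fun y => (P.jostKer x y : ℂ) := (integrable_jostKer h hx).ofReal

theorem jostFun_eq (x : ℝ) (z : ℂ) : P.jostFun x z =
    P.cPlus x * Complex.exp (Complex.I * z * P.muPlus x) +
      P.cMinus x * Complex.exp (Complex.I * z * P.muMinus x) +
      ft (fun y => (P.jostKer x y : ℂ)) z := by
  rw [jostFun, e0_eq, ft]

theorem integral_conj_jostFun_mul_rft (h : P.Admissible) {x : ℝ} (hx : 0 ≤ x) {m : ℝ} {φ : ℝ → ℝ}
    (hφ : IsTest m φ) : ∫ l : ℝ, starRingEnd ℂ (P.jostFun x l) * rft φ l =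
      2 * Real.pi * (P.cPlus x * φ (P.muPlus x) + P.cMinus x * φ (P.muMinus x) +
        ∫ t, (P.jostKer x t : ℂ) * φ t) := by
  have hK := integrable_ofReal_jostKer h hx
  have hexp : ∀ b : ℝ, Integrable fun l : ℝ => Complex.exp (-(Complex.I * l * b)) * rft φ l :=
    fun b => integrable_mul_rft (C := 1) (by fun_prop : Continuous fun l : ℝ =>
      Complex.exp (-(Complex.I * l * b))).aestronglyMeasurable (Eventually.of_forall fun l => by
        rw [show -(Complex.I * l * (b : ℂ)) = ((-(l * b) : ℝ) : ℂ) * Complex.I by push_cast; ring,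
          Complex.norm_exp_ofReal_mul_I]) hφ
  have i3 : Integrable fun l : ℝ => ft (fun y => (P.jostKer x y : ℂ)) (-l) * rft φ l := by
    have := (continuous_ft_ofReal hK).comp continuous_neg
    simp only [Function.comp_def, Complex.ofReal_neg] at this
    refine integrable_mul_rft (C := ∫ t, ‖(P.jostKer x t : ℂ)‖) this.aestronglyMeasurable
      (Eventually.of_forall fun l => ?_) hφ
    rw [← Complex.ofReal_neg]
    exact norm_ft_ofReal_le _ (-l)
  have e1 : ∀ l : ℝ, starRingEnd ℂ (P.jostFun x l) * rft φ l =
      P.cPlus x * (Complex.exp (-(Complex.I * l * P.muPlus x)) * rft φ l) +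
      P.cMinus x * (Complex.exp (-(Complex.I * l * P.muMinus x)) * rft φ l) +
      ft (fun y => (P.jostKer x y : ℂ)) (-l) * rft φ l := by
    intro l
    rw [← jostFun_neg_conj h, Complex.conj_ofReal, jostFun_eq]
    simp only [mul_neg, neg_mul]
    ring
  simp only [e1]
  have i12 := ((hexp (P.muPlus x)).const_mul (P.cPlus x : ℂ)).add
    ((hexp (P.muMinus x)).const_mul (P.cMinus x : ℂ))
  simp only [Pi.add_def] at i12
  rw [integral_add i12 i3, integral_add ((hexp _).const_mul _) ((hexp _).const_mul _),
    integral_const_mul, integral_const_mul, hφ.integral_cexp_mul_rft, hφ.integral_cexp_mul_rft,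
    hφ.integral_ft_neg_mul_rft hK]
  ring

/-- Multiplication by the Jost solution acts on test functions as translation by `μ⁺(x)` and `μ⁻(x)`
and averaging over `jostKer`; this gives the equation its correlation form. -/
theorem integral_mul_jostFun_mul_rft (h : P.Admissible) {x : ℝ} (hx : 0 ≤ x) {v : ℝ → ℂ}
    {φ : ℝ → ℝ} (hv : Integrable fun l : ℝ => v l * rft φ l) :
    ∫ l : ℝ, v l * P.jostFun x l * rft φ l =
      P.cPlus x * (∫ l : ℝ, v l * rft (fun u => φ (u - P.muPlus x)) l) +
      P.cMinus x * (∫ l : ℝ, v l * rft (fun u => φ (u - P.muMinus x)) l) +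
      ∫ t, (P.jostKer x t : ℂ) * ∫ l : ℝ, v l * rft (fun u => φ (u - t)) l := by
  have hK := integrable_ofReal_jostKer h hx
  simp only [integral_mul_rft_comp_sub]
  rw [integral_mul_ft hK hv, ft, ft, ← integral_const_mul, ← integral_const_mul]
  have hexp := integrable_ft_ofReal hv
  have i3 : Integrable fun l : ℝ => v l * rft φ l * ft (fun y => (P.jostKer x y : ℂ)) l :=
    hv.mul_bdd (c := ∫ t, ‖(P.jostKer x t : ℂ)‖) (continuous_ft_ofReal hK).aestronglyMeasurable
      (Eventually.of_forall fun l => norm_ft_ofReal_le _ l)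
  have i12 := ((hexp (P.muPlus x)).const_mul (P.cPlus x : ℂ)).add
    ((hexp (P.muMinus x)).const_mul (P.cMinus x : ℂ))
  simp only [Pi.add_def] at i12
  rw [← integral_add ((hexp _).const_mul _) ((hexp _).const_mul _), ← integral_add i12 i3]
  congr 1 with l
  rw [jostFun_eq, mul_right_comm Complex.I (l : ℂ), mul_right_comm Complex.I (l : ℂ)]
  ring

theorem muMinus_eq_sub (x : ℝ) : P.muMinus x = 2 * P.a - P.muPlus x := by
  rw [muMinus_eq, muPlus_eq]
  ring

/-- For `x < a` one has `τ c₊ = c₋`, so the point mass of `S₀` at `2a` cancels the reflected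
exponential of the conjugate Jost solution. This is what `S₀` is made for. For `x ≥ a` both sides
vanish. -/
theorem tau_mul_test_add (h : P.Admissible) {x : ℝ} {φ : ℝ → ℝ} (hφ : IsTest (P.muPlus x) φ) :
    P.tau * (P.cPlus x * φ (2 * P.a - P.muPlus x) + P.cMinus x * φ (2 * P.a - P.muMinus x)) =
      P.cMinus x * φ (P.muMinus x) := by
  rw [muMinus_eq_sub, sub_sub_cancel, hφ.eq_zero le_rfl, mul_zero, add_zero, ← mul_assoc]
  rcases lt_or_ge x P.a with hx | hx
  · congr 1
    rw [cPlus, cMinus, sqrtRho_of_lt h hx, tau]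
    have := h.α_pos
    field_simp
  · rw [cMinus_of_le hx, hφ.eq_zero, mul_zero, zero_mul]
    rw [muPlus_of_le hx]
    linarith

/-- The equation for the inverse Fourier transform of `S₀ - S`. -/
theorem exists_lam_equation (h : P.Regular) {x : ℝ} (hx : 0 ≤ x) : ∃ c : ℝ → ℂ,
    ∀ φ, IsTest (P.muPlus x) φ →
      P.cPlus x * P.lam (fun u => φ (u - P.muPlus x)) +
      P.cMinus x * P.lam (fun u => φ (u - P.muMinus x)) +
      ∫ t, (P.jostKer x t : ℂ) * P.lam (fun u => φ (u - t)) =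
      ∫ y, (P.tau * P.jostKer x (2 * P.a - y) - P.jostKer x y + expSum h.eig c y) * φ y := by
  obtain ⟨c, hc⟩ := exists_integral_jump_eq h.adm h.d1 h.d2 h.d3 h.ab hx
  have hpi : (2 * Real.pi : ℂ) ≠ 0 := by simp [Real.pi_ne_zero]
  refine ⟨fun k => 1 / (2 * Real.pi) * c k, fun φ hφ => ?_⟩
  have hK := integrable_ofReal_jostKer h.adm hx
  obtain ⟨M, -, hM⟩ := hφ.exists_bound
  have hmono : 2 * P.muPlus 0 ≤ P.muPlus x + P.muPlus x := by
    have := (muPlus_strictMono h.adm).monotone hx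
    linarith
  -- Translates by `t ≥ μ⁺(x)` are supported beyond `2 μ⁺(x) ≥ 2 μ⁺(0)`, where the transform of `S₀`
  -- is known.
  have hlam : ∀ t, P.muPlus x ≤ t → P.lam (fun u => φ (u - t)) = P.tau * φ (2 * P.a - t) -
      1 / (2 * (Real.pi : ℂ)) * ∫ l : ℝ, P.S l * rft (fun u => φ (u - t)) l := fun t ht =>
    lam_eq h ((hφ.comp_sub t).mono (by linarith))
  have hS := integrable_S_mul_rft h hφ
  have i1 : Integrable fun t => (P.jostKer x t : ℂ) * φ (2 * P.a - t) :=
    hK.mul_bdd (c := M) (hφ.continuous_ofReal.comp (continuous_const.sub continuous_id)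
      ).aestronglyMeasurable (Eventually.of_forall fun t => hM _)
  have i2 : Integrable fun t => (P.jostKer x t : ℂ) *
      ∫ l : ℝ, P.S l * rft (fun u => φ (u - t)) l := by
    simp only [integral_mul_rft_comp_sub]
    exact hK.mul_bdd (continuous_ft_ofReal hS).aestronglyMeasurable
      (Eventually.of_forall fun t => norm_ft_ofReal_le _ t)
  have e3 : ∫ t, (P.jostKer x t : ℂ) * P.lam (fun u => φ (u - t)) =
      P.tau * (∫ t, (P.jostKer x t : ℂ) * φ (2 * P.a - t)) - 1 / (2 * (Real.pi : ℂ)) *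
        ∫ t, (P.jostKer x t : ℂ) * ∫ l : ℝ, P.S l * rft (fun u => φ (u - t)) l := by
    rw [← integral_const_mul, ← integral_const_mul,
      ← integral_sub (i1.const_mul _) (i2.const_mul _)]
    congr 1 with t
    rcases lt_or_ge t (P.muPlus x) with ht | ht
    · simp [jostKer_eq_zero h.adm hx ht]
    · rw [hlam t ht]
      ring
  have e2 : (P.cMinus x : ℂ) * P.lam (fun u => φ (u - P.muMinus x)) = P.cMinus x *
      (P.tau * φ (2 * P.a - P.muMinus x) -
      1 / (2 * (Real.pi : ℂ)) * ∫ l : ℝ, P.S l * rft (fun u => φ (u - P.muMinus x)) l) := by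
    rcases cMinus_eq_zero_or h.adm x with h0 | h0
    · simp [h0]
    · rw [hlam _ h0]
  -- The jump relation for `Ψ = rft φ`. The values of `Ψ` at the eigenvalues become the exponential
  -- sum, as `rft φ (ik)` is the integral of `φ(y) exp(-ky)`.
  have hj := hc _ hφ.rft_mem_hardyClass
  rw [h.finsum_eq] at hj
  simp only [sub_mul] at hj
  have b1 : Integrable fun l : ℝ => P.S l * P.jostFun x l * rft φ l := by
    have hcont : Continuous fun l : ℝ => P.jostFun x l :=
      (continuousOn_jostFun h.adm hx).comp_continuous Complex.continuous_ofReal fun l => by simp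
    refine (hS.mul_bdd (c := P.jostConst) hcont.aestronglyMeasurable
      (Eventually.of_forall fun l => ?_)).congr (Eventually.of_forall fun l => by ring_nf)
    simpa using norm_jostFun_le h.adm hx (z := (l : ℂ)) (by simp)
  have b0 : Integrable fun l : ℝ => starRingEnd ℂ (P.jostFun x l) * rft φ l := by
    have hcont : Continuous fun l : ℝ => P.jostFun x l :=
      (continuousOn_jostFun h.adm hx).comp_continuous Complex.continuous_ofReal fun l => by simp
    refine integrable_mul_rft (C := P.jostConst)
      (Complex.continuous_conj.comp hcont).aestronglyMeasurable (Eventually.of_forall fun l => ?_) hφ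
    rw [Function.comp_apply, RCLike.norm_conj]
    simpa using norm_jostFun_le h.adm hx (z := (l : ℂ)) (by simp)
  rw [integral_sub b0 b1, integral_conj_jostFun_mul_rft h.adm hx hφ,
    integral_mul_jostFun_mul_rft h.adm hx hS, hφ.eq_zero le_rfl, Complex.ofReal_zero,
    mul_zero, zero_add] at hj
  have hτ := congrArg (fun r : ℝ => (r : ℂ)) (tau_mul_test_add h.adm hφ)
  push_cast at hτ
  have i4 : Integrable fun t => (P.jostKer x t : ℂ) * φ t :=
    hK.mul_bdd (c := M) hφ.continuous_ofReal.aestronglyMeasurable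
      (Eventually.of_forall fun t => hM _)
  have e5 : ∫ y, (P.jostKer x (2 * P.a - y) : ℂ) * φ y =
      ∫ t, (P.jostKer x t : ℂ) * φ (2 * P.a - t) := by
    rw [← integral_sub_left_eq_self (fun t => (P.jostKer x t : ℂ) * φ (2 * P.a - t)) _ (2 * P.a)]
    simp only [sub_sub_cancel]
  have i5 : Integrable fun y => (P.jostKer x (2 * P.a - y) : ℂ) * φ y :=
    (hK.comp_sub_left (2 * P.a)).mul_bdd (c := M) hφ.continuous_ofReal.aestronglyMeasurable
      (Eventually.of_forall fun t => hM _)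
  obtain ⟨i6, e6⟩ := integral_mul_expSum h.eig_pos (fun k => 1 / (2 * Real.pi) * c k)
    hφ.integrable hφ.ofReal_eq_zero
  have e7 : ∫ y, (P.tau * P.jostKer x (2 * P.a - y) - P.jostKer x y +
      expSum h.eig (fun k => 1 / (2 * Real.pi) * c k) y) * φ y =
      P.tau * (∫ t, (P.jostKer x t : ℂ) * φ (2 * P.a - t)) - (∫ t, (P.jostKer x t : ℂ) * φ t) +
        1 / (2 * Real.pi) * ∑ k ∈ h.eig, c k * rft φ (Complex.I * k) := by
    rw [← e5, Finset.mul_sum]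
    simp only [rft, ← mul_assoc]
    rw [← e6, ← integral_const_mul, ← integral_sub (i5.const_mul _) i4, ← integral_add _ i6]
    · congr 1 with y
      ring
    · exact (i5.const_mul _).sub i4
  rw [e7, e3, e2, hlam _ le_rfl]
  have hpi2 : 1 / (2 * Real.pi : ℂ) * (2 * Real.pi) = 1 := one_div_mul_cancel hpi
  linear_combination hτ + 1 / (2 * Real.pi : ℂ) * hj - (P.cMinus x * φ (P.muMinus x) +
    ∫ t, (P.jostKer x t : ℂ) * φ t) * hpi2

end ScatteringProblem

/-! ### Integrability of the inverse Fourier transform of `S₀ - S` -/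

theorem integral_indicator_mul_test {m : ℝ} {φ : ℝ → ℝ} (hφ : IsTest m φ) (G : ℝ → ℂ) :
    ∫ v, (Ioi m).indicator G v * φ v = ∫ v, G v * φ v := by
  congr 1 with v
  by_cases hv : v ∈ Ioi m
  · rw [indicator_of_mem hv]
  · rw [hφ.eq_zero (not_lt.1 hv)]
    simp

theorem tendsto_integral_mul_exp_neg {m : ℝ} {k : ℝ → ℂ} (hk : Integrable k)
    (hk0 : ∀ t < m, k t = 0) :
    Tendsto (fun β : ℝ => ∫ t, ‖k t‖ * Real.exp (-(β * (t - m)))) atTop (𝓝 0) := by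
  rw [← integral_zero ℝ ℝ]
  refine tendsto_integral_filter_of_dominated_convergence (fun t => ‖k t‖)
    (Eventually.of_forall fun β => hk.norm.aestronglyMeasurable.mul
      (by fun_prop : Continuous fun t : ℝ => Real.exp (-(β * (t - m)))).aestronglyMeasurable) ?_
    hk.norm ?_
  · filter_upwards [eventually_ge_atTop 0] with β hβ
    refine Eventually.of_forall fun t => ?_
    rcases lt_or_ge t m with ht | ht
    · simp [hk0 t ht]
    · rw [norm_mul, norm_norm, Real.norm_of_nonneg (Real.exp_pos _).le]
      refine mul_le_of_le_one_right (norm_nonneg _) (Real.exp_le_one_iff.2 ?_)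
      have := mul_nonneg hβ (sub_nonneg.2 ht)
      linarith
  · have hne : ∀ᵐ t : ℝ, t ≠ m := by simp [ae_iff]
    filter_upwards [hne] with t ht
    rcases lt_or_gt_of_ne ht with ht | ht
    · simp [hk0 t ht]
    · have h1 : Tendsto (fun β : ℝ => Real.exp (-(β * (t - m)))) atTop (𝓝 0) :=
        Real.tendsto_exp_neg_atTop_nhds_zero.comp
          (tendsto_id.atTop_mul_const (sub_pos.2 ht))
      simpa using h1.const_mul ‖k t‖

namespace ScatteringProblem

variable {P : ScatteringProblem}

theorem continuous_lam_comp_sub (h : P.Regular) {m : ℝ} {φ : ℝ → ℝ} (hφ : IsTest m φ) :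
    Continuous fun s => P.lam fun u => φ (u - s) := by
  simp only [lam_comp_sub]
  exact (continuous_ft_ofReal (integrable_S0_sub_S_mul_rft h hφ)).const_mul _

theorem exists_norm_lam_comp_sub_le (φ : ℝ → ℝ) :
    ∃ C, ∀ s, ‖P.lam fun u => φ (u - s)‖ ≤ C := by
  simp only [lam_comp_sub, norm_mul]
  exact ⟨_, fun s => mul_le_mul_of_nonneg_left (norm_ft_ofReal_le _ s) (norm_nonneg _)⟩

theorem integrable_lam_rhs (h : P.Regular) {x : ℝ} (hx : 0 ≤ x) (c : ℝ → ℂ) :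
    Integrable ((Ioi (P.muPlus x)).indicator fun y =>
      (P.tau * P.jostKer x (2 * P.a - y) - P.jostKer x y + expSum h.eig c y : ℂ)) := by
  have hK := integrable_ofReal_jostKer h.adm hx
  have h1 : Integrable fun y => (P.tau * P.jostKer x (2 * P.a - y) - P.jostKer x y : ℂ) :=
    ((hK.comp_sub_left _).const_mul _).sub hK
  exact (integrable_indicator_iff measurableSet_Ioi).2
    (h1.integrableOn.add (integrableOn_expSum h.eig_pos c _))

/-- Beyond the interface the reflected term is absent, and far out the kernel has norm below one. No
weight is needed (`β = 0`), but the result covers only test functions beyond `2X`. -/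
theorem exists_lam_eq_integral_of_large (h : P.Regular) : ∃ X, P.a ≤ X ∧ ∃ F : ℝ → ℂ,
    Integrable F ∧ ∀ ψ, IsTest (2 * X) ψ → P.lam ψ = ∫ u, F u * ψ u := by
  have h1 : Tendsto (fun x => 2 * (1 + P.α⁻¹) * (Real.exp (P.tailKap x) - 1)) atTop
      (𝓝 (2 * (1 + P.α⁻¹) * (Real.exp 0 - 1))) :=
    (((Real.continuous_exp.tendsto 0).comp (tendsto_tailKap h.adm)).sub_const 1).const_mul _
  rw [Real.exp_zero, sub_self, mul_zero] at h1
  obtain ⟨X, hX1, hXa⟩ := ((h1.eventually_lt_const one_pos).and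
    (eventually_ge_atTop P.a)).exists
  have hX0 : 0 ≤ X := h.adm.a_pos.le.trans hXa
  obtain ⟨c, hc⟩ := exists_lam_equation h hX0
  rw [cPlus_of_le hXa, cMinus_of_le hXa] at hc
  obtain ⟨F, hF, -, hFψ⟩ := exists_eq_integral_of_correlation (m := P.muPlus X) (m' := P.muPlus X)
    (a := 0) (β := 0) (L := P.lam) le_rfl le_rfl (integrable_ofReal_jostKer h.adm hX0)
    (fun t ht => by rw [jostKer_eq_zero h.adm hX0 ht, Complex.ofReal_zero])
    (by simpa using (integral_norm_jostKer_le h.adm hX0).trans_lt hX1)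
    (by simpa using integrable_lam_rhs h hX0 c)
    (fun φ hφ => by
      rw [integral_indicator_mul_test hφ, ← hc φ hφ]
      simp)
    (fun φ hφ => continuous_lam_comp_sub h hφ)
    (fun φ hφ => by
      obtain ⟨C, hC⟩ := exists_norm_lam_comp_sub_le (P := P) φ
      exact ⟨C, fun s _ => by simpa using hC s⟩)
  rw [muPlus_of_le hXa] at hFψ
  exact ⟨X, hXa, F, hF, hFψ⟩

/-- The inverse Fourier transform of `S₀ - S` is integrable on `(2 μ⁺(0), ∞)`. -/
theorem exists_lam_eq_integral (h : P.Regular) : ∃ F : ℝ → ℂ,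
    Integrable F ∧ ∀ ψ, IsTest (2 * P.muPlus 0) ψ → P.lam ψ = ∫ u, F u * ψ u := by
  obtain ⟨X, hXa, F₁, hF₁, hF₁ψ⟩ := exists_lam_eq_integral_of_large h
  obtain ⟨c, hc⟩ := exists_lam_equation h le_rfl
  have hcp := cPlus_nonneg h.adm 0
  have hcp' : (P.cPlus 0 : ℂ) ≠ 0 := Complex.ofReal_ne_zero.2 hcp.ne'
  set m := P.muPlus 0 with hm
  set m' := P.muMinus 0 with hm'
  have hma : m < P.a := by
    rw [hm, muPlus_eq, nu_of_lt h.adm h.adm.a_pos]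
    have := mul_pos h.adm.α_pos h.adm.a_pos
    linarith
  have hmm : m < m' := by
    rw [hm', muMinus_eq_sub, ← hm]
    linarith
  set k : ℝ → ℂ := fun t => (P.cPlus 0 : ℂ)⁻¹ * P.jostKer 0 t with hk
  have hki : Integrable k := (integrable_ofReal_jostKer h.adm le_rfl).const_mul _
  have hk0 : ∀ t < m, k t = 0 := fun t ht => by
    rw [hk]
    simp [jostKer_eq_zero h.adm le_rfl ht]
  set b : ℝ := P.cMinus 0 / P.cPlus 0 with hb
  -- At `x = 0` the coefficients need not be small. A large weight makes them so, because `m < m'`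
  -- and `k` lives on `t ≥ m`.
  obtain ⟨β, hsmall, hβ⟩ : ∃ β : ℝ, |b| * Real.exp (-(β * (m' - m))) +
      ∫ t, ‖k t‖ * Real.exp (-(β * (t - m))) < 1 ∧ 0 ≤ β := by
    have h1 : Tendsto (fun β : ℝ => Real.exp (-(β * (m' - m)))) atTop (𝓝 0) :=
      Real.tendsto_exp_neg_atTop_nhds_zero.comp (tendsto_id.atTop_mul_const (sub_pos.2 hmm))
    have h2 := (h1.const_mul |b|).add (tendsto_integral_mul_exp_neg hki hk0)
    rw [mul_zero, add_zero] at h2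
    exact ((h2.eventually_lt_const one_pos).and (eventually_ge_atTop 0)).exists
  -- Without the part already represented by `F₁`, the functional vanishes on test functions beyond
  -- `2X`, so growing weights do no harm.
  set L : (ℝ → ℝ) → ℂ := fun φ => P.lam φ - ∫ u, F₁ u * φ u with hL
  set r : ℝ → ℂ := fun y => P.tau * P.jostKer 0 (2 * P.a - y) - P.jostKer 0 y +
    expSum h.eig c y with hr
  set w : ℝ → ℂ := fun v => F₁ (v + m) + b * F₁ (v + m') + ∫ t, k t * F₁ (v + t) with hw
  have hkF : Integrable fun v => ∫ t, k t * F₁ (v + t) := by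
    simpa only [add_comm] using (integrable_mul_comp_add hki hF₁).integral_prod_right
  have hwi : Integrable w :=
    ((hF₁.comp_add_right m).add ((hF₁.comp_add_right m').const_mul _)).add hkF
  set g : ℝ → ℂ := fun v => (P.cPlus 0 : ℂ)⁻¹ * (Ioi m).indicator r v - (Ioi m).indicator w v
    with hg
  have hgi : Integrable g := ((integrable_lam_rhs h le_rfl c).const_mul _).sub
    (hwi.indicator measurableSet_Ioi)
  have hLeq : ∀ φ, IsTest m φ → L (fun u => φ (u - m)) + b * L (fun u => φ (u - m')) +
      ∫ t, k t * L (fun u => φ (u - t)) = ∫ v, g v * φ v := by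
    intro φ hφ
    obtain ⟨M, -, hM⟩ := hφ.exists_bound
    obtain ⟨C, hC⟩ := exists_norm_lam_comp_sub_le (P := P) φ
    have hbd : ∀ {f : ℝ → ℂ}, Integrable f → Integrable fun v => f v * φ v := fun hf =>
      hf.mul_bdd (c := M) hφ.continuous_ofReal.aestronglyMeasurable (Eventually.of_forall hM)
    have e1 : ∫ v, g v * φ v = (P.cPlus 0 : ℂ)⁻¹ * (∫ y, r y * φ y) - ∫ v, w v * φ v := by
      rw [← integral_indicator_mul_test hφ r, ← integral_indicator_mul_test hφ w,
        ← integral_const_mul, ← integral_sub ((hbd (integrable_lam_rhs h le_rfl c)).const_mul _)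
          (hbd (hwi.indicator measurableSet_Ioi))]
      congr 1 with v
      rw [hg]
      ring
    obtain ⟨i3, e3⟩ := hφ.integral_mul_integral hki hF₁
    have esh : ∀ b, ∫ u, F₁ u * φ (u - b) = ∫ v, F₁ (v + b) * φ v := fun b => by
      rw [← integral_add_right_eq_self (fun u => F₁ u * φ (u - b)) b]
      simp only [add_sub_cancel_right]
    have e2 : ∫ v, w v * φ v = (∫ u, F₁ u * φ (u - m)) + b * (∫ u, F₁ u * φ (u - m')) +
        ∫ t, k t * ∫ u, F₁ u * φ (u - t) := by
      have i1 := hbd (hF₁.comp_add_right m)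
      have i2 := (hbd (hF₁.comp_add_right m')).const_mul (b : ℂ)
      have i12 : Integrable fun v => F₁ (v + m) * φ v + b * (F₁ (v + m') * φ v) := i1.add i2
      rw [esh, esh, e3, ← integral_const_mul, ← integral_add i1 i2, ← integral_add i12 i3]
      congr 1 with v
      rw [hw]
      ring
    have e4 : ∫ t, k t * L (fun u => φ (u - t)) = (∫ t, k t * P.lam fun u => φ (u - t)) -
        ∫ t, k t * ∫ u, F₁ u * φ (u - t) := by
      rw [← integral_sub]
      · simp only [hL, mul_sub]
      · exact hki.mul_bdd (c := C) (continuous_lam_comp_sub h hφ).aestronglyMeasurable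
          (Eventually.of_forall hC)
      · refine hki.mul_bdd (c := ∫ u, ‖F₁ u‖ * M)
          (hφ.continuous_integral hF₁).aestronglyMeasurable (Eventually.of_forall fun s => ?_)
        refine norm_integral_le_of_norm_le (hF₁.norm.mul_const M) (Eventually.of_forall fun u => ?_)
        rw [norm_mul]
        exact mul_le_mul_of_nonneg_left (hM _) (norm_nonneg _)
    have e5 : ∫ t, k t * P.lam (fun u => φ (u - t)) = (P.cPlus 0 : ℂ)⁻¹ *
        ∫ t, (P.jostKer 0 t : ℂ) * P.lam fun u => φ (u - t) := by
      rw [← integral_const_mul]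
      simp only [hk, mul_assoc]
    rw [e1, e2, e4, e5, ← hc φ hφ, hL, hb]
    push_cast
    field_simp
    ring
  have hL0 : ∀ ψ, IsTest (2 * X) ψ → L ψ = 0 := fun ψ hψ => sub_eq_zero.2 (hF₁ψ ψ hψ)
  have hL0' : ∀ φ, IsTest m φ → ∀ s, 2 * X - m ≤ s → L (fun u => φ (u - s)) = 0 :=
    fun φ hφ s hs => hL0 _ ((hφ.comp_sub s).mono (by linarith))
  -- The right side inherits the bounded range from `L` through the equation, hence remains
  -- integrable with the weight.
  have hg0 : ∀ᵐ v, v ∈ Ioi (2 * X - m) → g v = 0 := by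
    refine ae_eq_zero_of_integral_test (hgi.integrableOn.locallyIntegrableOn) fun φ hφ => ?_
    have hs : ∀ t, m ≤ t → L (fun u => φ (u - t)) = 0 := fun t ht =>
      hL0 _ ((hφ.comp_sub t).mono (by linarith))
    rw [← hLeq φ (hφ.mono (by linarith)), hs m le_rfl, hs m' hmm.le, mul_zero, zero_add, zero_add]
    refine integral_eq_zero_of_ae (Eventually.of_forall fun t => ?_)
    rcases lt_or_ge t m with ht | ht
    · simp [hk0 t ht]
    · simp [hs t ht]
  have hgw : Integrable fun v => (Real.exp (β * (v + m)) : ℂ) * g v := by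
    refine (hgi.norm.const_mul (Real.exp (β * (2 * X - m + m)))).mono'
      ((by fun_prop : Continuous fun v : ℝ =>
        (Real.exp (β * (v + m)) : ℂ)).aestronglyMeasurable.mul hgi.aestronglyMeasurable) ?_
    filter_upwards [hg0] with v hv
    rcases lt_or_ge (2 * X - m) v with h1 | h1
    · simp [hv h1]
    · rw [norm_mul, Complex.norm_real, Real.norm_of_nonneg (Real.exp_pos _).le]
      gcongr
  obtain ⟨F₂, hF₂, -, hF₂ψ⟩ := exists_eq_integral_of_correlation hmm.le hβ hki hk0 hsmall hgw hLeq
    (fun φ hφ => (continuous_lam_comp_sub h hφ).sub (hφ.continuous_integral hF₁))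
    (fun φ hφ => by
      obtain ⟨M, -, hM⟩ := hφ.exists_bound
      obtain ⟨C, hC⟩ := exists_norm_lam_comp_sub_le (P := P) φ
      refine ⟨Real.exp (β * (2 * X - m)) * (C + ∫ u, ‖F₁ u‖ * M), fun s _ => ?_⟩
      have hCM : ‖L fun u => φ (u - s)‖ ≤ C + ∫ u, ‖F₁ u‖ * M := by
        refine (norm_sub_le _ _).trans (add_le_add (hC s) ?_)
        refine norm_integral_le_of_norm_le (hF₁.norm.mul_const M) (Eventually.of_forall fun u => ?_)
        rw [norm_mul]
        exact mul_le_mul_of_nonneg_left (hM _) (norm_nonneg _)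
      have h0 := (norm_nonneg _).trans hCM
      rcases le_or_gt (2 * X - m) s with hs | hs
      · rw [hL0' φ hφ s hs, norm_zero, mul_zero]
        positivity
      · exact mul_le_mul (Real.exp_le_exp.2 (mul_le_mul_of_nonneg_left hs.le hβ)) hCM
          (norm_nonneg _) (Real.exp_pos _).le)
  refine ⟨fun u => F₁ u + F₂ u, hF₁.add hF₂, fun ψ hψ => ?_⟩
  obtain ⟨M, -, hM⟩ := hψ.exists_bound
  have hbd : ∀ {f : ℝ → ℂ}, Integrable f → Integrable fun v => f v * ψ v := fun hf =>
    hf.mul_bdd (c := M) hψ.continuous_ofReal.aestronglyMeasurable (Eventually.of_forall hM)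
  simp only [add_mul]
  rw [integral_add (hbd hF₁) (hbd hF₂), ← hF₂ψ ψ hψ, hL]
  ring

end ScatteringProblem

/-! ### Density of exponential sums and bounded solutions of Hankel equations -/

/-- The additional factor `exp(-u)` raises the degree of each term by one, so that all exponents are
positive. -/
theorem cexp_mul_eval_eq_expSum (p : Polynomial ℂ) : ∃ s : Finset ℝ, (∀ k ∈ s, 0 < k) ∧
    ∃ c : ℝ → ℂ, ∀ u : ℝ, Complex.exp (-u) * p.eval (Complex.exp (-u)) = expSum s c u := by
  refine ⟨(Finset.range (p.natDegree + 1)).image fun i : ℕ => (i : ℝ) + 1, fun k hk => ?_,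
    fun k => p.coeff (⌊k⌋₊ - 1), fun u => ?_⟩
  · obtain ⟨i, -, rfl⟩ := Finset.mem_image.1 hk
    positivity
  · rw [expSum, Finset.sum_image fun i _ j _ hij => by exact_mod_cast add_right_cancel hij,
      Polynomial.eval_eq_sum_range, Finset.mul_sum]
    refine Finset.sum_congr rfl fun i _ => ?_
    rw [mul_left_comm, ← Complex.exp_nat_mul, ← Complex.exp_add, Nat.floor_add_one (by positivity),
      Nat.floor_natCast, Nat.add_sub_cancel]
    congr 2
    push_cast
    ring

theorem exists_polynomial_near_complex {f : ℝ → ℂ} {b : ℝ} (hf : ContinuousOn f (Icc 0 b)) {ε : ℝ}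
    (hε : 0 < ε) : ∃ p : Polynomial ℂ, ∀ x ∈ Icc 0 b, ‖p.eval (x : ℂ) - f x‖ ≤ ε := by
  obtain ⟨p, hp⟩ := exists_polynomial_near_of_continuousOn 0 b (fun x => (f x).re)
    (Complex.continuous_re.comp_continuousOn hf) (ε / 2) (half_pos hε)
  obtain ⟨q, hq⟩ := exists_polynomial_near_of_continuousOn 0 b (fun x => (f x).im)
    (Complex.continuous_im.comp_continuousOn hf) (ε / 2) (half_pos hε)
  refine ⟨p.map Complex.ofRealHom + Polynomial.C Complex.I * q.map Complex.ofRealHom,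
    fun x hx => ?_⟩
  have ep : (p.map Complex.ofRealHom).eval (x : ℂ) = (p.eval x : ℝ) :=
    Polynomial.eval_map_apply Complex.ofRealHom x
  have eq : (q.map Complex.ofRealHom).eval (x : ℂ) = (q.eval x : ℝ) :=
    Polynomial.eval_map_apply Complex.ofRealHom x
  rw [Polynomial.eval_add, Polynomial.eval_mul, Polynomial.eval_C, ep, eq]
  have e1 : ((p.eval x : ℝ) : ℂ) + Complex.I * (q.eval x : ℝ) - f x =
      ((p.eval x - (f x).re : ℝ) : ℂ) + Complex.I * ((q.eval x - (f x).im : ℝ) : ℂ) := by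
    apply Complex.ext <;> simp
  rw [e1]
  refine (norm_add_le _ _).trans ?_
  rw [norm_mul, Complex.norm_I, one_mul, Complex.norm_real, Complex.norm_real, Real.norm_eq_abs,
    Real.norm_eq_abs]
  linarith [hp x hx, hq x hx]

/-- Sums of decaying exponentials are dense in `L¹` of a half line. -/
theorem exists_integral_sub_expSum_le {f : ℝ → ℂ} (hf : Integrable f) (b : ℝ) {ε : ℝ} (hε : 0 < ε) :
    ∃ s : Finset ℝ, (∀ k ∈ s, 0 < k) ∧ ∃ c : ℝ → ℂ, ∫ u in Ioi b, ‖f u - expSum s c u‖ ≤ ε := by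
  obtain ⟨ψ, hψs, hψc, hψ, hψi⟩ := hf.exists_hasCompactSupport_integral_sub_le (half_pos hε)
  obtain ⟨R, hR⟩ := hψs.isCompact.bddAbove
  have hψR : ∀ u, R < u → ψ u = 0 := fun u hu => by
    by_contra h0
    exact absurd (hR (subset_tsupport ψ h0)) (not_le.2 hu)
  -- In the variable `s = exp(-u)` the claim is Weierstrass approximation on a compact interval.
  -- Since `ψ` vanishes for large `u`, `χ` vanishes near `s = 0` and is continuous there.
  set χ : ℝ → ℂ := fun s => ψ (-Real.log s) / (s : ℂ) with hχ
  have hχc : ContinuousOn χ (Icc 0 (Real.exp (-b))) := by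
    intro s hs
    rcases hs.1.eq_or_lt with h0 | h0
    · have h1 : (fun _ => (0 : ℂ)) =ᶠ[𝓝[Icc 0 (Real.exp (-b))] s] χ := by
        rw [← h0]
        filter_upwards [self_mem_nhdsWithin,
          mem_nhdsWithin_of_mem_nhds (Iio_mem_nhds (Real.exp_pos (-R)))] with t ht ht2
        rcases ht.1.eq_or_lt with h2 | h2
        · simp [hχ, ← h2]
        · rw [hχ]
          simp only
          rw [hψR, zero_div]
          have := (Real.log_lt_iff_lt_exp h2).2 ht2
          linarith
      refine (continuousWithinAt_const (b := (0 : ℂ))).congr_of_eventuallyEq h1.symm ?_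
      simp [hχ, ← h0]
    · have h1 : ContinuousAt χ s :=
        (hψ.continuousAt.comp (Real.continuousAt_log h0.ne').neg).div
          Complex.continuous_ofReal.continuousAt (Complex.ofReal_ne_zero.2 h0.ne')
      exact h1.continuousWithinAt
  obtain ⟨p, hp⟩ := exists_polynomial_near_complex hχc
    (show 0 < ε / 2 * Real.exp b by positivity)
  obtain ⟨s, hs, c, hc⟩ := cexp_mul_eval_eq_expSum p
  refine ⟨s, hs, c, ?_⟩
  have hexp : IntegrableOn (fun u : ℝ => ε / 2 * Real.exp b * Real.exp (-u)) (Ioi b) :=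
    (integrableOn_exp_neg_Ioi b).const_mul _
  have h1 : ∀ u ∈ Ioi b, ‖f u - expSum s c u‖ ≤
      ‖f u - ψ u‖ + ε / 2 * Real.exp b * Real.exp (-u) := by
    intro u hu
    have hmem : Real.exp (-u) ∈ Icc 0 (Real.exp (-b)) :=
      ⟨(Real.exp_pos _).le, Real.exp_le_exp.2 (neg_le_neg (le_of_lt hu))⟩
    have h2 := hp _ hmem
    have e1 : χ (Real.exp (-u)) * Complex.exp (-u) = ψ u := by
      rw [hχ]
      simp only
      rw [Real.log_exp, neg_neg, Complex.ofReal_exp, Complex.ofReal_neg,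
        div_mul_cancel₀ _ (Complex.exp_ne_zero _)]
    have e2 : ψ u - expSum s c u =
        (χ (Real.exp (-u)) - p.eval (Real.exp (-u) : ℂ)) * Complex.exp (-u) := by
      rw [sub_mul, e1, ← hc, Complex.ofReal_exp, Complex.ofReal_neg]
      ring
    have e3 : ‖ψ u - expSum s c u‖ ≤ ε / 2 * Real.exp b * Real.exp (-u) := by
      rw [e2, norm_mul, ← Complex.ofReal_neg, ← Complex.ofReal_exp, Complex.norm_real,
        Real.norm_of_nonneg (Real.exp_pos _).le, norm_sub_rev]
      gcongr
    calc _ = ‖(f u - ψ u) + (ψ u - expSum s c u)‖ := by rw [sub_add_sub_cancel]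
      _ ≤ _ := (norm_add_le _ _).trans (by linarith)
  have hfψ := (hf.sub hψi).norm
  calc ∫ u in Ioi b, ‖f u - expSum s c u‖
      ≤ ∫ u in Ioi b, (‖f u - ψ u‖ + ε / 2 * Real.exp b * Real.exp (-u)) :=
        setIntegral_mono_on (hf.integrableOn.sub (integrableOn_expSum hs c b)).norm
          (hfψ.integrableOn.add hexp) measurableSet_Ioi h1
    _ = (∫ u in Ioi b, ‖f u - ψ u‖) + ε / 2 * Real.exp b * ∫ u in Ioi b, Real.exp (-u) := by
        rw [← integral_const_mul]
        exact integral_add hfψ.integrableOn hexp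
    _ ≤ ε / 2 + ε / 2 * Real.exp b * Real.exp (-b) := by
        rw [integral_exp_neg_Ioi]
        gcongr
        exact (setIntegral_le_integral hfψ (Eventually.of_forall fun u => norm_nonneg _)).trans hψc
    _ = ε := by
        rw [mul_assoc, ← Real.exp_add]
        simp

theorem integral_mul_expSum_add {s : Finset ℝ} (hs : ∀ k ∈ s, 0 < k) (c : ℝ → ℂ) {g : ℝ → ℂ}
    (hg : Integrable g) {b : ℝ} (hb : ∀ u < b, g u = 0) (y : ℝ) :
    Integrable (fun t => g t * expSum s c (t + y)) ∧
      ∫ t, g t * expSum s c (t + y) = expSum s (fun k => c k * ft g (Complex.I * k)) y := by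
  have h1 : ∀ t, expSum s c (t + y) = expSum s (fun k => c k * Complex.exp (-(k * y))) t := by
    intro t
    refine Finset.sum_congr rfl fun k _ => ?_
    rw [mul_assoc, ← Complex.exp_add]
    push_cast
    congr 2
    ring
  simp only [h1]
  obtain ⟨h2, h3⟩ := integral_mul_expSum hs (fun k => c k * Complex.exp (-(k * y))) hg hb
  refine ⟨h2, h3.trans (Finset.sum_congr rfl fun k _ => ?_)⟩
  ring

theorem norm_expSum_le {s : Finset ℝ} (hs : ∀ k ∈ s, 0 < k) (c : ℝ → ℂ) {b u : ℝ} (hu : b ≤ u) :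
    ‖expSum s c u‖ ≤ ∑ k ∈ s, ‖c k‖ * Real.exp (-(k * b)) := by
  refine (norm_sum_le _ _).trans (Finset.sum_le_sum fun k hk => ?_)
  rw [norm_mul, ← Complex.ofReal_mul, ← Complex.ofReal_neg, ← Complex.ofReal_exp,
    Complex.norm_real, Real.norm_of_nonneg (Real.exp_pos _).le]
  have := mul_le_mul_of_nonneg_left hu (hs k hk).le
  gcongr

/-- Integrable solutions of a Hankel equation with a small reflection term are bounded. -/
theorem exists_norm_le_of_hankel {τ a m : ℝ} (hτ : |τ| < 1) {b g : ℝ → ℂ} (hb : Integrable b)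
    (hg : Integrable g) (hg0 : ∀ t ≤ m, g t = 0)
    (heq : ∀ᵐ y, m < y → g y - τ * g (a - y) + ∫ t, g t * b (t + y) = 0) :
    ∃ M, ∀ᵐ y, ‖g y‖ ≤ M := by
  obtain ⟨s, hs, c, hsc⟩ := exists_integral_sub_expSum_le hb (2 * m)
    (show 0 < (1 - |τ|) / 2 by linarith)
  set d : ℝ → ℂ := (Ioi (2 * m)).indicator fun u => b u - expSum s c u with hd
  have hdi : Integrable d := (integrable_indicator_iff measurableSet_Ioi).2
    (hb.integrableOn.sub (integrableOn_expSum hs c _))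
  have hdn : ∫ u, ‖d u‖ ≤ (1 - |τ|) / 2 := by
    rw [hd]
    simp only [norm_indicator_eq_indicator_norm]
    rwa [integral_indicator measurableSet_Ioi]
  set θ := |τ| + ∫ u, ‖d u‖ with hθ
  have hθ1 : θ < 1 := by linarith
  set B := ∑ k ∈ s, ‖c k‖ * Real.exp (-(k * (2 * m))) with hB
  -- `M` solves `M = θ M + B ‖g‖₁`. With this choice the excess `p` of `‖g‖` over `M` satisfies a
  -- homogeneous inequality whose factor is `θ < 1`, and integration gives `p = 0` almost
  -- everywhere.
  set M := B * (∫ t, ‖g t‖) / (1 - θ) with hM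
  have hM0 : 0 ≤ M := div_nonneg (mul_nonneg (Finset.sum_nonneg fun k _ => by positivity)
    (integral_nonneg fun _ => norm_nonneg _)) (by linarith)
  set p : ℝ → ℝ := fun t => max (‖g t‖ - M) 0 with hp
  have hpg : ∀ t, p t ≤ ‖g t‖ := fun t => max_le (by linarith) (norm_nonneg _)
  have hp0 : ∀ t, 0 ≤ p t := fun t => le_max_right _ _
  have hgp : ∀ t, ‖g t‖ ≤ p t + M := fun t => by linarith [le_max_left (‖g t‖ - M) 0]
  have hpi : Integrable p := hg.norm.mono' ((hg.aestronglyMeasurable.norm.sub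
    aestronglyMeasurable_const).sup aestronglyMeasurable_const) (Eventually.of_forall fun t => by
      rw [Real.norm_of_nonneg (hp0 t)]; exact hpg t)
  have hJ := (integrable_mul_comp_add hpi.ofReal hdi).norm
  simp only [norm_mul, RCLike.norm_ofReal, abs_of_nonneg (hp0 _)] at hJ
  have key : ∀ᵐ y, p y ≤ |τ| * p (a - y) + ∫ t, p t * ‖d (t + y)‖ := by
    filter_upwards [heq, hJ.prod_left_ae] with y hy hyi
    have hI : 0 ≤ ∫ t, p t * ‖d (t + y)‖ :=
      integral_nonneg fun t => mul_nonneg (hp0 t) (norm_nonneg _)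
    refine max_le ?_ (add_nonneg (mul_nonneg (abs_nonneg _) (hp0 _)) hI)
    rcases le_or_gt y m with hym | hym
    · rw [hg0 y hym, norm_zero]
      have := mul_nonneg (abs_nonneg τ) (hp0 (a - y))
      linarith
    have hdy := (hdi.comp_add_right y).norm
    have i12 : Integrable fun t => p t * ‖d (t + y)‖ + M * ‖d (t + y)‖ := hyi.add (hdy.const_mul M)
    have e1 : ‖∫ t, g t * b (t + y)‖ ≤ (∫ t, p t * ‖d (t + y)‖) + M * (∫ t, ‖d t‖) +
        B * ∫ t, ‖g t‖ := by
      rw [← integral_add_right_eq_self (fun t => ‖d t‖) y, ← integral_const_mul,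
        ← integral_const_mul, ← integral_add hyi (hdy.const_mul M),
        ← integral_add i12 (hg.norm.const_mul B)]
      refine norm_integral_le_of_norm_le (i12.add (hg.norm.const_mul B))
        (Eventually.of_forall fun t => ?_)
      rcases le_or_gt t m with htm | htm
      · rw [hg0 t htm, zero_mul, norm_zero, mul_zero, add_zero]
        exact add_nonneg (mul_nonneg (hp0 _) (norm_nonneg _)) (mul_nonneg hM0 (norm_nonneg _))
      · have hty : 2 * m < t + y := by linarith
        have e2 : b (t + y) = d (t + y) + expSum s c (t + y) := by
          rw [hd, indicator_of_mem (mem_Ioi.2 hty)]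
          ring
        rw [norm_mul, e2]
        have h3 := norm_expSum_le hs c hty.le
        calc ‖g t‖ * ‖d (t + y) + expSum s c (t + y)‖
            ≤ ‖g t‖ * (‖d (t + y)‖ + B) := by
              gcongr
              exact (norm_add_le _ _).trans (by linarith)
          _ = ‖g t‖ * ‖d (t + y)‖ + B * ‖g t‖ := by ring
          _ ≤ (p t + M) * ‖d (t + y)‖ + B * ‖g t‖ := by
              gcongr
              exact hgp t
          _ = _ := by ring
    have e3 : ‖(τ : ℂ) * g (a - y)‖ ≤ |τ| * (p (a - y) + M) := by
      rw [norm_mul, Complex.norm_real, Real.norm_eq_abs]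
      exact mul_le_mul_of_nonneg_left (hgp _) (abs_nonneg _)
    have e4 : ‖g y‖ ≤ ‖(τ : ℂ) * g (a - y)‖ + ‖∫ t, g t * b (t + y)‖ := by
      rw [show g y = (τ : ℂ) * g (a - y) - ∫ t, g t * b (t + y) by linear_combination hy hym]
      exact norm_sub_le _ _
    have e5 : M = θ * M + B * ∫ t, ‖g t‖ := by
      have h1 : M * (1 - θ) = B * ∫ t, ‖g t‖ := div_mul_cancel₀ _ (by linarith)
      linarith
    rw [hθ] at e5
    linarith
  have hpp : ∫ y, p y ≤ θ * ∫ y, p y := by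
    have h1 : ∫ y, ∫ t, p t * ‖d (t + y)‖ = (∫ t, p t) * ∫ u, ‖d u‖ := by
      rw [integral_integral_swap]
      · rw [← integral_mul_const]
        congr 1 with t
        rw [integral_const_mul, integral_add_left_eq_self (fun u => ‖d u‖) t]
      · exact hJ.swap
    calc ∫ y, p y ≤ ∫ y, (|τ| * p (a - y) + ∫ t, p t * ‖d (t + y)‖) :=
          integral_mono_ae hpi (((hpi.comp_sub_left a).const_mul _).add hJ.integral_prod_right) key
      _ = |τ| * (∫ y, p y) + (∫ t, p t) * ∫ u, ‖d u‖ := by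
          rw [integral_add ((hpi.comp_sub_left a).const_mul _) hJ.integral_prod_right,
            integral_const_mul, integral_sub_left_eq_self p _ a, h1]
      _ = _ := by rw [hθ]; ring
  have hpz : ∫ y, p y = 0 := by
    have := integral_nonneg (μ := volume) (f := p) hp0
    nlinarith
  refine ⟨M, ?_⟩
  filter_upwards [(integral_eq_zero_iff_of_nonneg hp0 hpi).1 hpz] with y hy
  have := hgp y
  rw [hy] at this
  simpa using this

/-! ### The homogeneous main equation -/

theorem ft_conj_I_mul (g : ℝ → ℂ) (k : ℝ) :
    ft (fun t => starRingEnd ℂ (g t)) (Complex.I * k) = starRingEnd ℂ (ft g (Complex.I * k)) := by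
  rw [ft, ft, ← integral_conj]
  congr 1 with t
  rw [map_mul, cexp_I_mul_I, ← Complex.exp_conj]
  simp

theorem rft_comp_neg (φ : ℝ → ℝ) (z : ℂ) : rft (fun u => φ (-u)) z = rft φ (-z) := by
  rw [rft, rft, ft, ft, ← integral_neg_eq_self]
  congr 1 with u
  push_cast
  rw [neg_neg, mul_neg, mul_neg, neg_mul]

theorem IsTest.exists_comp_neg {m : ℝ} {φ : ℝ → ℝ} (hφ : IsTest m φ) :
    ∃ m', IsTest m' fun u => φ (-u) :=
  exists_isTest_of_hasCompactSupport (hφ.contDiff.comp contDiff_neg)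
    (hφ.compact.comp_homeomorph (Homeomorph.neg ℝ))

/-- The two conditions make the Fourier transform vanish on either open half line, and a single
point carries no square integrable mass. -/
theorem ae_eq_zero_of_integral_mul_rft {v : ℝ → ℂ} (hv : MemLp v 2)
    (h0 : ∀ φ, IsTest 0 φ → ∫ l : ℝ, v l * rft φ l = 0)
    (h1 : ∀ φ, IsTest 0 φ → ∫ l : ℝ, v l * rft φ (-l) = 0) : v =ᵐ[volume] 0 := by
  obtain ⟨w, hw, hwφ, hwn⟩ := exists_fourier_memLp_two hv
  have hwl : LocallyIntegrable w := hw.locallyIntegrable (by norm_num)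
  have e0 : ∀ᵐ u, u ∈ Ioi (0 : ℝ) → w u = 0 :=
    ae_eq_zero_of_integral_test (hwl.locallyIntegrableOn _) fun φ hφ => by
      rw [hwφ hφ, h0 φ hφ, mul_zero]
  have hneg := (Measure.measurePreserving_neg (volume : Measure ℝ))
  have hw' : MemLp (fun u => w (-u)) 2 := hw.comp_measurePreserving hneg
  have e1 : ∀ᵐ u, u ∈ Ioi (0 : ℝ) → w (-u) = 0 := by
    refine ae_eq_zero_of_integral_test ((hw'.locallyIntegrable (by norm_num)).locallyIntegrableOn _)
      fun φ hφ => ?_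
    obtain ⟨m, hm⟩ := hφ.exists_comp_neg
    have e2 := hwφ hm
    simp only [rft_comp_neg] at e2
    rw [h1 φ hφ, mul_zero, ← integral_neg_eq_self] at e2
    simpa only [neg_neg] using e2
  have e2 := hneg.quasiMeasurePreserving.ae e1
  have hne : ∀ᵐ u : ℝ, u ≠ 0 := by simp [ae_iff]
  have hw0 : ∀ᵐ u, w u = 0 := by
    filter_upwards [e0, e2, hne] with u h1 h2 h3
    rcases lt_or_gt_of_ne h3 with h4 | h4
    · simpa using h2 (by simpa using h4)
    · exact h1 h4
  have h2 : ∫ u, ‖w u‖ ^ 2 = 0 := by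
    rw [integral_eq_zero_of_ae (hw0.mono fun u hu => by simp [hu])]
  rw [h2] at hwn
  have hpi : (0 : ℝ) < 1 / (2 * Real.pi) := by positivity
  have h3 : ∫ l, ‖v l‖ ^ 2 = 0 := ((mul_eq_zero.1 hwn.symm).resolve_left hpi.ne')
  have h4 := (integral_eq_zero_iff_of_nonneg (fun l => by positivity)
    ((memLp_two_iff_integrable_sq_norm hv.1).1 hv)).1 h3
  filter_upwards [h4] with l hl
  simpa using hl

theorem ft_mul_rft_mem_hardyClass {g : ℝ → ℂ} (hg : Integrable g) {m : ℝ} (hg0 : ∀ t < m, g t = 0)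
    {φ : ℝ → ℝ} (hφ : IsTest 0 φ) : (fun z => ft g z * rft φ z) ∈ hardyClass m := by
  obtain ⟨h1, h2, C, hC⟩ := hφ.rft_mem_hardyClass
  refine ⟨(differentiableOn_ft hg hg0).mul h1, (continuousOn_ft hg hg0).mul h2,
    (∫ t, ‖g t‖) * C, fun z hz => ?_⟩
  have h3 := hC z hz
  rw [mul_zero, neg_zero, Real.exp_zero, mul_one] at h3
  rw [norm_mul]
  calc _ ≤ (∫ t, ‖g t‖) * Real.exp (-(z.im * m)) * (C / (1 + ‖z‖ ^ 2)) :=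
        mul_le_mul (norm_ft_le hg hg0 hz) h3 (norm_nonneg _)
          (mul_nonneg (integral_nonneg fun _ => norm_nonneg _) (Real.exp_pos _).le)
    _ = _ := by ring

namespace ScatteringProblem

variable {P : ScatteringProblem} {x : ℝ} {f g : ℝ → ℂ}

/-- The homogeneous main equation, tested against smooth functions. -/
theorem integral_add_expSum_mul_test (h : P.Regular) (hx : 0 ≤ x) (hf : Integrable f)
    (hfl : ∀ φ, IsTest (2 * P.muPlus 0) φ → ∫ u, f u * φ u = P.lam φ) (hg : Integrable g)
    (hg0 : ∀ t ≤ P.muPlus x, g t = 0)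
    (heq : ∀ᵐ y, P.muPlus x < y → g y - P.tau * g (2 * P.a - y) +
      ∫ t, g t * (f (t + y) + expSum h.eig (fun k => P.normSq k) (t + y)) = 0)
    {φ : ℝ → ℝ} (hφ : IsTest (P.muPlus x) φ) :
    ∫ y, (g y + expSum h.eig (fun k => P.normSq k * ft g (Complex.I * k)) y) * φ y =
      1 / (2 * (Real.pi : ℂ)) * ∫ l : ℝ, P.S l * ft g l * rft φ l := by
  obtain ⟨M, -, hM⟩ := hφ.exists_bound
  have hgl : ∀ t < P.muPlus x, g t = 0 := fun t ht => hg0 t ht.le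
  have hbd : ∀ {f : ℝ → ℂ}, Integrable f → Integrable fun v => f v * φ v := fun hf =>
    hf.mul_bdd (c := M) hφ.continuous_ofReal.aestronglyMeasurable (Eventually.of_forall hM)
  have hS := integrable_S_mul_rft h hφ
  set p := expSum h.eig (fun k => P.normSq k * ft g (Complex.I * k)) with hp
  obtain ⟨i3, e3⟩ := hφ.integral_mul_integral hg hf
  have i4 : Integrable fun y => p y * φ y := by
    have := (integral_mul_expSum h.eig_pos (fun k => P.normSq k * ft g (Complex.I * k))
      hφ.integrable hφ.ofReal_eq_zero).1
    exact this.congr (Eventually.of_forall fun y => mul_comm _ _)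
  have hprod := (integrable_mul_comp_add hg hf).prod_left_ae
  have e1 : ∀ᵐ y, g y * φ y - P.tau * (g (2 * P.a - y) * φ y) +
      ((∫ t, g t * f (y + t)) * φ y + p y * φ y) = 0 := by
    filter_upwards [heq, hprod] with y hy hyi
    rcases le_or_gt y (P.muPlus x) with hym | hym
    · simp [hφ.eq_zero hym]
    · obtain ⟨i5, e5⟩ := integral_mul_expSum_add h.eig_pos (fun k => (P.normSq k : ℂ)) hg hgl y
      have h1 := hy hym
      simp only [mul_add] at h1
      rw [integral_add hyi i5, e5, ← hp] at h1
      simp only [add_comm y]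
      linear_combination (φ y : ℂ) * h1
  have i1 := hbd hg
  have i2 := (hbd (hg.comp_sub_left (2 * P.a))).const_mul (P.tau : ℂ)
  have e2 := integral_eq_zero_of_ae e1
  have i12 : Integrable fun y => g y * φ y - P.tau * (g (2 * P.a - y) * φ y) := i1.sub i2
  have i34 : Integrable fun y => (∫ t, g t * f (y + t)) * φ y + p y * φ y := i3.add i4
  rw [integral_add i12 i34, integral_sub i1 i2, integral_const_mul,
    integral_add i3 i4, ← e3] at e2
  have hmono : 2 * P.muPlus 0 ≤ P.muPlus x + P.muPlus x := by
    have := (muPlus_strictMono h.adm).monotone hx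
    linarith
  have i6 : Integrable fun t => g t * φ (2 * P.a - t) :=
    hg.mul_bdd (c := M) (hφ.continuous_ofReal.comp (continuous_const.sub continuous_id)
      ).aestronglyMeasurable (Eventually.of_forall fun t => hM _)
  have i7 : Integrable fun t => g t * ft (fun l : ℝ => P.S l * rft φ l) t :=
    hg.mul_bdd (continuous_ft_ofReal hS).aestronglyMeasurable
      (Eventually.of_forall fun t => norm_ft_ofReal_le _ t)
  -- The part of `f` coming from `S₀` is the point mass `τ` at `2a`; it cancels the reflection term
  -- of the equation.
  have e6 : ∫ t, g t * ∫ u, f u * φ (u - t) = P.tau * (∫ t, g t * φ (2 * P.a - t)) -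
      1 / (2 * (Real.pi : ℂ)) * ∫ l : ℝ, P.S l * ft g l * rft φ l := by
    have e7 : ∫ l : ℝ, P.S l * ft g l * rft φ l =
        ∫ t : ℝ, g t * ft (fun l : ℝ => P.S l * rft φ l) t := by
      rw [integral_mul_ft hg hS]
      congr 1 with l
      ring
    rw [e7, ← integral_const_mul, ← integral_const_mul,
      ← integral_sub (i6.const_mul _) (i7.const_mul _)]
    congr 1 with t
    rcases le_or_gt t (P.muPlus x) with ht | ht
    · simp [hg0 t ht]
    · have h1 : IsTest (2 * P.muPlus 0) fun u => φ (u - t) := (hφ.comp_sub t).mono (by linarith)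
      rw [hfl _ h1, lam_eq h h1, integral_mul_rft_comp_sub]
      ring
  have e8 : ∫ y, g (2 * P.a - y) * φ y = ∫ t, g t * φ (2 * P.a - t) := by
    rw [← integral_sub_left_eq_self (fun t => g t * φ (2 * P.a - t)) _ (2 * P.a)]
    simp only [sub_sub_cancel]
  rw [e6, e8] at e2
  simp only [add_mul]
  rw [integral_add i1 i4]
  linear_combination e2

/-- The homogeneous main equation has only the trivial solution. -/
theorem ae_eq_zero_of_homogeneous (h : P.Regular) (hx : 0 < x) (hf : Integrable f)
    (hfl : ∀ φ, IsTest (2 * P.muPlus 0) φ → ∫ u, f u * φ u = P.lam φ) (hg : Integrable g)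
    (hg0 : ∀ t ≤ P.muPlus x, g t = 0)
    (heq : ∀ᵐ y, P.muPlus x < y → g y - P.tau * g (2 * P.a - y) +
      ∫ t, g t * (f (t + y) + expSum h.eig (fun k => P.normSq k) (t + y)) = 0) :
    g =ᵐ[volume] 0 := by
  have hgl : ∀ t < P.muPlus x, g t = 0 := fun t ht => hg0 t ht.le
  have hpi : (0 : ℝ) < 2 * Real.pi := by positivity
  have hpi' : (2 * Real.pi : ℂ) ≠ 0 := by simp [Real.pi_ne_zero]
  -- Boundedness puts the integrable solution into `L²`, where Plancherel's identity is available.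
  obtain ⟨M, hM⟩ : ∃ M, ∀ᵐ y, ‖g y‖ ≤ M := by
    have hb : Integrable ((Ioi (2 * P.muPlus x)).indicator
        fun u => f u + expSum h.eig (fun k => P.normSq k) u) :=
      (integrable_indicator_iff measurableSet_Ioi).2
        (hf.integrableOn.add (integrableOn_expSum h.eig_pos _ _))
    refine exists_norm_le_of_hankel (a := 2 * P.a) (abs_tau_lt h.adm) hb hg hg0 ?_
    filter_upwards [heq] with y hy hym
    rw [← hy hym]
    congr 2 with t
    rcases le_or_gt t (P.muPlus x) with ht | ht
    · simp [hg0 t ht]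
    · rw [indicator_of_mem (by simp only [mem_Ioi]; linarith)]
  have hg2 : MemLp g 2 := by
    rw [memLp_two_iff_integrable_sq_norm hg.1]
    refine (hg.norm.const_mul M).mono' (hg.1.norm.pow 2) (hM.mono fun y hy => ?_)
    rw [norm_pow, norm_norm, sq]
    exact mul_le_mul_of_nonneg_right hy (norm_nonneg _)
  have hgsq := (memLp_two_iff_integrable_sq_norm hg.1).1 hg2
  obtain ⟨hF2, hFn⟩ := memLp_two_ft hg hg2
  have hSm : AEStronglyMeasurable fun l : ℝ => P.S l * ft g l :=
    (aestronglyMeasurable_S h.adm).mul hF2.1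
  have hSle : ∀ᵐ l : ℝ, ‖P.S l * ft g l‖ ≤ ‖ft g l‖ := by
    filter_upwards [ae_norm_S_le h.adm h.d1 h.d3] with l hl
    rw [norm_mul]
    exact mul_le_of_le_one_left (norm_nonneg _) hl
  have hS2 : MemLp (fun l : ℝ => P.S l * ft g l) 2 := hF2.of_le hSm hSle
  obtain ⟨w, hw, hwφ, hwn⟩ := exists_fourier_memLp_two hS2
  have hwsq := (memLp_two_iff_integrable_sq_norm hw.1).1 hw
  have hwle : ∫ u, ‖w u‖ ^ 2 ≤ ∫ u, ‖g u‖ ^ 2 := by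
    rw [hwn]
    calc _ ≤ 1 / (2 * Real.pi) * ∫ l : ℝ, ‖ft g l‖ ^ 2 := by
          refine mul_le_mul_of_nonneg_left (integral_mono_ae
            ((memLp_two_iff_integrable_sq_norm hSm).1 hS2)
            ((memLp_two_iff_integrable_sq_norm hF2.1).1 hF2) ?_) (by positivity)
          filter_upwards [hSle] with l hl
          gcongr
      _ = _ := by rw [hFn]; field_simp
  set c : ℝ → ℂ := fun k => P.normSq k * ft g (Complex.I * k) with hc
  have hwg : ∀ᵐ u, u ∈ Ioi (P.muPlus x) → w u - (g u + expSum h.eig c u) = 0 := by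
    have hpl : LocallyIntegrable (expSum h.eig c) := (continuous_expSum _ _).locallyIntegrable
    have hwl : LocallyIntegrable w := hw.locallyIntegrable (by norm_num)
    refine ae_eq_zero_of_integral_test ((hwl.sub (hg.locallyIntegrable.add hpl)).locallyIntegrableOn _)
      fun φ hφ => ?_
    have hint : ∀ {f : ℝ → ℂ}, LocallyIntegrable f → Integrable fun u => f u * φ u := fun hf => by
      simpa only [smul_eq_mul, mul_comm] using
        hf.integrable_smul_left_of_hasCompactSupport hφ.continuous_ofReal hφ.compact_ofReal
    have i2 : Integrable fun u => (g u + expSum h.eig c u) * φ u :=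
      hint (hg.locallyIntegrable.add hpl)
    simp only [sub_mul]
    rw [integral_sub (hint hwl) i2, hwφ hφ, sub_eq_zero]
    exact (integral_add_expSum_mul_test h hx.le hf hfl hg hg0 heq hφ).symm
  have hcg : Integrable fun t => starRingEnd ℂ (g t) :=
    (RCLike.conjLIE (K := ℂ)).toContinuousLinearEquiv.toContinuousLinearMap.integrable_comp hg
  obtain ⟨ip, ep⟩ := integral_mul_expSum h.eig_pos c hcg (b := P.muPlus x)
    fun u hu => by rw [hgl u hu, map_zero]
  -- Where `g` vanishes this is trivial; to the right of `μ⁺(x)` one has `w = g` plus the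
  -- exponential sum.
  have hpt : ∀ᵐ u, ‖w u - g u‖ ^ 2 = ‖w u‖ ^ 2 - ‖g u‖ ^ 2 -
      2 * (starRingEnd ℂ (g u) * expSum h.eig c u).re := by
    filter_upwards [hwg] with u hu
    rcases le_or_gt u (P.muPlus x) with hum | hum
    · simp [hg0 u hum]
    · have h1 := hu hum
      rw [show w u = g u + expSum h.eig c u by linear_combination h1, add_sub_cancel_left]
      simp only [← Complex.normSq_eq_norm_sq, Complex.normSq_apply, Complex.add_re, Complex.add_im,
        Complex.mul_re, Complex.conj_re, Complex.conj_im]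
      ring
  have hre : ∫ u, (starRingEnd ℂ (g u) * expSum h.eig c u).re =
      ∑ k ∈ h.eig, P.normSq k * ‖ft g (Complex.I * k)‖ ^ 2 := by
    have h1 : ∫ u, (starRingEnd ℂ (g u) * expSum h.eig c u).re =
        (∫ u, starRingEnd ℂ (g u) * expSum h.eig c u).re := integral_re ip
    rw [h1, ep, Complex.re_sum]
    refine Finset.sum_congr rfl fun k _ => ?_
    rw [ft_conj_I_mul, hc]
    simp only
    rw [mul_assoc, Complex.mul_conj, Complex.normSq_eq_norm_sq, ← Complex.ofReal_mul,
      Complex.ofReal_re]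
  -- As `‖w‖ ≤ ‖g‖`, this identity forces `w = g` and the vanishing of every term of the sum.
  have hsum : ∫ u, ‖w u - g u‖ ^ 2 = (∫ u, ‖w u‖ ^ 2) - (∫ u, ‖g u‖ ^ 2) -
      2 * ∑ k ∈ h.eig, P.normSq k * ‖ft g (Complex.I * k)‖ ^ 2 := by
    have i1 : Integrable fun u => ‖w u‖ ^ 2 - ‖g u‖ ^ 2 := hwsq.sub hgsq
    have i2 : Integrable fun u => 2 * (starRingEnd ℂ (g u) * expSum h.eig c u).re :=
      ip.re.const_mul 2
    rw [integral_congr_ae hpt, integral_sub i1 i2, integral_sub hwsq hgsq, integral_const_mul,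
      ← hre]
  have hpos : ∀ k ∈ h.eig, 0 ≤ P.normSq k * ‖ft g (Complex.I * k)‖ ^ 2 := fun k hk =>
    mul_nonneg (normSq_pos h.adm h.d1 h.d2 h.d3 (h.mem_eig.1 hk)).le (by positivity)
  have hdn : 0 ≤ ∫ u, ‖w u - g u‖ ^ 2 := integral_nonneg fun u => by positivity
  have hsn := Finset.sum_nonneg hpos
  have hft0 : ∀ k ∈ P.eigenSet, ft g (Complex.I * k) = 0 := by
    intro k hk
    have h1 := (Finset.sum_eq_zero_iff_of_nonneg hpos).1 (by linarith) k (h.mem_eig.2 hk)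
    have h2 := (mul_eq_zero.1 h1).resolve_left (normSq_pos h.adm h.d1 h.d2 h.d3 hk).ne'
    exact norm_eq_zero.1 (pow_eq_zero_iff two_ne_zero |>.1 h2)
  have hweq : w =ᵐ[volume] g := by
    have h1 := (integral_eq_zero_iff_of_nonneg (fun u => by positivity)
      ((memLp_two_iff_integrable_sq_norm (hw.sub hg2).1).1 (hw.sub hg2))).1
        (show ∫ u, ‖(w - g) u‖ ^ 2 = 0 from le_antisymm
          (by simp only [Pi.sub_apply]; linarith) hdn)
    filter_upwards [h1] with u hu
    simpa [sub_eq_zero] using hu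
  have hFneg : MemLp (fun l : ℝ => ft g (-l)) 2 := by
    have := hF2.comp_measurePreserving (Measure.measurePreserving_neg (volume : Measure ℝ))
    simpa only [Function.comp_def, Complex.ofReal_neg] using this
  have hmulint : ∀ {v : ℝ → ℂ}, MemLp v 2 → ∀ {m : ℝ} {φ : ℝ → ℝ}, IsTest m φ →
      Integrable fun l : ℝ => v l * rft φ l := by
    intro v hv m φ hφ
    have h2 : MemLp (fun l : ℝ => rft φ l) 2 := (memLp_two_ft hφ.integrable
      (hφ.continuous_ofReal.memLp_of_hasCompactSupport hφ.compact_ofReal)).1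
    exact hv.integrable_mul h2
  -- The equality `w = g`, read on the Fourier side.
  have hS : ∀ᵐ l : ℝ, P.S l * ft g l = ft g (-l) := by
    have hall : ∀ {m : ℝ} {φ : ℝ → ℝ}, IsTest m φ →
        ∫ l : ℝ, (P.S l * ft g l - ft g (-l)) * rft φ l = 0 := by
      intro m φ hφ
      simp only [sub_mul]
      rw [integral_sub (hmulint hS2 hφ) (hmulint hFneg hφ), hφ.integral_ft_neg_mul_rft hg,
        sub_eq_zero, ← integral_congr_ae (hweq.mono fun u hu => congrArg (· * (φ u : ℂ)) hu),
        hwφ hφ, ← mul_assoc, mul_one_div_cancel hpi', one_mul]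
    have hz := ae_eq_zero_of_integral_mul_rft (hS2.sub hFneg) (fun φ hφ => hall hφ) fun φ hφ => by
      obtain ⟨m, hm⟩ := hφ.exists_comp_neg
      have := hall hm
      simpa only [rft_comp_neg, Pi.sub_apply] using this
    filter_upwards [hz] with l hl
    exact sub_eq_zero.1 hl
  have hec : Continuous fun l : ℝ => P.jostFun x l :=
    (continuousOn_jostFun h.adm hx.le).comp_continuous Complex.continuous_ofReal fun l => by simp
  have heb : ∀ l : ℝ, ‖P.jostFun x l‖ ≤ P.jostConst := fun l => by
    simpa using norm_jostFun_le h.adm hx.le (z := (l : ℂ)) (by simp)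
  -- By `hS`, `G` is the jump `conj e - S e` times the transform of `g`. The jump relation, without
  -- residues because the transform vanishes at the eigenvalues, makes `G` annihilate test functions
  -- on `(0, ∞)`. In the form with `ft g (-l)` it is visibly odd, so it annihilates those on the
  -- other half line too.
  set G : ℝ → ℂ := fun l => starRingEnd ℂ (P.jostFun x l) * ft g l - P.jostFun x l * ft g (-l)
    with hG
  have hG2 : MemLp G 2 := by
    refine MemLp.sub (hF2.of_le_mul (c := P.jostConst)
      ((Complex.continuous_conj.comp hec).aestronglyMeasurable.mul hF2.1)
      (Eventually.of_forall fun l => ?_)) (hFneg.of_le_mul (c := P.jostConst)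
      (hec.aestronglyMeasurable.mul hFneg.1) (Eventually.of_forall fun l => ?_))
    · rw [norm_mul, RCLike.norm_conj]
      exact mul_le_mul_of_nonneg_right (heb l) (norm_nonneg _)
    · rw [norm_mul]
      exact mul_le_mul_of_nonneg_right (heb l) (norm_nonneg _)
  have hGS : ∀ᵐ l : ℝ, G l =
      (starRingEnd ℂ (P.jostFun x l) - P.S l * P.jostFun x l) * ft g l := by
    filter_upwards [hS] with l hl
    rw [hG]
    simp only
    rw [← hl]
    ring
  have hGφ : ∀ φ, IsTest 0 φ → ∫ l : ℝ, G l * rft φ l = 0 := fun φ hφ => by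
    rw [← integral_jump_eq_zero h.adm h.d1 h.d2 h.d3 h.ab hx.le
      (ft_mul_rft_mem_hardyClass hg hgl hφ) fun k hk => by rw [hft0 k hk, zero_mul]]
    refine integral_congr_ae ?_
    filter_upwards [hGS] with l hl
    rw [hl, mul_assoc]
  have hGodd : ∀ l, G (-l) = -G l := fun l => by
    have h1 := jostFun_neg_conj h.adm x l
    rw [Complex.conj_ofReal] at h1
    rw [hG]
    simp only [Complex.ofReal_neg, h1, neg_neg, Complex.conj_conj]
    ring
  have hG0 := ae_eq_zero_of_integral_mul_rft hG2 hGφ fun φ hφ => by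
    rw [← integral_neg_eq_self]
    simp only [hGodd, Complex.ofReal_neg, neg_neg, neg_mul, integral_neg, hGφ φ hφ, neg_zero]
  have hω := ae_ofReal_ne_zero_of_differentiable (differentiable_omega h.adm hx.le)
    (exists_omega_ne_zero h.adm h.d1 h.d2 h.d3 h.ab hx)
  have hft : ∀ᵐ l : ℝ, ft g l = 0 := by
    filter_upwards [hG0, hGS, hω, ae_jostE_ne_zero h.adm h.d1 h.d3 h.ab] with l h1 h2 h3 h4
    rw [h2, S_eq h.adm h4.1] at h1
    have h5 := jostE_mul_conj_sub h.adm h4.1 hx.le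
    have h6 : starRingEnd ℂ (P.jostFun x l) - P.jostEConj l / P.jostE l * P.jostFun x l ≠ 0 := by
      intro h7
      have h8 : 2 * Complex.I * l * P.omega l x = 0 := by
        rw [← h5]
        have := h4.2
        field_simp at h7
        linear_combination h7
      have : (l : ℂ) ≠ 0 := Complex.ofReal_ne_zero.2 h4.1
      simp [h3, this] at h8
    exact (mul_eq_zero.1 h1).resolve_left h6
  have h0 : ∫ u, ‖g u‖ ^ 2 = 0 := by
    rw [integral_eq_zero_of_ae (hft.mono fun l hl => by simp [hl])] at hFn
    exact (mul_eq_zero.1 hFn.symm).resolve_left hpi.ne'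
  filter_upwards [(integral_eq_zero_iff_of_nonneg (fun u => by positivity) hgsq).1 h0] with u hu
  simpa using hu

end ScatteringProblem

/-! ### Solvability of the main equation -/

/-- The Fredholm alternative for perturbations of an invertible operator by operators of finite
rank. -/
theorem exists_eq_of_injective_add_finite_rank {V : Type*} [NormedAddCommGroup V]
    [NormedSpace ℂ V] [CompleteSpace V] {N T : V →L[ℂ] V} (hN : ‖N‖ < 1) {W : Submodule ℂ V}
    [FiniteDimensional ℂ W] (hT : ∀ v, T v ∈ W) (hinj : ∀ v, v + (N v + T v) = 0 → v = 0) (y : V) :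
    ∃ v, v + (N v + T v) = y := by
  obtain ⟨u, hu⟩ := isUnit_one_sub_of_norm_lt_one (x := -N) (by rwa [norm_neg])
  set B := u⁻¹.1 with hB
  have hBN : ∀ v, B v + N (B v) = v := fun v => by
    have h1 : (u.1 * B) v = v := by rw [hB, Units.mul_inv]; rfl
    rw [hu, sub_neg_eq_add] at h1
    exact h1
  -- With `B = (1 + N)⁻¹` the problem reduces to `1 + T B`, which maps the finite dimensional space
  -- `W` into itself; there injectivity gives surjectivity.
  set L : W →ₗ[ℂ] W := LinearMap.id + ((T.comp B).toLinearMap.comp W.subtype).codRestrict W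
    fun w => hT _ with hL
  have hLv : ∀ w : W, (L w : V) = w + T (B w) := fun w => rfl
  have hLi : Function.Injective L := by
    rw [injective_iff_map_eq_zero]
    intro w hw
    have h1 : (w : V) + T (B w) = 0 := by rw [← hLv, hw]; rfl
    have h2 : B w = 0 := hinj _ (by rw [← add_assoc, hBN, h1])
    have h3 := hBN w
    rw [h2, map_zero, add_zero] at h3
    exact Subtype.ext h3.symm
  obtain ⟨w, hw⟩ := LinearMap.injective_iff_surjective.1 hLi ⟨T (B y), hT _⟩
  have h1 : (w : V) + T (B w) = T (B y) := by rw [← hLv, hw]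
  -- By the choice of `w`, applying `1 + N` to this vector gives `y - w` and applying `T` gives `w`.
  refine ⟨B (y - w), ?_⟩
  rw [← add_assoc, hBN, map_sub, map_sub, ← h1]
  abel

theorem exists_hankel_clm (m : ℝ) {b : ℝ → ℂ} (hb : Integrable b) :
    ∃ T : Lp ℂ 1 (volume.restrict (Ioi m)) →L[ℂ] Lp ℂ 1 (volume.restrict (Ioi m)),
      ‖T‖ ≤ ∫ u, ‖b u‖ ∧ ∀ v, ∀ᵐ y ∂volume.restrict (Ioi m),
        IntegrableOn (fun t => v t * b (t + y)) (Ioi m) ∧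
          T v y = ∫ t in Ioi m, v t * b (t + y) := by
  refine exists_kernel_clm (k := fun t y => b (t + y)) (integral_nonneg fun _ => norm_nonneg _) ?_
    (Eventually.of_forall fun t => ⟨(hb.comp_add_left t).integrableOn, ?_⟩)
  · rw [Measure.prod_restrict]
    exact (hb.aestronglyMeasurable.comp_quasiMeasurePreserving
      (quasiMeasurePreserving_add volume volume)).restrict
  · exact (setIntegral_le_integral (hb.comp_add_left t).norm (Eventually.of_forall fun y =>
      norm_nonneg _)).trans_eq (integral_add_left_eq_self (fun y => ‖b y‖) t)

theorem IsTest.setIntegral_mul {m : ℝ} {φ : ℝ → ℝ} (hφ : IsTest m φ) (f : ℝ → ℂ) :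
    ∫ u in Ioi m, f u * φ u = ∫ u, f u * φ u :=
  setIntegral_eq_integral_of_forall_compl_eq_zero fun u hu => by
    rw [hφ.eq_zero (not_lt.1 hu), Complex.ofReal_zero, mul_zero]

namespace ScatteringProblem

variable {P : ScatteringProblem} {f : ℝ → ℂ} {x : ℝ}

theorem exists_isF0s (h : P.Regular) : ∃ f, P.IsF0s f := by
  obtain ⟨F, hF, hFψ⟩ := exists_lam_eq_integral h
  refine ⟨F, hF.integrableOn.locallyIntegrableOn, fun φ h1 h2 h3 => ?_⟩
  have hφ : IsTest (2 * P.muPlus 0) φ := ⟨h1, h2, h3⟩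
  rw [hφ.setIntegral_mul, ← hFψ φ hφ]
  rfl

theorem IsF0s.integral_indicator (hf : P.IsF0s f) {φ : ℝ → ℝ} (hφ : IsTest (2 * P.muPlus 0) φ) :
    ∫ u, (Ioi (2 * P.muPlus 0)).indicator f u * φ u = P.lam φ := by
  rw [integral_indicator_mul_test hφ, ← hφ.setIntegral_mul]
  exact hf.2 φ hφ.1 hφ.2 hφ.3

/-- `IsF0s` asks only for local integrability, but it determines the function almost everywhere, and
one integrable representative is already known. -/
theorem IsF0s.integrable_indicator (h : P.Regular) (hf : P.IsF0s f) :
    Integrable ((Ioi (2 * P.muPlus 0)).indicator f) := by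
  obtain ⟨F, hF, hFψ⟩ := exists_lam_eq_integral h
  have h1 : ∀ᵐ u, u ∈ Ioi (2 * P.muPlus 0) → f u - F u = 0 := by
    refine ae_eq_zero_of_integral_test (hf.1.sub hF.integrableOn.locallyIntegrableOn) fun φ hφ => ?_
    have i1 : Integrable fun u => f u * φ u := by
      rw [← integrableOn_iff_integrable_of_support_subset (s := tsupport φ) fun u hu =>
        subset_tsupport φ fun h0 => hu (by rw [h0, Complex.ofReal_zero, mul_zero])]
      exact (hf.1.integrableOn_compact_subset hφ.supp hφ.compact).mul_continuousOn
        hφ.continuous_ofReal.continuousOn hφ.compact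
    obtain ⟨M, -, hM⟩ := hφ.exists_bound
    have i2 : Integrable fun u => F u * φ u := hF.mul_bdd (c := M)
      hφ.continuous_ofReal.aestronglyMeasurable (Eventually.of_forall hM)
    simp only [sub_mul]
    rw [integral_sub i1 i2, ← hFψ φ hφ, ← hφ.setIntegral_mul, sub_eq_zero]
    exact hf.2 φ hφ.1 hφ.2 hφ.3
  refine (hF.indicator (measurableSet_Ioi (a := 2 * P.muPlus 0))).congr ?_
  filter_upwards [h1] with u hu
  by_cases hm : u ∈ Ioi (2 * P.muPlus 0)
  · rw [indicator_of_mem hm, indicator_of_mem hm, sub_eq_zero.1 (hu hm)]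
  · rw [indicator_of_notMem hm, indicator_of_notMem hm]

theorem F0_eq (h : P.Regular) (u : ℝ) :
    P.F0 f u = f u + expSum h.eig (fun k => P.normSq k) u := by
  rw [F0, h.finsum_eq]
  rfl

theorem integrableOn_F0 (h : P.Regular) (hf : P.IsF0s f) :
    IntegrableOn (P.F0 f) (Ioi (2 * P.muPlus 0)) :=
  (((integrable_indicator_iff measurableSet_Ioi).1 (hf.integrable_indicator h)).add
    (integrableOn_expSum h.eig_pos (fun k => P.normSq k) _)).congr
      (Eventually.of_forall fun u => (F0_eq h u).symm)

theorem integrableOn_F (h : P.Regular) (hf : P.IsF0s f) (hx : 0 ≤ x) :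
    IntegrableOn (P.F f x) (Ioi (P.muPlus x)) := by
  have h0 := (muPlus_strictMono h.adm).monotone hx
  have hb : ∀ b, P.muPlus x ≤ b → IntegrableOn (fun y => f (y + b)) (Ioi (P.muPlus x)) := by
    intro b hb
    refine ((hf.integrable_indicator h).comp_add_right b).integrableOn.congr_fun
      (fun y hy => indicator_of_mem ?_ _) measurableSet_Ioi
    have : P.muPlus x < y := hy
    simp only [mem_Ioi]
    linarith
  have h2 : IntegrableOn (fun y => (P.cMinus x : ℂ) * f (y + P.muMinus x)) (Ioi (P.muPlus x)) := by
    rcases cMinus_eq_zero_or h.adm x with h1 | h1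
    · simp [h1]
    · exact (hb _ h1).const_mul _
  refine ((((hb _ le_rfl).const_mul (P.cPlus x : ℂ)).add h2).add (integrableOn_expSum h.eig_pos
    (fun k => P.normSq k * P.e0 x (Complex.I * k)) _)).congr (Eventually.of_forall fun y => ?_)
  simp only [F, Fs, h.finsum_eq, expSum, Pi.add_apply, cPlus, cMinus, sqrtRho]
  push_cast
  simp only [one_div]

/-- The operator of the main equation is a perturbation of an invertible operator by an operator
of finite rank. -/
theorem exists_main_operator (h : P.Regular) (hf : P.IsF0s f) (hx : 0 ≤ x) :
    ∃ (N T : Lp ℂ 1 (volume.restrict (Ioi (P.muPlus x))) →L[ℂ]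
        Lp ℂ 1 (volume.restrict (Ioi (P.muPlus x))))
      (W : Submodule ℂ (Lp ℂ 1 (volume.restrict (Ioi (P.muPlus x))))),
      ‖N‖ < 1 ∧ FiniteDimensional ℂ W ∧ (∀ v, T v ∈ W) ∧
      ∀ v, ∀ᵐ y ∂volume.restrict (Ioi (P.muPlus x)),
        IntegrableOn (fun t => v t * P.F0 f (t + y)) (Ioi (P.muPlus x)) ∧
        (v + (N v + T v) : Lp ℂ 1 (volume.restrict (Ioi (P.muPlus x)))) y =
          v y + (∫ t in Ioi (P.muPlus x), v t * P.F0 f (t + y)) -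
            P.tau * (Ioi (P.muPlus x)).indicator (fun t => v t) (2 * P.a - y) := by
  set m := P.muPlus x with hm
  have h0 := (muPlus_strictMono h.adm).monotone hx
  have hF0 : IntegrableOn (P.F0 f) (Ioi (2 * m)) :=
    (integrableOn_F0 h hf).mono_set (Ioi_subset_Ioi (by linarith))
  have hτ := abs_tau_lt h.adm
  -- The remainder of the approximation has norm at most `(1 - |τ|) / 2`; together with the
  -- reflection, of norm at most `|τ|`, it stays below one.
  obtain ⟨s, hs, c, hsc⟩ := exists_integral_sub_expSum_le
    ((integrable_indicator_iff measurableSet_Ioi).2 hF0) (2 * m)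
    (show 0 < (1 - |P.tau|) / 2 by linarith)
  set d : ℝ → ℂ := (Ioi (2 * m)).indicator fun u => P.F0 f u - expSum s c u with hd
  have hdi : Integrable d := (integrable_indicator_iff measurableSet_Ioi).2
    (hF0.sub (integrableOn_expSum hs c _))
  have hdn : ∫ u, ‖d u‖ ≤ (1 - |P.tau|) / 2 := by
    refine le_trans (le_of_eq ?_) hsc
    rw [hd]
    simp only [norm_indicator_eq_indicator_norm]
    rw [integral_indicator measurableSet_Ioi]
    exact setIntegral_congr_fun measurableSet_Ioi fun u hu => by simp only [indicator_of_mem hu]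
  have hqi : Integrable ((Ioi (2 * m)).indicator (expSum s c)) :=
    (integrable_indicator_iff measurableSet_Ioi).2 (integrableOn_expSum hs c _)
  obtain ⟨D, hD, hD2⟩ := exists_hankel_clm m hdi
  obtain ⟨T, -, hT⟩ := exists_hankel_clm m hqi
  obtain ⟨R, hR, hR2⟩ := exists_reflection_clm m (2 * P.a)
  have hei : ∀ k ∈ s, IntegrableOn (expSum {k} 1) (Ioi m) := fun k hk =>
    integrableOn_expSum (by simpa using hs k hk) 1 m
  set e : s → Lp ℂ 1 (volume.restrict (Ioi m)) := fun k => (hei k k.2).toL1 (expSum {k.1} 1) with he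
  refine ⟨-((P.tau : ℂ) • R) + D, T, Submodule.span ℂ (Set.range e), ?_,
    FiniteDimensional.span_of_finite ℂ (Set.finite_range e), fun v => ?_, fun v => ?_⟩
  · refine (norm_add_le _ _).trans_lt ?_
    rw [norm_neg, norm_smul, Complex.norm_real, Real.norm_eq_abs]
    have := mul_le_of_le_one_right (abs_nonneg P.tau) hR
    linarith
  · set g := (Ioi m).indicator v with hg
    have hgi : Integrable g := (integrable_indicator_iff measurableSet_Ioi).2 (L1.integrable_coeFn v)
    have hg0 : ∀ t < m, g t = 0 := fun t ht => indicator_of_notMem (by simpa using ht.le) _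
    -- `exp(-k (t + y))` factorises, so the Hankel operator of an exponential sum takes values in
    -- the span of its exponentials.
    have key : T v = ∑ k : s, (c k * ft g (Complex.I * (k : ℝ))) • e k := by
      refine Lp.ext ?_
      have hae : ∀ᵐ y ∂volume.restrict (Ioi m), ∀ k : s, e k y = expSum {k.1} 1 y :=
        ae_all_iff.2 fun k => (hei k k.2).coeFn_toL1
      have hsm : ∀ᵐ y ∂volume.restrict (Ioi m), ∀ k : s,
          ((c k * ft g (Complex.I * (k : ℝ))) • e k : Lp ℂ 1 (volume.restrict (Ioi m))) y =
            (c k * ft g (Complex.I * (k : ℝ))) * e k y :=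
        ae_all_iff.2 fun k => Lp.coeFn_smul _ _
      filter_upwards [hT v, hae, hsm, Lp.coeFn_finsetSum Finset.univ
        fun k : s => (c k * ft g (Complex.I * (k : ℝ))) • e k,
        ae_restrict_mem measurableSet_Ioi] with y h1 h2 h3 h4 hy
      have hy : m < y := hy
      rw [h1.2, h4, ← integral_indicator measurableSet_Ioi]
      have e1 := (integral_mul_expSum_add hs c hgi hg0 y).2
      rw [expSum, ← Finset.sum_coe_sort] at e1
      simp only [Finset.sum_apply, h3, h2, expSum, Finset.sum_singleton, Pi.one_apply, one_mul]
      rw [← e1]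
      congr 1 with t
      by_cases ht : t ∈ Ioi m
      · have hty : t + y ∈ Ioi (2 * m) := by
          simp only [mem_Ioi] at ht ⊢
          linarith
        rw [indicator_of_mem ht, hg, indicator_of_mem ht, indicator_of_mem hty]
      · rw [indicator_of_notMem ht, hg, indicator_of_notMem ht, zero_mul]
    rw [key]
    exact Submodule.sum_mem _ fun k _ => Submodule.smul_mem _ _ (Submodule.subset_span ⟨k, rfl⟩)
  · filter_upwards [hT v, hD2 v, hR2 v, Lp.coeFn_add v ((-((P.tau : ℂ) • R) + D) v + T v),
      Lp.coeFn_add ((-((P.tau : ℂ) • R) + D) v) (T v), Lp.coeFn_add ((-((P.tau : ℂ) • R)) v) (D v),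
      Lp.coeFn_neg ((P.tau : ℂ) • R v), Lp.coeFn_smul (P.tau : ℂ) (R v),
      ae_restrict_mem measurableSet_Ioi] with y h1 h2 h3 h4 h5 h6 h7 h8 hy
    have hy : m < y := hy
    have e1 : EqOn (fun t => v t * d (t + y) + v t * (Ioi (2 * m)).indicator (expSum s c) (t + y))
        (fun t => v t * P.F0 f (t + y)) (Ioi m) := fun t ht => by
      have hty : t + y ∈ Ioi (2 * m) := by
        simp only [mem_Ioi] at ht ⊢
        linarith
      simp only [hd, indicator_of_mem hty]
      ring
    refine ⟨(h2.1.add h1.1).congr_fun e1 measurableSet_Ioi, ?_⟩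
    have e2 : (-((P.tau : ℂ) • R)) v y = -(P.tau * (Ioi m).indicator (fun t => v t) (2 * P.a - y)) := by
      rw [← h3]
      refine h7.trans ?_
      rw [Pi.neg_apply, h8, Pi.smul_apply, smul_eq_mul]
    rw [h4, Pi.add_apply, h5, Pi.add_apply, add_apply, h6, Pi.add_apply, e2,
      h1.2, h2.2, ← setIntegral_congr_fun measurableSet_Ioi e1, integral_add h2.1 h1.1]
    ring

theorem existsUnique_solvesMainEquation (h : P.Regular) (hf : P.IsF0s f) (hx : 0 < x) :
    ∃! K : Lp ℂ 1 (volume.restrict (Ioi (P.muPlus x))), P.SolvesMainEquation f x K := by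
  obtain ⟨N, T, W, hN, hW, hT, hA⟩ := exists_main_operator h hf hx.le
  have h0 := muPlus_strictMono h.adm hx
  have hinj : ∀ v, v + (N v + T v) = 0 → v = 0 := by
    intro v hv
    set g := (Ioi (P.muPlus x)).indicator v with hg
    have hz := ae_eq_zero_of_homogeneous (g := g) h hx (hf.integrable_indicator h)
      (fun φ hφ => hf.integral_indicator hφ)
      ((integrable_indicator_iff measurableSet_Ioi).2 (L1.integrable_coeFn v))
      (fun t ht => indicator_of_notMem (by simpa using ht) _) (by
        have hA0 := hA v
        rw [hv] at hA0
        filter_upwards [(ae_restrict_iff' measurableSet_Ioi).1 hA0,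
          (ae_restrict_iff' measurableSet_Ioi).1 (Lp.coeFn_zero ℂ 1 _)] with y h1 h2 hy
        have h3 := (h1 hy).2
        rw [h2 hy, ← integral_indicator measurableSet_Ioi] at h3
        have e1 : ∀ t, g t * ((Ioi (2 * P.muPlus 0)).indicator f (t + y) +
            expSum h.eig (fun k => P.normSq k) (t + y)) =
            (Ioi (P.muPlus x)).indicator (fun t => v t * P.F0 f (t + y)) t := by
          intro t
          by_cases ht : t ∈ Ioi (P.muPlus x)
          · have hty : t + y ∈ Ioi (2 * P.muPlus 0) := by
              simp only [mem_Ioi] at ht ⊢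
              linarith
            rw [hg, indicator_of_mem ht, indicator_of_mem ht, indicator_of_mem hty, F0_eq h]
          · rw [hg, indicator_of_notMem ht, indicator_of_notMem ht, zero_mul]
        simp only [e1]
        rw [hg, indicator_of_mem (mem_Ioi.2 hy)]
        rw [Pi.zero_apply] at h3
        linear_combination -h3)
    refine Lp.ext ?_
    filter_upwards [ae_restrict_of_ae hz, ae_restrict_mem measurableSet_Ioi,
      Lp.coeFn_zero ℂ 1 (volume.restrict (Ioi (P.muPlus x)))] with y h1 h2 h3
    rw [h3, ← h1, hg, indicator_of_mem h2]
  have hF := integrableOn_F h hf hx.le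
  have hiff : ∀ K, P.SolvesMainEquation f x K ↔ K + (N K + T K) = -hF.toL1 (P.F f x) := by
    intro K
    rw [Lp.ext_iff, SolvesMainEquation]
    refine eventually_congr ?_
    filter_upwards [hA K, Lp.coeFn_neg (hF.toL1 (P.F f x)), hF.coeFn_toL1] with y h1 h2 h3
    rw [h1.2, h2, Pi.neg_apply, h3, and_iff_right h1.1]
    constructor <;> intro h4 <;> linear_combination h4
  obtain ⟨K, hK⟩ := exists_eq_of_injective_add_finite_rank hN hT hinj (-hF.toL1 (P.F f x))
  refine ⟨K, (hiff K).2 hK, fun K' hK' => sub_eq_zero.1 (hinj _ ?_)⟩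
  rw [map_sub, map_sub, ← sub_eq_zero.2 (((hiff K').1 hK').trans hK.symm)]
  abel

end ScatteringProblem

/-! ### Reduction to a measurable potential -/

namespace ScatteringProblem

/-- The problem obtained from `P` by changing the potential to `r`. -/
def withPotential (P : ScatteringProblem) (r : ℝ → ℝ) : ScatteringProblem := { P with q := r }

variable {P : ScatteringProblem} {r : ℝ → ℝ}

/-- The potential enters the equation only under integrals over subsets of `(0, ∞)`, so solutions
and all scattering data depend only on its class modulo null sets there. -/
theorem isSolution_withPotential (h : ∀ᵐ x, 0 < x → r x = P.q x) :
    (P.withPotential r).IsSolution = P.IsSolution := by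
  funext z y y'
  have key : ∀ x : ℝ, 0 ≤ x →
      ∫ t in (0 : ℝ)..x, ((r t : ℂ) - z ^ 2 * P.rho t) * y t =
        ∫ t in (0 : ℝ)..x, ((P.q t : ℂ) - z ^ 2 * P.rho t) * y t := by
    intro x hx
    refine intervalIntegral.integral_congr_ae ?_
    filter_upwards [h] with t ht hm
    rw [uIoc_of_le hx] at hm
    rw [ht hm.1]
  refine propext (and_congr Iff.rfl (forall₂_congr fun x hx => ?_))
  change y' x = y' 0 + ∫ t in (0 : ℝ)..x, ((r t : ℂ) - z ^ 2 * P.rho t) * y t ↔ _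
  rw [key x hx]

theorem jostPair_withPotential (h : ∀ᵐ x, 0 < x → r x = P.q x) :
    (P.withPotential r).jostPair = P.jostPair := by
  funext z
  unfold jostPair IsJost
  rw [isSolution_withPotential h]

theorem E_withPotential (h : ∀ᵐ x, 0 < x → r x = P.q x) :
    (P.withPotential r).E = P.E := by
  funext z
  unfold E jost jostDeriv
  rw [jostPair_withPotential h]
  rfl

theorem S_withPotential (h : ∀ᵐ x, 0 < x → r x = P.q x) :
    (P.withPotential r).S = P.S := by
  funext z
  unfold S jost jostDeriv
  rw [jostPair_withPotential h, E_withPotential h]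
  rfl

theorem eigenSet_withPotential (h : ∀ᵐ x, 0 < x → r x = P.q x) :
    (P.withPotential r).eigenSet = P.eigenSet := by
  unfold eigenSet
  rw [E_withPotential h]

theorem normSq_withPotential (h : ∀ᵐ x, 0 < x → r x = P.q x) :
    (P.withPotential r).normSq = P.normSq := by
  funext k
  unfold normSq normInvSq ratioSq jost jostDeriv
  rw [jostPair_withPotential h]
  rfl

theorem isF0s_withPotential (h : ∀ᵐ x, 0 < x → r x = P.q x) :
    (P.withPotential r).IsF0s = P.IsF0s := by
  funext f
  unfold IsF0s
  rw [S_withPotential h]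
  rfl

theorem solvesMainEquation_withPotential (h : ∀ᵐ x, 0 < x → r x = P.q x) {f : ℝ → ℂ} {x : ℝ}
    (K : Lp ℂ 1 (volume.restrict (Ioi (P.muPlus x)))) :
    (P.withPotential r).SolvesMainEquation f x K ↔ P.SolvesMainEquation f x K := by
  have hF : (P.withPotential r).F f = P.F f := by
    funext x y
    unfold F
    rw [eigenSet_withPotential h, normSq_withPotential h]
    rfl
  have hF0 : (P.withPotential r).F0 f = P.F0 f := by
    funext u
    unfold F0
    rw [eigenSet_withPotential h, normSq_withPotential h]
  unfold SolvesMainEquation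
  rw [hF, hF0]
  rfl

/-- Integrability supplies a measurable representative of `(1 + x) q`, and `1 + x` is positive on
the half line. -/
theorem exists_measurable_potential
    (hq : IntegrableOn (fun x : ℝ => (1 + x) * P.q x) (Ioi 0)) :
    ∃ r : ℝ → ℝ, Measurable r ∧ IntegrableOn (fun x : ℝ => (1 + x) * r x) (Ioi 0) ∧
      ∀ᵐ x, 0 < x → r x = P.q x := by
  have hm := hq.aestronglyMeasurable
  have he : ∀ᵐ x, 0 < x → hm.mk _ x / (1 + x) = P.q x := by
    filter_upwards [(ae_restrict_iff' measurableSet_Ioi).1 hm.ae_eq_mk] with x hx h0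
    rw [← hx h0, mul_div_cancel_left₀ _ (by linarith)]
  refine ⟨fun x => hm.mk _ x / (1 + x),
    hm.stronglyMeasurable_mk.measurable.div (measurable_const.add measurable_id), ?_, he⟩
  refine hq.congr_fun_ae ((ae_restrict_iff' measurableSet_Ioi).2 ?_)
  filter_upwards [he] with x hx h0
  rw [hx h0]

end ScatteringProblem

theorem mainTheorem2 (P : ScatteringProblem)
    (hq : IntegrableOn (fun x : ℝ => (1 + x) * P.q x) (Ioi 0))
    (ha : 0 < P.a) (hα : 0 < P.α) (hα1 : P.α ≠ 1)
    (hδ1 : P.delta1 ≤ 0) (hδ2 : P.delta2 ≤ 0) (hδ3 : 0 ≤ P.delta3)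
    (hAB : ∀ z : ℂ, 0 < z.im → ¬ (P.coeffA z = 0 ∧ P.coeffB z = 0)) :
    P.eigenSet.Finite ∧
    (∃ f : ℝ → ℂ, P.IsF0s f) ∧
    ∀ f : ℝ → ℂ, P.IsF0s f → ∀ x : ℝ, 0 < x →
      ∃! K : Lp ℂ 1 (volume.restrict (Ioi (P.muPlus x))), P.SolvesMainEquation f x K := by
  obtain ⟨r, hrm, hri, hr⟩ := ScatteringProblem.exists_measurable_potential hq
  have hreg : (P.withPotential r).Regular := ⟨⟨ha, hα, hrm, hri⟩, hδ1, hδ2, hδ3, hAB⟩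
  refine ⟨?_, ?_, fun f hf x hx => ?_⟩
  · rw [← ScatteringProblem.eigenSet_withPotential hr]
    exact ScatteringProblem.finite_eigenSet hreg.adm hδ1 hδ2 hδ3 hAB
  · rw [← ScatteringProblem.isF0s_withPotential hr]
    exact ScatteringProblem.exists_isF0s hreg
  · rw [← ScatteringProblem.isF0s_withPotential hr] at hf
    obtain ⟨K, hK, hu⟩ := ScatteringProblem.existsUnique_solvesMainEquation hreg hf hx
    exact ⟨K, (ScatteringProblem.solvesMainEquation_withPotential hr K).1 hK, fun K' hK' =>
      hu K' ((ScatteringProblem.solvesMainEquation_withPotential hr K').2 hK')⟩
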